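/- **Setting.** Let $d\ge 2$, $s\in(0,1)$ and $\gamma\in\mathbb R$ with $\gamma+2s\in[0,2]$. Consider the Boltzmann equation $$\partial_t f+v\cdot\nabla_x f=Q(f,f),\qquad Q(f_1,f_2)(v)=\mathrm{PV}\int_{\mathbb R^d}\int_{\mathbb S^{d-1}}\big[f_1(v'_*)f_2(v')-f_1(v_*)f_2(v)\big]\,B(|v-v_*|,\cos\theta)\,d\sigma\,dv_*,$$ on $[0,T]\times\mathbb T^d\times\mathbb R^d$, where $v'=\frac{v+v_*}2+\frac{|v-v_*|}2\sigma$, $v'_*=\frac{v+v_*}2-\frac{|v-v_*|}2\sigma$, $\cos\theta=\frac{v-v_*}{|v-v_*|}\cdot\sigma$, $\theta\in[0,\pi]$, and $B(r,\cos\theta)=r^\gamma\,(\sin\tfrac\theta2)^{-(d-2)+\gamma}(\tan\tfrac\theta2)^{-(\gamma+2s+1)}\,\tilde b(\cos\theta)$ with $\tilde b$ smooth on $[-1,1]$ and $0<\tilde b_0\le\tilde b\le\tilde b_1$ for constants $\tilde b_0,\tilde b_1$. The principal value is the limit as $\delta\to0^+$ of the (absolutely convergent) integral over $\{|v'-v|>\delta\}$.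 For $T\in(0,+\infty]$ (with $[0,T]$ read as $[0,\infty)$ if $T=+\infty$), a *classical solution with mild decay* is a continuous function $f:[0,T]\times\mathbb T^d\times\mathbb R^d\to[0,\infty)$ that is differentiable in $t$ (one-sidedly at the end points) and in $x$ and twice differentiable in $v$ everywhere, satisfies the equation at every point, and satisfies $f(t,x,v)\to0$ as $|v|\to\infty$, uniformly in $t\in[0,T]$ and $x\in\mathbb T^d$. Assume that for constants $m_0,M_0,E_0,H_0>0$ and all $(t,x)\in[0,T]\times\mathbb T^d$ $$m_0\le\int f\,dv\le M_0,\qquad \int f|v|^2\,dv\le E_0,\qquad \int f\ln f\,dv\le H_0 ,$$ the integrals being finite. Below $\min(1,|v|^{-q})$ is $1$ at $v=0$, and "admissible constant" means one that depends only on $d,s,\gamma,\tilde b_0,\tilde b_1,m_0,M_0,E_0,H_0$ (in particular neither on $f$ nor on $T$). **Theorem (pointwise moment bounds revisited).** Let $f$ be such a solution, and $f_0(x,v)=f(0,x,v)$. 1. If $\gamma\in(-2,0]$, there is an admissible $N>0$ such that, with $q=d+1+\frac{\gamma d}{2s}$ if $\gamma<0$, and for every $q\in[0,d+1)$ if $\gamma=0$,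 $$f(t,x,v)\le N\big(1+t^{-\frac d{2s}}\big)\min(1,|v|^{-q})\qquad\forall\,t\in(0,T],\ x\in\mathbb T^d,\ v\in\mathbb R^d.$$ 2. If $\gamma>0$, there are admissible $N,\beta>0$ such that $$f(t,x,v)\le N\big(1+t^{-\beta}\big)\min(1,|v|^{-d-1})\qquad\forall\,t\in(0,T],\ x\in\mathbb T^d,\ v\in\mathbb R^d.$$ 3. If $\gamma\le0$ and $\gamma+2s<1$, there is an admissible $q_0\ge 0$ such that for all $q\ge q_0$ and $C>0$ there is $N>0$, depending only on $q$, $C$ and the parameters of an admissible constant, such that $f_0\le C\min(1,|v|^{-q})$ implies $$f(t,x,v)\le N\min(1,|v|^{-q})\qquad\forall\,t\in[0,T],\ x\in\mathbb T^d,\ v\in\mathbb R^d.$$ 4. If $\gamma>0$, there is an admissible $q_0>0$ such that for every $q>0$ there are $N,\beta>0$, depending only on $q$ and the parameters of an admissible constant, such that, if $|v|^{q_0}f(t,x,v)\to0$ as $|v|\to\infty$ uniformly in $t\in[0,T]$ and $x\in\mathbb T^d$, then $$f(t,x,v)\le N\big(1+t^{-\beta}\big)\min(1,|v|^{-q})\qquad\forall\,t\in(0,T],\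 x\in\mathbb T^d,\ v\in\mathbb R^d.$$ -/

import Mathlib

open MeasureTheory Set Filter Topology
open scoped ContDiff

noncomputable section

namespace Boltzmann

/-- The velocity space `ℝ^d` with its Euclidean norm (also used for lifted positions). -/
abbrev Vel (d : ℕ) : Type := EuclideanSpace ℝ (Fin d)

/-- The unit sphere `𝕊^{d-1}`. -/
abbrev Sph (d : ℕ) : Type := Metric.sphere (0 : Vel d) 1

/-- The surface measure `dσ` on `𝕊^{d-1}`. -/
def surfaceMeasure (d : ℕ) : Measure (Sph d) := (volume : Measure (Vel d)).toSphere

/-! ### The collision kernel -/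

/-- `b̃ : [-1,1] → ℝ` is smooth and `b₀ ≤ b̃ ≤ b₁`. -/
structure IsAngularFactor (b₀ b₁ : ℝ) (bt : ℝ → ℝ) : Prop where
  smooth : ContDiffOn ℝ ∞ bt (Icc (-1) 1)
  lower : ∀ c ∈ Icc (-1 : ℝ) 1, b₀ ≤ bt c
  upper : ∀ c ∈ Icc (-1 : ℝ) 1, bt c ≤ b₁

/-- `b(cos θ) = (sin θ/2)^{-(d-2)+γ} (tan θ/2)^{-(γ+2s+1)} b̃(cos θ)`, as a function of
`c = cos θ`, with `θ ∈ [0,π]`. -/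
def angularKernel (d : ℕ) (γ s : ℝ) (bt : ℝ → ℝ) (c : ℝ) : ℝ :=
  Real.sin (Real.arccos c / 2) ^ (-((d : ℝ) - 2) + γ) *
    Real.tan (Real.arccos c / 2) ^ (-(γ + 2 * s + 1)) * bt c

/-- `B(r, cos θ) = r^γ b(cos θ)`. -/
def collisionKernel (d : ℕ) (γ s : ℝ) (bt : ℝ → ℝ) (r c : ℝ) : ℝ :=
  r ^ γ * angularKernel d γ s bt c

/-! ### The collision operator -/

/-- `v' = (v + v_*)/2 + (|v - v_*|/2) σ`. -/
def vPrime {d : ℕ} (v vs : Vel d) (σ : Sph d) : Vel d :=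
  (1 / 2 : ℝ) • (v + vs) + (‖v - vs‖ / 2) • (σ : Vel d)

/-- `v'_* = (v + v_*)/2 - (|v - v_*|/2) σ`. -/
def vPrimeStar {d : ℕ} (v vs : Vel d) (σ : Sph d) : Vel d :=
  (1 / 2 : ℝ) • (v + vs) - (‖v - vs‖ / 2) • (σ : Vel d)

/-- `cos θ = ((v - v_*)/|v - v_*|) · σ`. -/
def cosDeviation {d : ℕ} (v vs : Vel d) (σ : Sph d) : ℝ :=
  inner ℝ (‖v - vs‖⁻¹ • (v - vs)) (σ : Vel d)

/-- The integrand `[f₁(v'_*) f₂(v') - f₁(v_*) f₂(v)] B(|v - v_*|, cos θ)` at `(v_*, σ)`. -/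
def collisionIntegrand {d : ℕ} (γ s : ℝ) (bt : ℝ → ℝ) (f₁ f₂ : Vel d → ℝ) (v : Vel d)
    (p : Vel d × Sph d) : ℝ :=
  (f₁ (vPrimeStar v p.1 p.2) * f₂ (vPrime v p.1 p.2) - f₁ p.1 * f₂ v) *
    collisionKernel d γ s bt ‖v - p.1‖ (cosDeviation v p.1 p.2)

/-- The collisions `(v_*, σ)` with `|v' - v| > δ`. -/
def nonGrazing {d : ℕ} (v : Vel d) (δ : ℝ) : Set (Vel d × Sph d) :=
  {p | δ < ‖vPrime v p.1 p.2 - v‖}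

/-- `Q(f₁, f₂)(v) = L`. The kernel is not integrable at grazing collisions, so the integral over
`ℝ^d × 𝕊^{d-1}` is the Cauchy principal value at `v' = v`: the integral over `|v' - v| > δ`
converges absolutely for every `δ > 0`, and it tends to `L` as `δ → 0⁺`. -/
def HasCollisionValue {d : ℕ} (γ s : ℝ) (bt : ℝ → ℝ) (f₁ f₂ : Vel d → ℝ) (v : Vel d)
    (L : ℝ) : Prop :=
  (∀ δ : ℝ, 0 < δ → IntegrableOn (collisionIntegrand γ s bt f₁ f₂ v) (nonGrazing v δ)
      ((volume : Measure (Vel d)).prod (surfaceMeasure d))) ∧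
    Tendsto (fun δ : ℝ => ∫ p in nonGrazing v δ, collisionIntegrand γ s bt f₁ f₂ v p
      ∂((volume : Measure (Vel d)).prod (surfaceMeasure d))) (𝓝[>] 0) (𝓝 L)

/-! ### Solutions -/

/-- The time interval `[0,T]`, which is `[0,∞)` if `T = ∞`. -/
def timeInterval (T : EReal) : Set ℝ := {t | 0 ≤ t ∧ (t : EReal) ≤ T}

/-- `|v|^{p} f(t,x,v) → 0` as `|v| → ∞`, uniformly in `t ∈ [0,T]` and `x`. -/
def UniformDecay {d : ℕ} (T : EReal) (p : ℝ) (f : ℝ → Vel d → Vel d → ℝ) : Prop :=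
  ∀ ε : ℝ, 0 < ε → ∃ R : ℝ, 0 < R ∧ ∀ t ∈ timeInterval T, ∀ x v : Vel d,
    R ≤ ‖v‖ → ‖v‖ ^ p * f t x v ≤ ε

/-- Classical solutions `f ≥ 0` on `[0,T] × 𝕋^d × ℝ^d` of `∂_t f + v · ∇_x f = Q(f,f)` with mild
decay. Functions on `𝕋^d = ℝ^d/ℤ^d` are `ℤ^d`-periodic functions of `x ∈ ℝ^d`; time derivatives
are one-sided at the ends of `[0,T]`, and the values `f t` for `t ∉ [0,T]` play no role. -/
structure IsMildDecaySolution {d : ℕ} (γ s : ℝ) (bt : ℝ → ℝ) (T : EReal)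
    (f : ℝ → Vel d → Vel d → ℝ) : Prop where
  periodic : ∀ t ∈ timeInterval T, ∀ (x v : Vel d) (k : Fin d → ℤ),
    f t (x + WithLp.toLp 2 (fun i => (k i : ℝ))) v = f t x v
  nonneg : ∀ t ∈ timeInterval T, ∀ x v : Vel d, 0 ≤ f t x v
  continuous : ContinuousOn (fun p : ℝ × Vel d × Vel d => f p.1 p.2.1 p.2.2)
    (timeInterval T ×ˢ univ)
  differentiable_t : ∀ t ∈ timeInterval T, ∀ x v : Vel d,
    DifferentiableWithinAt ℝ (fun τ => f τ x v) (timeInterval T) t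
  differentiable_x : ∀ t ∈ timeInterval T, ∀ v : Vel d, Differentiable ℝ (fun x => f t x v)
  differentiable_v : ∀ t ∈ timeInterval T, ∀ x : Vel d, Differentiable ℝ (f t x)
  twice_differentiable_v : ∀ t ∈ timeInterval T, ∀ x : Vel d,
    Differentiable ℝ (fderiv ℝ (f t x))
  equation : ∀ t ∈ timeInterval T, ∀ x v : Vel d,
    HasCollisionValue γ s bt (f t x) (f t x) v
      (derivWithin (fun τ => f τ x v) (timeInterval T) t + fderiv ℝ (fun y => f t y v) x v)
  decay : UniformDecay T 0 f

/-- The bounds `m₀ ≤ M(t,x) ≤ M₀`, `E(t,x) ≤ E₀`, `H(t,x) ≤ H₀` on `[0,T] × 𝕋^d` for the mass,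
energy and entropy densities, the integrals being finite. -/
structure HydroBounds {d : ℕ} (T : EReal) (m₀ M₀ E₀ H₀ : ℝ)
    (f : ℝ → Vel d → Vel d → ℝ) : Prop where
  mass_integrable : ∀ t ∈ timeInterval T, ∀ x : Vel d, Integrable (fun v => f t x v)
  energy_integrable : ∀ t ∈ timeInterval T, ∀ x : Vel d,
    Integrable (fun v => f t x v * ‖v‖ ^ 2)
  entropy_integrable : ∀ t ∈ timeInterval T, ∀ x : Vel d,
    Integrable (fun v => f t x v * Real.log (f t x v))
  mass_lower : ∀ t ∈ timeInterval T, ∀ x : Vel d, m₀ ≤ ∫ v, f t x v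
  mass_upper : ∀ t ∈ timeInterval T, ∀ x : Vel d, ∫ v, f t x v ≤ M₀
  energy_upper : ∀ t ∈ timeInterval T, ∀ x : Vel d, ∫ v, f t x v * ‖v‖ ^ 2 ≤ E₀
  entropy_upper : ∀ t ∈ timeInterval T, ∀ x : Vel d,
    ∫ v, f t x v * Real.log (f t x v) ≤ H₀

/-- `min(1, |v|^{-q})` for `q ≥ 0`, with the value `1` at `v = 0`
(see `decayWeight_eq` and `decayWeight_zero`). -/
def decayWeight {d : ℕ} (q : ℝ) (v : Vel d) : ℝ := max 1 ‖v‖ ^ (-q)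

theorem decayWeight_eq {d : ℕ} {q : ℝ} (hq : 0 ≤ q) {v : Vel d} (hv : v ≠ 0) :
    decayWeight q v = min 1 (‖v‖ ^ (-q)) := by
  have hpos : 0 < ‖v‖ := norm_pos_iff.mpr hv
  unfold decayWeight
  rcases le_total ‖v‖ 1 with h | h
  · rw [max_eq_left h, Real.one_rpow, min_eq_left]
    exact Real.one_le_rpow_of_pos_of_le_one_of_nonpos hpos h (by linarith)
  · rw [max_eq_right h, min_eq_right]
    exact Real.rpow_le_one_of_one_le_of_nonpos h (by linarith)

theorem decayWeight_zero {d : ℕ} (q : ℝ) : decayWeight q (0 : Vel d) = 1 := by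
  simp [decayWeight]

end Boltzmann

end

/-!
# Pointwise decay for the Boltzmann equation without cutoff

All four bounds come from one comparison principle (`IsMildDecaySolution.lt_of_barrier`). If a
barrier `g(t,v)` lies above `f` initially and for large `|v|`, then at a first contact point the
gradient of `f` in `x` vanishes and `∂_t f ≥ ∂_t g`, so it is enough to show that the collision
operator is less than `∂_t g` wherever `f(t,x,·)` touches `g(t,·)` from below. At such a point the
collision operator is estimated directly from the mass, energy and entropy bounds.

A collision is described by the orthogonal displacements `u = v' - v` and `w = v'_* - v`. In these
variables the kernel becomes a measure that disintegrates over the direction of `u` or of `w`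
(Carleman's representation, `lintegral_collisionMeasure_carleman`). The integrand splits into
`f(v'_*) (f(v') - f(v))` and `f(v) (f(v'_*) - f(v_*))`; the second part is bounded by the Riesz
potential `∫ f(v_*) |v - v_*|^γ dv_*` through the cancellation lemma (`exists_cancellation`). In the
first part, terms odd in `u` integrate to zero, which leaves a gain minus a loss
(`CollisionBound`, `exists_collision_le`).

Write `d` for the dimension, `⟨v⟩ = max(1,|v|)` and `φ_q = ⟨v⟩^{-q}`.

* For `q ≤ d + 1` and the barrier `N (φ_q + ε)`, the gain is of order `φ_q ⟨v⟩^γ`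
  (`exists_weight_gain`). The loss is superlinear: `f` cannot exceed half of its contact value on
  more than a small set around `v`, and on the rest of a suitable annulus `f(v') ≤ f(v)/2`. This
  produces the term `-c f(v) ⟨v⟩^γ (f(v) ⟨v⟩^{d+1})^{2s/d}` (`exists_contact_bound`), which also
  absorbs the Riesz potential. It beats the time derivative of `N (1 + t^{-d/(2s)})`
  precisely when the powers of `⟨v⟩` are harmless, which fixes the exponent for `γ < 0`.
* For large `q`, the gain is `O(φ_q |v|^γ)` uniformly in `q`, once `f(v'_*)` rather than `f(v')` is
  compared with the barrier where `|v'| < |v|/2`, whereas collisions with `v'_*` bounded produce a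
  loss of order `q^s φ_q |v|^γ` (`exists_swappedIncrement_le_neg`). Hence for `q` large the collision
  operator is negative at contact points with `|v|` large; contact for the other `v` is excluded by
  the bounds for `q ≤ d + 1`.
-/

namespace Boltzmann

open Real
open scoped ENNReal RealInnerProductSpace

/-! ### Polar coordinates and orthogonal decomposition -/

instance surfaceMeasure.instIsFiniteMeasure (d : ℕ) : IsFiniteMeasure (surfaceMeasure d) :=
  inferInstanceAs (IsFiniteMeasure (volume : Measure (Vel d)).toSphere)

theorem lintegral_polar {n : ℕ} {F : Vel (n + 1) → ℝ≥0∞} (hF : Measurable F) :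
    ∫⁻ x, F x = ∫⁻ e : Sph (n + 1),
      (∫⁻ r in Ioi (0 : ℝ), ENNReal.ofReal (r ^ n) * F (r • (e : Vel (n + 1))))
      ∂(surfaceMeasure (n + 1)) := by
  have hmp := (volume : Measure (Vel (n + 1))).measurePreserving_homeomorphUnitSphereProd
  have h1 : ∫⁻ x, F x = ∫⁻ x : ({(0 : Vel (n + 1))}ᶜ : Set (Vel (n + 1))), F x.1 ∂(volume.comap Subtype.val) := by
    rw [lintegral_subtype_comap (measurableSet_singleton _).compl F, restrict_compl_singleton]
  have hG : Measurable fun p : Sph (n + 1) × Ioi (0 : ℝ) => F ((p.2 : ℝ) • (p.1 : Vel (n + 1))) :=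
    hF.comp (by fun_prop)
  have h2 : ∫⁻ x : ({(0 : Vel (n + 1))}ᶜ : Set (Vel (n + 1))), F x.1 ∂(volume.comap Subtype.val) =
      ∫⁻ p : Sph (n + 1) × Ioi (0 : ℝ), F ((p.2 : ℝ) • (p.1 : Vel (n + 1)))
        ∂((surfaceMeasure (n + 1)).prod (Measure.volumeIoiPow n)) := by
    have := hmp.lintegral_comp hG
    simp only [finrank_euclideanSpace, Fintype.card_fin, Nat.add_sub_cancel] at this
    rw [surfaceMeasure, ← this]
    refine lintegral_congr fun x => ?_
    have hx : ‖(x : Vel (n + 1))‖ ≠ 0 := norm_ne_zero_iff.2 x.2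
    congr 1
    simp [smul_smul, hx]
  rw [h1, h2, lintegral_prod _ hG.aemeasurable]
  refine lintegral_congr fun e => ?_
  have hGe : Measurable fun r : Ioi (0 : ℝ) => F ((r : ℝ) • (e : Vel (n + 1))) :=
    hF.comp (by fun_prop)
  rw [Measure.volumeIoiPow, lintegral_withDensity_eq_lintegral_mul _ (by fun_prop) hGe,
    ← lintegral_subtype_comap measurableSet_Ioi]
  rfl

theorem lintegral_sphere_neg {d : ℕ} {G : Sph d → ℝ≥0∞} (hG : Measurable G) :
    ∫⁻ e, G (-e) ∂(surfaceMeasure d) = ∫⁻ e, G e ∂(surfaceMeasure d) := by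
  have hm : Measurable (fun e : Sph d => -e) := continuous_neg.measurable
  have : (surfaceMeasure d).map (fun e : Sph d => -e) = surfaceMeasure d := by
    ext s hs
    rw [Measure.map_apply hm hs, surfaceMeasure, Measure.toSphere_apply' _ (hm hs),
      Measure.toSphere_apply' _ hs]
    congr 1
    rw [← Measure.measure_neg]
    congr 1
    ext x
    simp only [Set.mem_neg, Set.mem_smul, mem_image, mem_preimage]
    constructor
    · rintro ⟨r, hr, _, ⟨e, he, rfl⟩, hx⟩
      exact ⟨r, hr, _, ⟨-e, he, rfl⟩, by
        change r • (-(e : Vel d)) = x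
        rw [smul_neg, neg_eq_iff_eq_neg]; exact hx⟩
    · rintro ⟨r, hr, _, ⟨e, he, rfl⟩, hx⟩
      exact ⟨r, hr, _, ⟨-e, by simpa using he, rfl⟩, by simp [← hx]⟩
  rw [← lintegral_map hG hm, this]

/-- Every unit vector `e` of `ℝ^{n+1}` has an isometric parametrization `ι` of `e^⊥` by `ℝ^n`, and
then `(t, y) ↦ t e + ι y` preserves Lebesgue measure. -/
theorem exists_orthogonal_chart {n : ℕ} (e : Sph (n + 1)) :
    ∃ ι : Vel n →ₗᵢ[ℝ] Vel (n + 1), (∀ y, ⟪(e : Vel (n + 1)), ι y⟫ = 0) ∧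
      ∀ G : Vel (n + 1) → ℝ≥0∞, Measurable G →
        ∫⁻ x, G x = ∫⁻ t : ℝ, ∫⁻ y, G (t • (e : Vel (n + 1)) + ι y) := by
  have he : ‖(e : Vel (n + 1))‖ = 1 := by simp
  obtain ⟨b, hb⟩ := Orthonormal.exists_orthonormalBasis_extension_of_card_eq (𝕜 := ℝ)
    (E := Vel (n + 1)) (ι := Fin (n + 1)) (by simp) (v := fun _ => (e : Vel (n + 1)))
    (s := {0}) (by
      rw [orthonormal_subsingleton_iff]
      rintro ⟨i, hi⟩
      simp [Set.domRestrict])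
  have hb0 : b 0 = e := hb 0 rfl
  let L : Vel n →ₗ[ℝ] Vel (n + 1) :=
    { toFun := fun y => ∑ i, y i • b i.succ
      map_add' := fun x y => by simp [add_smul, Finset.sum_add_distrib]
      map_smul' := fun c x => by simp [mul_smul, Finset.smul_sum] }
  have hcomb : ∀ (t : ℝ) (y : Vel n), t • (e : Vel (n + 1)) + L y =
      b.repr.symm (WithLp.toLp 2 (Fin.cons t (fun i => y i))) := by
    intro t y
    rw [← OrthonormalBasis.sum_repr_symm, Fin.sum_univ_succ]
    simp [hb0, L]
  have hL : ∀ y, L y = b.repr.symm (WithLp.toLp 2 (Fin.cons 0 (fun i => y i))) := by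
    intro y; rw [← hcomb]; simp
  let ι : Vel n →ₗᵢ[ℝ] Vel (n + 1) :=
    { L with
      norm_map' := fun y => by
        change ‖L y‖ = ‖y‖
        rw [hL, LinearIsometryEquiv.norm_map, EuclideanSpace.norm_eq, EuclideanSpace.norm_eq,
          Fin.sum_univ_succ]
        simp }
  have hι : ∀ y, ι y = L y := fun _ => rfl
  refine ⟨ι, fun y => ?_, fun G hG => ?_⟩
  · rw [hι, hL]
    have : (e : Vel (n + 1)) = b.repr.symm (EuclideanSpace.single 0 1) := by
      rw [← hb0]; simp
    rw [this, LinearIsometryEquiv.inner_map_map]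
    simp [EuclideanSpace.inner_single_left]
  · have m1 : ∫⁻ x, G x = ∫⁻ x : Vel (n + 1), G (b.repr.symm x) :=
      (b.measurePreserving_repr_symm.lintegral_comp hG).symm
    have hG1 : Measurable fun x : Vel (n + 1) => G (b.repr.symm x) :=
      hG.comp b.repr.symm.continuous.measurable
    have m2 : ∫⁻ x : Vel (n + 1), G (b.repr.symm x) =
        ∫⁻ x : Fin (n + 1) → ℝ, G (b.repr.symm (WithLp.toLp 2 x)) :=
      ((PiLp.volume_preserving_toLp (Fin (n + 1))).lintegral_comp hG1).symm
    have hG2 : Measurable fun x : Fin (n + 1) → ℝ => G (b.repr.symm (WithLp.toLp 2 x)) :=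
      hG1.comp (by fun_prop)
    have m3 := ((volume_preserving_piFinSuccAbove (fun _ : Fin (n + 1) => ℝ) 0).symm _).lintegral_comp
      hG2
    rw [m1, m2, ← m3, Measure.volume_eq_prod]
    refine (lintegral_prod _ (hG2.comp (MeasurableEquiv.measurable _)).aemeasurable).trans ?_
    refine lintegral_congr fun t => ?_
    have hG3 : Measurable fun y : Fin n → ℝ =>
        G (b.repr.symm (WithLp.toLp 2
          ((MeasurableEquiv.piFinSuccAbove (fun _ : Fin (n + 1) => ℝ) 0).symm (t, y)))) :=
      hG2.comp ((MeasurableEquiv.measurable _).comp (by fun_prop))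
    have hG4 : Measurable fun y : Vel n => G (t • (e : Vel (n + 1)) + ι y) :=
      hG.comp (by have := ι.continuous; fun_prop)
    rw [← (PiLp.volume_preserving_toLp (Fin n)).lintegral_comp hG4]
    refine lintegral_congr fun y => ?_
    rw [hι, hcomb]
    change G (b.repr.symm (WithLp.toLp 2 ((Fin.insertNthEquiv (fun _ => ℝ) 0) (t, y)))) = _
    simp only [Fin.insertNthEquiv_zero]
    rfl

/-! ### The reflection formula on the sphere -/

/-- The quadratic lift `x ↦ |x|² a - 2 (a·x) x` of the reflection map `e ↦ a - 2 (a·e) e`. -/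
noncomputable def reflLift {d : ℕ} (a x : Vel d) : Vel d := ‖x‖ ^ 2 • a - (2 * ⟪a, x⟫) • x

/-- The derivative of `reflLift a` at `x`. -/
noncomputable def reflLiftDeriv {d : ℕ} (a x : Vel d) : Vel d →L[ℝ] Vel d :=
  (2 • innerSL ℝ x).smulRight a - ((2 • innerSL ℝ a).smulRight x +
    (2 * ⟪a, x⟫) • ContinuousLinearMap.id ℝ (Vel d))

theorem hasFDerivAt_reflLift {d : ℕ} (a x : Vel d) :
    HasFDerivAt (reflLift a) (reflLiftDeriv a x) x := by
  have h1 : HasFDerivAt (fun x : Vel d => ‖x‖ ^ 2) (2 • innerSL ℝ x) x :=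
    (hasStrictFDerivAt_norm_sq x).hasFDerivAt
  have h2 : HasFDerivAt (fun x : Vel d => 2 * ⟪a, x⟫) (2 • innerSL ℝ a) x := by
    have := ((innerSL ℝ a).hasFDerivAt (x := x)).const_mul 2
    convert! this using 1
    ext; simp
  have h3 := (h1.smul_const a).sub (h2.smul (hasFDerivAt_id x))
  convert! h3 using 1
  ext h
  simp [reflLiftDeriv]
  ring

/-- Up to the scalar `-2⟪a, x⟫` the derivative is the identity plus a matrix of rank two, so that
Sylvester's identity reduces the determinant to one of size two. -/
theorem det_reflLiftDeriv {n : ℕ} (hn : 1 ≤ n) (a x : Vel (n + 1)) (ha : ‖a‖ = 1)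
    (hx : ⟪a, x⟫ ≠ 0) :
    |(reflLiftDeriv a x).det| = 2 ^ (n + 1) * |⟪a, x⟫| ^ (n - 1) * ‖x‖ ^ 2 := by
  set α : ℝ := ⟪a, x⟫ with hα
  let A : Matrix (Fin (n + 1)) (Fin 2) ℝ := Matrix.of fun i j => if j = 0 then a i else x i
  let B : Matrix (Fin 2) (Fin (n + 1)) ℝ :=
    Matrix.of fun j i => if j = 0 then -(α⁻¹ * x i) else α⁻¹ * a i
  let Φ := WithLp.linearEquiv 2 ℝ (Fin (n + 1) → ℝ)
  have hM : LinearMap.toMatrix' ((Φ : Vel (n + 1) →ₗ[ℝ] (Fin (n + 1) → ℝ)) ∘ₗ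
      (reflLiftDeriv a x : Vel (n + 1) →ₗ[ℝ] Vel (n + 1)) ∘ₗ
      (Φ.symm : (Fin (n + 1) → ℝ) →ₗ[ℝ] Vel (n + 1))) = (-(2 * α)) • (1 + A * B) := by
    ext i j
    rw [LinearMap.toMatrix'_apply]
    simp [Φ, reflLiftDeriv, Matrix.mul_apply, Fin.sum_univ_two, A, B,
      Matrix.one_apply]
    have hs : ∀ p : Vel (n + 1), ⟪p, PiLp.single 2 j (1 : ℝ)⟫ = p j := fun p => by
      have := EuclideanSpace.inner_single_right (𝕜 := ℝ) j 1 p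
      simpa using this
    rw [hs, hs, ← hα]
    split_ifs <;> field_simp <;> ring
  have hin : ∀ p q : Vel (n + 1), ∑ i, p i * q i = ⟪p, q⟫ := fun p q => by
    simp [PiLp.inner_apply, mul_comm]
  have hdet : (1 + A * B).det = ‖x‖ ^ 2 / α ^ 2 := by
    rw [Matrix.det_one_add_mul_comm, Matrix.det_fin_two]
    have e00 : (B * A) 0 0 = -1 := by
      have : (B * A) 0 0 = -(α⁻¹ * ∑ i, x i * a i) := by
        simp [Matrix.mul_apply, A, B, Finset.mul_sum, mul_assoc]
      rw [this, hin, real_inner_comm, ← hα, inv_mul_cancel₀ hx]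
    have e01 : (B * A) 0 1 = -(α⁻¹ * ‖x‖ ^ 2) := by
      have : (B * A) 0 1 = -(α⁻¹ * ∑ i, x i * x i) := by
        simp [Matrix.mul_apply, A, B, Finset.mul_sum, mul_assoc]
      rw [this, hin, real_inner_self_eq_norm_sq]
    have e10 : (B * A) 1 0 = α⁻¹ := by
      have : (B * A) 1 0 = (α⁻¹ * ∑ i, a i * a i) := by
        simp [Matrix.mul_apply, A, B, Finset.mul_sum, mul_assoc]
      rw [this, hin, real_inner_self_eq_norm_sq, ha]; simp
    have e11 : (B * A) 1 1 = 1 := by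
      have : (B * A) 1 1 = (α⁻¹ * ∑ i, a i * x i) := by
        simp [Matrix.mul_apply, A, B, Finset.mul_sum, mul_assoc]
      rw [this, hin, ← hα, inv_mul_cancel₀ hx]
    simp [e00, e01, e10, e11]
    field_simp
  have : (reflLiftDeriv a x).det = (-(2 * α)) ^ (n + 1) * (‖x‖ ^ 2 / α ^ 2) := by
    rw [ContinuousLinearMap.det, ← LinearMap.det_conj _ Φ,
      ← LinearMap.det_toMatrix', hM, Matrix.det_smul, hdet]
    simp
  obtain ⟨k, rfl⟩ : ∃ k, n = k + 1 := ⟨n - 1, by omega⟩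
  rw [this, abs_mul, abs_pow, abs_neg, abs_mul, abs_of_pos (two_pos : (0 : ℝ) < 2), abs_div, abs_pow,
    abs_pow, abs_of_nonneg (norm_nonneg x), mul_pow]
  have : |α| ≠ 0 := by simpa using hx
  simp only [Nat.add_sub_cancel]
  field_simp
  ring

theorem norm_reflLift {d : ℕ} (a x : Vel d) (ha : ‖a‖ = 1) : ‖reflLift a x‖ = ‖x‖ ^ 2 := by
  have h : ‖reflLift a x‖ ^ 2 = (‖x‖ ^ 2) ^ 2 := by
    rw [reflLift, norm_sub_sq_real, norm_smul, norm_smul, inner_smul_left, inner_smul_right, ha]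
    simp only [norm_mul, norm_pow, Real.norm_eq_abs, conj_trivial, mul_pow, sq_abs]
    ring
  exact (pow_left_inj₀ (norm_nonneg _) (by positivity) two_ne_zero).1 h

theorem reflLift_injOn {d : ℕ} (a : Vel d) (ha : ‖a‖ = 1) :
    InjOn (reflLift a) {x | ⟪a, x⟫ < 0} := by
  intro x hx y hy h
  simp only [mem_ofPred_eq] at hx hy
  have hn : ‖x‖ ^ 2 = ‖y‖ ^ 2 := by rw [← norm_reflLift a x ha, h, norm_reflLift a y ha]
  have h1 : ⟪a, x⟫ • x = ⟪a, y⟫ • y := by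
    simp only [reflLift, hn] at h
    have h2 := sub_right_injective h
    simp only [mul_smul] at h2
    exact smul_right_injective _ (two_ne_zero : (2 : ℝ) ≠ 0) h2
  have h3 : ⟪a, x⟫ = ⟪a, y⟫ := by
    have h4 := congrArg (fun z => ⟪a, z⟫) h1
    simp only [inner_smul_right] at h4
    nlinarith
  rw [h3] at h1
  exact smul_right_injective _ hy.ne h1

/-- The lift misses at most the line spanned by `a`, which is a null set. The preimage of `y` off
this line is proportional to `y/|y| - a`. -/
theorem compl_image_reflLift {d : ℕ} (a : Vel d) (ha : ‖a‖ = 1) :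
    (reflLift a '' {x | ⟪a, x⟫ < 0})ᶜ ⊆ (ℝ ∙ a : Submodule ℝ (Vel d)) := by
  intro y hy
  by_contra hya
  refine hy ?_
  have hy0 : y ≠ 0 := by rintro rfl; exact hya (Submodule.zero_mem _)
  have hny : 0 < ‖y‖ := norm_pos_iff.2 hy0
  set σ : Vel d := ‖y‖⁻¹ • y with hσ
  have hσ1 : ‖σ‖ = 1 := by simp [hσ, norm_smul, hny.ne']
  have hyσ : y = ‖y‖ • σ := by simp [hσ, smul_smul, hny.ne']
  have hne : σ - a ≠ 0 := by
    intro h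
    refine hya ?_
    rw [hyσ, sub_eq_zero.1 h]
    exact Submodule.smul_mem _ _ (Submodule.mem_span_singleton_self a)
  have hk : 0 < ‖σ - a‖ := norm_pos_iff.2 hne
  have hin : ⟪a, σ - a⟫ = -(‖σ - a‖ ^ 2 / 2) := by
    rw [norm_sub_sq_real, inner_sub_right, real_inner_self_eq_norm_sq, hσ1, ha,
      real_inner_comm]
    ring
  refine ⟨(√‖y‖ / ‖σ - a‖) • (σ - a), ?_, ?_⟩
  · simp only [mem_ofPred_eq, inner_smul_right, hin]
    have : 0 < √‖y‖ / ‖σ - a‖ := by positivity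
    nlinarith [sq_pos_of_pos hk]
  · have e1 : ‖(√‖y‖ / ‖σ - a‖) • (σ - a)‖ ^ 2 = ‖y‖ := by
      rw [norm_smul, Real.norm_eq_abs, abs_of_nonneg (by positivity), div_mul_cancel₀ _ hk.ne',
        Real.sq_sqrt hny.le]
    have e2 : 2 * (√‖y‖ / ‖σ - a‖ * -(‖σ - a‖ ^ 2 / 2)) * (√‖y‖ / ‖σ - a‖) = -‖y‖ := by
      have := Real.mul_self_sqrt hny.le
      field_simp
      nlinarith
    rw [reflLift, e1, inner_smul_right, hin, smul_smul, e2]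
    conv_rhs => rw [hyσ]
    module

theorem lintegral_pow_mul_indicator (k : ℕ) {c : ℝ} (hc : 0 ≤ c) :
    ∫⁻ r in Ioi (0 : ℝ), ENNReal.ofReal (r ^ k) * (Iio c).indicator 1 r =
      ENNReal.ofReal (c ^ (k + 1) / (k + 1)) := by
  have : ∀ r : ℝ, ENNReal.ofReal (r ^ k) * (Iio c).indicator 1 r =
      (Iio c).indicator (fun r => ENNReal.ofReal (r ^ k)) r := by
    intro r; by_cases h : r < c <;> simp [h]
  simp_rw [this]
  rw [lintegral_indicator measurableSet_Iio, Measure.restrict_restrict measurableSet_Iio,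
    Iio_inter_Ioi, Measure.restrict_congr_set Ioo_ae_eq_Ioc,
    ← ofReal_integral_eq_lintegral_ofReal, ← intervalIntegral.integral_of_le hc,
    integral_pow]
  · simp
  · exact (intervalIntegral.intervalIntegrable_pow k).1
  · filter_upwards [ae_restrict_mem measurableSet_Ioc] with r hr
    exact pow_nonneg hr.1.le _

/-- The change of variables `σ = a - 2 (a·e) e` on the unit sphere. It is the change of variables
`reflLift a` of `ℝ^{n+1}`, read in polar coordinates. -/
theorem lintegral_sphere_reflection {n : ℕ} (hn : 1 ≤ n) (a : Vel (n + 1)) (ha : ‖a‖ = 1)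
    {G : Vel (n + 1) → ℝ≥0∞} (hG : Measurable G) :
    ∫⁻ σ : Sph (n + 1), G σ ∂(surfaceMeasure (n + 1)) =
      2 ^ n * ∫⁻ e : Sph (n + 1), ({e | ⟪a, (e : Vel (n + 1))⟫ < 0} : Set (Sph (n + 1))).indicator
        (fun e => ENNReal.ofReal (|⟪a, (e : Vel (n + 1))⟫| ^ (n - 1)) *
          G (a - (2 * ⟪a, (e : Vel (n + 1))⟫) • e)) e ∂(surfaceMeasure (n + 1)) := by
  set U : Set (Vel (n + 1)) := {x | ⟪a, x⟫ < 0} with hU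
  have hUm : MeasurableSet U := measurableSet_lt (by fun_prop) measurable_const
  -- the test function is `G` extended homogeneously to the unit ball
  let g : Vel (n + 1) → ℝ≥0∞ := fun y => (Iio (1 : ℝ)).indicator 1 ‖y‖ * G (‖y‖⁻¹ • y)
  have hg : Measurable g := by
    refine Measurable.mul ?_ (hG.comp (by fun_prop))
    exact (measurable_one.indicator measurableSet_Iio).comp measurable_norm
  have hint : ∀ k : ℕ, ∫⁻ r in Ioi (0 : ℝ), ENNReal.ofReal (r ^ k) * (Iio (1 : ℝ)).indicator 1 r =
      ENNReal.ofReal (1 / (k + 1)) := fun k => by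
    rw [lintegral_pow_mul_indicator k zero_le_one, one_pow]
  have hL : ∫⁻ x, g x = (∫⁻ σ : Sph (n + 1), G σ ∂(surfaceMeasure (n + 1))) *
      ENNReal.ofReal (1 / (n + 1)) := by
    rw [lintegral_polar hg, ← lintegral_mul_const _ (by exact hG.comp measurable_subtype_coe)]
    refine lintegral_congr fun e => ?_
    rw [← hint n, ← lintegral_const_mul _ (by
      refine Measurable.mul (by fun_prop) (measurable_one.indicator measurableSet_Iio))]
    refine setLIntegral_congr_fun measurableSet_Ioi fun r hr => ?_
    have hr' : (0 : ℝ) < r := hr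
    simp only [g, norm_smul, Real.norm_eq_abs, abs_of_pos hr', norm_eq_of_mem_sphere, mul_one,
      smul_smul, inv_mul_cancel₀ hr'.ne', one_smul]
    ring
  have hR : ∫⁻ x, g x = ∫⁻ x in U, ENNReal.ofReal |(reflLiftDeriv a x).det| * g (reflLift a x) := by
    rw [← lintegral_image_eq_lintegral_abs_det_fderiv_mul volume hUm
      (fun x _ => (hasFDerivAt_reflLift a x).hasFDerivWithinAt) (reflLift_injOn a ha) g]
    rw [← setLIntegral_univ]
    refine setLIntegral_congr ?_
    refine (ae_eq_univ.2 (measure_mono_null (compl_image_reflLift a ha) ?_)).symm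
    refine Measure.addHaar_submodule _ _ fun h => ?_
    have := finrank_span_singleton (K := ℝ) (v := a) (by rintro rfl; simp at ha)
    rw [h, finrank_top, finrank_euclideanSpace, Fintype.card_fin] at this
    omega
  have hcont : Continuous (reflLift a) :=
    continuous_iff_continuousAt.2 fun x => (hasFDerivAt_reflLift a x).continuousAt
  let c : ℝ≥0∞ := ENNReal.ofReal (2 ^ n / (n + 1))
  have hR2 : ∫⁻ x in U, ENNReal.ofReal |(reflLiftDeriv a x).det| * g (reflLift a x) =
      c * ∫⁻ e : Sph (n + 1), ({e | ⟪a, (e : Vel (n + 1))⟫ < 0} : Set (Sph (n + 1))).indicator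
        (fun e => ENNReal.ofReal (|⟪a, (e : Vel (n + 1))⟫| ^ (n - 1)) *
          G (a - (2 * ⟪a, (e : Vel (n + 1))⟫) • e)) e ∂(surfaceMeasure (n + 1)) := by
    have e1 : ∫⁻ x in U, ENNReal.ofReal |(reflLiftDeriv a x).det| * g (reflLift a x) =
        ∫⁻ x, U.indicator (fun x => ENNReal.ofReal (2 ^ (n + 1) * |⟪a, x⟫| ^ (n - 1) * ‖x‖ ^ 2) *
          g (reflLift a x)) x := by
      rw [lintegral_indicator hUm]
      refine setLIntegral_congr_fun hUm fun x hx => ?_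
      simp only [det_reflLiftDeriv hn a x ha (ne_of_lt hx)]
    rw [e1, lintegral_polar, ← lintegral_const_mul]
    · refine lintegral_congr fun e => ?_
      by_cases he : ⟪a, (e : Vel (n + 1))⟫ < 0
      · rw [indicator_of_mem (by exact he)]
        have e2 : ∀ r ∈ Ioi (0 : ℝ), ENNReal.ofReal (r ^ n) * U.indicator (fun x =>
            ENNReal.ofReal (2 ^ (n + 1) * |⟪a, x⟫| ^ (n - 1) * ‖x‖ ^ 2) *
              g (reflLift a x)) (r • (e : Vel (n + 1))) =
            (2 ^ (n + 1) * (ENNReal.ofReal (|⟪a, (e : Vel (n + 1))⟫| ^ (n - 1)) *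
              G (a - (2 * ⟪a, (e : Vel (n + 1))⟫) • e))) *
              (ENNReal.ofReal (r ^ (2 * n + 1)) * (Iio (1 : ℝ)).indicator 1 r) := by
          intro r hr
          have hr' : (0 : ℝ) < r := hr
          have hmem : r • (e : Vel (n + 1)) ∈ U := by
            simp only [hU, mem_ofPred_eq, inner_smul_right]; exact mul_neg_of_pos_of_neg hr' he
          have hlift : reflLift a (r • (e : Vel (n + 1))) =
              r ^ 2 • (a - (2 * ⟪a, (e : Vel (n + 1))⟫) • (e : Vel (n + 1))) := by
            simp only [reflLift, norm_smul, Real.norm_eq_abs, abs_of_pos hr',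
              norm_eq_of_mem_sphere, mul_one, inner_smul_right]
            module
          have hnorm : ‖reflLift a (r • (e : Vel (n + 1)))‖ = r ^ 2 := by
            rw [norm_reflLift _ _ ha]; simp [norm_smul, abs_of_pos hr']
          have hind : (Iio (1 : ℝ)).indicator (1 : ℝ → ℝ≥0∞) (r ^ 2) =
              (Iio (1 : ℝ)).indicator 1 r := by
            have : r ^ 2 < 1 ↔ r < 1 := by
              rw [sq_lt_one_iff₀ hr'.le]
            simp [indicator, this]
          rw [indicator_of_mem hmem]
          simp only [g]
          rw [hnorm, hind, hlift, smul_smul, inv_mul_cancel₀ (by positivity), one_smul]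
          have hpow : ENNReal.ofReal (r ^ n) * ENNReal.ofReal
              (2 ^ (n + 1) * |⟪a, r • (e : Vel (n + 1))⟫| ^ (n - 1) * ‖r • (e : Vel (n + 1))‖ ^ 2) =
              2 ^ (n + 1) * ENNReal.ofReal (|⟪a, (e : Vel (n + 1))⟫| ^ (n - 1)) *
                ENNReal.ofReal (r ^ (2 * n + 1)) := by
            have h2 : (2 : ℝ≥0∞) ^ (n + 1) = ENNReal.ofReal (2 ^ (n + 1)) := by
              rw [ENNReal.ofReal_pow (by norm_num)]; simp
            rw [h2, ← ENNReal.ofReal_mul (by positivity), ← ENNReal.ofReal_mul (by positivity),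
              ← ENNReal.ofReal_mul (by positivity)]
            congr 1
            simp only [inner_smul_right, abs_mul, abs_of_pos hr', norm_smul, Real.norm_eq_abs,
              norm_eq_of_mem_sphere, mul_one, mul_pow]
            obtain ⟨k, rfl⟩ : ∃ k, n = k + 1 := ⟨n - 1, by omega⟩
            simp only [Nat.add_sub_cancel]
            ring
          rw [← mul_assoc, ← mul_assoc, hpow]
          ring
        rw [setLIntegral_congr_fun measurableSet_Ioi e2, lintegral_const_mul _ (by
          refine Measurable.mul (by fun_prop) (measurable_one.indicator measurableSet_Iio)), hint,
          mul_right_comm]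
        congr 1
        have h2 : (2 : ℝ≥0∞) ^ (n + 1) = ENNReal.ofReal (2 ^ (n + 1)) := by
          rw [ENNReal.ofReal_pow (by norm_num)]; simp
        rw [h2, ← ENNReal.ofReal_mul (by positivity)]
        congr 1
        push_cast
        field_simp
        ring
      · rw [indicator_of_notMem (by exact he), mul_zero]
        rw [setLIntegral_congr_fun (g := fun _ => 0) measurableSet_Ioi, lintegral_zero]
        intro r hr
        simp only
        rw [indicator_of_notMem, mul_zero]
        have hr' : (0 : ℝ) < r := hr
        simp only [hU, mem_ofPred_eq, inner_smul_right, not_lt]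
        exact mul_nonneg hr'.le (not_lt.1 he)
    · refine Measurable.indicator ?_ (measurableSet_lt (by fun_prop) measurable_const)
      exact Measurable.mul (by fun_prop) (hG.comp (by fun_prop))
    · refine Measurable.indicator ?_ hUm
      exact Measurable.mul (by fun_prop) (hg.comp hcont.measurable)
  have hc : c = 2 ^ n * ENNReal.ofReal (1 / (n + 1)) := by
    have h2 : (2 : ℝ≥0∞) ^ n = ENNReal.ofReal (2 ^ n) := by
      rw [ENNReal.ofReal_pow (by norm_num)]; simp
    rw [h2, ← ENNReal.ofReal_mul (by positivity)]
    simp only [c]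
    congr 1
    ring
  rw [hL] at hR
  rw [hR2, hc, mul_right_comm] at hR
  exact (ENNReal.mul_left_inj (by simp; positivity) (by simp)).1 hR

/-! ### The measure on pairs of orthogonal displacements -/

/-- The displacements `(v' - v, v'_* - v)` of a collision, as a function of the relative velocity
`z = v - v_*` and of `σ`. -/
noncomputable def displacements {d : ℕ} (p : Vel d × Sph d) : Vel d × Vel d :=
  ((1 / 2 : ℝ) • (‖p.1‖ • (p.2 : Vel d) - p.1), -((1 / 2 : ℝ) • (p.1 + ‖p.1‖ • (p.2 : Vel d))))

theorem continuous_displacements {d : ℕ} : Continuous (displacements (d := d)) := by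
  unfold displacements; fun_prop

/-- The image of `dz dσ` under `displacements`. -/
noncomputable def pairMeasure (d : ℕ) : Measure (Vel d × Vel d) :=
  ((volume : Measure (Vel d)).prod (surfaceMeasure d)).map displacements

theorem lintegral_pairMeasure {d : ℕ} {F : Vel d × Vel d → ℝ≥0∞} (hF : Measurable F) :
    ∫⁻ p, F p ∂(pairMeasure d) =
      ∫⁻ z : Vel d, ∫⁻ σ : Sph d, F (displacements (z, σ)) ∂(surfaceMeasure d) := by
  rw [pairMeasure, lintegral_map hF continuous_displacements.measurable]
  exact lintegral_prod _ (hF.comp continuous_displacements.measurable).aemeasurable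

theorem inner_displacements {d : ℕ} (p : Vel d × Sph d) :
    ⟪(displacements p).1, (displacements p).2⟫ = 0 := by
  simp only [displacements, inner_neg_right, inner_smul_left, inner_smul_right, inner_sub_left,
    inner_add_right, real_inner_self_eq_norm_sq, norm_eq_of_mem_sphere,
    real_inner_comm p.1 (p.2 : Vel d)]
  simp
  ring

theorem ae_pairMeasure_inner {d : ℕ} : ∀ᵐ p ∂(pairMeasure d), ⟪p.1, p.2⟫ = 0 := by
  rw [pairMeasure, ae_map_iff continuous_displacements.aemeasurable
    (measurableSet_eq_fun (by fun_prop) measurable_const)]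
  exact ae_of_all _ inner_displacements

theorem displacements_neg {d : ℕ} (z : Vel d) (σ : Sph d) :
    displacements (z, -σ) = (displacements (z, σ)).swap := by
  have h : ((-σ : Sph d) : Vel d) = -(σ : Vel d) := rfl
  simp only [displacements, Prod.swap, h]
  ext1 <;> simp only <;> module

theorem lintegral_pairMeasure_swap {d : ℕ} {F : Vel d × Vel d → ℝ≥0∞} (hF : Measurable F) :
    ∫⁻ p, F p.swap ∂(pairMeasure d) = ∫⁻ p, F p ∂(pairMeasure d) := by
  rw [lintegral_pairMeasure hF,
    lintegral_pairMeasure (F := fun p => F p.swap) (hF.comp measurable_swap)]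
  refine lintegral_congr fun z => ?_
  have := lintegral_sphere_neg (G := fun σ : Sph d => F (displacements (z, σ)))
    (hF.comp (continuous_displacements.measurable.comp (by fun_prop)))
  rw [← this]
  simp only [displacements_neg]

theorem lintegral_pairMeasure_eq {n : ℕ} (hn : 1 ≤ n) {F : Vel (n + 1) × Vel (n + 1) → ℝ≥0∞}
    (hF : Measurable F) :
    ∫⁻ p, F p ∂(pairMeasure (n + 1)) =
      2 ^ n * ∫⁻ z : Vel (n + 1), ∫⁻ e : Sph (n + 1),
        ({e | 0 < ⟪(e : Vel (n + 1)), z⟫} : Set (Sph (n + 1))).indicator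
        (fun e => ENNReal.ofReal ((⟪(e : Vel (n + 1)), z⟫ / ‖z‖) ^ (n - 1)) *
          F (⟪(e : Vel (n + 1)), z⟫ • (e : Vel (n + 1)),
            z - ⟪(e : Vel (n + 1)), z⟫ • (e : Vel (n + 1)))) e
        ∂(surfaceMeasure (n + 1)) := by
  rw [lintegral_pairMeasure hF, ← lintegral_neg_eq_self, ← lintegral_const_mul' _ _ (by simp)]
  refine lintegral_congr_ae ?_
  have h0 : ∀ᵐ z : Vel (n + 1), z ≠ 0 := by
    rw [ae_iff]; simp
  filter_upwards [h0] with z hz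
  have hz' : ‖z‖ ≠ 0 := norm_ne_zero_iff.2 hz
  have hzp : 0 < ‖z‖ := norm_pos_iff.2 hz
  set a : Vel (n + 1) := -(‖z‖⁻¹ • z) with ha
  have ha1 : ‖a‖ = 1 := by simp [ha, norm_smul, hz']
  let G : Vel (n + 1) → ℝ≥0∞ := fun σ =>
    F ((1 / 2 : ℝ) • (‖-z‖ • σ - -z), -((1 / 2 : ℝ) • (-z + ‖-z‖ • σ)))
  have hG : Measurable G := hF.comp (by fun_prop)
  have := lintegral_sphere_reflection hn a ha1 hG
  rw [show ∫⁻ σ : Sph (n + 1), F (displacements (-z, σ)) ∂(surfaceMeasure (n + 1)) =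
    ∫⁻ σ : Sph (n + 1), G σ ∂(surfaceMeasure (n + 1)) from rfl, this]
  congr 1
  refine lintegral_congr fun e => ?_
  have hae : ⟪a, (e : Vel (n + 1))⟫ = -(⟪(e : Vel (n + 1)), z⟫ / ‖z‖) := by
    rw [ha, inner_neg_left, inner_smul_left, real_inner_comm]; simp; ring
  have hiff : ⟪a, (e : Vel (n + 1))⟫ < 0 ↔ 0 < ⟪(e : Vel (n + 1)), z⟫ := by
    rw [hae, neg_lt_zero]
    exact ⟨fun h => by simpa [hz'] using (mul_pos h hzp), fun h => div_pos h hzp⟩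
  by_cases he : 0 < ⟪(e : Vel (n + 1)), z⟫
  · rw [indicator_of_mem (by exact hiff.2 he), indicator_of_mem (by exact he), hae, abs_neg,
      abs_of_pos (div_pos he hzp)]
    congr 1
    simp only [G, norm_neg]
    have hk : ‖z‖ • (a - (2 * -(⟪(e : Vel (n + 1)), z⟫ / ‖z‖)) • (e : Vel (n + 1))) =
        -z + (2 * ⟪(e : Vel (n + 1)), z⟫) • (e : Vel (n + 1)) := by
      rw [ha, smul_sub, smul_neg, smul_smul, smul_smul, mul_inv_cancel₀ hz',
        show ‖z‖ * (2 * -(⟪(e : Vel (n + 1)), z⟫ / ‖z‖)) = -(2 * ⟪(e : Vel (n + 1)), z⟫) by field_simp]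
      module
    rw [hk]
    congr 2 <;> module
  · rw [indicator_of_notMem (by exact fun h => he (hiff.1 h)), indicator_of_notMem (by exact he)]

/-- A linear isometry of `ℝ^n` onto the orthogonal complement of `e`. -/
noncomputable def chart {n : ℕ} (e : Sph (n + 1)) : Vel n →ₗᵢ[ℝ] Vel (n + 1) :=
  (exists_orthogonal_chart e).choose

@[simp] theorem inner_chart {n : ℕ} (e : Sph (n + 1)) (y : Vel n) :
    ⟪(e : Vel (n + 1)), chart e y⟫ = 0 :=
  (exists_orthogonal_chart e).choose_spec.1 y

theorem lintegral_chart {n : ℕ} (e : Sph (n + 1)) {G : Vel (n + 1) → ℝ≥0∞} (hG : Measurable G) :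
    ∫⁻ x, G x = ∫⁻ t : ℝ, ∫⁻ y, G (t • (e : Vel (n + 1)) + chart e y) :=
  (exists_orthogonal_chart e).choose_spec.2 G hG

theorem inner_smul_add_chart {n : ℕ} (e : Sph (n + 1)) (t : ℝ) (y : Vel n) :
    ⟪(e : Vel (n + 1)), t • (e : Vel (n + 1)) + chart e y⟫ = t := by
  rw [inner_add_right, inner_smul_right, inner_chart, real_inner_self_eq_norm_sq]; simp

theorem norm_smul_add_chart {n : ℕ} (e : Sph (n + 1)) (t : ℝ) (y : Vel n) :
    ‖t • (e : Vel (n + 1)) + chart e y‖ = √(t ^ 2 + ‖y‖ ^ 2) := by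
  rw [eq_comm, Real.sqrt_eq_iff_mul_self_eq (by positivity) (norm_nonneg _), ← pow_two,
    norm_add_sq_real, inner_smul_left, inner_chart, norm_smul]
  simp

/-- Carleman coordinates: `u = t e` and `w ∈ e^⊥`. -/
theorem lintegral_pairMeasure_carleman {n : ℕ} (hn : 1 ≤ n)
    {F : Vel (n + 1) × Vel (n + 1) → ℝ≥0∞} (hF : Measurable F) :
    ∫⁻ p, F p ∂(pairMeasure (n + 1)) =
      2 ^ n * ∫⁻ e : Sph (n + 1), (∫⁻ t in Ioi (0 : ℝ), ∫⁻ y : Vel n,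
        ENNReal.ofReal ((t / √(t ^ 2 + ‖y‖ ^ 2)) ^ (n - 1)) *
          F (t • (e : Vel (n + 1)), chart e y)) ∂(surfaceMeasure (n + 1)) := by
  rw [lintegral_pairMeasure_eq hn hF, lintegral_lintegral_swap]
  · congr 1
    refine lintegral_congr fun e => ?_
    let U : Set (Vel (n + 1)) := {z | 0 < ⟪(e : Vel (n + 1)), z⟫}
    have hU : MeasurableSet U := measurableSet_lt measurable_const (by fun_prop)
    let G : Vel (n + 1) → ℝ≥0∞ := fun z =>
      ENNReal.ofReal ((⟪(e : Vel (n + 1)), z⟫ / ‖z‖) ^ (n - 1)) *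
          F (⟪(e : Vel (n + 1)), z⟫ • (e : Vel (n + 1)),
            z - ⟪(e : Vel (n + 1)), z⟫ • (e : Vel (n + 1)))
    have hG : Measurable G := Measurable.mul (by fun_prop) (hF.comp (by fun_prop))
    have := lintegral_chart e (hG.indicator hU)
    refine (Eq.trans ?_ this).trans ?_
    · refine lintegral_congr fun z => ?_
      by_cases hz : 0 < ⟪(e : Vel (n + 1)), z⟫
      · rw [indicator_of_mem (by exact hz), indicator_of_mem (by exact hz)]
      · rw [indicator_of_notMem (by exact hz), indicator_of_notMem (by exact hz)]
    · rw [← lintegral_indicator measurableSet_Ioi]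
      refine lintegral_congr fun t => ?_
      by_cases ht : 0 < t
      · rw [indicator_of_mem (by exact ht)]
        refine lintegral_congr fun y => ?_
        rw [indicator_of_mem (by
          change 0 < ⟪(e : Vel (n + 1)), _⟫; rw [inner_smul_add_chart]; exact ht)]
        simp only [G, inner_smul_add_chart, norm_smul_add_chart, add_sub_cancel_left]
      · rw [indicator_of_notMem (by exact ht)]
        rw [lintegral_congr (g := fun _ => 0) fun y => ?_, lintegral_zero]
        rw [indicator_of_notMem (by
          change ¬ 0 < ⟪(e : Vel (n + 1)), _⟫; rw [inner_smul_add_chart]; exact ht)]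
  · refine Measurable.aemeasurable ?_
    have : MeasurableSet {p : Vel (n + 1) × Sph (n + 1) | 0 < ⟪(p.2 : Vel (n + 1)), p.1⟫} :=
      measurableSet_lt measurable_const (by fun_prop)
    have hm := Measurable.indicator (f := fun p : Vel (n + 1) × Sph (n + 1) =>
        ENNReal.ofReal ((⟪(p.2 : Vel (n + 1)), p.1⟫ / ‖p.1‖) ^ (n - 1)) *
          F (⟪(p.2 : Vel (n + 1)), p.1⟫ • (p.2 : Vel (n + 1)),
            p.1 - ⟪(p.2 : Vel (n + 1)), p.1⟫ • (p.2 : Vel (n + 1)))) (by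
      refine Measurable.mul (by fun_prop) (hF.comp (by fun_prop))) this
    convert! hm using 1

/-- Carleman coordinates with the roles of the two displacements exchanged. -/
theorem lintegral_pairMeasure_carleman_swap {n : ℕ} (hn : 1 ≤ n)
    {F : Vel (n + 1) × Vel (n + 1) → ℝ≥0∞} (hF : Measurable F) :
    ∫⁻ p, F p ∂(pairMeasure (n + 1)) =
      2 ^ n * ∫⁻ e : Sph (n + 1), (∫⁻ t in Ioi (0 : ℝ), ∫⁻ y : Vel n,
        ENNReal.ofReal ((t / √(t ^ 2 + ‖y‖ ^ 2)) ^ (n - 1)) *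
          F (chart e y, t • (e : Vel (n + 1)))) ∂(surfaceMeasure (n + 1)) := by
  rw [← lintegral_pairMeasure_swap hF]
  exact lintegral_pairMeasure_carleman hn (hF.comp measurable_swap)

theorem lintegral_pairMeasure_neg_fst {n : ℕ} (hn : 1 ≤ n)
    {F : Vel (n + 1) × Vel (n + 1) → ℝ≥0∞} (hF : Measurable F) :
    ∫⁻ p, F (-p.1, p.2) ∂(pairMeasure (n + 1)) = ∫⁻ p, F p ∂(pairMeasure (n + 1)) := by
  rw [lintegral_pairMeasure_carleman_swap hn hF,
    lintegral_pairMeasure_carleman_swap hn (F := fun p => F (-p.1, p.2)) (hF.comp (by fun_prop))]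
  congr 1
  refine lintegral_congr fun e => lintegral_congr fun t => ?_
  rw [← lintegral_neg_eq_self]
  simp

/-! ### The collision measure -/

/-- `|u|^{-n-2s} |w|^{γ+2s+1} (|u|² + |w|²)^{(n-1)/2}`: the collision kernel in dimension `n + 1`, in
terms of the displacements, without its angular factor. -/
noncomputable def pairKernel {n : ℕ} (γ s : ℝ) (p : Vel (n + 1) × Vel (n + 1)) : ℝ :=
  √(‖p.1‖ ^ 2 + ‖p.2‖ ^ 2) ^ (n - 1) * (‖p.1‖ ^ (-(n + 2 * s)) * ‖p.2‖ ^ (γ + 2 * s + 1))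

/-- `cos θ` in terms of the displacements. -/
noncomputable def pairCos {d : ℕ} (p : Vel d × Vel d) : ℝ :=
  (‖p.2‖ ^ 2 - ‖p.1‖ ^ 2) / (‖p.1‖ ^ 2 + ‖p.2‖ ^ 2)

/-- The image of `B dv_* dσ` under the displacements, with angular factor `β`. -/
noncomputable def collisionMeasure (n : ℕ) (γ s : ℝ) (β : ℝ → ℝ) :
    Measure (Vel (n + 1) × Vel (n + 1)) :=
  (pairMeasure (n + 1)).withDensity fun p => ENNReal.ofReal (pairKernel γ s p * β (pairCos p))

theorem measurable_pairKernel {n : ℕ} (γ s : ℝ) : Measurable (pairKernel (n := n) γ s) := by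
  unfold pairKernel; fun_prop

theorem measurable_pairCos {d : ℕ} : Measurable (pairCos (d := d)) := by
  unfold pairCos; fun_prop

theorem pairKernel_nonneg {n : ℕ} (γ s : ℝ) (p : Vel (n + 1) × Vel (n + 1)) :
    0 ≤ pairKernel γ s p := by
  unfold pairKernel; positivity

theorem lintegral_collisionMeasure {n : ℕ} {γ s : ℝ} {β : ℝ → ℝ} (hβ : Measurable β)
    {F : Vel (n + 1) × Vel (n + 1) → ℝ≥0∞} (hF : Measurable F) :
    ∫⁻ p, F p ∂(collisionMeasure n γ s β) =
      ∫⁻ p, ENNReal.ofReal (pairKernel γ s p * β (pairCos p)) * F p ∂(pairMeasure (n + 1)) := by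
  rw [collisionMeasure, lintegral_withDensity_eq_lintegral_mul _ _ hF]
  · rfl
  · exact ((measurable_pairKernel γ s).mul (hβ.comp measurable_pairCos)).ennreal_ofReal

theorem lintegral_collisionMeasure_le {n : ℕ} {γ s b : ℝ} {β : ℝ → ℝ} (hβ : Measurable β)
    (hb0 : 0 ≤ b) (hb : ∀ c, β c ≤ b) {F : Vel (n + 1) × Vel (n + 1) → ℝ≥0∞} (hF : Measurable F) :
    ∫⁻ p, F p ∂(collisionMeasure n γ s β) ≤
      ENNReal.ofReal b * ∫⁻ p, F p ∂(collisionMeasure n γ s 1) := by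
  rw [lintegral_collisionMeasure hβ hF, lintegral_collisionMeasure measurable_one hF,
    ← lintegral_const_mul' _ _ ENNReal.ofReal_ne_top]
  refine lintegral_mono fun p => ?_
  rw [← mul_assoc, ← ENNReal.ofReal_mul hb0]
  refine mul_le_mul_left (ENNReal.ofReal_le_ofReal ?_) _
  have := mul_le_mul_of_nonneg_left (hb (pairCos p)) (pairKernel_nonneg γ s p)
  simp only [Pi.one_apply]
  linarith

theorem le_lintegral_collisionMeasure {n : ℕ} {γ s b : ℝ} {β : ℝ → ℝ} (hβ : Measurable β)
    (hb0 : 0 ≤ b) (hb : ∀ c, b ≤ β c) {F : Vel (n + 1) × Vel (n + 1) → ℝ≥0∞} (hF : Measurable F) :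
    ENNReal.ofReal b * ∫⁻ p, F p ∂(collisionMeasure n γ s 1) ≤
      ∫⁻ p, F p ∂(collisionMeasure n γ s β) := by
  rw [lintegral_collisionMeasure hβ hF, lintegral_collisionMeasure measurable_one hF,
    ← lintegral_const_mul' _ _ ENNReal.ofReal_ne_top]
  refine lintegral_mono fun p => ?_
  rw [← mul_assoc, ← ENNReal.ofReal_mul hb0]
  refine mul_le_mul_left (ENNReal.ofReal_le_ofReal ?_) _
  have := mul_le_mul_of_nonneg_left (hb (pairCos p)) (pairKernel_nonneg γ s p)
  simp only [Pi.one_apply]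
  linarith

theorem rpow_sqrt_add_sq_weight {n : ℕ} (hn : 1 ≤ n) {t : ℝ} (ht : 0 < t) (y : ℝ) :
    (t / √(t ^ 2 + y ^ 2)) ^ (n - 1) * √(t ^ 2 + y ^ 2) ^ (n - 1) = t ^ ((n : ℝ) - 1) := by
  have h : 0 < √(t ^ 2 + y ^ 2) := by positivity
  rw [← mul_pow, div_mul_cancel₀ _ h.ne', ← Real.rpow_natCast]
  congr 1
  push_cast [hn]; rfl

theorem lintegral_collisionMeasure_carleman {n : ℕ} (hn : 1 ≤ n) {γ s : ℝ} {β : ℝ → ℝ}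
    (hβ : Measurable β) {F : Vel (n + 1) × Vel (n + 1) → ℝ≥0∞} (hF : Measurable F) :
    ∫⁻ p, F p ∂(collisionMeasure n γ s β) =
      2 ^ n * ∫⁻ e : Sph (n + 1), (∫⁻ t in Ioi (0 : ℝ), ∫⁻ y : Vel n,
        ENNReal.ofReal (t ^ (-1 - 2 * s) * ‖y‖ ^ (γ + 2 * s + 1) *
          β ((‖y‖ ^ 2 - t ^ 2) / (t ^ 2 + ‖y‖ ^ 2))) *
          F (t • (e : Vel (n + 1)), chart e y)) ∂(surfaceMeasure (n + 1)) := by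
  rw [lintegral_collisionMeasure hβ hF, lintegral_pairMeasure_carleman hn
    (F := fun p => ENNReal.ofReal (pairKernel γ s p * β (pairCos p)) * F p) (Measurable.mul
    ((measurable_pairKernel γ s).mul (hβ.comp measurable_pairCos)).ennreal_ofReal hF)]
  congr 1
  refine lintegral_congr fun e => setLIntegral_congr_fun measurableSet_Ioi fun t ht =>
    lintegral_congr fun y => ?_
  have ht' : (0 : ℝ) < t := ht
  rw [← mul_assoc, ← ENNReal.ofReal_mul (by positivity)]
  congr 2
  simp only [pairKernel, pairCos, norm_smul, Real.norm_eq_abs, abs_of_pos ht',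
    norm_eq_of_mem_sphere, mul_one, LinearIsometry.norm_map]
  rw [← mul_assoc, ← mul_assoc, rpow_sqrt_add_sq_weight hn ht', ← mul_assoc, ← Real.rpow_add ht']
  congr 3
  ring

theorem lintegral_collisionMeasure_carleman_swap {n : ℕ} (hn : 1 ≤ n) {γ s : ℝ} {β : ℝ → ℝ}
    (hβ : Measurable β) {F : Vel (n + 1) × Vel (n + 1) → ℝ≥0∞} (hF : Measurable F) :
    ∫⁻ p, F p ∂(collisionMeasure n γ s β) =
      2 ^ n * ∫⁻ e : Sph (n + 1), (∫⁻ t in Ioi (0 : ℝ), ∫⁻ y : Vel n,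
        ENNReal.ofReal (t ^ n * t ^ (γ + 2 * s) * ‖y‖ ^ (-(n + 2 * s)) *
          β ((t ^ 2 - ‖y‖ ^ 2) / (t ^ 2 + ‖y‖ ^ 2))) *
          F (chart e y, t • (e : Vel (n + 1)))) ∂(surfaceMeasure (n + 1)) := by
  rw [lintegral_collisionMeasure hβ hF, lintegral_pairMeasure_carleman_swap hn
    (F := fun p => ENNReal.ofReal (pairKernel γ s p * β (pairCos p)) * F p) (Measurable.mul
    ((measurable_pairKernel γ s).mul (hβ.comp measurable_pairCos)).ennreal_ofReal hF)]
  congr 1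
  refine lintegral_congr fun e => setLIntegral_congr_fun measurableSet_Ioi fun t ht =>
    lintegral_congr fun y => ?_
  have ht' : (0 : ℝ) < t := ht
  rw [← mul_assoc, ← ENNReal.ofReal_mul (by positivity)]
  congr 2
  simp only [pairKernel, pairCos, norm_smul, Real.norm_eq_abs, abs_of_pos ht',
    norm_eq_of_mem_sphere, mul_one, LinearIsometry.norm_map]
  rw [add_comm (‖y‖ ^ 2) (t ^ 2), ← mul_assoc, ← mul_assoc, rpow_sqrt_add_sq_weight hn ht']
  rw [← Real.rpow_natCast t n, ← Real.rpow_add ht']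
  have : t ^ ((n : ℝ) + (γ + 2 * s)) = t ^ ((n : ℝ) - 1) * t ^ (γ + 2 * s + 1) := by
    rw [← Real.rpow_add ht']; congr 1; ring
  rw [this]
  ring

theorem lintegral_norm_eq {n : ℕ} (hn : 1 ≤ n) {Φ : ℝ → ℝ≥0∞} (hΦ : Measurable Φ) :
    ∫⁻ y : Vel n, Φ ‖y‖ = surfaceMeasure n univ *
      ∫⁻ τ in Ioi (0 : ℝ), ENNReal.ofReal (τ ^ (n - 1)) * Φ τ := by
  obtain ⟨k, rfl⟩ : ∃ k, n = k + 1 := ⟨n - 1, by omega⟩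
  rw [lintegral_polar (F := fun y => Φ ‖y‖) (hΦ.comp measurable_norm)]
  rw [lintegral_congr (g := fun _ => ∫⁻ τ in Ioi (0 : ℝ), ENNReal.ofReal (τ ^ k) * Φ τ) fun e => ?_]
  · rw [lintegral_const, mul_comm]; simp
  · refine setLIntegral_congr_fun measurableSet_Ioi fun t ht => ?_
    have ht' : (0 : ℝ) < t := ht
    simp [norm_smul, abs_of_pos ht']

theorem lintegral_rpow_norm_mul {n : ℕ} (hn : 1 ≤ n) (s : ℝ) {Φ : ℝ → ℝ≥0∞} (hΦ : Measurable Φ) :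
    ∫⁻ y : Vel n, ENNReal.ofReal (‖y‖ ^ (-(n + 2 * s))) * Φ ‖y‖ = surfaceMeasure n univ *
      ∫⁻ τ in Ioi (0 : ℝ), ENNReal.ofReal (τ ^ (-1 - 2 * s)) * Φ τ := by
  rw [lintegral_norm_eq hn (Φ := fun τ => ENNReal.ofReal (τ ^ (-(n + 2 * s))) * Φ τ)
    (Measurable.mul (by fun_prop) hΦ)]
  congr 1
  refine setLIntegral_congr_fun measurableSet_Ioi fun t ht => ?_
  have ht' : (0 : ℝ) < t := ht
  rw [← mul_assoc, ← ENNReal.ofReal_mul (by positivity), ← Real.rpow_natCast, ← Real.rpow_add ht']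
  congr 3
  push_cast [hn]; ring

/-- Against the collision measure without angular factor, functions of `w` and functions of `|u|`
decouple. -/
theorem lintegral_collisionMeasure_mul {n : ℕ} (hn : 1 ≤ n) {γ s : ℝ}
    {A : Vel (n + 1) → ℝ≥0∞} (hA : Measurable A) {Φ : ℝ → ℝ≥0∞} (hΦ : Measurable Φ) :
    ∫⁻ p, A p.2 * Φ ‖p.1‖ ∂(collisionMeasure n γ s 1) =
      2 ^ n * surfaceMeasure n univ * (∫⁻ w, A w * ENNReal.ofReal (‖w‖ ^ (γ + 2 * s))) *
        ∫⁻ τ in Ioi (0 : ℝ), ENNReal.ofReal (τ ^ (-1 - 2 * s)) * Φ τ := by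
  rw [lintegral_collisionMeasure_carleman_swap hn measurable_one
    (F := fun p => A p.2 * Φ ‖p.1‖) (Measurable.mul (by fun_prop) (hΦ.comp (by fun_prop)))]
  have hw : Measurable fun w : Vel (n + 1) => A w * ENNReal.ofReal (‖w‖ ^ (γ + 2 * s)) :=
    hA.mul (by fun_prop)
  rw [lintegral_polar hw, mul_assoc, mul_assoc, mul_left_comm (surfaceMeasure n univ),
    ← lintegral_rpow_norm_mul hn s hΦ]
  congr 1
  have hym : Measurable fun y : Vel n => ENNReal.ofReal (‖y‖ ^ (-(n + 2 * s))) * Φ ‖y‖ :=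
    Measurable.mul (by fun_prop) (hΦ.comp measurable_norm)
  have hte : Measurable fun p : Sph (n + 1) × ℝ => ENNReal.ofReal (p.2 ^ n) *
      (A (p.2 • (p.1 : Vel (n + 1))) *
        ENNReal.ofReal (‖p.2 • (p.1 : Vel (n + 1))‖ ^ (γ + 2 * s))) :=
    Measurable.mul (by fun_prop) (hw.comp (by fun_prop))
  rw [← lintegral_mul_const]
  · refine lintegral_congr fun e => ?_
    rw [← lintegral_mul_const]
    · refine setLIntegral_congr_fun measurableSet_Ioi fun t ht => ?_
      have ht' : (0 : ℝ) < t := ht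
      simp only
      rw [← lintegral_const_mul _ hym]
      refine lintegral_congr fun y => ?_
      simp only [Pi.one_apply, mul_one, norm_smul, Real.norm_eq_abs, abs_of_pos ht',
        norm_eq_of_mem_sphere, LinearIsometry.norm_map]
      rw [ENNReal.ofReal_mul (by positivity), ENNReal.ofReal_mul (by positivity)]
      ring
    · exact hte.comp measurable_prodMk_left
  · exact hte.lintegral_prod_right'

/-! ### The cancellation inequality -/

theorem lintegral_comp_smul_pos {n : ℕ} {t : ℝ} (ht : 0 < t) {G : Vel n → ℝ≥0∞}
    (hG : Measurable G) : ∫⁻ y, G y = ENNReal.ofReal (t ^ n) * ∫⁻ η, G (t • η) := by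
  have h := Measure.map_addHaar_smul (volume : Measure (Vel n)) ht.ne'
  have h2 : ∫⁻ η, G (t • η) = ∫⁻ y, G y ∂(volume.map (t • · : Vel n → Vel n)) :=
    (lintegral_map hG (by fun_prop)).symm
  rw [h2, h, lintegral_smul_measure, finrank_euclideanSpace, Fintype.card_fin, smul_eq_mul,
    ← mul_assoc, ← ENNReal.ofReal_mul (by positivity), abs_of_pos (by positivity),
    mul_inv_cancel₀ (by positivity)]
  simp

/-- The gnomonic projection: `e = (a + ι η)/√(1+|η|²)` parametrizes a half sphere. -/
theorem lintegral_sphere_gnomonic {n : ℕ} (a : Sph (n + 1)) {φ : ℝ → ℝ≥0∞} (hφ : Measurable φ) :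
    ∫⁻ e : Sph (n + 1), ({e | 0 < ⟪(a : Vel (n + 1)), (e : Vel (n + 1))⟫} : Set (Sph (n + 1))).indicator
        (fun e => φ ⟪(a : Vel (n + 1)), (e : Vel (n + 1))⟫) e ∂(surfaceMeasure (n + 1)) =
      ∫⁻ η : Vel n, ENNReal.ofReal ((√(1 + ‖η‖ ^ 2))⁻¹ ^ (n + 1)) * φ (√(1 + ‖η‖ ^ 2))⁻¹ := by
  have haa : ‖(a : Vel (n + 1))‖ = 1 := by simp
  let U : Set (Vel (n + 1)) := {z | 0 < ⟪(a : Vel (n + 1)), z⟫}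
  have hU : MeasurableSet U := measurableSet_lt measurable_const (by fun_prop)
  let G : Vel (n + 1) → ℝ≥0∞ := fun z =>
    φ (⟪(a : Vel (n + 1)), z⟫ / ‖z‖) * (Iio (1 : ℝ)).indicator 1 ‖z‖
  have hI : Measurable ((Iio (1 : ℝ)).indicator (1 : ℝ → ℝ≥0∞)) :=
    measurable_one.indicator measurableSet_Iio
  have hG : Measurable G := (hφ.comp (by fun_prop)).mul (hI.comp measurable_norm)
  have h1 := lintegral_polar (hG.indicator hU)
  rw [lintegral_chart a (hG.indicator hU)] at h1
  have hL : ∀ t : ℝ, ∫⁻ y, U.indicator G (t • (a : Vel (n + 1)) + chart a y) =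
      (Ioi (0 : ℝ)).indicator (fun t => ∫⁻ η : Vel n, φ (√(1 + ‖η‖ ^ 2))⁻¹ *
        (ENNReal.ofReal (t ^ n) * (Iio (√(1 + ‖η‖ ^ 2))⁻¹).indicator 1 t)) t := by
    intro t
    by_cases ht : 0 < t
    · rw [indicator_of_mem (by exact ht)]
      have hm : ∀ y : Vel n, U.indicator G (t • (a : Vel (n + 1)) + chart a y) =
          φ (t / √(t ^ 2 + ‖y‖ ^ 2)) * (Iio (1 : ℝ)).indicator 1 √(t ^ 2 + ‖y‖ ^ 2) := by
        intro y
        rw [indicator_of_mem (by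
          change 0 < ⟪(a : Vel (n + 1)), _⟫; rw [inner_smul_add_chart]; exact ht)]
        simp only [G, inner_smul_add_chart, norm_smul_add_chart]
      rw [lintegral_congr hm, lintegral_comp_smul_pos ht
        (G := fun y => φ (t / √(t ^ 2 + ‖y‖ ^ 2)) * (Iio (1 : ℝ)).indicator 1 √(t ^ 2 + ‖y‖ ^ 2))
        (Measurable.mul (hφ.comp (by fun_prop)) (hI.comp (by fun_prop))), ← lintegral_const_mul' _ _ ENNReal.ofReal_ne_top]
      refine lintegral_congr fun η => ?_
      have h2 : √(t ^ 2 + ‖t • η‖ ^ 2) = t * √(1 + ‖η‖ ^ 2) := by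
        rw [norm_smul, Real.norm_eq_abs, abs_of_pos ht, ← Real.sqrt_sq ht.le, ← Real.sqrt_mul
          (by positivity), Real.sqrt_sq ht.le]
        congr 1; ring
      have h3 : 0 < √(1 + ‖η‖ ^ 2) := by positivity
      rw [h2, show t / (t * √(1 + ‖η‖ ^ 2)) = (√(1 + ‖η‖ ^ 2))⁻¹ by field_simp]
      have h4 : t * √(1 + ‖η‖ ^ 2) < 1 ↔ t < (√(1 + ‖η‖ ^ 2))⁻¹ := by
        rw [← one_div, lt_div_iff₀ h3]
      simp only [indicator, mem_Iio, h4, Pi.one_apply]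
      ring
    · rw [indicator_of_notMem (by exact ht)]
      rw [lintegral_congr (g := fun _ => 0) fun y => ?_, lintegral_zero]
      rw [indicator_of_notMem (by
        change ¬ 0 < ⟪(a : Vel (n + 1)), _⟫; rw [inner_smul_add_chart]; exact ht)]
  have hmeas : Measurable fun p : ℝ × Vel n => φ (√(1 + ‖p.2‖ ^ 2))⁻¹ *
        (ENNReal.ofReal (p.1 ^ n) * (Iio (√(1 + ‖p.2‖ ^ 2))⁻¹).indicator 1 p.1) := by
    refine (hφ.comp (by fun_prop)).mul (Measurable.mul (by fun_prop) ?_)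
    have : MeasurableSet {p : ℝ × Vel n | p.1 < (√(1 + ‖p.2‖ ^ 2))⁻¹} :=
      measurableSet_lt (by fun_prop) (by fun_prop)
    exact (measurable_one.indicator this : Measurable ({p : ℝ × Vel n |
      p.1 < (√(1 + ‖p.2‖ ^ 2))⁻¹}.indicator (1 : ℝ × Vel n → ℝ≥0∞)))
  have hL2 : ∫⁻ t : ℝ, ∫⁻ y, U.indicator G (t • (a : Vel (n + 1)) + chart a y) =
      (∫⁻ η : Vel n, ENNReal.ofReal ((√(1 + ‖η‖ ^ 2))⁻¹ ^ (n + 1)) * φ (√(1 + ‖η‖ ^ 2))⁻¹) *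
        ENNReal.ofReal (1 / (n + 1)) := by
    rw [lintegral_congr hL, lintegral_indicator measurableSet_Ioi, lintegral_lintegral_swap
      hmeas.aemeasurable, ← lintegral_mul_const']
    · refine lintegral_congr fun η => ?_
      rw [lintegral_const_mul, lintegral_pow_mul_indicator n (by positivity), mul_right_comm,
        ← ENNReal.ofReal_mul (by positivity), mul_comm]
      · congr 2; ring
      · exact Measurable.mul (by fun_prop) (measurable_one.indicator measurableSet_Iio)
    · exact ENNReal.ofReal_ne_top
  rw [hL2] at h1
  have hR : ∀ e : Sph (n + 1), ∫⁻ r in Ioi (0 : ℝ), ENNReal.ofReal (r ^ n) *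
      U.indicator G (r • (e : Vel (n + 1))) =
      ({e | 0 < ⟪(a : Vel (n + 1)), (e : Vel (n + 1))⟫} : Set (Sph (n + 1))).indicator
        (fun e => φ ⟪(a : Vel (n + 1)), (e : Vel (n + 1))⟫) e * ENNReal.ofReal (1 / (n + 1)) := by
    intro e
    have h5 := lintegral_pow_mul_indicator n (zero_le_one (α := ℝ))
    rw [one_pow] at h5
    have h7 : Measurable fun r : ℝ => ENNReal.ofReal (r ^ n) * (Iio (1 : ℝ)).indicator 1 r :=
      Measurable.mul (by fun_prop) hI
    rw [← h5, ← lintegral_const_mul _ h7]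
    refine setLIntegral_congr_fun measurableSet_Ioi fun r hr => ?_
    have hr' : (0 : ℝ) < r := hr
    have h6 : 0 < ⟪(a : Vel (n + 1)), r • (e : Vel (n + 1))⟫ ↔
        0 < ⟪(a : Vel (n + 1)), (e : Vel (n + 1))⟫ := by
      rw [inner_smul_right]; exact mul_pos_iff_of_pos_left hr'
    by_cases he : 0 < ⟪(a : Vel (n + 1)), (e : Vel (n + 1))⟫
    · rw [indicator_of_mem (by exact h6.2 he), indicator_of_mem (by exact he)]
      simp only [G, inner_smul_right, norm_smul, Real.norm_eq_abs, abs_of_pos hr',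
        norm_eq_of_mem_sphere, mul_one, mul_div_cancel_left₀ _ hr'.ne']
      ring
    · rw [indicator_of_notMem (by exact fun h => he (h6.1 h)), indicator_of_notMem (by exact he)]
      simp
  rw [lintegral_congr hR, lintegral_mul_const' _ _ ENNReal.ofReal_ne_top] at h1
  exact ((ENNReal.mul_left_inj (by simp; positivity) (by simp)).1 h1).symm

/-- The gain weight of a function of `v_*'`, as an integral over the hyperplane orthogonal to
`z = v_*' - v`: here `|η| = |v' - v| / |z|` is the tangent of half of the deviation angle. -/
theorem lintegral_gain {n : ℕ} (hn : 1 ≤ n) (γ s : ℝ) {β : ℝ → ℝ} (hβ : Measurable β)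
    {A : Vel (n + 1) → ℝ≥0∞} (hA : Measurable A) (δ : ℝ) :
    ∫⁻ p in {p | δ < ‖p.1‖}, A p.2 ∂(collisionMeasure n γ s β) =
      2 ^ n * ∫⁻ z, A z * ENNReal.ofReal (‖z‖ ^ γ) *
        ∫⁻ η : Vel n, ENNReal.ofReal (‖η‖ ^ (-(n + 2 * s)) * β ((1 - ‖η‖ ^ 2) / (1 + ‖η‖ ^ 2))) *
          (Ioi δ).indicator 1 (‖z‖ * ‖η‖) := by
  have hI : Measurable ((Ioi δ).indicator (1 : ℝ → ℝ≥0∞)) :=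
    measurable_one.indicator measurableSet_Ioi
  have hS : MeasurableSet {p : Vel (n + 1) × Vel (n + 1) | δ < ‖p.1‖} :=
    measurableSet_lt measurable_const (by fun_prop)
  rw [← lintegral_indicator hS]
  have e1 : ∀ p : Vel (n + 1) × Vel (n + 1), {p : Vel (n + 1) × Vel (n + 1) | δ < ‖p.1‖}.indicator
      (fun p => A p.2) p = (Ioi δ).indicator 1 ‖p.1‖ * A p.2 := by
    intro p
    by_cases h : δ < ‖p.1‖
    · rw [indicator_of_mem (by exact h), indicator_of_mem (by exact h)]; simp
    · rw [indicator_of_notMem (by exact h), indicator_of_notMem (by exact h)]; simp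
  have hF : Measurable fun p : Vel (n + 1) × Vel (n + 1) => (Ioi δ).indicator 1 ‖p.1‖ * A p.2 :=
    Measurable.mul (hI.comp (by fun_prop)) (hA.comp measurable_snd)
  have hg : Measurable fun z : Vel (n + 1) => ∫⁻ η : Vel n,
      ENNReal.ofReal (‖η‖ ^ (-(n + 2 * s)) * β ((1 - ‖η‖ ^ 2) / (1 + ‖η‖ ^ 2))) *
          (Ioi δ).indicator 1 (‖z‖ * ‖η‖) := by
    refine Measurable.lintegral_prod_right' (f := fun p : Vel (n + 1) × Vel n =>
      ENNReal.ofReal (‖p.2‖ ^ (-(n + 2 * s)) * β ((1 - ‖p.2‖ ^ 2) / (1 + ‖p.2‖ ^ 2))) *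
          (Ioi δ).indicator 1 (‖p.1‖ * ‖p.2‖)) ?_
    refine Measurable.mul (Measurable.ennreal_ofReal (Measurable.mul (by fun_prop)
      (hβ.comp (by fun_prop)))) (hI.comp (by fun_prop))
  have hK : ∀ r : ℝ, Measurable fun η : Vel n => ENNReal.ofReal (‖η‖ ^ (-(n + 2 * s)) *
      β ((1 - ‖η‖ ^ 2) / (1 + ‖η‖ ^ 2))) * (Ioi δ).indicator 1 (r * ‖η‖) := fun r =>
    Measurable.mul (Measurable.ennreal_ofReal (Measurable.mul (by fun_prop)
      (hβ.comp (by fun_prop)))) (hI.comp (by fun_prop))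
  have hz : Measurable fun z : Vel (n + 1) => A z * ENNReal.ofReal (‖z‖ ^ γ) := by fun_prop
  rw [lintegral_congr e1, lintegral_collisionMeasure_carleman_swap hn hβ hF,
    lintegral_polar (F := fun z => A z * ENNReal.ofReal (‖z‖ ^ γ) * ∫⁻ η : Vel n,
      ENNReal.ofReal (‖η‖ ^ (-(n + 2 * s)) * β ((1 - ‖η‖ ^ 2) / (1 + ‖η‖ ^ 2))) *
          (Ioi δ).indicator 1 (‖z‖ * ‖η‖)) (hz.mul hg)]
  congr 1
  refine lintegral_congr fun e => setLIntegral_congr_fun measurableSet_Ioi fun t ht => ?_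
  have ht' : (0 : ℝ) < t := ht
  simp only
  rw [lintegral_comp_smul_pos ht' (G := fun y => ENNReal.ofReal (t ^ n * t ^ (γ + 2 * s) *
    ‖y‖ ^ (-(n + 2 * s)) * β ((t ^ 2 - ‖y‖ ^ 2) / (t ^ 2 + ‖y‖ ^ 2))) *
    ((Ioi δ).indicator 1 ‖chart e y‖ * A (t • (e : Vel (n + 1))))), ← lintegral_const_mul',
    ← lintegral_const_mul _ (hK _), ← lintegral_const_mul _ ((hK _).const_mul _)]
  · refine lintegral_congr fun η => ?_
    have hnorm : ‖t • η‖ = t * ‖η‖ := by rw [norm_smul, Real.norm_eq_abs, abs_of_pos ht']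
    have hnorm2 : ‖t • (e : Vel (n + 1))‖ = t := by simp [norm_smul, abs_of_pos ht']
    simp only [LinearIsometry.norm_map, hnorm, hnorm2]
    have hcos : (t ^ 2 - (t * ‖η‖) ^ 2) / (t ^ 2 + (t * ‖η‖) ^ 2) =
        (1 - ‖η‖ ^ 2) / (1 + ‖η‖ ^ 2) := by
      rw [mul_pow, ← mul_one_sub, ← mul_one_add, mul_div_mul_left _ _ (by positivity)]
    have hpow : t ^ n * (t ^ n * t ^ (γ + 2 * s) * (t * ‖η‖) ^ (-(n + 2 * s)) *
        β ((1 - ‖η‖ ^ 2) / (1 + ‖η‖ ^ 2))) = t ^ n * t ^ γ *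
        (‖η‖ ^ (-(n + 2 * s)) * β ((1 - ‖η‖ ^ 2) / (1 + ‖η‖ ^ 2))) := by
      rw [Real.mul_rpow ht'.le (norm_nonneg _)]
      have : t ^ n * t ^ (γ + 2 * s) * t ^ (-(n + 2 * s)) = t ^ γ := by
        rw [← Real.rpow_natCast, ← Real.rpow_add ht', ← Real.rpow_add ht']
        congr 1; ring
      linear_combination (t ^ n * ‖η‖ ^ (-(n + 2 * s)) *
        β ((1 - ‖η‖ ^ 2) / (1 + ‖η‖ ^ 2))) * this
    rw [hcos, ← mul_assoc, ← ENNReal.ofReal_mul (by positivity), hpow,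
      ENNReal.ofReal_mul (by positivity), ENNReal.ofReal_mul (by positivity)]
    ring
  · exact ENNReal.ofReal_ne_top
  · refine Measurable.mul (Measurable.ennreal_ofReal (Measurable.mul (by fun_prop)
      (hβ.comp (by fun_prop)))) (Measurable.mul_const (hI.comp ?_) _)
    simp only [LinearIsometry.norm_map]
    fun_prop

/-- The loss weight of a function of `v_*`, in the same variable `η` as in `lintegral_gain`, where
now `z = v_* - v` and `|v' - v| = |z| |η| / √(1 + |η|²)`. It differs from the gain weight by the
factor `(1 + |η|²)^{-(d + γ)/2}` and by the truncation. -/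
theorem lintegral_loss {n : ℕ} (hn : 1 ≤ n) (γ s : ℝ) {β : ℝ → ℝ} (hβ : Measurable β)
    {A : Vel (n + 1) → ℝ≥0∞} (hA : Measurable A) (δ : ℝ) :
    ∫⁻ p in {p | δ < ‖p.1‖}, A (p.1 + p.2) ∂(collisionMeasure n γ s β) =
      2 ^ n * ∫⁻ z, A z * ENNReal.ofReal (‖z‖ ^ γ) *
        ∫⁻ η : Vel n, ENNReal.ofReal (√(1 + ‖η‖ ^ 2) ^ (-(n + 1 + γ)) *
          (‖η‖ ^ (-(n + 2 * s)) * β ((1 - ‖η‖ ^ 2) / (1 + ‖η‖ ^ 2)))) *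
          (Ioi δ).indicator 1 (‖z‖ * (‖η‖ / √(1 + ‖η‖ ^ 2))) := by
  have hI : Measurable ((Ioi δ).indicator (1 : ℝ → ℝ≥0∞)) :=
    measurable_one.indicator measurableSet_Ioi
  have hS : MeasurableSet {p : Vel (n + 1) × Vel (n + 1) | δ < ‖p.1‖} :=
    measurableSet_lt measurable_const (by fun_prop)
  rw [← lintegral_indicator hS]
  have e1 : ∀ p : Vel (n + 1) × Vel (n + 1), {p : Vel (n + 1) × Vel (n + 1) | δ < ‖p.1‖}.indicator
      (fun p => A (p.1 + p.2)) p = (Ioi δ).indicator 1 ‖p.1‖ * A (p.1 + p.2) := by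
    intro p
    by_cases h : δ < ‖p.1‖
    · rw [indicator_of_mem (by exact h), indicator_of_mem (by exact h)]; simp
    · rw [indicator_of_notMem (by exact h), indicator_of_notMem (by exact h)]; simp
  have hF : Measurable fun p : Vel (n + 1) × Vel (n + 1) =>
      (Ioi δ).indicator 1 ‖p.1‖ * A (p.1 + p.2) :=
    Measurable.mul (hI.comp (by fun_prop)) (hA.comp (by fun_prop))
  have hF2 : Measurable fun p : Vel (n + 1) × Vel (n + 1) =>
      ENNReal.ofReal (pairKernel γ s p * β (pairCos p)) *
        ((Ioi δ).indicator 1 ‖p.1‖ * A (p.1 + p.2)) :=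
    ((measurable_pairKernel γ s).mul (hβ.comp measurable_pairCos)).ennreal_ofReal.mul hF
  rw [lintegral_congr e1, lintegral_collisionMeasure hβ hF, ← lintegral_pairMeasure_swap hF2,
    lintegral_pairMeasure_eq hn (F := fun p => ENNReal.ofReal (pairKernel γ s p.swap *
      β (pairCos p.swap)) * ((Ioi δ).indicator 1 ‖p.swap.1‖ * A (p.swap.1 + p.swap.2)))
      (hF2.comp measurable_swap)]
  congr 1
  refine lintegral_congr_ae ?_
  have h0 : ∀ᵐ z : Vel (n + 1), z ≠ 0 := by
    rw [ae_iff]; simp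
  filter_upwards [h0] with z hz
  have hr : 0 < ‖z‖ := norm_pos_iff.2 hz
  set r : ℝ := ‖z‖ with hrdef
  let a : Sph (n + 1) := ⟨r⁻¹ • z, by
    simp only [mem_sphere_iff_norm, sub_zero, norm_smul, norm_inv, Real.norm_eq_abs, abs_of_pos hr]
    exact inv_mul_cancel₀ hr.ne'⟩
  have haz : z = r • (a : Vel (n + 1)) := by simp [a, smul_smul, hr.ne']
  let φ : ℝ → ℝ≥0∞ := fun c => ENNReal.ofReal (c ^ (n - 1) * (r ^ (n - 1) *
    ((r * √(1 - c ^ 2)) ^ (-(n + 2 * s)) * (r * c) ^ (γ + 2 * s + 1)) *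
    β (2 * c ^ 2 - 1))) * ((Ioi δ).indicator 1 (r * √(1 - c ^ 2)))
  have hφ : Measurable φ := Measurable.mul (Measurable.ennreal_ofReal (Measurable.mul (by fun_prop)
      (Measurable.mul (by fun_prop) (hβ.comp (by fun_prop))))) (hI.comp (by fun_prop))
  have hin : ∀ e : Sph (n + 1), ⟪(e : Vel (n + 1)), z⟫ =
      r * ⟪(a : Vel (n + 1)), (e : Vel (n + 1))⟫ := by
    intro e; conv_lhs => rw [haz]
    rw [inner_smul_right, real_inner_comm]
  have e2 : ∀ e : Sph (n + 1), ({e | 0 < ⟪(e : Vel (n + 1)), z⟫} : Set (Sph (n + 1))).indicator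
        (fun e => ENNReal.ofReal ((⟪(e : Vel (n + 1)), z⟫ / r) ^ (n - 1)) *
          (ENNReal.ofReal (pairKernel γ s (⟪(e : Vel (n + 1)), z⟫ • (e : Vel (n + 1)),
            z - ⟪(e : Vel (n + 1)), z⟫ • (e : Vel (n + 1))).swap *
          β (pairCos (⟪(e : Vel (n + 1)), z⟫ • (e : Vel (n + 1)),
            z - ⟪(e : Vel (n + 1)), z⟫ • (e : Vel (n + 1))).swap)) *
          ((Ioi δ).indicator 1 ‖(⟪(e : Vel (n + 1)), z⟫ • (e : Vel (n + 1)),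
            z - ⟪(e : Vel (n + 1)), z⟫ • (e : Vel (n + 1))).swap.1‖ *
            A ((⟪(e : Vel (n + 1)), z⟫ • (e : Vel (n + 1)),
            z - ⟪(e : Vel (n + 1)), z⟫ • (e : Vel (n + 1))).swap.1 +
            (⟪(e : Vel (n + 1)), z⟫ • (e : Vel (n + 1)),
            z - ⟪(e : Vel (n + 1)), z⟫ • (e : Vel (n + 1))).swap.2)))) e =
      A z * ({e | 0 < ⟪(a : Vel (n + 1)), (e : Vel (n + 1))⟫} : Set (Sph (n + 1))).indicator
        (fun e => φ ⟪(a : Vel (n + 1)), (e : Vel (n + 1))⟫) e := by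
    intro e
    have hiff : 0 < ⟪(e : Vel (n + 1)), z⟫ ↔ 0 < ⟪(a : Vel (n + 1)), (e : Vel (n + 1))⟫ := by
      rw [hin]; exact mul_pos_iff_of_pos_left hr
    by_cases he : 0 < ⟪(a : Vel (n + 1)), (e : Vel (n + 1))⟫
    · rw [indicator_of_mem (by exact hiff.2 he), indicator_of_mem
        (show e ∈ {e : Sph (n + 1) | 0 < ⟪(a : Vel (n + 1)), (e : Vel (n + 1))⟫} from he)]
      simp only [Prod.fst_swap, Prod.snd_swap, sub_add_cancel]
      set c : ℝ := ⟪(a : Vel (n + 1)), (e : Vel (n + 1))⟫ with hc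
      rw [hin, ← hc]
      have hn1 : ‖(r * c) • (e : Vel (n + 1))‖ = r * c := by
        simp [norm_smul, abs_of_pos hr, abs_of_pos he]
      have hc1 : c ≤ 1 := by
        have := real_inner_le_norm (a : Vel (n + 1)) (e : Vel (n + 1))
        simpa using this
      have hc2 : 0 ≤ 1 - c ^ 2 := by nlinarith
      have hn2 : ‖z - (r * c) • (e : Vel (n + 1))‖ = r * √(1 - c ^ 2) := by
        have : ‖z - (r * c) • (e : Vel (n + 1))‖ ^ 2 = (r * √(1 - c ^ 2)) ^ 2 := by
          rw [norm_sub_sq_real, inner_smul_right, real_inner_comm, hin, ← hc, hn1, ← hrdef,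
            mul_pow r (√(1 - c ^ 2)), Real.sq_sqrt hc2]
          ring
        exact (pow_left_inj₀ (norm_nonneg _) (by positivity) two_ne_zero).1 this
      have hsum : (r * √(1 - c ^ 2)) ^ 2 + (r * c) ^ 2 = r ^ 2 := by
        rw [mul_pow, mul_pow, Real.sq_sqrt hc2]; ring
      have hcos : ((r * c) ^ 2 - (r * √(1 - c ^ 2)) ^ 2) / r ^ 2 = 2 * c ^ 2 - 1 := by
        rw [mul_pow, mul_pow, Real.sq_sqrt hc2]; field_simp; ring
      simp only [pairKernel, pairCos, Prod.swap_prod_mk, hn1, hn2, hsum, hcos, φ,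
        Real.sqrt_sq hr.le]
      rw [← mul_assoc, ← ENNReal.ofReal_mul (by positivity), mul_div_cancel_left₀ _ hr.ne']
      ring
    · rw [indicator_of_notMem (by exact fun h => he (hiff.1 h)), indicator_of_notMem (by exact he),
        mul_zero]
  rw [lintegral_congr e2, lintegral_const_mul, lintegral_sphere_gnomonic a hφ, mul_assoc]
  · congr 1
    rw [← lintegral_const_mul' _ _ ENNReal.ofReal_ne_top]
    refine lintegral_congr fun η => ?_
    set q : ℝ := √(1 + ‖η‖ ^ 2) with hq
    have hq0 : 0 < q := by positivity
    have hq2 : q ^ 2 = 1 + ‖η‖ ^ 2 := Real.sq_sqrt (by positivity)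
    have h1 : √(1 - q⁻¹ ^ 2) = ‖η‖ / q := by
      have : 1 - q⁻¹ ^ 2 = (‖η‖ / q) ^ 2 := by
        rw [div_pow, inv_pow, hq2]; field_simp; ring
      rw [this, Real.sqrt_sq (by positivity)]
    have h2 : 2 * q⁻¹ ^ 2 - 1 = (1 - ‖η‖ ^ 2) / (1 + ‖η‖ ^ 2) := by
      rw [inv_pow, hq2]; field_simp; ring
    simp only [φ, h1, h2]
    conv_lhs => rw [← mul_assoc, ← ENNReal.ofReal_mul (by positivity)]
    conv_rhs => rw [← mul_assoc, ← ENNReal.ofReal_mul (by positivity)]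
    congr 2
    have h3 : q⁻¹ ^ (n + 1) * (q⁻¹ ^ (n - 1) * (r ^ (n - 1) * ((r * (‖η‖ / q)) ^ (-(n + 2 * s)) *
      (r * q⁻¹) ^ (γ + 2 * s + 1)))) = r ^ γ * (q ^ (-(n + 1 + γ)) * ‖η‖ ^ (-(n + 2 * s))) := by
      obtain ⟨k, rfl⟩ : ∃ k, n = k + 1 := ⟨n - 1, by omega⟩
      rw [Real.mul_rpow hr.le (by positivity), Real.mul_rpow hr.le (by positivity),
        Real.div_rpow (norm_nonneg _) hq0.le, Real.inv_rpow hq0.le, inv_pow, inv_pow,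
        ← Real.rpow_natCast, ← Real.rpow_natCast, ← Real.rpow_natCast, ← Real.rpow_neg hq0.le,
        ← Real.rpow_neg hq0.le, ← Real.rpow_neg hq0.le, div_eq_mul_inv, ← Real.rpow_neg hq0.le]
      have hr1 : r ^ γ = r ^ (((k + 1 - 1 : ℕ) : ℝ)) * r ^ (-(((k + 1 : ℕ) : ℝ) + 2 * s)) *
          r ^ (γ + 2 * s + 1) := by
        rw [← Real.rpow_add hr, ← Real.rpow_add hr]; congr 1; push_cast; simp; ring
      have hq1 : q ^ (-(((k + 1 : ℕ) : ℝ) + 1 + γ)) = q ^ (-(((k + 1 + 1 : ℕ) : ℝ))) *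
          q ^ (-(((k + 1 - 1 : ℕ) : ℝ))) * q ^ (-(-(((k + 1 : ℕ) : ℝ) + 2 * s))) *
          q ^ (-(γ + 2 * s + 1)) := by
        rw [← Real.rpow_add hq0, ← Real.rpow_add hq0, ← Real.rpow_add hq0]; congr 1
        push_cast; simp; ring
      rw [hr1, hq1]
      ring
    linear_combination β ((1 - ‖η‖ ^ 2) / (1 + ‖η‖ ^ 2)) * h3
  · refine Measurable.indicator (hφ.comp (by fun_prop)) (measurableSet_lt measurable_const
      (by fun_prop))

theorem lintegral_rpow_tail {s κ : ℝ} (hs : 0 < s) (hκ : 0 < κ) :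
    ∫⁻ τ in Ioi (0 : ℝ), ENNReal.ofReal (τ ^ (-1 - 2 * s)) * (Ioi κ).indicator 1 τ =
      ENNReal.ofReal (κ ^ (-(2 * s)) / (2 * s)) := by
  have : ∀ τ : ℝ, ENNReal.ofReal (τ ^ (-1 - 2 * s)) * (Ioi κ).indicator 1 τ =
      (Ioi κ).indicator (fun τ => ENNReal.ofReal (τ ^ (-1 - 2 * s))) τ := by
    intro r; by_cases h : κ < r <;> simp [h]
  simp_rw [this]
  have hi := integrableOn_Ioi_rpow_of_lt (a := -1 - 2 * s) (by linarith) hκ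
  rw [lintegral_indicator measurableSet_Ioi, Measure.restrict_restrict measurableSet_Ioi,
    inter_eq_left.2 (Ioi_subset_Ioi hκ.le), ← ofReal_integral_eq_lintegral_ofReal hi,
    integral_Ioi_rpow_of_lt (by linarith) hκ]
  · congr 1
    rw [show -1 - 2 * s + 1 = -(2 * s) by ring, neg_div_neg_eq]
  · filter_upwards [ae_restrict_mem measurableSet_Ioi] with r hr
    exact Real.rpow_nonneg (hκ.trans hr).le _

theorem lintegral_rpow_head {s κ : ℝ} (hs : s < 1) (hκ : 0 ≤ κ) :
    ∫⁻ τ in Ioi (0 : ℝ), ENNReal.ofReal (τ ^ (-1 - 2 * s)) *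
        (Iic κ).indicator (fun τ => ENNReal.ofReal (τ ^ 2)) τ =
      ENNReal.ofReal (κ ^ (2 - 2 * s) / (2 - 2 * s)) := by
  have : ∀ τ ∈ Ioi (0 : ℝ), ENNReal.ofReal (τ ^ (-1 - 2 * s)) *
      (Iic κ).indicator (fun τ => ENNReal.ofReal (τ ^ 2)) τ =
      (Iic κ).indicator (fun τ => ENNReal.ofReal (τ ^ (1 - 2 * s))) τ := by
    intro r hr
    have hr' : (0 : ℝ) < r := hr
    by_cases h : r ≤ κ
    · rw [indicator_of_mem (by exact h), indicator_of_mem (by exact h),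
        ← ENNReal.ofReal_mul (by positivity), ← Real.rpow_natCast, ← Real.rpow_add hr']
      congr 2
      push_cast; ring
    · rw [indicator_of_notMem (by exact h), indicator_of_notMem (by exact h), mul_zero]
  rw [setLIntegral_congr_fun measurableSet_Ioi this, lintegral_indicator measurableSet_Iic,
    Measure.restrict_restrict measurableSet_Iic, Iic_inter_Ioi,
    ← ofReal_integral_eq_lintegral_ofReal, ← intervalIntegral.integral_of_le hκ,
    integral_rpow (Or.inl (by linarith))]
  · rw [show 1 - 2 * s + 1 = 2 - 2 * s by ring, Real.zero_rpow (by linarith), sub_zero]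
  · exact (intervalIntegral.intervalIntegrable_rpow' (by linarith)).1
  · filter_upwards [ae_restrict_mem measurableSet_Ioc] with r hr
    exact Real.rpow_nonneg hr.1.le _

theorem one_sub_rpow_neg_le {x a : ℝ} (hx : 0 ≤ x) (ha : 0 ≤ a) : 1 - (1 + x) ^ (-a) ≤ a * x := by
  rw [Real.rpow_def_of_pos (by linarith)]
  have h1 := Real.add_one_le_exp (Real.log (1 + x) * -a)
  have h2 : Real.log (1 + x) ≤ x := by
    have := Real.log_le_sub_one_of_pos (show 0 < 1 + x by linarith); linarith
  nlinarith

/-- The collisions whose truncation differs in the gain and in the loss term carry a bounded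
weight. -/
theorem lintegral_truncation_gap_le {s ε : ℝ} (hs : s ∈ Ioo (0 : ℝ) 1) (hε : 0 < ε) :
    ∫⁻ τ in Ioi (0 : ℝ), ENNReal.ofReal (τ ^ (-1 - 2 * s)) *
      {τ : ℝ | ε < τ ∧ τ / √(1 + τ ^ 2) ≤ ε}.indicator 1 τ ≤
        ENNReal.ofReal (1 + (1 / 2) ^ (-(2 * s)) / (2 * s)) := by
  obtain ⟨hs0, hs1⟩ := hs
  have hpos : (0 : ℝ) ≤ (1 / 2) ^ (-(2 * s)) / (2 * s) := by positivity
  rcases le_or_gt (1 / 2) ε with h | h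
  · calc _ ≤ ∫⁻ τ in Ioi (0 : ℝ), ENNReal.ofReal (τ ^ (-1 - 2 * s)) *
          (Ioi (1 / 2 : ℝ)).indicator 1 τ := by
          refine lintegral_mono fun τ => mul_le_mul_right (indicator_le_indicator_of_subset
            (fun x hx => lt_of_le_of_lt h hx.1) (fun _ => bot_le) τ) _
      _ ≤ _ := by
          rw [lintegral_rpow_tail hs0 (by norm_num)]
          exact ENNReal.ofReal_le_ofReal (by linarith)
  · have key : ∀ τ ∈ Ioi (0 : ℝ), ENNReal.ofReal (τ ^ (-1 - 2 * s)) *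
        {τ : ℝ | ε < τ ∧ τ / √(1 + τ ^ 2) ≤ ε}.indicator 1 τ ≤
        (Ioc ε (ε + ε ^ 3)).indicator (fun _ => ENNReal.ofReal (ε ^ (-1 - 2 * s))) τ := by
      intro τ hτ
      have hτ' : (0 : ℝ) < τ := hτ
      by_cases hm : ε < τ ∧ τ / √(1 + τ ^ 2) ≤ ε
      · have hle : τ ≤ ε + ε ^ 3 := by
          have h1 : τ ≤ ε * √(1 + τ ^ 2) := (div_le_iff₀ (by positivity)).1 hm.2
          have h2 : τ ^ 2 ≤ ε ^ 2 * (1 + τ ^ 2) := by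
            have := pow_le_pow_left₀ hτ'.le h1 2
            rwa [mul_pow, Real.sq_sqrt (by positivity)] at this
          have h4 : ε ^ 2 < 1 / 4 := by nlinarith
          have h3 : τ ^ 2 * (1 - ε ^ 2) ≤ (ε + ε ^ 3) ^ 2 * (1 - ε ^ 2) := by
            have : (ε + ε ^ 3) ^ 2 * (1 - ε ^ 2) - ε ^ 2 =
              ε ^ 2 * (ε ^ 2 * (1 - ε ^ 2 - ε ^ 2 * ε ^ 2)) := by ring
            have h5 : 0 ≤ 1 - ε ^ 2 - ε ^ 2 * ε ^ 2 := by nlinarith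
            have := mul_nonneg (sq_nonneg ε) (mul_nonneg (sq_nonneg ε) h5)
            nlinarith
          exact (pow_le_pow_iff_left₀ hτ'.le (by positivity) two_ne_zero).1
            (le_of_mul_le_mul_right h3 (by linarith))
        rw [indicator_of_mem (show τ ∈ {τ : ℝ | ε < τ ∧ τ / √(1 + τ ^ 2) ≤ ε} from hm), indicator_of_mem (show τ ∈ Ioc ε (ε + ε ^ 3) from ⟨hm.1, hle⟩), Pi.one_apply, mul_one]
        exact ENNReal.ofReal_le_ofReal
          (Real.rpow_le_rpow_of_nonpos hε hm.1.le (by linarith))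
      · rw [indicator_of_notMem (by exact hm), mul_zero]; exact bot_le
    calc _ ≤ ∫⁻ τ in Ioi (0 : ℝ),
          (Ioc ε (ε + ε ^ 3)).indicator (fun _ => ENNReal.ofReal (ε ^ (-1 - 2 * s))) τ :=
          setLIntegral_mono' measurableSet_Ioi key
      _ ≤ ∫⁻ τ, (Ioc ε (ε + ε ^ 3)).indicator (fun _ => ENNReal.ofReal (ε ^ (-1 - 2 * s))) τ :=
          setLIntegral_le_lintegral _ _
      _ = ENNReal.ofReal (ε ^ (-1 - 2 * s) * ε ^ 3) := by
          rw [lintegral_indicator measurableSet_Ioc, setLIntegral_const, Real.volume_Ioc,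
            ← ENNReal.ofReal_mul (by positivity)]
          congr 2; ring
      _ ≤ _ := by
          refine ENNReal.ofReal_le_ofReal ?_
          rw [← Real.rpow_natCast, ← Real.rpow_add hε]
          have : ε ^ (-1 - 2 * s + ((3 : ℕ) : ℝ)) ≤ 1 :=
            Real.rpow_le_one hε.le (by linarith) (by push_cast; linarith)
          exact this.trans (le_add_of_nonneg_right hpos)

/-- The gain term minus the loss term of a function of `v_*` alone is controlled by its Riesz
potential, uniformly in the truncation: the cancellation at grazing collisions. -/
theorem exists_cancellation {n : ℕ} (hn : 1 ≤ n) {γ s b : ℝ} (hs : s ∈ Ioo (0 : ℝ) 1)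
    (hγ : 0 ≤ n + 1 + γ) (hb : 0 ≤ b) :
    ∃ C : ℝ, 0 ≤ C ∧ ∀ β : ℝ → ℝ, Measurable β → (∀ c, 0 ≤ β c) → (∀ c, β c ≤ b) →
      ∀ A : Vel (n + 1) → ℝ≥0∞, Measurable A → ∀ δ : ℝ, 0 < δ →
      ∫⁻ p in {p | δ < ‖p.1‖}, A p.2 ∂(collisionMeasure n γ s β) ≤
        ∫⁻ p in {p | δ < ‖p.1‖}, A (p.1 + p.2) ∂(collisionMeasure n γ s β) +
          ENNReal.ofReal C * ∫⁻ z, A z * ENNReal.ofReal (‖z‖ ^ γ) := by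
  obtain ⟨hs0, hs1⟩ := hs
  set p : ℝ := n + 1 + γ with hp
  -- difference of the two weights: `1 - (1 + τ²)^{-p/2}` is quadratic at the origin, which makes
  -- it integrable against `τ^{-1-2s}`
  let Φ₁ : ℝ → ℝ≥0∞ := fun τ => ENNReal.ofReal (b * (1 - √(1 + τ ^ 2) ^ (-p)))
  have hΦ₁ : Measurable Φ₁ := by fun_prop
  let J : ℝ≥0∞ := surfaceMeasure n univ * (ENNReal.ofReal (b * (p / 2)) *
      ENNReal.ofReal (1 ^ (2 - 2 * s) / (2 - 2 * s)) + ENNReal.ofReal b *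
      ENNReal.ofReal (1 ^ (-(2 * s)) / (2 * s)) +
      ENNReal.ofReal b * ENNReal.ofReal (1 + (1 / 2) ^ (-(2 * s)) / (2 * s)))
  have hJ : J ≠ ⊤ := by
    refine ENNReal.mul_ne_top (measure_ne_top _ _) ?_
    simp [ENNReal.mul_eq_top]
  have hJ1 : ∫⁻ η : Vel n, ENNReal.ofReal (‖η‖ ^ (-(n + 2 * s))) * Φ₁ ‖η‖ ≤
      surfaceMeasure n univ * (ENNReal.ofReal (b * (p / 2)) *
      ENNReal.ofReal (1 ^ (2 - 2 * s) / (2 - 2 * s)) + ENNReal.ofReal b *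
      ENNReal.ofReal (1 ^ (-(2 * s)) / (2 * s))) := by
    rw [lintegral_rpow_norm_mul hn s hΦ₁, ← lintegral_rpow_head hs1 zero_le_one,
      ← lintegral_rpow_tail hs0 zero_lt_one]
    refine mul_le_mul_right ?_ _
    have hA1 : Measurable fun τ : ℝ => ENNReal.ofReal (τ ^ (-1 - 2 * s)) *
        (Iic 1).indicator (fun τ => ENNReal.ofReal (τ ^ 2)) τ :=
      Measurable.mul (by fun_prop) ((by fun_prop : Measurable fun τ : ℝ =>
        ENNReal.ofReal (τ ^ 2)).indicator measurableSet_Iic)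
    have hA2 : Measurable fun τ : ℝ => ENNReal.ofReal (τ ^ (-1 - 2 * s)) *
        (Ioi 1).indicator 1 τ :=
      Measurable.mul (by fun_prop) (measurable_one.indicator measurableSet_Ioi)
    rw [← lintegral_const_mul _ hA1, ← lintegral_const_mul _ hA2,
      ← lintegral_add_left (hA1.const_mul _)]
    refine setLIntegral_mono' measurableSet_Ioi fun τ hτ => ?_
    have hτ' : (0 : ℝ) < τ := hτ
    have hsq : √(1 + τ ^ 2) ^ (-p) = (1 + τ ^ 2) ^ (-(p / 2)) := by
      rw [Real.sqrt_eq_rpow, ← Real.rpow_mul (by positivity)]; congr 1; ring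
    rcases le_or_gt τ 1 with h | h
    · rw [indicator_of_mem (by exact h), indicator_of_notMem (by simpa using h)]
      simp only [mul_zero, add_zero]
      rw [mul_left_comm]
      refine mul_le_mul_right ?_ _
      rw [← ENNReal.ofReal_mul (by positivity)]
      refine ENNReal.ofReal_le_ofReal ?_
      rw [mul_assoc, hsq]
      exact mul_le_mul_of_nonneg_left (one_sub_rpow_neg_le (by positivity) (by positivity)) hb
    · rw [indicator_of_mem (show τ ∈ Ioi 1 from h), indicator_of_notMem (by simpa using h)]
      simp only [mul_zero, zero_add, Pi.one_apply, mul_one]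
      rw [mul_comm]
      refine mul_le_mul_left ?_ _
      refine ENNReal.ofReal_le_ofReal ?_
      have : 0 ≤ √(1 + τ ^ 2) ^ (-p) := by positivity
      nlinarith
  refine ⟨(2 ^ n * J).toReal, ENNReal.toReal_nonneg, fun β hβ hβ0 hβb A hA δ hδ => ?_⟩
  rw [ENNReal.ofReal_toReal (ENNReal.mul_ne_top (by simp) hJ), lintegral_gain hn γ s hβ hA,
    lintegral_loss hn γ s hβ hA, mul_assoc, ← mul_add]
  refine mul_le_mul_right ?_ _
  have hAm : Measurable fun z : Vel (n + 1) => A z * ENNReal.ofReal (‖z‖ ^ γ) :=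
    hA.mul (by fun_prop)
  have hI : Measurable ((Ioi δ).indicator (1 : ℝ → ℝ≥0∞)) :=
    measurable_one.indicator measurableSet_Ioi
  rw [← lintegral_const_mul _ hAm, ← lintegral_add_right _ (hAm.const_mul J)]
  refine lintegral_mono fun z => ?_
  simp only
  rw [mul_comm J, ← mul_add]
  refine mul_le_mul_right ?_ _
  rcases (norm_nonneg z).eq_or_lt with hz | hz
  · rw [← hz, lintegral_congr (g := fun _ => 0) fun η => by simp [hδ.le]]; simp
  set r := ‖z‖ with hr
  -- gap between the two truncations: it starts at `δ / r`, and its length is cubic in `δ / r` if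
  -- `δ / r` is small
  let D : Set ℝ := {τ : ℝ | δ / r < τ ∧ τ / √(1 + τ ^ 2) ≤ δ / r}
  have hD : MeasurableSet D := (measurableSet_lt measurable_const measurable_id).inter
    (measurableSet_le (by fun_prop : Measurable fun τ : ℝ => τ / √(1 + τ ^ 2)) measurable_const)
  have hDm : Measurable (D.indicator (1 : ℝ → ℝ≥0∞)) := measurable_one.indicator hD
  have hJ2 : ∫⁻ η : Vel n, ENNReal.ofReal (‖η‖ ^ (-(n + 2 * s))) *
      (ENNReal.ofReal b * D.indicator 1 ‖η‖) ≤ surfaceMeasure n univ *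
      (ENNReal.ofReal b * ENNReal.ofReal (1 + (1 / 2) ^ (-(2 * s)) / (2 * s))) := by
    rw [lintegral_rpow_norm_mul hn s (Φ := fun τ => ENNReal.ofReal b * D.indicator 1 τ)
      (hDm.const_mul _)]
    refine mul_le_mul_right ?_ _
    refine le_trans (le_of_eq ?_) (mul_le_mul_right (lintegral_truncation_gap_le ⟨hs0, hs1⟩
      (div_pos hδ hz)) (ENNReal.ofReal b))
    rw [← lintegral_const_mul' _ _ ENNReal.ofReal_ne_top]
    refine lintegral_congr fun τ => ?_
    rw [mul_left_comm]
  have hm1 : Measurable fun η : Vel n => ENNReal.ofReal (√(1 + ‖η‖ ^ 2) ^ (-p) *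
      (‖η‖ ^ (-(n + 2 * s)) * β ((1 - ‖η‖ ^ 2) / (1 + ‖η‖ ^ 2)))) *
      (Ioi δ).indicator 1 (r * (‖η‖ / √(1 + ‖η‖ ^ 2))) :=
    Measurable.mul (Measurable.ennreal_ofReal (Measurable.mul (by fun_prop) (Measurable.mul
      (by fun_prop) (hβ.comp (by fun_prop))))) (hI.comp (by fun_prop))
  have hm2 : Measurable fun η : Vel n => ENNReal.ofReal (‖η‖ ^ (-(n + 2 * s))) * Φ₁ ‖η‖ :=
    Measurable.mul (by fun_prop) (hΦ₁.comp measurable_norm)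
  calc _ ≤ ∫⁻ η : Vel n, (ENNReal.ofReal (√(1 + ‖η‖ ^ 2) ^ (-p) *
      (‖η‖ ^ (-(n + 2 * s)) * β ((1 - ‖η‖ ^ 2) / (1 + ‖η‖ ^ 2)))) *
      (Ioi δ).indicator 1 (r * (‖η‖ / √(1 + ‖η‖ ^ 2)))) +
      (ENNReal.ofReal (‖η‖ ^ (-(n + 2 * s))) * Φ₁ ‖η‖ +
      ENNReal.ofReal (‖η‖ ^ (-(n + 2 * s))) * (ENNReal.ofReal b * D.indicator 1 ‖η‖)) := by
        refine lintegral_mono fun η => ?_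
        set q : ℝ := √(1 + ‖η‖ ^ 2) with hq
        have hq1 : 1 ≤ q := Real.one_le_sqrt.2 (by linarith [sq_nonneg ‖η‖])
        have hq0 : 0 < q := by linarith
        have hqp : q ^ (-p) ≤ 1 := Real.rpow_le_one_of_one_le_of_nonpos hq1 (by linarith)
        have hqp0 : 0 ≤ q ^ (-p) := by positivity
        set X : ℝ := ‖η‖ ^ (-(n + 2 * s)) with hX
        have hX0 : 0 ≤ X := by positivity
        set B : ℝ := β ((1 - ‖η‖ ^ 2) / (1 + ‖η‖ ^ 2)) with hB
        have hB0 : 0 ≤ B := hβ0 _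
        have hB1 : B ≤ b := hβb _
        simp only
        by_cases h1 : δ < r * ‖η‖
        · rw [indicator_of_mem (by exact h1), Pi.one_apply, mul_one]
          by_cases h2 : δ < r * (‖η‖ / q)
          · rw [indicator_of_mem (by exact h2), Pi.one_apply, mul_one, ← add_assoc]
            refine le_trans ?_ le_self_add
            simp only [Φ₁]
            rw [← ENNReal.ofReal_mul hX0, ← ENNReal.ofReal_add (by positivity)
              (mul_nonneg hX0 (mul_nonneg hb (by linarith)))]
            refine ENNReal.ofReal_le_ofReal ?_
            have : X * B = q ^ (-p) * (X * B) + X * (B * (1 - q ^ (-p))) := by ring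
            rw [this]
            gcongr
            linarith
          · have hmem : ‖η‖ ∈ D := by
              refine ⟨?_, ?_⟩
              · rw [div_lt_iff₀ hz]; linarith
              · rw [le_div_iff₀ hz]; linarith
            rw [indicator_of_mem hmem, Pi.one_apply, mul_one, ← add_assoc]
            refine le_trans ?_ le_add_self
            rw [← ENNReal.ofReal_mul hX0]
            exact ENNReal.ofReal_le_ofReal (by gcongr)
        · rw [indicator_of_notMem (by exact h1), mul_zero]; exact bot_le
    _ ≤ _ := by
        rw [lintegral_add_left hm1, lintegral_add_left hm2]
        refine add_le_add_right ((add_le_add hJ1 hJ2).trans (le_of_eq ?_)) _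
        simp only [J]
        ring

/-! ### The collision operator in terms of displacements -/

theorem norm_displacements_fst_sq {d : ℕ} (z : Vel d) (σ : Sph d) :
    ‖(displacements (z, σ)).1‖ ^ 2 = (‖z‖ ^ 2 - ‖z‖ * ⟪z, (σ : Vel d)⟫) / 2 := by
  have hσ : ‖(σ : Vel d)‖ = 1 := norm_eq_of_mem_sphere σ
  simp only [displacements]
  rw [norm_smul, mul_pow, norm_sub_sq_real, norm_smul, hσ, real_inner_smul_left,
    real_inner_comm, Real.norm_of_nonneg (by norm_num : (0 : ℝ) ≤ 1 / 2), norm_norm]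
  ring

theorem norm_displacements_snd_sq {d : ℕ} (z : Vel d) (σ : Sph d) :
    ‖(displacements (z, σ)).2‖ ^ 2 = (‖z‖ ^ 2 + ‖z‖ * ⟪z, (σ : Vel d)⟫) / 2 := by
  have hσ : ‖(σ : Vel d)‖ = 1 := norm_eq_of_mem_sphere σ
  simp only [displacements]
  rw [norm_neg, norm_smul, mul_pow, norm_add_sq_real, norm_smul, hσ, real_inner_smul_right,
    Real.norm_of_nonneg (by norm_num : (0 : ℝ) ≤ 1 / 2), norm_norm]
  ring

theorem collisionKernel_eq {n : ℕ} (hn : 1 ≤ n) {γ s : ℝ} (hm : 0 < γ + 2 * s + 1) (bt : ℝ → ℝ)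
    (z : Vel (n + 1)) (σ : Sph (n + 1)) (hu : 0 < ‖(displacements (z, σ)).1‖) :
    collisionKernel (n + 1) γ s bt ‖z‖ ⟪‖z‖⁻¹ • z, (σ : Vel (n + 1))⟫ =
      pairKernel γ s (displacements (z, σ)) * bt (pairCos (displacements (z, σ))) := by
  have hz : 0 < ‖z‖ := by
    rcases (norm_nonneg z).eq_or_lt with h | h
    · exfalso
      have := norm_displacements_fst_sq z σ
      rw [← h] at this
      nlinarith
    · exact h
  have hu2 := norm_displacements_fst_sq z σ
  have hw2 := norm_displacements_snd_sq z σ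
  set u := (displacements (z, σ)).1
  set w := (displacements (z, σ)).2
  set r := ‖z‖
  set c := ⟪r⁻¹ • z, (σ : Vel (n + 1))⟫ with hc
  have hzc : ⟪z, (σ : Vel (n + 1))⟫ = r * c := by
    rw [hc, real_inner_smul_left]; field_simp
  rw [hzc] at hu2 hw2
  have hc1 : c ≤ 1 := by nlinarith [sq_nonneg ‖u‖, mul_pos hz hz]
  have hc2 : -1 ≤ c := by nlinarith [sq_nonneg ‖w‖, mul_pos hz hz]
  have hsin : Real.sin (Real.arccos c / 2) = ‖u‖ / r := by
    rw [Real.sin_half_eq_sqrt (Real.arccos_nonneg c) (by linarith [Real.arccos_le_pi c, Real.pi_pos]),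
      Real.cos_arccos hc2 hc1, Real.sqrt_eq_iff_eq_sq (by linarith) (by positivity), div_pow, hu2]
    field_simp
  have hcos : Real.cos (Real.arccos c / 2) = ‖w‖ / r := by
    rw [Real.cos_half (by linarith [Real.arccos_nonneg c, Real.pi_pos]) (Real.arccos_le_pi c),
      Real.cos_arccos hc2 hc1, Real.sqrt_eq_iff_eq_sq (by linarith) (by positivity), div_pow, hw2]
    field_simp
  have hpc : pairCos (displacements (z, σ)) = c := by
    simp only [pairCos]
    change (‖w‖ ^ 2 - ‖u‖ ^ 2) / (‖u‖ ^ 2 + ‖w‖ ^ 2) = c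
    rw [hu2, hw2]; field_simp; ring
  have hr2 : √(‖u‖ ^ 2 + ‖w‖ ^ 2) = r := by
    rw [Real.sqrt_eq_iff_eq_sq (by positivity) hz.le, hu2, hw2]; ring
  rw [hpc]
  unfold collisionKernel angularKernel
  rw [← mul_assoc]
  congr 1
  simp only [pairKernel]
  change _ = √(‖u‖ ^ 2 + ‖w‖ ^ 2) ^ (n - 1) * (‖u‖ ^ (-((n : ℝ) + 2 * s)) * ‖w‖ ^ (γ + 2 * s + 1))
  rw [hr2, Real.tan_eq_sin_div_cos, hsin, hcos]
  rcases (norm_nonneg w).eq_or_lt with hw | hw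
  · -- at `w = 0` both sides vanish: the left one because `tan (π / 2) = 0` by convention
    rw [← hw, zero_div, div_zero, Real.zero_rpow (by linarith), Real.zero_rpow (by linarith)]
    ring
  · rw [show ‖u‖ / r / (‖w‖ / r) = ‖u‖ / ‖w‖ by field_simp, Real.div_rpow hu.le hz.le,
      Real.div_rpow hu.le hw.le, ← Real.rpow_natCast r (n - 1), Nat.cast_sub hn,
      Real.rpow_neg hw.le (γ + 2 * s + 1), div_inv_eq_mul,
      show (-(((n + 1 : ℕ) : ℝ) - 2) + γ) = γ - (n - 1 : ℝ) by push_cast; ring]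
    have h1 : ‖u‖ ^ (-((n : ℝ) + 2 * s)) =
        ‖u‖ ^ (γ - (n - 1 : ℝ)) * ‖u‖ ^ (-(γ + 2 * s + 1)) := by
      rw [← Real.rpow_add hu]; congr 1; ring
    have h2 : r ^ γ = r ^ ((n : ℝ) - (1 : ℕ)) * r ^ (γ - (n - 1 : ℝ)) := by
      rw [← Real.rpow_add hz]; congr 1; push_cast; ring
    rw [h1, h2]
    have : r ^ (γ - (n - 1 : ℝ)) ≠ 0 := (Real.rpow_pos_of_pos hz _).ne'
    field_simp

/-- The change of variables `(v_*, σ) ↦ (v' - v, v'_* - v)`. -/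
theorem measurePreserving_displacements {d : ℕ} (v : Vel d) :
    MeasurePreserving (fun p : Vel d × Sph d => displacements (v - p.1, p.2))
      ((volume : Measure (Vel d)).prod (surfaceMeasure d)) (pairMeasure d) := by
  have h1 : MeasurePreserving (fun p : Vel d × Sph d => (v - p.1, p.2))
      ((volume : Measure (Vel d)).prod (surfaceMeasure d))
      ((volume : Measure (Vel d)).prod (surfaceMeasure d)) :=
    (Measure.measurePreserving_sub_left volume v).prod (MeasurePreserving.id _)
  exact (⟨continuous_displacements.measurable, rfl⟩ : MeasurePreserving displacements
    ((volume : Measure (Vel d)).prod (surfaceMeasure d)) (pairMeasure d)).comp h1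

theorem vPrime_eq {d : ℕ} (v vs : Vel d) (σ : Sph d) :
    vPrime v vs σ = v + (displacements (v - vs, σ)).1 := by
  simp only [vPrime, displacements]; module

theorem vPrimeStar_eq {d : ℕ} (v vs : Vel d) (σ : Sph d) :
    vPrimeStar v vs σ = v + (displacements (v - vs, σ)).2 := by
  simp only [vPrimeStar, displacements]; module

theorem eq_add_displacements {d : ℕ} (v vs : Vel d) (σ : Sph d) :
    vs = v + ((displacements (v - vs, σ)).1 + (displacements (v - vs, σ)).2) := by
  simp only [displacements]; module

/-- The increment `f(v'_*) f(v') - f(v_*) f(v)` in terms of the displacements. -/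
def collisionIncrement {d : ℕ} (f : Vel d → ℝ) (v : Vel d) (p : Vel d × Vel d) : ℝ :=
  f (v + p.2) * f (v + p.1) - f (v + (p.1 + p.2)) * f v

theorem measurableSet_lt_norm_fst {d : ℕ} (δ : ℝ) :
    MeasurableSet {p : Vel d × Vel d | δ < ‖p.1‖} :=
  measurableSet_lt measurable_const (by fun_prop)

/-- The truncated collision integrals are integrals against the collision measure. -/
theorem truncated_collision_eq {n : ℕ} (hn : 1 ≤ n) {γ s : ℝ} (hm : 0 < γ + 2 * s + 1)
    {bt β : ℝ → ℝ} (hβ : Measurable β) (hβ0 : ∀ c, 0 ≤ β c)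
    (hbt : ∀ c ∈ Icc (-1 : ℝ) 1, bt c = β c) {f : Vel (n + 1) → ℝ} (hf : Continuous f)
    (v : Vel (n + 1)) {δ : ℝ} (hδ : 0 < δ)
    (hi : IntegrableOn (collisionIntegrand γ s bt f f v) (nonGrazing v δ)
      ((volume : Measure (Vel (n + 1))).prod (surfaceMeasure (n + 1)))) :
    IntegrableOn (collisionIncrement f v) {p | δ < ‖p.1‖} (collisionMeasure n γ s β) ∧
    ∫ p in nonGrazing v δ, collisionIntegrand γ s bt f f v p
      ∂((volume : Measure (Vel (n + 1))).prod (surfaceMeasure (n + 1))) =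
    ∫ p in {p | δ < ‖p.1‖}, collisionIncrement f v p ∂(collisionMeasure n γ s β) := by
  have hmp := measurePreserving_displacements v
  have hS := measurableSet_lt_norm_fst (d := n + 1) δ
  have hng : nonGrazing v δ =
      (fun p : Vel (n + 1) × Sph (n + 1) => displacements (v - p.1, p.2)) ⁻¹' {p | δ < ‖p.1‖} := by
    ext p
    simp only [nonGrazing, mem_preimage, Set.mem_ofPred_eq, vPrime_eq, add_sub_cancel_left]
  have hpc : ∀ p : Vel (n + 1) × Vel (n + 1), pairCos p ∈ Icc (-1 : ℝ) 1 := by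
    intro p
    unfold pairCos
    rcases (add_nonneg (sq_nonneg ‖p.1‖) (sq_nonneg ‖p.2‖)).eq_or_lt with h | h
    · rw [← h, div_zero]; norm_num
    · refine ⟨?_, ?_⟩
      · rw [le_div_iff₀ h]; nlinarith [sq_nonneg ‖p.1‖, sq_nonneg ‖p.2‖]
      · rw [div_le_iff₀ h]; nlinarith [sq_nonneg ‖p.1‖, sq_nonneg ‖p.2‖]
  set k : Vel (n + 1) × Vel (n + 1) → ℝ := fun p => pairKernel γ s p * β (pairCos p) with hk
  have hk0 : ∀ p, 0 ≤ k p := fun p => mul_nonneg (pairKernel_nonneg γ s p) (hβ0 _)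
  have hkm : Measurable k := (measurable_pairKernel γ s).mul (hβ.comp measurable_pairCos)
  set F : Vel (n + 1) × Vel (n + 1) → ℝ := fun p => k p • collisionIncrement f v p with hF
  have hcm : Measurable (collisionIncrement f v) := by
    unfold collisionIncrement
    exact Continuous.measurable (by fun_prop)
  have hFm : Measurable F := hkm.smul hcm
  have hpt : EqOn (collisionIntegrand γ s bt f f v)
      (fun p => F (displacements (v - p.1, p.2))) (nonGrazing v δ) := by
    intro p hp
    rw [hng] at hp
    have hp' : δ < ‖(displacements (v - p.1, p.2)).1‖ := hp
    simp only [collisionIntegrand, cosDeviation, hF, hk, smul_eq_mul]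
    rw [collisionKernel_eq hn hm bt _ _ (hδ.trans hp'), hbt _ (hpc _), vPrime_eq, vPrimeStar_eq,
      mul_comm, collisionIncrement, ← eq_add_displacements]
  have hmeas : MeasurableSet (nonGrazing v δ) := by rw [hng]; exact hmp.measurable hS
  have hi2 : IntegrableOn F {p | δ < ‖p.1‖} (pairMeasure (n + 1)) := by
    have h1 := (integrableOn_congr_fun hpt hmeas).1 hi
    rw [hng] at h1
    exact ((hmp.restrict_preimage hS).integrable_comp hFm.aestronglyMeasurable).1 h1
  have hres : (collisionMeasure n γ s β).restrict {p | δ < ‖p.1‖} =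
      ((pairMeasure (n + 1)).restrict {p | δ < ‖p.1‖}).withDensity
        fun p => ENNReal.ofReal (k p) := by
    rw [collisionMeasure, restrict_withDensity hS]
  have htr : ∀ p, (ENNReal.ofReal (k p)).toReal = k p := fun p => ENNReal.toReal_ofReal (hk0 p)
  constructor
  · rw [IntegrableOn, hres, integrable_withDensity_iff_integrable_smul' hkm.ennreal_ofReal
      (by simp)]
    simp only [htr]
    exact hi2
  · rw [hres, integral_withDensity_eq_integral_toReal_smul hkm.ennreal_ofReal (by simp)]
    simp only [htr]
    rw [setIntegral_congr_fun hmeas hpt, hng, ← hmp.map_eq,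
      setIntegral_map hS hFm.aestronglyMeasurable hmp.measurable.aemeasurable]

/-! ### Upper bounds for the collision operator -/

theorem setLIntegral_lt_norm_fst {d : ℕ} (μ : Measure (Vel d × Vel d)) (δ : ℝ)
    (F : Vel d × Vel d → ℝ≥0∞) :
    ∫⁻ p in {p | δ < ‖p.1‖}, F p ∂μ = ∫⁻ p, F p * (Ioi δ).indicator 1 ‖p.1‖ ∂μ := by
  rw [← lintegral_indicator (measurableSet_lt_norm_fst δ)]
  refine lintegral_congr fun p => ?_
  by_cases h : δ < ‖p.1‖
  · rw [indicator_of_mem (by exact h), indicator_of_mem (by exact h), Pi.one_apply, mul_one]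
  · rw [indicator_of_notMem (by exact h), indicator_of_notMem (by exact h), mul_zero]

theorem lintegral_collisionMeasure_neg_fst {n : ℕ} (hn : 1 ≤ n) {γ s : ℝ} {β : ℝ → ℝ}
    (hβ : Measurable β) {F : Vel (n + 1) × Vel (n + 1) → ℝ≥0∞} (hF : Measurable F) :
    ∫⁻ p, F (-p.1, p.2) ∂(collisionMeasure n γ s β) = ∫⁻ p, F p ∂(collisionMeasure n γ s β) := by
  have hF' : Measurable fun p : Vel (n + 1) × Vel (n + 1) => F (-p.1, p.2) :=
    hF.comp (by fun_prop)
  have hG : Measurable fun p : Vel (n + 1) × Vel (n + 1) =>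
      ENNReal.ofReal (pairKernel γ s p * β (pairCos p)) * F p :=
    ((measurable_pairKernel γ s).mul (hβ.comp measurable_pairCos)).ennreal_ofReal.mul hF
  rw [lintegral_collisionMeasure hβ hF', lintegral_collisionMeasure hβ hF,
    ← lintegral_pairMeasure_neg_fst hn hG]
  refine lintegral_congr fun p => ?_
  simp only [pairKernel, pairCos, norm_neg]

theorem ae_collisionMeasure_inner {n : ℕ} {γ s : ℝ} {β : ℝ → ℝ} :
    ∀ᵐ p ∂(collisionMeasure n γ s β), ⟪p.1, p.2⟫ = 0 :=
  (withDensity_absolutelyContinuous _ _).ae_le ae_pairMeasure_inner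

theorem lintegral_truncated_lt_top {n : ℕ} (hn : 1 ≤ n) {γ s b : ℝ} (hs : 0 < s) {β : ℝ → ℝ}
    (hβ : Measurable β) (hb0 : 0 ≤ b) (hb : ∀ c, β c ≤ b) {A : Vel (n + 1) → ℝ≥0∞}
    (hA : Measurable A) (hfin : ∫⁻ w, A w * ENNReal.ofReal (‖w‖ ^ (γ + 2 * s)) < ⊤)
    {δ : ℝ} (hδ : 0 < δ) :
    ∫⁻ p in {p | δ < ‖p.1‖}, A p.2 ∂(collisionMeasure n γ s β) < ⊤ := by
  have hI : Measurable ((Ioi δ).indicator (1 : ℝ → ℝ≥0∞)) :=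
    measurable_one.indicator measurableSet_Ioi
  have hF : Measurable fun p : Vel (n + 1) × Vel (n + 1) =>
      A p.2 * (Ioi δ).indicator 1 ‖p.1‖ :=
    (hA.comp measurable_snd).mul (hI.comp (by fun_prop))
  rw [setLIntegral_lt_norm_fst]
  refine (lintegral_collisionMeasure_le hβ hb0 hb hF).trans_lt ?_
  rw [lintegral_collisionMeasure_mul hn hA hI, lintegral_rpow_tail hs hδ]
  have h1 : surfaceMeasure n univ < ⊤ := measure_lt_top _ _
  have h2 : (2 : ℝ≥0∞) ^ n < ⊤ := by simp
  exact ENNReal.mul_lt_top ENNReal.ofReal_lt_top (ENNReal.mul_lt_top (ENNReal.mul_lt_top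
    (ENNReal.mul_lt_top h2 h1) hfin) ENNReal.ofReal_lt_top)

/-- `E(u,w)` is, on orthogonal displacements, at most a term `f(v + w) ℓ(u)` with `ℓ` odd, which
integrates to zero against the collision measure, plus a gain `P` minus a loss `G` whose integrals
differ by at most `a`. -/
def CollisionBound (n : ℕ) (γ s : ℝ) (β : ℝ → ℝ) (f : Vel (n + 1) → ℝ) (v : Vel (n + 1))
    (E : Vel (n + 1) → Vel (n + 1) → ℝ) (a : ℝ) : Prop :=
  ∃ (ℓ : Vel (n + 1) → ℝ) (P G : Vel (n + 1) × Vel (n + 1) → ℝ) (M δ p g : ℝ),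
    Measurable ℓ ∧ (∀ u, ℓ (-u) = -ℓ u) ∧ (∀ u, |ℓ u| ≤ M) ∧
    Measurable P ∧ Measurable G ∧ (∀ x, 0 ≤ P x) ∧ (∀ x, 0 ≤ G x) ∧ 0 < δ ∧ 0 ≤ p ∧ 0 ≤ g ∧
    (∀ u w, ⟪u, w⟫ = 0 → E u w ≤ f (v + w) * ℓ u + P (u, w) - G (u, w)) ∧
    ∫⁻ x, ENNReal.ofReal (P x) ∂(collisionMeasure n γ s β) ≤ ENNReal.ofReal p ∧
    ENNReal.ofReal g ≤ ∫⁻ x in {x | δ < ‖x.1‖}, ENNReal.ofReal (G x) ∂(collisionMeasure n γ s β) ∧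
    p - g ≤ a

namespace CollisionBound

variable {n : ℕ} {γ s : ℝ} {β : ℝ → ℝ} {f : Vel (n + 1) → ℝ} {v : Vel (n + 1)}
  {E E₁ E₂ : Vel (n + 1) → Vel (n + 1) → ℝ} {a a₁ a₂ : ℝ}

theorem mono (h : CollisionBound n γ s β f v E₁ a₁)
    (hE : ∀ u w, ⟪u, w⟫ = 0 → E u w ≤ E₁ u w) (ha : a₁ ≤ a) :
    CollisionBound n γ s β f v E a := by
  obtain ⟨ℓ, P, G, M, δ, p, g, h1, h2, h3, h4, h5, h6, h7, h8, h9, h10, h11, h12, h13, h14⟩ := h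
  exact ⟨ℓ, P, G, M, δ, p, g, h1, h2, h3, h4, h5, h6, h7, h8, h9, h10,
    fun u w hi => (hE u w hi).trans (h11 u w hi), h12, h13, h14.trans ha⟩

theorem add (h : CollisionBound n γ s β f v E₁ a₁) (h' : CollisionBound n γ s β f v E₂ a₂) :
    CollisionBound n γ s β f v (fun u w => E₁ u w + E₂ u w) (a₁ + a₂) := by
  obtain ⟨ℓ, P, G, M, δ, p, g, h1, h2, h3, h4, h5, h6, h7, h8, h9, h10, h11, h12, h13, h14⟩ := h
  obtain ⟨ℓ', P', G', M', δ', p', g', k1, k2, k3, k4, k5, k6, k7, k8, k9, k10, k11, k12, k13,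
    k14⟩ := h'
  refine ⟨fun u => ℓ u + ℓ' u, fun x => P x + P' x, fun x => G x + G' x, M + M', min δ δ', p + p',
    g + g', h1.add k1, fun u => ?_, fun u => (abs_add_le _ _).trans (add_le_add (h3 u) (k3 u)),
    h4.add k4, h5.add k5, fun x => add_nonneg (h6 x) (k6 x), fun x => add_nonneg (h7 x) (k7 x),
    lt_min h8 k8, add_nonneg h9 k9, add_nonneg h10 k10, fun u w hi => ?_, ?_, ?_, by linarith⟩
  · simp only [h2, k2]; ring
  · have := h11 u w hi
    have := k11 u w hi
    simp only
    linarith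
  · simp_rw [ENNReal.ofReal_add (h6 _) (k6 _)]
    rw [lintegral_add_left h4.ennreal_ofReal, ENNReal.ofReal_add h9 k9]
    exact add_le_add h12 k12
  · simp_rw [ENNReal.ofReal_add (h7 _) (k7 _)]
    rw [lintegral_add_left h5.ennreal_ofReal, ENNReal.ofReal_add h10 k10]
    refine add_le_add (h13.trans (lintegral_mono_set fun x hx => ?_))
      (k13.trans (lintegral_mono_set fun x hx => ?_))
    · exact lt_of_le_of_lt (min_le_left _ _) (show δ < ‖x.1‖ from hx)
    · exact lt_of_le_of_lt (min_le_right _ _) (show δ' < ‖x.1‖ from hx)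

theorem const_mul {c : ℝ} (hc : 0 ≤ c) (h : CollisionBound n γ s β f v E a) :
    CollisionBound n γ s β f v (fun u w => c * E u w) (c * a) := by
  obtain ⟨ℓ, P, G, M, δ, p, g, h1, h2, h3, h4, h5, h6, h7, h8, h9, h10, h11, h12, h13, h14⟩ := h
  refine ⟨fun u => c * ℓ u, fun x => c * P x, fun x => c * G x, c * M, δ, c * p,
    c * g, h1.const_mul c, fun u => ?_, fun u => ?_,
    h4.const_mul c, h5.const_mul c, fun x => mul_nonneg hc (h6 x), fun x => mul_nonneg hc (h7 x),
    h8, mul_nonneg hc h9, mul_nonneg hc h10, fun u w hi => ?_, ?_, ?_, ?_⟩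
  · simp only [h2]; ring
  · rw [abs_mul, abs_of_nonneg hc]; exact mul_le_mul_of_nonneg_left (h3 u) hc
  · have := mul_le_mul_of_nonneg_left (h11 u w hi) hc
    simp only
    linarith
  · simp_rw [ENNReal.ofReal_mul hc]
    rw [lintegral_const_mul _ h4.ennreal_ofReal]
    exact mul_le_mul_right h12 _
  · simp_rw [ENNReal.ofReal_mul hc]
    rw [lintegral_const_mul _ h5.ennreal_ofReal]
    exact mul_le_mul_right h13 _
  · rw [← mul_sub]; exact mul_le_mul_of_nonneg_left h14 hc

end CollisionBound

/-- A bound for `f(v'_*) (f(v') - f(v))` gives one for the collision operator: the remaining part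
`f(v) (f(v'_*) - f(v_*))` of the increment is controlled by cancellation. -/
theorem truncated_collision_le {n : ℕ} (hn : 1 ≤ n) {γ s b C : ℝ} (hs : s ∈ Ioo (0 : ℝ) 1)
    {β : ℝ → ℝ} (hβ : Measurable β) (hb : ∀ c, β c ≤ b) (hb0 : 0 ≤ b) (hC : 0 ≤ C)
    {f : Vel (n + 1) → ℝ} (hf : Continuous f) (hf0 : ∀ x, 0 ≤ f x) {B : ℝ} (hB : ∀ x, f x ≤ B)
    {v : Vel (n + 1)} (hfin : ∫⁻ w, ENNReal.ofReal (f (v + w)) *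
      ENNReal.ofReal (‖w‖ ^ (γ + 2 * s)) < ⊤)
    (hcancel : ∀ δ : ℝ, 0 < δ →
      ∫⁻ p in {p | δ < ‖p.1‖}, ENNReal.ofReal (f (v + p.2)) ∂(collisionMeasure n γ s β) ≤
        ∫⁻ p in {p | δ < ‖p.1‖}, ENNReal.ofReal (f (v + (p.1 + p.2)))
          ∂(collisionMeasure n γ s β) +
          ENNReal.ofReal C * ∫⁻ z, ENNReal.ofReal (f (v + z)) * ENNReal.ofReal (‖z‖ ^ γ))
    {a K : ℝ} (hK0 : 0 ≤ K)
    (hK : ∫⁻ z, ENNReal.ofReal (f (v + z)) * ENNReal.ofReal (‖z‖ ^ γ) ≤ ENNReal.ofReal K)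
    (hE : CollisionBound n γ s β f v (fun u w => f (v + w) * (f (v + u) - f v)) a) :
    ∃ δ₀ : ℝ, 0 < δ₀ ∧ ∀ δ ∈ Ioo (0 : ℝ) δ₀,
      IntegrableOn (collisionIncrement f v) {p | δ < ‖p.1‖} (collisionMeasure n γ s β) →
      ∫ p in {p | δ < ‖p.1‖}, collisionIncrement f v p ∂(collisionMeasure n γ s β) ≤
        a + f v * C * K := by
  obtain ⟨ℓ, P, G, M, δ₀, p, g, hℓ, hodd, hℓM, hP, hG, hP0, hG0, hδ₀, hp0, hg0, hpt, hPi, hGi,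
    hpg⟩ := hE
  refine ⟨δ₀, hδ₀, fun δ hδ hint => ?_⟩
  have hfm : Measurable f := hf.measurable
  have hM : 0 ≤ M := (abs_nonneg _).trans (hℓM 0)
  have hB0 : 0 ≤ B := (hf0 0).trans (hB 0)
  set S : Set (Vel (n + 1) × Vel (n + 1)) := {p | δ < ‖p.1‖} with hS
  have hSm : MeasurableSet S := measurableSet_lt_norm_fst δ
  set μ := collisionMeasure n γ s β with hμ
  have hm1 : Measurable fun w => ENNReal.ofReal (f (v + w)) :=
    (hfm.comp (by fun_prop)).ennreal_ofReal
  have hc := lintegral_truncated_lt_top hn hs.1 hβ hb0 hb hm1 hfin hδ.1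
  have hm2 : Measurable fun p : Vel (n + 1) × Vel (n + 1) => ENNReal.ofReal (f (v + p.2)) :=
    hm1.comp measurable_snd
  -- the gain and the loss are integrable away from grazing collisions
  have hAi : IntegrableOn (fun p : Vel (n + 1) × Vel (n + 1) => f (v + p.2) * f (v + p.1)) S μ := by
    refine ⟨Continuous.aestronglyMeasurable (by fun_prop), ?_⟩
    rw [hasFiniteIntegral_iff_ofReal (Eventually.of_forall fun p => mul_nonneg (hf0 _) (hf0 _))]
    calc _ ≤ ∫⁻ p in S, ENNReal.ofReal B * ENNReal.ofReal (f (v + p.2)) ∂μ := by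
          refine lintegral_mono fun p => ?_
          simp only
          rw [← ENNReal.ofReal_mul hB0]
          refine ENNReal.ofReal_le_ofReal ?_
          rw [mul_comm]
          exact mul_le_mul_of_nonneg_right (hB _) (hf0 _)
      _ = ENNReal.ofReal B * ∫⁻ p in S, ENNReal.ofReal (f (v + p.2)) ∂μ :=
          lintegral_const_mul _ hm2
      _ < ⊤ := ENNReal.mul_lt_top ENNReal.ofReal_lt_top hc
  have hBi : IntegrableOn (fun p : Vel (n + 1) × Vel (n + 1) => f (v + (p.1 + p.2)) * f v) S μ := by
    have := hAi.sub hint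
    refine this.congr (Eventually.of_forall fun p => ?_)
    simp only [Pi.sub_apply, collisionIncrement]
    ring
  have hD : ∫ p in S, collisionIncrement f v p ∂μ = ∫ p in S, f (v + p.2) * f (v + p.1) ∂μ -
      ∫ p in S, f (v + (p.1 + p.2)) * f v ∂μ := by
    rw [← integral_sub hAi hBi]; rfl
  -- the odd term
  have hodd' : ∫⁻ p in S, ENNReal.ofReal (f (v + p.2) * max (-ℓ p.1) 0) ∂μ =
      ∫⁻ p in S, ENNReal.ofReal (f (v + p.2) * max (ℓ p.1) 0) ∂μ := by
    have hI : Measurable ((Ioi δ).indicator (1 : ℝ → ℝ≥0∞)) :=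
      measurable_one.indicator measurableSet_Ioi
    have hF : Measurable fun p : Vel (n + 1) × Vel (n + 1) =>
        ENNReal.ofReal (f (v + p.2) * max (ℓ p.1) 0) * (Ioi δ).indicator 1 ‖p.1‖ :=
      (Measurable.ennreal_ofReal (Measurable.mul (hfm.comp (by fun_prop))
        ((hℓ.comp measurable_fst).max measurable_const))).mul (hI.comp (by fun_prop))
    rw [setLIntegral_lt_norm_fst, setLIntegral_lt_norm_fst,
      ← lintegral_collisionMeasure_neg_fst hn hβ hF]
    refine lintegral_congr fun p => ?_
    simp only [hodd, norm_neg]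
  have hXfin : ∫⁻ p in S, ENNReal.ofReal (f (v + p.2) * max (ℓ p.1) 0) ∂μ ≠ ⊤ := by
    refine ne_top_of_le_ne_top (ENNReal.mul_lt_top (ENNReal.ofReal_lt_top (r := M)) hc).ne ?_
    rw [← lintegral_const_mul _ hm2]
    refine lintegral_mono fun p => ?_
    simp only
    rw [← ENNReal.ofReal_mul hM, mul_comm M]
    exact ENNReal.ofReal_le_ofReal (mul_le_mul_of_nonneg_left
      (max_le ((le_abs_self _).trans (hℓM _)) hM) (hf0 _))
  have hsum : ∫⁻ p in S, ENNReal.ofReal (f (v + p.2) * f (v + p.1)) ∂μ +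
      ∫⁻ p in S, ENNReal.ofReal (G p) ∂μ +
      ∫⁻ p in S, ENNReal.ofReal (f (v + p.2) * max (ℓ p.1) 0) ∂μ ≤
      ∫⁻ p in S, ENNReal.ofReal (P p) ∂μ +
      ∫⁻ p in S, ENNReal.ofReal (f (v + p.2)) * ENNReal.ofReal (f v) ∂μ +
      ∫⁻ p in S, ENNReal.ofReal (f (v + p.2) * max (ℓ p.1) 0) ∂μ := by
    have hmA : Measurable fun p : Vel (n + 1) × Vel (n + 1) =>
        ENNReal.ofReal (f (v + p.2) * f (v + p.1)) :=
      Measurable.ennreal_ofReal (Continuous.measurable (by fun_prop))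
    nth_rewrite 1 [← hodd']
    have hmAG : Measurable fun p : Vel (n + 1) × Vel (n + 1) =>
        ENNReal.ofReal (f (v + p.2) * f (v + p.1)) + ENNReal.ofReal (G p) :=
      Measurable.add hmA hG.ennreal_ofReal
    have hmPC : Measurable fun p : Vel (n + 1) × Vel (n + 1) =>
        ENNReal.ofReal (P p) + ENNReal.ofReal (f (v + p.2)) * ENNReal.ofReal (f v) :=
      Measurable.add hP.ennreal_ofReal (hm2.mul_const _)
    rw [← lintegral_add_left hmA, ← lintegral_add_left hmAG,
      ← lintegral_add_left hP.ennreal_ofReal, ← lintegral_add_left hmPC]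
    refine lintegral_mono_ae (ae_restrict_of_ae ?_)
    filter_upwards [ae_collisionMeasure_inner] with x hx
    have h1 := hpt x.1 x.2 hx
    have h2 : ℓ x.1 = max (ℓ x.1) 0 - max (-ℓ x.1) 0 := by
      rcases le_total (ℓ x.1) 0 with h | h
      · rw [max_eq_right h, max_eq_left (by linarith)]; ring
      · rw [max_eq_left h, max_eq_right (by linarith)]; ring
    have h3 : 0 ≤ f (v + x.2) * max (ℓ x.1) 0 := mul_nonneg (hf0 _) (le_max_right _ _)
    have h4 : 0 ≤ f (v + x.2) * max (-ℓ x.1) 0 := mul_nonneg (hf0 _) (le_max_right _ _)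
    rw [← ENNReal.ofReal_mul (hf0 _), ← ENNReal.ofReal_add (mul_nonneg (hf0 _) (hf0 _)) (hG0 _),
      ← ENNReal.ofReal_add (add_nonneg (mul_nonneg (hf0 _) (hf0 _)) (hG0 _)) h4,
      ← ENNReal.ofReal_add (hP0 _) (mul_nonneg (hf0 _) (hf0 _)),
      ← ENNReal.ofReal_add (add_nonneg (hP0 _) (mul_nonneg (hf0 _) (hf0 _))) h3]
    refine ENNReal.ofReal_le_ofReal ?_
    rw [h2] at h1
    simp only [Prod.mk.eta] at h1
    nlinarith
  have hsum2 := ENNReal.le_of_add_le_add_right hXfin hsum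
  have hBl : ∫⁻ p in S, ENNReal.ofReal (f (v + (p.1 + p.2))) * ENNReal.ofReal (f v) ∂μ =
      ENNReal.ofReal (∫ p in S, f (v + (p.1 + p.2)) * f v ∂μ) := by
    rw [ofReal_integral_eq_lintegral_ofReal hBi
      (Eventually.of_forall fun p => mul_nonneg (hf0 _) (hf0 _))]
    exact lintegral_congr fun p => (ENNReal.ofReal_mul (hf0 _)).symm
  have hmB : Measurable fun p : Vel (n + 1) × Vel (n + 1) =>
      ENNReal.ofReal (f (v + (p.1 + p.2))) :=
    Measurable.ennreal_ofReal (Continuous.measurable (by fun_prop))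
  have hA0 : 0 ≤ ∫ p in S, f (v + p.2) * f (v + p.1) ∂μ :=
    integral_nonneg fun p => mul_nonneg (hf0 _) (hf0 _)
  have hB0' : 0 ≤ ∫ p in S, f (v + (p.1 + p.2)) * f v ∂μ :=
    integral_nonneg fun p => mul_nonneg (hf0 _) (hf0 _)
  have hCK : 0 ≤ f v * C * K := mul_nonneg (mul_nonneg (hf0 _) hC) hK0
  have hfinal : ENNReal.ofReal (∫ p in S, f (v + p.2) * f (v + p.1) ∂μ) + ENNReal.ofReal g ≤
      ENNReal.ofReal p + (ENNReal.ofReal (∫ p in S, f (v + (p.1 + p.2)) * f v ∂μ) +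
        ENNReal.ofReal (f v * C * K)) := by
    rw [ofReal_integral_eq_lintegral_ofReal hAi
      (Eventually.of_forall fun p => mul_nonneg (hf0 _) (hf0 _))]
    refine (add_le_add_right (hGi.trans (lintegral_mono_set fun x hx => hδ.2.trans hx)) _).trans
      (hsum2.trans (add_le_add ((setLIntegral_le_lintegral _ _).trans hPi) ?_))
    rw [lintegral_mul_const _ hm2, ← hBl, lintegral_mul_const _ hmB]
    refine (mul_le_mul_left (hcancel δ hδ.1) _).trans ?_
    rw [add_mul]
    refine add_le_add_right ?_ _
    calc _ ≤ ENNReal.ofReal C * ENNReal.ofReal K * ENNReal.ofReal (f v) :=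
          mul_le_mul_left (mul_le_mul_right hK _) _
      _ = _ := by
          rw [ENNReal.ofReal_mul (mul_nonneg (hf0 _) hC), ENNReal.ofReal_mul (hf0 _)]; ring
  rw [← ENNReal.ofReal_add hA0 hg0, ← ENNReal.ofReal_add hB0' hCK,
    ← ENNReal.ofReal_add hp0 (add_nonneg hB0' hCK), ENNReal.ofReal_le_ofReal_iff (by positivity)]
    at hfinal
  rw [hD]
  linarith

/-- Any bound `a` for the part `f(v'_*) (f(v') - f(v))` of the collision operator bounds the
operator, up to the Riesz potential of `f`. -/
theorem exists_collision_le {n : ℕ} (hn : 1 ≤ n) {γ s b₀ b₁ : ℝ} (hs : s ∈ Ioo (0 : ℝ) 1)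
    (hγs : 0 ≤ γ + 2 * s) (hb₀ : 0 < b₀) (hb₁ : b₀ ≤ b₁) :
    ∃ C : ℝ, 0 ≤ C ∧ ∀ bt : ℝ → ℝ, IsAngularFactor b₀ b₁ bt →
      ∃ β : ℝ → ℝ, Measurable β ∧ (∀ c, b₀ ≤ β c) ∧ (∀ c, β c ≤ b₁) ∧
      ∀ f : Vel (n + 1) → ℝ, Continuous f → (∀ x, 0 ≤ f x) → (∃ B, ∀ x, f x ≤ B) →
      ∀ (v : Vel (n + 1)) (L a K : ℝ), HasCollisionValue γ s bt f f v L →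
        ∫⁻ w, ENNReal.ofReal (f (v + w)) * ENNReal.ofReal (‖w‖ ^ (γ + 2 * s)) < ⊤ → 0 ≤ K →
        ∫⁻ z, ENNReal.ofReal (f (v + z)) * ENNReal.ofReal (‖z‖ ^ γ) ≤ ENNReal.ofReal K →
        CollisionBound n γ s β f v (fun u w => f (v + w) * (f (v + u) - f v)) a →
        L ≤ a + f v * C * K := by
  have hn' : (1 : ℝ) ≤ n := by exact_mod_cast hn
  obtain ⟨C, hC, hcan⟩ := exists_cancellation (b := b₁) hn (γ := γ) hs
    (by linarith [hs.2]) (by linarith)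
  refine ⟨C, hC, fun bt hbt => ?_⟩
  have h11 : (-1 : ℝ) ≤ 1 := by norm_num
  set β : ℝ → ℝ := IccExtend h11 ((Icc (-1) 1).domRestrict bt) with hβ
  have hβm : Measurable β :=
    (Continuous.Icc_extend' (hbt.smooth.continuousOn.domRestrict)).measurable
  have hβ0 : ∀ c, b₀ ≤ β c := fun c => hbt.lower _ (projIcc (-1 : ℝ) 1 h11 c).2
  have hβ1 : ∀ c, β c ≤ b₁ := fun c => hbt.upper _ (projIcc (-1 : ℝ) 1 h11 c).2
  have hβt : ∀ c ∈ Icc (-1 : ℝ) 1, bt c = β c := fun c hc => by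
    rw [hβ, IccExtend_of_mem h11 _ hc]; rfl
  refine ⟨β, hβm, hβ0, hβ1, fun f hf hf0 hB v L a K hL hfin hK0 hK hE => ?_⟩
  obtain ⟨B, hB⟩ := hB
  have hβ00 : ∀ c, 0 ≤ β c := fun c => hb₀.le.trans (hβ0 c)
  obtain ⟨δ₀, hδ₀, hle⟩ := truncated_collision_le hn hs hβm hβ1 (by linarith) hC hf hf0 hB hfin
    (fun δ hδ => hcan β hβm hβ00 hβ1 (fun w => ENNReal.ofReal (f (v + w)))
      (Measurable.ennreal_ofReal (Continuous.measurable (by fun_prop))) δ hδ) hK0 hK hE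
  refine le_of_tendsto hL.2 ?_
  filter_upwards [Ioo_mem_nhdsGT hδ₀] with δ hδ
  obtain ⟨h1, h2⟩ := truncated_collision_eq hn (γ := γ) (s := s) (by linarith) hβm hβ00 hβt hf v
    hδ.1 (hL.1 δ hδ.1)
  rw [h2]
  exact hle δ hδ h1

/-! ### Velocity profiles with bounded mass, energy and entropy -/

/-- A bounded continuous velocity distribution with mass between `m₀` and `M₀`, energy at most
`E₀`, and large values of small mass; the last condition is what the entropy bound provides. -/
structure IsProfile {d : ℕ} (m₀ M₀ E₀ h₀ : ℝ) (f : Vel d → ℝ) : Prop where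
  continuous : Continuous f
  nonneg : ∀ x, 0 ≤ f x
  bounded : ∃ B, ∀ x, f x ≤ B
  mass_lower : ENNReal.ofReal m₀ ≤ ∫⁻ x, ENNReal.ofReal (f x)
  mass_upper : ∫⁻ x, ENNReal.ofReal (f x) ≤ ENNReal.ofReal M₀
  energy : ∫⁻ x, ENNReal.ofReal (f x) * ENNReal.ofReal (‖x‖ ^ 2) ≤ ENNReal.ofReal E₀
  entropy : ∀ K, 1 < K → ∫⁻ x in {x | K < f x}, ENNReal.ofReal (f x) ≤
    ENNReal.ofReal (h₀ / Real.log K)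

/-- The convexity inequality `x y - e^{y-1} ≤ x log x`. -/
theorem mul_sub_exp_le_mul_log {x : ℝ} (hx : 0 ≤ x) (y : ℝ) :
    x * y - Real.exp (y - 1) ≤ x * Real.log x := by
  rcases hx.eq_or_lt with h | h
  · rw [← h]; simp [(Real.exp_pos _).le]
  · have h1 := Real.add_one_le_exp (y - 1 - Real.log x)
    have h2 : Real.exp (y - 1 - Real.log x) * x = Real.exp (y - 1) := by
      rw [Real.exp_sub, Real.exp_log h]; field_simp
    nlinarith

/-- The entropy bound has no sign: `f log f + f |v|² + e^{-|v|² - 1}` is a nonnegative function, and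
it dominates `f log K` where `f > K`. -/
theorem isProfile_of_bounds {d : ℕ} {m₀ M₀ E₀ H₀ : ℝ} {f : Vel d → ℝ} (hf : Continuous f)
    (hf0 : ∀ x, 0 ≤ f x) (hfb : ∃ B, ∀ x, f x ≤ B) (hi : Integrable f)
    (hie : Integrable fun v => f v * ‖v‖ ^ 2) (hih : Integrable fun v => f v * Real.log (f v))
    (hm : m₀ ≤ ∫ v, f v) (hM : ∫ v, f v ≤ M₀) (hE : ∫ v, f v * ‖v‖ ^ 2 ≤ E₀)
    (hH : ∫ v, f v * Real.log (f v) ≤ H₀) :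
    IsProfile m₀ M₀ E₀ (H₀ + E₀ + (∫ v : Vel d, Real.exp (-‖v‖ ^ 2 - 1))) f := by
  have hmass : ∫⁻ x, ENNReal.ofReal (f x) = ENNReal.ofReal (∫ x, f x) :=
    (ofReal_integral_eq_lintegral_ofReal hi (Eventually.of_forall hf0)).symm
  refine ⟨hf, hf0, hfb, ?_, ?_, ?_, fun K hK => ?_⟩
  · rw [hmass]; exact ENNReal.ofReal_le_ofReal hm
  · rw [hmass]; exact ENNReal.ofReal_le_ofReal hM
  · simp_rw [← ENNReal.ofReal_mul (hf0 _)]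
    rw [← ofReal_integral_eq_lintegral_ofReal hie
      (Eventually.of_forall fun x => mul_nonneg (hf0 x) (by positivity))]
    exact ENNReal.ofReal_le_ofReal hE
  · have hg : Integrable fun v : Vel d => Real.exp (-‖v‖ ^ 2 - 1) := by
      have := (GaussianFourier.integrable_cexp_neg_mul_sq_norm_add (V := Vel d) (b := 1)
        (by simp) 0 0).norm
      simp only [Complex.norm_exp] at this
      refine (this.mul_const (Real.exp (-1))).congr (Eventually.of_forall fun v => ?_)
      simp only
      rw [← Real.exp_add]
      congr 1
      simp [← Complex.ofReal_pow]
      ring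
    have hlog := Real.log_pos hK
    set h : Vel d → ℝ := fun v => f v * Real.log (f v) + f v * ‖v‖ ^ 2 + Real.exp (-‖v‖ ^ 2 - 1)
      with hh
    have hhi : Integrable h := (hih.add hie).add hg
    have hh0 : ∀ v, 0 ≤ h v := fun v => by
      have := mul_sub_exp_le_mul_log (hf0 v) (-‖v‖ ^ 2)
      simp only [hh]; linarith
    have hS : MeasurableSet {x | K < f x} := measurableSet_lt measurable_const hf.measurable
    calc _ ≤ ∫⁻ x in {x | K < f x}, ENNReal.ofReal (h x / Real.log K) := by
          refine setLIntegral_mono' hS fun x hx => ENNReal.ofReal_le_ofReal ?_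
          have hx' : K < f x := hx
          rw [le_div_iff₀ hlog]
          have h1 : Real.log K ≤ Real.log (f x) := Real.log_le_log (by linarith) hx'.le
          have h2 := mul_le_mul_of_nonneg_left h1 (hf0 x)
          have h3 : 0 ≤ f x * ‖x‖ ^ 2 := mul_nonneg (hf0 x) (by positivity)
          have h4 := Real.exp_pos (-‖x‖ ^ 2 - 1)
          simp only [hh]; linarith
      _ ≤ ∫⁻ x, ENNReal.ofReal (h x / Real.log K) := setLIntegral_le_lintegral _ _
      _ = ENNReal.ofReal (∫ x, h x / Real.log K) :=
          (ofReal_integral_eq_lintegral_ofReal (hhi.div_const _)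
            (Eventually.of_forall fun x => div_nonneg (hh0 x) hlog.le)).symm
      _ ≤ _ := by
          refine ENNReal.ofReal_le_ofReal ?_
          rw [integral_div]
          refine div_le_div_of_nonneg_right ?_ hlog.le
          have e1 : ∫ v, h v = (∫ v, (f v * Real.log (f v) + f v * ‖v‖ ^ 2)) +
              ∫ v : Vel d, Real.exp (-‖v‖ ^ 2 - 1) := integral_add (hih.add hie) hg
          have e2 : ∫ v, (f v * Real.log (f v) + f v * ‖v‖ ^ 2) =
              (∫ v, f v * Real.log (f v)) + ∫ v, f v * ‖v‖ ^ 2 := integral_add hih hie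
          rw [e1, e2]
          linarith

namespace IsProfile

variable {d : ℕ} {m₀ M₀ E₀ h₀ : ℝ} {f : Vel d → ℝ}

theorem measurable (h : IsProfile m₀ M₀ E₀ h₀ f) : Measurable fun x => ENNReal.ofReal (f x) :=
  h.continuous.measurable.ennreal_ofReal

theorem measurable_add (h : IsProfile m₀ M₀ E₀ h₀ f) (v : Vel d) :
    Measurable fun w => ENNReal.ofReal (f (v + w)) :=
  h.measurable.comp (measurable_const_add v)

/-- Mass at distance at least `r` from the origin. -/
theorem lintegral_far_le (h : IsProfile m₀ M₀ E₀ h₀ f) {r : ℝ} (hr : 0 < r) :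
    ∫⁻ x in {x | r ≤ ‖x‖}, ENNReal.ofReal (f x) ≤ ENNReal.ofReal (E₀ / r ^ 2) := by
  have hS : MeasurableSet {x : Vel d | r ≤ ‖x‖} := measurableSet_le measurable_const measurable_norm
  have hm : Measurable fun x => ENNReal.ofReal (f x) * ENNReal.ofReal (‖x‖ ^ 2) :=
    h.measurable.mul (by fun_prop)
  calc _ ≤ ∫⁻ x in {x | r ≤ ‖x‖}, ENNReal.ofReal (1 / r ^ 2) *
        (ENNReal.ofReal (f x) * ENNReal.ofReal (‖x‖ ^ 2)) := by
        refine setLIntegral_mono' hS fun x hx => ?_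
        have hx' : r ≤ ‖x‖ := hx
        rw [← ENNReal.ofReal_mul (h.nonneg _), ← ENNReal.ofReal_mul (by positivity)]
        refine ENNReal.ofReal_le_ofReal ?_
        rw [one_div, inv_mul_eq_div, le_div_iff₀ (by positivity)]
        exact mul_le_mul_of_nonneg_left (pow_le_pow_left₀ hr.le hx' 2) (h.nonneg _)
    _ ≤ ∫⁻ x, ENNReal.ofReal (1 / r ^ 2) *
        (ENNReal.ofReal (f x) * ENNReal.ofReal (‖x‖ ^ 2)) := setLIntegral_le_lintegral _ _
    _ ≤ ENNReal.ofReal (1 / r ^ 2) * ENNReal.ofReal E₀ := by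
        rw [lintegral_const_mul _ hm]; exact mul_le_mul_right h.energy _
    _ = _ := by rw [← ENNReal.ofReal_mul (by positivity)]; congr 1; ring

theorem lintegral_rpow_lt_top (h : IsProfile m₀ M₀ E₀ h₀ f) {a : ℝ} (ha0 : 0 ≤ a) (ha : a ≤ 2)
    (v : Vel d) :
    ∫⁻ w, ENNReal.ofReal (f (v + w)) * ENNReal.ofReal (‖w‖ ^ a) < ⊤ := by
  have hm : Measurable fun x => ENNReal.ofReal (f x) * ENNReal.ofReal (‖x‖ ^ 2) :=
    h.measurable.mul (by fun_prop)
  have hm1 : Measurable fun w => ENNReal.ofReal (1 + 2 * ‖v‖ ^ 2) * ENNReal.ofReal (f (v + w)) :=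
    (h.measurable_add v).const_mul _
  have hm2 : Measurable fun w => ENNReal.ofReal (f (v + w)) * ENNReal.ofReal (‖v + w‖ ^ 2) :=
    hm.comp (measurable_const_add v)
  calc _ ≤ ∫⁻ w, (ENNReal.ofReal (1 + 2 * ‖v‖ ^ 2) * ENNReal.ofReal (f (v + w)) +
        ENNReal.ofReal 2 * (ENNReal.ofReal (f (v + w)) * ENNReal.ofReal (‖v + w‖ ^ 2))) := by
        refine lintegral_mono fun w => ?_
        simp only
        have h0 := h.nonneg (v + w)
        rw [← ENNReal.ofReal_mul h0, ← ENNReal.ofReal_mul h0, ← ENNReal.ofReal_mul (by positivity),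
          ← ENNReal.ofReal_mul (by positivity), ← ENNReal.ofReal_add (by positivity)
          (by positivity)]
        refine ENNReal.ofReal_le_ofReal ?_
        have h1 : ‖w‖ ^ a ≤ 1 + ‖w‖ ^ 2 := by
          rcases le_total ‖w‖ 1 with hw | hw
          · have := Real.rpow_le_one (norm_nonneg w) hw ha0
            nlinarith [sq_nonneg ‖w‖]
          · have := Real.rpow_le_rpow_of_exponent_le hw ha
            rw [Real.rpow_two] at this
            linarith
        have h2 : ‖w‖ ^ 2 ≤ 2 * ‖v‖ ^ 2 + 2 * ‖v + w‖ ^ 2 := by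
          have : ‖w‖ ≤ ‖v + w‖ + ‖v‖ := by
            have := norm_sub_le (v + w) v
            rwa [add_sub_cancel_left] at this
          nlinarith [norm_nonneg w, norm_nonneg v, norm_nonneg (v + w), sq_nonneg (‖v‖ - ‖v + w‖)]
        have h3 : f (v + w) * ‖w‖ ^ a ≤ f (v + w) * (1 + 2 * ‖v‖ ^ 2 + 2 * ‖v + w‖ ^ 2) :=
          mul_le_mul_of_nonneg_left (by linarith) h0
        linarith
    _ < ⊤ := by
        rw [lintegral_add_left hm1, lintegral_const_mul _ (h.measurable_add v),
          lintegral_const_mul _ hm2,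
          lintegral_add_left_eq_self (fun x => ENNReal.ofReal (f x)) v,
          lintegral_add_left_eq_self (fun x => ENNReal.ofReal (f x) * ENNReal.ofReal (‖x‖ ^ 2)) v]
        exact ENNReal.add_lt_top.2 ⟨ENNReal.mul_lt_top ENNReal.ofReal_lt_top
          (h.mass_upper.trans_lt ENNReal.ofReal_lt_top), ENNReal.mul_lt_top ENNReal.ofReal_lt_top
          (h.energy.trans_lt ENNReal.ofReal_lt_top)⟩

/-- Interpolation of the energy against `|v - v_*|^a`, `a ∈ [0,2]`. -/
theorem lintegral_min_le (h : IsProfile m₀ M₀ E₀ h₀ f) {a : ℝ} (ha0 : 0 ≤ a) (ha : a ≤ 2)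
    {v : Vel d} (hv : 0 < ‖v‖) :
    ∫⁻ w, ENNReal.ofReal (f (v + w) * min 1 (‖v + w‖ ^ 2 / ‖v‖ ^ 2)) * ENNReal.ofReal (‖w‖ ^ a) ≤
      ENNReal.ofReal (4 * E₀ * ‖v‖ ^ (a - 2)) := by
  have hm : Measurable fun x => ENNReal.ofReal (f x) * ENNReal.ofReal (‖x‖ ^ 2) :=
    h.measurable.mul (by fun_prop)
  have hm2 : Measurable fun w => ENNReal.ofReal (f (v + w)) * ENNReal.ofReal (‖v + w‖ ^ 2) :=
    hm.comp (measurable_const_add v)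
  calc _ ≤ ∫⁻ w, ENNReal.ofReal (4 * ‖v‖ ^ (a - 2)) *
        (ENNReal.ofReal (f (v + w)) * ENNReal.ofReal (‖v + w‖ ^ 2)) := by
        refine lintegral_mono fun w => ?_
        have h0 := h.nonneg (v + w)
        have hmin : 0 ≤ min 1 (‖v + w‖ ^ 2 / ‖v‖ ^ 2) := le_min zero_le_one (by positivity)
        simp only
        rw [← ENNReal.ofReal_mul h0, ← ENNReal.ofReal_mul (mul_nonneg h0 hmin),
          ← ENNReal.ofReal_mul (by positivity)]
        refine ENNReal.ofReal_le_ofReal ?_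
        rw [mul_assoc, mul_left_comm (4 * ‖v‖ ^ (a - 2))]
        refine mul_le_mul_of_nonneg_left ?_ h0
        have hw : ‖w‖ ≤ ‖v + w‖ + ‖v‖ := by
          have := norm_sub_le (v + w) v
          rwa [add_sub_cancel_left] at this
        have e : ‖v‖ ^ (a - 2) = ‖v‖ ^ a / ‖v‖ ^ 2 := by
          rw [Real.rpow_sub hv, Real.rpow_two]
        have h2a : (2 : ℝ) ^ a ≤ 4 := by
          have := Real.rpow_le_rpow_of_exponent_le (one_le_two) ha
          rw [Real.rpow_two] at this; linarith
        rcases le_total ‖v + w‖ ‖v‖ with hc | hc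
        · have h3 : ‖w‖ ^ a ≤ 4 * ‖v‖ ^ a := by
            calc ‖w‖ ^ a ≤ (2 * ‖v‖) ^ a :=
                  Real.rpow_le_rpow (norm_nonneg _) (by linarith) ha0
              _ = 2 ^ a * ‖v‖ ^ a := Real.mul_rpow (by norm_num) hv.le
              _ ≤ _ := by gcongr
          calc _ ≤ ‖v + w‖ ^ 2 / ‖v‖ ^ 2 * (4 * ‖v‖ ^ a) := by
                gcongr
                exact min_le_right _ _
            _ = _ := by rw [e]; ring
        · have hvw : 0 < ‖v + w‖ := hv.trans_le hc
          have h3 : ‖w‖ ^ a ≤ 4 * ‖v + w‖ ^ a := by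
            calc ‖w‖ ^ a ≤ (2 * ‖v + w‖) ^ a :=
                  Real.rpow_le_rpow (norm_nonneg _) (by linarith) ha0
              _ = 2 ^ a * ‖v + w‖ ^ a := Real.mul_rpow (by norm_num) hvw.le
              _ ≤ _ := by gcongr
          have h4 : ‖v + w‖ ^ (a - 2) ≤ ‖v‖ ^ (a - 2) :=
            Real.rpow_le_rpow_of_nonpos hv hc (by linarith)
          have h5 : ‖v + w‖ ^ a = ‖v + w‖ ^ (a - 2) * ‖v + w‖ ^ 2 := by
            rw [← Real.rpow_two, ← Real.rpow_add hvw]; congr 1; ring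
          calc _ ≤ 1 * (4 * ‖v + w‖ ^ a) := by
                gcongr
                exact min_le_left _ _
            _ = 4 * ‖v + w‖ ^ (a - 2) * ‖v + w‖ ^ 2 := by rw [h5]; ring
            _ ≤ _ := by gcongr
    _ ≤ ENNReal.ofReal (4 * ‖v‖ ^ (a - 2)) * ENNReal.ofReal E₀ := by
        rw [lintegral_const_mul _ hm2,
          lintegral_add_left_eq_self (fun x => ENNReal.ofReal (f x) * ENNReal.ofReal (‖x‖ ^ 2)) v]
        exact mul_le_mul_right h.energy _
    _ = _ := by rw [← ENNReal.ofReal_mul (by positivity)]; congr 1; ring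

end IsProfile

/-- Half of the mass of a profile is carried by a bounded set on which the profile is bounded; this
core cannot concentrate near any `v`, whence a lower bound for its moments centred at `v`. -/
theorem exists_core {d : ℕ} (hd : d ≠ 0) {m₀ E₀ h₀ a : ℝ} (hm₀ : 0 < m₀) (hE₀ : 0 ≤ E₀)
    (hh₀ : 0 ≤ h₀) (ha : 0 ≤ a) :
    ∃ R L₀ c : ℝ, 1 ≤ R ∧ 1 ≤ L₀ ∧ 0 < c ∧ ∀ (M₀ : ℝ) (f : Vel d → ℝ), IsProfile m₀ M₀ E₀ h₀ f →
      ∀ v : Vel d, ENNReal.ofReal (c * max 1 ‖v‖ ^ a) ≤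
        ∫⁻ w, ENNReal.ofReal (({x | ‖x‖ ≤ R ∧ f x ≤ L₀} : Set (Vel d)).indicator f (v + w)) *
          ENNReal.ofReal (‖w‖ ^ a) := by
  set R : ℝ := 1 + 4 * E₀ / m₀ with hR
  have hR1 : 1 ≤ R := by rw [hR]; have : 0 ≤ 4 * E₀ / m₀ := by positivity
                         linarith
  set L₀ : ℝ := Real.exp (1 + 4 * h₀ / m₀) with hL
  have hL1 : 1 < L₀ := by rw [hL]; exact Real.one_lt_exp_iff.2 (by positivity)
  set vol : ℝ := (volume (Metric.ball (0 : Vel d) 1)).toReal with hvol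
  have hvol_nn : 0 ≤ vol := ENNReal.toReal_nonneg
  set D : ℝ := 4 * (L₀ * ((2 * R) ^ d * vol)) + 1 with hD
  have hD0 : 0 < D := by positivity
  set c₀ : ℝ := min (1 / 2) (m₀ / D) with hc₀
  have hc₀0 : 0 < c₀ := lt_min (by norm_num) (by positivity)
  have hc₀1 : c₀ ≤ 1 / 2 := min_le_left _ _
  have hc₀2 : c₀ * D ≤ m₀ := by rw [← le_div_iff₀ hD0]; exact min_le_right _ _
  refine ⟨R, L₀, m₀ / 4 * c₀ ^ a, hR1, hL1.le, by positivity, fun M₀ f h v => ?_⟩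
  set A : Set (Vel d) := {x | ‖x‖ ≤ R ∧ f x ≤ L₀} with hA
  have hAm : MeasurableSet A := (measurableSet_le measurable_norm measurable_const).inter
    (measurableSet_le h.continuous.measurable measurable_const)
  set V := max 1 ‖v‖ with hV
  have hV1 : 1 ≤ V := le_max_left _ _
  -- the energy and the entropy each bound a quarter of the mass outside of the core
  have hmA : ENNReal.ofReal (m₀ / 2) ≤ ∫⁻ x in A, ENNReal.ofReal (f x) := by
    have h1 : ∫⁻ x, ENNReal.ofReal (f x) ≤ (∫⁻ x in A, ENNReal.ofReal (f x)) +
        ((∫⁻ x in {x | R ≤ ‖x‖}, ENNReal.ofReal (f x)) +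
          ∫⁻ x in {x | L₀ < f x}, ENNReal.ofReal (f x)) := by
      rw [← setLIntegral_univ]
      refine (lintegral_mono_set (t := A ∪ ({x | R ≤ ‖x‖} ∪ {x | L₀ < f x})) fun x _ => ?_).trans
        ((lintegral_union_le _ _ _).trans (add_le_add_right (lintegral_union_le _ _ _) _))
      by_cases h1 : ‖x‖ ≤ R
      · by_cases h2 : f x ≤ L₀
        · exact Or.inl ⟨h1, h2⟩
        · exact Or.inr (Or.inr (not_le.1 h2))
      · exact Or.inr (Or.inl (not_le.1 h1).le)
    have h2 := h.lintegral_far_le (r := R) (by linarith)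
    have h3 := h.entropy L₀ hL1
    have h4 : E₀ / R ^ 2 ≤ m₀ / 4 := by
      rw [div_le_iff₀ (by positivity)]
      have : m₀ / 4 * R = m₀ / 4 + E₀ := by rw [hR]; field_simp
      nlinarith
    have h5 : h₀ / Real.log L₀ ≤ m₀ / 4 := by
      rw [hL, Real.log_exp, div_le_iff₀ (by positivity)]
      have : m₀ / 4 * (1 + 4 * h₀ / m₀) = m₀ / 4 + h₀ := by field_simp
      linarith
    have h6 : ENNReal.ofReal (m₀ / 2) + ENNReal.ofReal (m₀ / 2) ≤
        (∫⁻ x in A, ENNReal.ofReal (f x)) + ENNReal.ofReal (m₀ / 2) := by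
      rw [← ENNReal.ofReal_add (by positivity) (by positivity), add_halves]
      refine (h.mass_lower.trans h1).trans (add_le_add_right ?_ _)
      refine (add_le_add (h2.trans (ENNReal.ofReal_le_ofReal h4))
        (h3.trans (ENNReal.ofReal_le_ofReal h5))).trans (le_of_eq ?_)
      rw [← ENNReal.ofReal_add (by positivity) (by positivity)]; congr 1; ring
    exact ENNReal.le_of_add_le_add_right ENNReal.ofReal_ne_top h6
  -- for large `v` the core does not meet the ball; otherwise the bound `f ≤ L₀` is used
  have hnear : ∫⁻ x in A ∩ Metric.ball v (c₀ * V), ENNReal.ofReal (f x) ≤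
      ENNReal.ofReal (m₀ / 4) := by
    rcases le_or_gt (2 * R) ‖v‖ with hv | hv
    · have : A ∩ Metric.ball v (c₀ * V) = ∅ := by
        rw [eq_empty_iff_forall_notMem]
        rintro x ⟨hx1, hx2⟩
        have hx2' := Metric.mem_ball.1 hx2
        rw [hV, max_eq_right (by linarith), dist_eq_norm] at hx2'
        have h1 := norm_sub_norm_le v x
        rw [norm_sub_rev] at h1
        have h2 := hx1.1
        nlinarith [norm_nonneg v]
      rw [this]; simp
    · have hVR : V ≤ 2 * R := max_le (by linarith) hv.le
      calc _ ≤ ∫⁻ x in A ∩ Metric.ball v (c₀ * V), ENNReal.ofReal L₀ :=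
            setLIntegral_mono' (hAm.inter Metric.isOpen_ball.measurableSet) fun x hx =>
              ENNReal.ofReal_le_ofReal hx.1.2
        _ = ENNReal.ofReal L₀ * volume (A ∩ Metric.ball v (c₀ * V)) := setLIntegral_const _ _
        _ ≤ ENNReal.ofReal L₀ * (ENNReal.ofReal ((c₀ * V) ^ d) * ENNReal.ofReal vol) := by
            refine mul_le_mul_right ((measure_mono inter_subset_right).trans (le_of_eq ?_)) _
            rw [Measure.addHaar_ball_of_pos _ _ (by positivity), finrank_euclideanSpace, Fintype.card_fin,
              hvol, ENNReal.ofReal_toReal measure_ball_lt_top.ne]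
        _ ≤ _ := by
            rw [← ENNReal.ofReal_mul (by positivity), ← ENNReal.ofReal_mul (by positivity)]
            refine ENNReal.ofReal_le_ofReal ?_
            have h1 : (c₀ * V) ^ d ≤ c₀ * (2 * R) ^ d := by
              rw [mul_pow]
              have : c₀ ^ d ≤ c₀ := pow_le_of_le_one hc₀0.le (by linarith) hd
              gcongr
            have h2 : L₀ * ((c₀ * V) ^ d * vol) ≤ L₀ * (c₀ * (2 * R) ^ d * vol) := by gcongr
            rw [hD] at hc₀2
            nlinarith
  have hfar : ENNReal.ofReal (m₀ / 4) ≤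
      ∫⁻ x in A \ Metric.ball v (c₀ * V), ENNReal.ofReal (f x) := by
    have h1 := lintegral_inter_add_sdiff (μ := volume) (fun x => ENNReal.ofReal (f x)) A
      (Metric.isOpen_ball (x := v) (ε := c₀ * V)).measurableSet
    have h2 : ENNReal.ofReal (m₀ / 4) + ENNReal.ofReal (m₀ / 4) ≤ ENNReal.ofReal (m₀ / 4) +
        ∫⁻ x in A \ Metric.ball v (c₀ * V), ENNReal.ofReal (f x) := by
      rw [← ENNReal.ofReal_add (by positivity) (by positivity),
        show m₀ / 4 + m₀ / 4 = m₀ / 2 by ring]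
      refine hmA.trans ?_
      rw [← h1]
      exact add_le_add_left hnear _
    exact ENNReal.le_of_add_le_add_left ENNReal.ofReal_ne_top h2
  have htrans := lintegral_add_left_eq_self (μ := (volume : Measure (Vel d)))
    (fun x => ENNReal.ofReal (A.indicator f x) * ENNReal.ofReal (‖x - v‖ ^ a)) v
  simp only [add_sub_cancel_left] at htrans
  rw [htrans]
  calc _ = ENNReal.ofReal ((c₀ * V) ^ a) * ENNReal.ofReal (m₀ / 4) := by
        rw [← ENNReal.ofReal_mul (by positivity), Real.mul_rpow hc₀0.le (by linarith)]
        congr 1; ring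
    _ ≤ ENNReal.ofReal ((c₀ * V) ^ a) *
        ∫⁻ x in A \ Metric.ball v (c₀ * V), ENNReal.ofReal (f x) := mul_le_mul_right hfar _
    _ = ∫⁻ x in A \ Metric.ball v (c₀ * V), ENNReal.ofReal ((c₀ * V) ^ a) *
        ENNReal.ofReal (f x) := (lintegral_const_mul _ h.measurable).symm
    _ ≤ ∫⁻ x in A \ Metric.ball v (c₀ * V), ENNReal.ofReal (A.indicator f x) *
        ENNReal.ofReal (‖x - v‖ ^ a) := by
        refine setLIntegral_mono' (hAm.diff Metric.isOpen_ball.measurableSet) fun x hx => ?_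
        rw [indicator_of_mem hx.1, mul_comm]
        refine mul_le_mul_right (ENNReal.ofReal_le_ofReal
          (Real.rpow_le_rpow (by positivity) ?_ ha)) _
        have := hx.2
        rw [Metric.mem_ball, not_lt, dist_eq_norm] at this
        exact this
    _ ≤ _ := setLIntegral_le_lintegral _ _

/-! ### Riesz potentials of a profile -/

theorem exists_lintegral_ball_rpow_le {n : ℕ} {γ : ℝ} (hγ : 0 < n + 1 + γ) :
    ∃ C : ℝ, 0 ≤ C ∧ ∀ ρ : ℝ, 0 < ρ →
      ∫⁻ z in {z : Vel (n + 1) | ‖z‖ < ρ}, ENNReal.ofReal (‖z‖ ^ γ) ≤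
        ENNReal.ofReal (C * ρ ^ (n + 1 + γ)) := by
  refine ⟨(surfaceMeasure (n + 1) univ).toReal / (n + 1 + γ), by positivity, fun ρ hρ => ?_⟩
  have hS : MeasurableSet {z : Vel (n + 1) | ‖z‖ < ρ} :=
    measurableSet_lt measurable_norm measurable_const
  have hΦ : Measurable ((Iio ρ).indicator fun τ : ℝ => ENNReal.ofReal (τ ^ γ)) :=
    Measurable.indicator (by fun_prop) measurableSet_Iio
  rw [← lintegral_indicator hS]
  have e1 : ∀ z : Vel (n + 1), {z : Vel (n + 1) | ‖z‖ < ρ}.indicator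
      (fun z => ENNReal.ofReal (‖z‖ ^ γ)) z =
      (Iio ρ).indicator (fun τ : ℝ => ENNReal.ofReal (τ ^ γ)) ‖z‖ := fun z => rfl
  simp_rw [e1]
  rw [lintegral_norm_eq (by omega) hΦ]
  have e2 : ∀ τ ∈ Ioi (0 : ℝ), ENNReal.ofReal (τ ^ (n + 1 - 1)) *
      (Iio ρ).indicator (fun τ : ℝ => ENNReal.ofReal (τ ^ γ)) τ =
      (Iio ρ).indicator (fun τ => ENNReal.ofReal (τ ^ (n + γ))) τ := by
    intro τ hτ
    have hτ' : (0 : ℝ) < τ := hτ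
    by_cases h : τ < ρ
    · rw [indicator_of_mem (by exact h), indicator_of_mem (by exact h),
        ← ENNReal.ofReal_mul (by positivity), Nat.add_sub_cancel, ← Real.rpow_natCast,
        ← Real.rpow_add hτ']
    · rw [indicator_of_notMem (by exact h), indicator_of_notMem (by exact h), mul_zero]
  rw [setLIntegral_congr_fun measurableSet_Ioi e2, lintegral_indicator measurableSet_Iio,
    Measure.restrict_restrict measurableSet_Iio, Iio_inter_Ioi]
  have hi : IntervalIntegrable (fun τ : ℝ => τ ^ (n + γ)) volume 0 ρ :=
    intervalIntegral.intervalIntegrable_rpow' (by linarith)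
  rw [Measure.restrict_congr_set Ioo_ae_eq_Ioc, ← ofReal_integral_eq_lintegral_ofReal hi.1,
    ← intervalIntegral.integral_of_le hρ.le, integral_rpow (Or.inl (by linarith)),
    ← ENNReal.ofReal_toReal (measure_ne_top (surfaceMeasure (n + 1)) univ),
    ← ENNReal.ofReal_mul ENNReal.toReal_nonneg]
  · refine ENNReal.ofReal_le_ofReal (le_of_eq ?_)
    rw [Real.zero_rpow (by linarith), sub_zero, show (n : ℝ) + γ + 1 = n + 1 + γ by ring]
    rw [ENNReal.ofReal_toReal (measure_ne_top _ _)]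
    ring
  · filter_upwards [ae_restrict_mem measurableSet_Ioc] with τ hτ
    exact Real.rpow_nonneg hτ.1.le _

namespace IsProfile

variable {m₀ M₀ E₀ h₀ : ℝ}

theorem lintegral_near_le {d : ℕ} {f : Vel d → ℝ} (h : IsProfile m₀ M₀ E₀ h₀ f)
    (hM : 0 ≤ M₀) (hE : 0 ≤ E₀) (v : Vel d) :
    ∫⁻ x in {x | ‖x - v‖ < max 1 ‖v‖ / 2}, ENNReal.ofReal (f x) ≤
      ENNReal.ofReal ((M₀ + 4 * E₀) * max 1 ‖v‖ ^ (-2 : ℝ)) := by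
  rcases le_or_gt 1 ‖v‖ with hv | hv
  · rw [max_eq_right hv]
    have hv0 : 0 < ‖v‖ := by linarith
    calc _ ≤ ∫⁻ x in {x | ‖v‖ / 2 ≤ ‖x‖}, ENNReal.ofReal (f x) := by
          refine lintegral_mono_set fun x hx => ?_
          have hx' : ‖x - v‖ < ‖v‖ / 2 := hx
          have := norm_sub_norm_le v x
          rw [norm_sub_rev] at this
          change ‖v‖ / 2 ≤ ‖x‖
          linarith
      _ ≤ ENNReal.ofReal (E₀ / (‖v‖ / 2) ^ 2) := h.lintegral_far_le (by positivity)
      _ ≤ _ := by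
          refine ENNReal.ofReal_le_ofReal ?_
          have e : E₀ / (‖v‖ / 2) ^ 2 = 4 * E₀ * ‖v‖ ^ (-2 : ℝ) := by
            rw [Real.rpow_neg hv0.le, Real.rpow_two]; field_simp; norm_num
          rw [e]
          gcongr
          linarith
  · rw [max_eq_left hv.le, Real.one_rpow, mul_one]
    exact (setLIntegral_le_lintegral _ _).trans (h.mass_upper.trans
      (ENNReal.ofReal_le_ofReal (by linarith)))

/-- Bound for the Riesz potential of negative order, with a splitting radius `ρ` and a splitting
height `K`: `f ≤ G` near `v`, and `η` bounds the mass of the part of `f` near `v` that exceeds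
`K`. -/
theorem exists_riesz_le {n : ℕ} {γ : ℝ} (hγ : 0 < n + 1 + γ) (hγ0 : γ ≤ 0) (hM : 0 ≤ M₀) :
    ∃ C : ℝ, 1 ≤ C ∧ ∀ f : Vel (n + 1) → ℝ, IsProfile m₀ M₀ E₀ h₀ f →
      ∀ (v : Vel (n + 1)) (G ρ K η : ℝ), 0 ≤ G → 0 < ρ → 0 ≤ K → 0 ≤ η →
      (∀ x, ‖x - v‖ < max 1 ‖v‖ / 2 → f x ≤ G) →
      ∫⁻ x in {x | ‖x - v‖ < max 1 ‖v‖ / 2 ∧ K < f x}, ENNReal.ofReal (f x) ≤ ENNReal.ofReal η →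
      ∫⁻ z, ENNReal.ofReal (f (v + z)) * ENNReal.ofReal (‖z‖ ^ γ) ≤
        ENNReal.ofReal (C * (G * ρ ^ (n + 1 + γ) + ρ ^ γ * η + K * max 1 ‖v‖ ^ (n + 1 + γ) +
          max 1 ‖v‖ ^ γ)) := by
  obtain ⟨C, hC, hball⟩ := exists_lintegral_ball_rpow_le (n := n) hγ
  refine ⟨C + 1 + M₀ * 2 ^ (-γ), by have : 0 ≤ M₀ * 2 ^ (-γ) := by positivity
                                    linarith,
    fun f h v G ρ K η hG hρ hK hη hfG hmass => ?_⟩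
  set V := max 1 ‖v‖ with hV
  have hV1 : 1 ≤ V := le_max_left _ _
  have hV0 : 0 < V := by linarith
  have htrans := lintegral_add_left_eq_self (μ := (volume : Measure (Vel (n + 1))))
    (fun x => ENNReal.ofReal (f x) * ENNReal.ofReal (‖x - v‖ ^ γ)) v
  simp only [add_sub_cancel_left] at htrans
  rw [htrans]
  let B : ℝ → Set (Vel (n + 1)) := fun r => {x | ‖x - v‖ < r}
  let T : Set (Vel (n + 1)) := {x | ‖x - v‖ < V / 2 ∧ K < f x}
  have hB : ∀ r, MeasurableSet (B r) := fun r =>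
    measurableSet_lt (by fun_prop) measurable_const
  have hT : MeasurableSet T := (hB _).inter
    (measurableSet_lt measurable_const h.continuous.measurable)
  have hrm : Measurable fun x : Vel (n + 1) => ENNReal.ofReal (‖x - v‖ ^ γ) := by fun_prop
  have hballB : ∀ r, 0 < r → ∫⁻ x in B r, ENNReal.ofReal (‖x - v‖ ^ γ) ≤
      ENNReal.ofReal (C * r ^ (n + 1 + γ)) := by
    intro r hr
    refine le_trans (le_of_eq ?_) (hball r hr)
    rw [← lintegral_indicator (hB r), ← lintegral_indicator
      (measurableSet_lt measurable_norm measurable_const)]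
    have := lintegral_add_left_eq_self (μ := (volume : Measure (Vel (n + 1))))
      (fun x => (B r).indicator (fun x => ENNReal.ofReal (‖x - v‖ ^ γ)) x) v
    rw [← this]
    refine lintegral_congr fun z => ?_
    simp only [B, indicator, Set.mem_ofPred_eq, add_sub_cancel_left]
  -- four regions: near `v` with `|x - v| < ρ`, then `f > K`, then `f ≤ K`; and far from `v`
  have hpt : ∀ x, ENNReal.ofReal (f x) * ENNReal.ofReal (‖x - v‖ ^ γ) ≤
      (B ρ).indicator (fun x => ENNReal.ofReal G * ENNReal.ofReal (‖x - v‖ ^ γ)) x +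
      (T.indicator (fun x => ENNReal.ofReal (ρ ^ γ) * ENNReal.ofReal (f x)) x +
      ((B V).indicator (fun x => ENNReal.ofReal K * ENNReal.ofReal (‖x - v‖ ^ γ)) x +
      ENNReal.ofReal ((V / 2) ^ γ) * ENNReal.ofReal (f x))) := by
    intro x
    by_cases h1 : ‖x - v‖ < V / 2
    · by_cases h2 : ‖x - v‖ < ρ
      · rw [indicator_of_mem (show x ∈ B ρ from h2)]
        refine le_trans ?_ le_self_add
        exact mul_le_mul_left (ENNReal.ofReal_le_ofReal (hfG x h1)) _
      · by_cases h3 : K < f x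
        · rw [indicator_of_mem (show x ∈ T from ⟨h1, h3⟩)]
          refine le_trans (le_trans ?_ le_self_add) le_add_self
          rw [mul_comm]
          exact mul_le_mul_left (ENNReal.ofReal_le_ofReal
            (Real.rpow_le_rpow_of_nonpos hρ (not_lt.1 h2) hγ0)) _
        · rw [indicator_of_mem (show x ∈ B V from lt_trans h1 (by linarith))]
          refine le_trans (le_trans (le_trans ?_ le_self_add) le_add_self) le_add_self
          exact mul_le_mul_left (ENNReal.ofReal_le_ofReal (not_lt.1 h3)) _
    · refine le_trans (le_trans (le_trans ?_ le_add_self) le_add_self) le_add_self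
      rw [mul_comm]
      exact mul_le_mul_left (ENNReal.ofReal_le_ofReal
            (Real.rpow_le_rpow_of_nonpos (by positivity) (not_lt.1 h1) hγ0)) _
  refine (lintegral_mono hpt).trans ?_
  have m1 : Measurable ((B ρ).indicator fun x => ENNReal.ofReal G * ENNReal.ofReal (‖x - v‖ ^ γ)) :=
    (hrm.const_mul _).indicator (hB _)
  have m2 : Measurable (T.indicator fun x => ENNReal.ofReal (ρ ^ γ) * ENNReal.ofReal (f x)) :=
    (h.measurable.const_mul _).indicator hT
  have m3 : Measurable ((B V).indicator fun x => ENNReal.ofReal K * ENNReal.ofReal (‖x - v‖ ^ γ)) :=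
    (hrm.const_mul _).indicator (hB _)
  rw [lintegral_add_left m1, lintegral_add_left m2, lintegral_add_left m3,
    lintegral_indicator (hB _), lintegral_indicator hT, lintegral_indicator (hB _),
    lintegral_const_mul _ hrm, lintegral_const_mul _ h.measurable, lintegral_const_mul _ hrm,
    lintegral_const_mul _ h.measurable]
  calc _ ≤ ENNReal.ofReal G * ENNReal.ofReal (C * ρ ^ (n + 1 + γ)) +
        (ENNReal.ofReal (ρ ^ γ) * ENNReal.ofReal η +
        (ENNReal.ofReal K * ENNReal.ofReal (C * V ^ (n + 1 + γ)) +
        ENNReal.ofReal ((V / 2) ^ γ) * ENNReal.ofReal M₀)) :=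
        add_le_add (mul_le_mul_right (hballB ρ hρ) _) (add_le_add (mul_le_mul_right hmass _)
          (add_le_add (mul_le_mul_right (hballB V hV0) _) (mul_le_mul_right h.mass_upper _)))
    _ ≤ _ := by
        have e : (V / 2) ^ γ = V ^ γ * 2 ^ (-γ) := by
          rw [Real.div_rpow hV0.le (by norm_num), Real.rpow_neg (by norm_num), div_eq_mul_inv]
        have p1 : 0 ≤ ρ ^ (n + 1 + γ) := by positivity
        have p2 : 0 ≤ V ^ (n + 1 + γ) := by positivity
        have p3 : 0 ≤ ρ ^ γ * η := by positivity
        have p4 : 0 ≤ V ^ γ := by positivity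
        have p5 : 0 ≤ M₀ * 2 ^ (-γ) := by positivity
        rw [← ENNReal.ofReal_mul hG, ← ENNReal.ofReal_mul (by positivity),
          ← ENNReal.ofReal_mul hK, ← ENNReal.ofReal_mul (by positivity),
          ← ENNReal.ofReal_add (by positivity) (by positivity),
          ← ENNReal.ofReal_add (by positivity) (by positivity),
          ← ENNReal.ofReal_add (by positivity) (by positivity)]
        refine ENNReal.ofReal_le_ofReal ?_
        rw [e]
        have q1 := mul_nonneg hG p1
        have q2 := mul_nonneg hK p2
        have q3 := mul_nonneg p5 q1
        have q4 := mul_nonneg p5 q2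
        have q5 := mul_nonneg p5 p3
        have q6 := mul_nonneg hC p3
        have q7 := mul_nonneg hC p4
        nlinarith

theorem riesz_le_of_nonneg {d : ℕ} {γ : ℝ} (hγ0 : 0 ≤ γ) (hγ2 : γ ≤ 2) (hM : 0 ≤ M₀)
    (hE : 0 ≤ E₀) {f : Vel d → ℝ} (h : IsProfile m₀ M₀ E₀ h₀ f) (v : Vel d) :
    ∫⁻ z, ENNReal.ofReal (f (v + z)) * ENNReal.ofReal (‖z‖ ^ γ) ≤
      ENNReal.ofReal (4 * (M₀ + E₀) * max 1 ‖v‖ ^ γ) := by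
  set V := max 1 ‖v‖ with hV
  have hV1 : 1 ≤ V := le_max_left _ _
  have hV0 : 0 < V := by linarith
  have hm : Measurable fun x => ENNReal.ofReal (f x) * ENNReal.ofReal (‖x‖ ^ 2) :=
    h.measurable.mul (by fun_prop)
  have hm2 : Measurable fun w => ENNReal.ofReal (f (v + w)) * ENNReal.ofReal (‖v + w‖ ^ 2) :=
    hm.comp (measurable_const_add v)
  have h4 : (2 : ℝ) ^ γ ≤ 4 := by
    have := Real.rpow_le_rpow_of_exponent_le (one_le_two) hγ2
    rw [Real.rpow_two] at this; linarith
  have hpt : ∀ z, ENNReal.ofReal (f (v + z)) * ENNReal.ofReal (‖z‖ ^ γ) ≤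
      ENNReal.ofReal (4 * V ^ γ) * (ENNReal.ofReal (f (v + z)) +
        ENNReal.ofReal (f (v + z)) * ENNReal.ofReal (‖v + z‖ ^ 2)) := by
    intro z
    have h0 := h.nonneg (v + z)
    rw [← ENNReal.ofReal_mul h0, ← ENNReal.ofReal_mul h0, ← ENNReal.ofReal_add h0 (by positivity),
      ← ENNReal.ofReal_mul (by positivity)]
    refine ENNReal.ofReal_le_ofReal ?_
    have hz : ‖z‖ ≤ ‖v + z‖ + ‖v‖ := by
      have := norm_sub_le (v + z) v
      rwa [add_sub_cancel_left] at this
    have hvV : ‖v‖ ≤ V := le_max_right _ _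
    have key : ‖z‖ ^ γ ≤ 4 * V ^ γ * (1 + ‖v + z‖ ^ 2) := by
      rcases le_total ‖v + z‖ V with hc | hc
      · calc ‖z‖ ^ γ ≤ (2 * V) ^ γ := Real.rpow_le_rpow (norm_nonneg _) (by linarith) hγ0
          _ = 2 ^ γ * V ^ γ := Real.mul_rpow (by norm_num) hV0.le
          _ ≤ 4 * V ^ γ * 1 := by rw [mul_one]; gcongr
          _ ≤ _ := by gcongr; nlinarith
      · have hp : 0 < ‖v + z‖ := hV0.trans_le hc
        have h1 : 1 ≤ ‖v + z‖ / V := (one_le_div hV0).2 hc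
        calc ‖z‖ ^ γ ≤ (2 * ‖v + z‖) ^ γ := Real.rpow_le_rpow (norm_nonneg _) (by linarith) hγ0
          _ = 2 ^ γ * ‖v + z‖ ^ γ := Real.mul_rpow (by norm_num) hp.le
          _ = 2 ^ γ * (V ^ γ * (‖v + z‖ / V) ^ γ) := by
              rw [← Real.mul_rpow hV0.le (by positivity), mul_div_cancel₀ _ hV0.ne']
          _ ≤ 4 * (V ^ γ * (‖v + z‖ / V) ^ (2 : ℝ)) := by
              gcongr
          _ ≤ 4 * (V ^ γ * ‖v + z‖ ^ 2) := by
              rw [Real.rpow_two]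
              gcongr
              exact div_le_self hp.le hV1
          _ ≤ _ := by
              have : 0 ≤ V ^ γ := by positivity
              nlinarith
    calc f (v + z) * ‖z‖ ^ γ ≤ f (v + z) * (4 * V ^ γ * (1 + ‖v + z‖ ^ 2)) :=
          mul_le_mul_of_nonneg_left key h0
      _ = _ := by ring
  refine (lintegral_mono hpt).trans ?_
  have hm3 : Measurable fun z => ENNReal.ofReal (f (v + z)) +
      ENNReal.ofReal (f (v + z)) * ENNReal.ofReal (‖v + z‖ ^ 2) := (h.measurable_add v).add hm2
  rw [lintegral_const_mul _ hm3,
    lintegral_add_left (h.measurable_add v),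
    lintegral_add_left_eq_self (fun x => ENNReal.ofReal (f x)) v,
    lintegral_add_left_eq_self (fun x => ENNReal.ofReal (f x) * ENNReal.ofReal (‖x‖ ^ 2)) v]
  refine (mul_le_mul_right (add_le_add h.mass_upper h.energy) _).trans (le_of_eq ?_)
  rw [← ENNReal.ofReal_add hM hE, ← ENNReal.ofReal_mul (by positivity)]
  congr 1; ring

end IsProfile

/-- The Riesz potential of a profile is negligible against `⟨v⟩^γ X^{2s/d}`, where
`X = g ⟨v⟩^{d+1}` and `g` bounds the profile near `v`, as `X → ∞`. If `γ = -2s` both have the same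
homogeneity, and the gain comes from the energy for large `v` and from the entropy otherwise. -/
theorem exists_riesz_le_small {n : ℕ} (hn : 1 ≤ n) {γ s m₀ M₀ E₀ h₀ A : ℝ} (hs : 0 < s)
    (hγs : 0 ≤ γ + 2 * s) (hγ : -2 < γ) (hγ2 : γ ≤ 2) (hM : 0 ≤ M₀) (hE : 0 ≤ E₀) (hh : 0 ≤ h₀)
    (hA : 1 ≤ A) {δ : ℝ} (hδ : 0 < δ) :
    ∃ X₀ : ℝ, 1 ≤ X₀ ∧ ∀ f : Vel (n + 1) → ℝ, IsProfile m₀ M₀ E₀ h₀ f →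
      ∀ (v : Vel (n + 1)) (g : ℝ), 0 < g →
      (∀ x, ‖x - v‖ < max 1 ‖v‖ / 2 → f x ≤ A * g) →
      X₀ ≤ g * max 1 ‖v‖ ^ ((n : ℝ) + 2) →
      ∫⁻ z, ENNReal.ofReal (f (v + z)) * ENNReal.ofReal (‖z‖ ^ γ) ≤
        ENNReal.ofReal (δ * (max 1 ‖v‖ ^ γ *
          (g * max 1 ‖v‖ ^ ((n : ℝ) + 2)) ^ (2 * s / (n + 1)))) := by
  have hn' : (1 : ℝ) ≤ n := by exact_mod_cast hn
  have hd0 : (0 : ℝ) < n + 1 := by linarith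
  set e : ℝ := 2 * s / (n + 1) with he
  have he0 : 0 < e := by positivity
  -- powers of `X` beat constants
  have hlarge : ∀ c : ℝ, ∃ X₀ : ℝ, 1 ≤ X₀ ∧ ∀ X, X₀ ≤ X → c ≤ X ^ e := by
    intro c
    obtain ⟨X₁, h1⟩ := ((tendsto_rpow_atTop he0).eventually_ge_atTop c).exists_forall_of_atTop
    exact ⟨max 1 X₁, le_max_left _ _, fun X hX => h1 X ((le_max_right _ _).trans hX)⟩
  rcases lt_or_ge 0 γ with hγ0 | hγ0
  · obtain ⟨X₀, hX₀, hX⟩ := hlarge (4 * (M₀ + E₀) / δ)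
    refine ⟨X₀, hX₀, fun f h v g hg hfg hgX => ?_⟩
    refine (h.riesz_le_of_nonneg hγ0.le hγ2 hM hE v).trans (ENNReal.ofReal_le_ofReal ?_)
    have h1 := hX _ hgX
    rw [div_le_iff₀ hδ] at h1
    have h2 : 0 ≤ max 1 ‖v‖ ^ γ := by positivity
    nlinarith
  obtain ⟨C, hC1, hC⟩ := IsProfile.exists_riesz_le (m₀ := m₀) (M₀ := M₀) (E₀ := E₀) (h₀ := h₀)
    (n := n) (γ := γ) (by linarith) hγ0 hM
  set D : ℝ := C * (A + M₀ + 4 * E₀) with hD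
  have hD0 : 0 < D := by positivity
  -- the radius beyond which the energy gives smallness
  have hexp : 0 < 2 + γ / (n + 1) := by
    have : -2 < γ / (n + 1) := by rw [lt_div_iff₀ hd0]; nlinarith
    linarith
  obtain ⟨R, hR1, hR⟩ : ∃ R : ℝ, 1 ≤ R ∧ ∀ V, R ≤ V → D * V ^ (-(2 + γ / (n + 1))) ≤ δ / 2 := by
    have ht := (tendsto_rpow_neg_atTop hexp).const_mul D
    rw [mul_zero] at ht
    obtain ⟨R, hR⟩ := (ht.eventually (Iic_mem_nhds (show 0 < δ / 2 by positivity))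
      ).exists_forall_of_atTop
    exact ⟨max 1 R, le_max_left _ _, fun V hV => hR V ((le_max_right _ _).trans hV)⟩
  have hexp2 : 0 < 1 + γ / (n + 1) := by
    have : -1 < γ / (n + 1) := by rw [lt_div_iff₀ hd0]; linarith
    linarith
  -- the mass that the entropy makes small
  obtain ⟨η, hη0, hη⟩ : ∃ η : ℝ, 0 < η ∧
      C * (A + 1) * η ^ (1 + γ / (n + 1)) ≤ δ / 2 * R ^ γ := by
    have h1 : Tendsto (fun η : ℝ => C * (A + 1) * η ^ (1 + γ / (n + 1))) (𝓝[>] 0) (𝓝 0) := by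
      have : ContinuousAt (fun η : ℝ => C * (A + 1) * η ^ (1 + γ / (n + 1))) 0 :=
        continuousAt_const.mul (Real.continuousAt_rpow_const _ _ (Or.inr hexp2.le))
      have h2 := this.tendsto
      rw [Real.zero_rpow hexp2.ne', mul_zero] at h2
      exact h2.mono_left nhdsWithin_le_nhds
    have hpos : 0 < δ / 2 * R ^ γ := by positivity
    obtain ⟨η, h3, h4⟩ := ((h1.eventually (Iic_mem_nhds hpos)).and self_mem_nhdsWithin).exists
    exact ⟨η, h4, h3⟩
  set K : ℝ := Real.exp (1 + h₀ / η) with hK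
  have hK1 : 1 < K := Real.one_lt_exp_iff.2 (by positivity)
  obtain ⟨X₁, hX₁1, hX₁⟩ := hlarge (C / (δ / 2))
  obtain ⟨X₂, hX₂1, hX₂⟩ := hlarge (C * (K * R ^ (n + 1 + γ) + 1) / (δ / 2 * R ^ γ))
  refine ⟨max X₁ X₂, hX₁1.trans (le_max_left _ _), fun f h v g hg hfg hgX => ?_⟩
  set V := max 1 ‖v‖ with hV
  have hV1 : 1 ≤ V := le_max_left _ _
  have hV0 : 0 < V := by linarith
  set X := g * V ^ ((n : ℝ) + 2) with hXdef
  have hX1 : 1 ≤ X := (hX₁1.trans (le_max_left _ _)).trans hgX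
  have hXe : X ^ (-γ / (n + 1)) ≤ X ^ e :=
    Real.rpow_le_rpow_of_exponent_le hX1 (by rw [he]; gcongr; linarith)
  have hc1 := hX₁ X ((le_max_left _ _).trans hgX)
  have hc2 := hX₂ X ((le_max_right _ _).trans hgX)
  rw [div_le_iff₀ (by positivity)] at hc1 hc2
  have hAg : 0 ≤ A * g := by positivity
  have hVγ : 0 < V ^ γ := by positivity
  have hXe0 : 0 < X ^ e := by positivity
  rcases le_or_gt R V with hVR | hVR
  · -- large velocities; at this `ρ` the bound `g ρ^d` for the mass of the ball is the energy bound
    -- `|v|^{-2}` for the mass near `v`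
    set ρ : ℝ := (g * V ^ (2 : ℝ)) ^ (-1 / ((n : ℝ) + 1)) with hρ
    have hρ0 : 0 < ρ := by positivity
    have hmass : ∫⁻ x in {x | ‖x - v‖ < V / 2 ∧ 0 < f x}, ENNReal.ofReal (f x) ≤
        ENNReal.ofReal ((M₀ + 4 * E₀) * V ^ (-2 : ℝ)) :=
      (lintegral_mono_set fun x hx => hx.1).trans (h.lintegral_near_le hM hE v)
    refine (hC f h v (A * g) ρ 0 _ hAg hρ0 le_rfl (by positivity) hfg hmass).trans
      (ENNReal.ofReal_le_ofReal ?_)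
    have hρd : ρ ^ ((n : ℝ) + 1 + γ) = ρ ^ γ * (g * V ^ (2 : ℝ))⁻¹ := by
      rw [add_comm _ γ, Real.rpow_add hρ0]
      congr 1
      rw [hρ, ← Real.rpow_mul (by positivity), div_mul_cancel₀ _ hd0.ne', Real.rpow_neg_one]
    have hργ : ρ ^ γ * V ^ (-2 : ℝ) = V ^ γ * (X ^ (-γ / (n + 1)) * V ^ (-(2 + γ / (n + 1)))) := by
      rw [hρ, hXdef, Real.mul_rpow hg.le (by positivity), ← Real.rpow_mul hV0.le,
        Real.mul_rpow (by positivity) (by positivity), Real.mul_rpow hg.le (by positivity),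
        ← Real.rpow_mul hg.le, ← Real.rpow_mul hV0.le, ← Real.rpow_mul hV0.le, mul_assoc,
        ← Real.rpow_add hV0, show -1 / ((n : ℝ) + 1) * γ = -γ / (n + 1) by ring,
        mul_left_comm (V ^ γ), mul_assoc (g ^ _), ← Real.rpow_add hV0,
        ← Real.rpow_add hV0]
      congr 2
      field_simp
      ring
    have hV2 : g * ρ ^ ((n : ℝ) + 1 + γ) = ρ ^ γ * V ^ (-2 : ℝ) := by
      rw [hρd, Real.rpow_neg hV0.le]; field_simp
    have hsm := hR V hVR
    calc _ = D * V ^ (-(2 + γ / (n + 1))) * (V ^ γ * X ^ (-γ / (n + 1))) + C * V ^ γ := by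
          have : A * g * ρ ^ ((n : ℝ) + 1 + γ) + ρ ^ γ * ((M₀ + 4 * E₀) * V ^ (-2 : ℝ)) =
              (A + M₀ + 4 * E₀) * (ρ ^ γ * V ^ (-2 : ℝ)) := by
            rw [mul_assoc, hV2]; ring
          rw [this, hργ, hD]; ring
      _ ≤ δ / 2 * (V ^ γ * X ^ e) + X ^ e * (δ / 2) * V ^ γ := by gcongr
      _ = _ := by ring
  · -- bounded velocities; at this `ρ` the bound `g ρ^d` is the mass `η` that exceeds the height `K`
    set ρ : ℝ := (g / η) ^ (-1 / ((n : ℝ) + 1)) with hρ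
    have hρ0 : 0 < ρ := by positivity
    have hmass : ∫⁻ x in {x | ‖x - v‖ < V / 2 ∧ K < f x}, ENNReal.ofReal (f x) ≤
        ENNReal.ofReal η := by
      refine (lintegral_mono_set fun x hx => hx.2).trans ((h.entropy K hK1).trans
        (ENNReal.ofReal_le_ofReal ?_))
      rw [hK, Real.log_exp, div_le_iff₀ (by positivity)]
      have : η * (1 + h₀ / η) = η + h₀ := by field_simp
      linarith
    refine (hC f h v (A * g) ρ K _ hAg hρ0 (by linarith) hη0.le hfg hmass).trans
      (ENNReal.ofReal_le_ofReal ?_)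
    have hρd : ρ ^ ((n : ℝ) + 1 + γ) = ρ ^ γ * (g / η)⁻¹ := by
      rw [add_comm _ γ, Real.rpow_add hρ0]
      congr 1
      rw [hρ, ← Real.rpow_mul (by positivity), div_mul_cancel₀ _ hd0.ne', Real.rpow_neg_one]
    have hργ : ρ ^ γ * η = g ^ (-γ / (n + 1)) * η ^ (1 + γ / (n + 1)) := by
      rw [hρ, ← Real.rpow_mul (by positivity), Real.div_rpow hg.le hη0.le,
        show -1 / ((n : ℝ) + 1) * γ = -γ / (n + 1) by ring, Real.rpow_add hη0, Real.rpow_one,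
        neg_div, Real.rpow_neg hη0.le]
      field_simp
    have hgX' : g ^ (-γ / (n + 1)) ≤ X ^ e := by
      refine le_trans (Real.rpow_le_rpow hg.le ?_ (div_nonneg (by linarith) hd0.le)) hXe
      rw [hXdef]
      exact le_mul_of_one_le_right hg.le (Real.one_le_rpow hV1 (by linarith))
    have hRV : R ^ γ ≤ V ^ γ := Real.rpow_le_rpow_of_nonpos hV0 hVR.le hγ0
    have hVp : V ^ ((n : ℝ) + 1 + γ) ≤ R ^ ((n : ℝ) + 1 + γ) :=
      Real.rpow_le_rpow hV0.le hVR.le (by linarith)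
    have hV1' : V ^ γ ≤ 1 := Real.rpow_le_one_of_one_le_of_nonpos hV1 hγ0
    have hK0 : 0 ≤ K := by linarith
    calc _ = C * (A + 1) * η ^ (1 + γ / (n + 1)) * g ^ (-γ / (n + 1)) +
          C * (K * V ^ ((n : ℝ) + 1 + γ) + V ^ γ) := by
          have : A * g * ρ ^ ((n : ℝ) + 1 + γ) = A * (ρ ^ γ * η) := by
            rw [hρd]; field_simp
          rw [this, hργ]; ring
      _ ≤ δ / 2 * R ^ γ * X ^ e + C * (K * R ^ ((n : ℝ) + 1 + γ) + 1) := by gcongr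
      _ ≤ δ / 2 * R ^ γ * X ^ e + X ^ e * (δ / 2 * R ^ γ) := by gcongr
      _ ≤ δ / 2 * V ^ γ * X ^ e + X ^ e * (δ / 2 * V ^ γ) := by gcongr
      _ = _ := by ring

/-! ### Increments of the weights -/

theorem decayWeight_pos {d : ℕ} (q : ℝ) (v : Vel d) : 0 < decayWeight q v :=
  Real.rpow_pos_of_pos (lt_of_lt_of_le one_pos (le_max_left _ _)) _

theorem decayWeight_le_one {d : ℕ} {q : ℝ} (hq : 0 ≤ q) (v : Vel d) : decayWeight q v ≤ 1 :=
  Real.rpow_le_one_of_one_le_of_nonpos (le_max_left _ _) (by linarith)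

theorem decayWeight_le_rpow {d : ℕ} {q : ℝ} (hq : 0 ≤ q) {v : Vel d} (hv : 0 < ‖v‖) :
    decayWeight q v ≤ ‖v‖ ^ (-q) :=
  Real.rpow_le_rpow_of_nonpos hv (le_max_right _ _) (by linarith)

theorem decayWeight_of_one_le {d : ℕ} (q : ℝ) {v : Vel d} (hv : 1 ≤ ‖v‖) :
    decayWeight q v = ‖v‖ ^ (-q) := by
  rw [decayWeight, max_eq_right hv]

theorem decayWeight_anti {d : ℕ} {q : ℝ} (hq : 0 ≤ q) {v v' : Vel d} (h : ‖v‖ ≤ ‖v'‖) :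
    decayWeight q v' ≤ decayWeight q v :=
  Real.rpow_le_rpow_of_nonpos (lt_of_lt_of_le one_pos (le_max_left _ _))
    (max_le_max_left _ h) (by linarith)

theorem decayWeight_le_of_exponent_le {d : ℕ} {p q : ℝ} (h : p ≤ q) (v : Vel d) :
    decayWeight q v ≤ decayWeight p v :=
  Real.rpow_le_rpow_of_exponent_le (le_max_left _ _) (by linarith)

theorem decayWeight_half {d : ℕ} {q : ℝ} (hq : 0 ≤ q) {v v' : Vel d}
    (h : max 1 ‖v‖ / 2 ≤ max 1 ‖v'‖) :
    decayWeight q v' ≤ 2 ^ q * decayWeight q v := by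
  have hV : 0 < max 1 ‖v‖ := lt_of_lt_of_le one_pos (le_max_left _ _)
  calc decayWeight q v' ≤ (max 1 ‖v‖ / 2) ^ (-q) :=
        Real.rpow_le_rpow_of_nonpos (by positivity) h (by linarith)
    _ = _ := by
        rw [Real.div_rpow hV.le (by norm_num), Real.rpow_neg (by norm_num : (0 : ℝ) ≤ 2),
          div_inv_eq_mul, mul_comm, decayWeight]

theorem continuous_decayWeight {d : ℕ} (q : ℝ) : Continuous (decayWeight (d := d) q) := by
  unfold decayWeight
  exact (continuous_const.max continuous_norm).rpow_const fun v =>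
    Or.inl (lt_of_lt_of_le one_pos (le_max_left _ _)).ne'

theorem exp_le_quadratic {p y : ℝ} (hy : y ≤ p) :
    Real.exp y ≤ 1 + y + (Real.exp p + 1) * y ^ 2 := by
  have hep := Real.exp_pos p
  rcases le_total |y| 1 with h | h
  · have := Real.abs_exp_sub_one_sub_id_le h
    have := (abs_le.1 this).2
    nlinarith [sq_nonneg y]
  · rcases le_or_gt 0 y with h0 | h0
    · rw [abs_of_nonneg h0] at h
      have := Real.exp_le_exp.2 hy
      have hy1 : 1 ≤ y ^ 2 := by nlinarith
      nlinarith [mul_le_mul_of_nonneg_left hy1 hep.le]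
    · rw [abs_of_neg h0] at h
      have : Real.exp y ≤ 1 := Real.exp_le_one_iff.2 h0.le
      nlinarith [sq_nonneg y]

theorem one_add_rpow_neg_le_quadratic {p b : ℝ} (hp : 0 ≤ p) (hb : |b| ≤ 1 / 2) :
    (1 + b) ^ (-p) ≤ 1 - p * b + (2 * p + 4 * p ^ 2 * (Real.exp p + 1)) * b ^ 2 := by
  have hb' := abs_le.1 hb
  have hlog : b - 2 * b ^ 2 ≤ Real.log (1 + b) := by
    have h1 := Real.abs_log_sub_add_sum_range_le (x := -b) (by rw [abs_neg]; linarith) 1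
    simp only [Finset.range_one, Finset.sum_singleton, sub_neg_eq_add, abs_neg] at h1
    norm_num at h1
    have h2 : b ^ 2 / (1 - |b|) ≤ 2 * b ^ 2 := by
      rw [div_le_iff₀ (by linarith)]; nlinarith [sq_nonneg b]
    have := (abs_le.1 h1).1
    linarith
  rw [Real.rpow_def_of_pos (by linarith)]
  have hy : Real.log (1 + b) * -p ≤ p * (2 * b ^ 2 - b) := by nlinarith
  set y := p * (2 * b ^ 2 - b) with hydef
  have hbb : b ^ 2 ≤ 1 / 4 := by nlinarith
  have hyp : y ≤ p := by rw [hydef]; nlinarith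
  refine (Real.exp_le_exp.2 hy).trans ((exp_le_quadratic hyp).trans ?_)
  have hy2 : y ^ 2 ≤ 4 * p ^ 2 * b ^ 2 := by
    have : y ^ 2 = p ^ 2 * b ^ 2 * (2 * b - 1) ^ 2 := by rw [hydef]; ring
    rw [this]
    have h4 : (2 * b - 1) ^ 2 ≤ 4 := by nlinarith
    have := mul_le_mul_of_nonneg_left h4 (mul_nonneg (sq_nonneg p) (sq_nonneg b))
    linarith
  have := mul_le_mul_of_nonneg_left hy2 (by positivity : 0 ≤ Real.exp p + 1)
  rw [hydef] at this ⊢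
  linarith

/-- The first-order term of the increment of `decayWeight q` at `v` for small displacements
`|u| ≤ κ |v|`, and zero where the weight is constant. -/
noncomputable def tilt {d : ℕ} (κ q : ℝ) (v u : Vel d) : ℝ :=
  ({u | 1 ≤ ‖v‖ ∧ ‖u‖ ≤ κ * ‖v‖} : Set (Vel d)).indicator
    (fun u => -q * ⟪v, u⟫ / ‖v‖ ^ 2 * decayWeight q v) u

theorem measurable_tilt {d : ℕ} (κ q : ℝ) (v : Vel d) : Measurable (tilt κ q v) := by
  refine Measurable.indicator (Continuous.measurable (by fun_prop)) ?_
  exact (MeasurableSet.const _).inter (measurableSet_le measurable_norm measurable_const)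

theorem tilt_neg {d : ℕ} (κ q : ℝ) (v u : Vel d) : tilt κ q v (-u) = -tilt κ q v u := by
  unfold tilt
  by_cases h : 1 ≤ ‖v‖ ∧ ‖u‖ ≤ κ * ‖v‖
  · rw [indicator_of_mem (by simpa using h), indicator_of_mem (by exact h), inner_neg_right]; ring
  · rw [indicator_of_notMem (by simpa using h), indicator_of_notMem (by exact h), neg_zero]

theorem abs_tilt_le {d : ℕ} {κ q : ℝ} (hq : 0 ≤ q) (v u : Vel d) :
    |tilt κ q v u| ≤ q * (‖u‖ / max 1 ‖v‖) * decayWeight q v := by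
  have hw := decayWeight_pos q v
  unfold tilt
  by_cases h : 1 ≤ ‖v‖ ∧ ‖u‖ ≤ κ * ‖v‖
  · have hv : 0 < ‖v‖ := by linarith [h.1]
    rw [indicator_of_mem (by exact h), abs_mul, abs_of_pos hw, abs_div, abs_mul, abs_neg,
      abs_of_nonneg hq, abs_of_nonneg (sq_nonneg ‖v‖), max_eq_right h.1]
    refine mul_le_mul_of_nonneg_right ?_ hw.le
    rw [div_le_iff₀ (by positivity), mul_assoc]
    refine mul_le_mul_of_nonneg_left ((abs_real_inner_le_norm v u).trans (le_of_eq ?_)) hq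
    field_simp
  · rw [indicator_of_notMem (by exact h), abs_zero]
    have : 0 < max 1 ‖v‖ := lt_of_lt_of_le one_pos (le_max_left _ _)
    positivity

theorem abs_tilt_le_const {d : ℕ} {κ q : ℝ} (hκ : 0 ≤ κ) (hq : 0 ≤ q) (v u : Vel d) :
    |tilt κ q v u| ≤ q * κ := by
  by_cases h : 1 ≤ ‖v‖ ∧ ‖u‖ ≤ κ * ‖v‖
  · have hv : 0 < ‖v‖ := by linarith [h.1]
    refine (abs_tilt_le hq v u).trans ?_
    rw [max_eq_right h.1]
    have h1 : ‖u‖ / ‖v‖ ≤ κ := (div_le_iff₀ hv).2 h.2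
    have h2 := decayWeight_le_one hq v
    have h3 := (decayWeight_pos q v).le
    calc _ ≤ q * κ * 1 := by gcongr
      _ = _ := mul_one _
  · unfold tilt
    rw [indicator_of_notMem (by exact h), abs_zero]
    positivity

/-- The size of the remainder of the first-order expansion. -/
noncomputable def remainderWeight {d : ℕ} (κ : ℝ) (v u w : Vel d) : ℝ :=
  min 1 (‖v + w‖ ^ 2 / ‖v‖ ^ 2) * if ‖u‖ ≤ κ * ‖v‖ then ‖u‖ ^ 2 / ‖v‖ ^ 2 else 1

theorem remainderWeight_nonneg {d : ℕ} (κ : ℝ) (v u w : Vel d) : 0 ≤ remainderWeight κ v u w := by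
  unfold remainderWeight
  refine mul_nonneg (le_min zero_le_one (by positivity)) ?_
  split_ifs <;> positivity

/-- First-order expansion of the weight for small displacements. Orthogonality of the displacements
replaces `v · u` by `v'_* · u`, so that the remainder is small when `|v'_*| ≪ |v|`. -/
theorem exists_decayWeight_increment_le_near {d : ℕ} {q : ℝ} (hq : 0 ≤ q) :
    ∃ C : ℝ, 0 ≤ C ∧ ∀ v u w : Vel d, 1 ≤ ‖v‖ → ⟪u, w⟫ = 0 → ‖u‖ ≤ ‖v‖ / 4 →
      decayWeight q (v + u) - decayWeight q v ≤ -q * ⟪v, u⟫ / ‖v‖ ^ 2 * decayWeight q v +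
        C * decayWeight q v * (min 1 (‖v + w‖ ^ 2 / ‖v‖ ^ 2) * (‖u‖ ^ 2 / ‖v‖ ^ 2)) := by
  set p := q / 2 with hp
  have hp0 : 0 ≤ p := by positivity
  set C₁ := 2 * p + 4 * p ^ 2 * (Real.exp p + 1) with hC₁
  have hC₁0 : 0 ≤ C₁ := by
    have := Real.exp_pos p
    positivity
  refine ⟨4 * C₁, by positivity, fun v u w hv huw hu => ?_⟩
  have hv0 : 0 < ‖v‖ := by linarith
  have hφ := decayWeight_pos q v
  have hin : ⟪v, u⟫ = ⟪v + w, u⟫ := by rw [inner_add_left, real_inner_comm u w, huw, add_zero]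
  have hc1 := abs_real_inner_le_norm v u
  have hc2 := abs_real_inner_le_norm (v + w) u
  set b := 2 * ⟪v, u⟫ / ‖v‖ ^ 2 with hb
  have hbabs : |b| ≤ 1 / 2 := by
    rw [hb, abs_div, abs_mul, abs_of_pos (by positivity : 0 < ‖v‖ ^ 2), abs_two,
      div_le_iff₀ (by positivity)]
    nlinarith
  have hb2 : b ^ 2 ≤ 4 * (min 1 (‖v + w‖ ^ 2 / ‖v‖ ^ 2) * (‖u‖ ^ 2 / ‖v‖ ^ 2)) := by
    rw [min_mul_of_nonneg _ _ (by positivity), mul_min_of_nonneg _ _ (by norm_num)]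
    refine le_min ?_ ?_
    · have := sq_le_sq' (by linarith [abs_le.1 hc1 |>.1]) (abs_le.1 hc1).2
      have e : 4 * (1 * (‖u‖ ^ 2 / ‖v‖ ^ 2)) = 4 * (‖v‖ * ‖u‖) ^ 2 / (‖v‖ ^ 2) ^ 2 := by
        field_simp
      rw [e, hb, div_pow, mul_pow]
      gcongr
      norm_num
    · have := sq_le_sq' (by linarith [abs_le.1 hc2 |>.1]) (abs_le.1 hc2).2
      have e : 4 * (‖v + w‖ ^ 2 / ‖v‖ ^ 2 * (‖u‖ ^ 2 / ‖v‖ ^ 2)) =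
          4 * (‖v + w‖ * ‖u‖) ^ 2 / (‖v‖ ^ 2) ^ 2 := by
        field_simp
      rw [e, hb, div_pow, mul_pow, hin]
      gcongr
      norm_num
  have hb' := abs_le.1 hbabs
  have hmain : decayWeight q (v + u) ≤ decayWeight q v * (1 + b) ^ (-p) := by
    have hvu0 : 0 < ‖v + u‖ := by
      have := norm_sub_le (v + u) u
      rw [add_sub_cancel_right] at this
      linarith
    refine (decayWeight_le_rpow hq hvu0).trans ?_
    rw [decayWeight_of_one_le q hv]
    have e1 : ∀ x : ℝ, 0 ≤ x → x ^ (-q) = (x ^ 2) ^ (-p) := fun x hx => by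
      rw [← Real.rpow_two, ← Real.rpow_mul hx]; congr 1; rw [hp]; ring
    rw [e1 _ hvu0.le, e1 _ hv0.le, ← Real.mul_rpow (by positivity) (by linarith)]
    refine Real.rpow_le_rpow_of_nonpos (mul_pos (by positivity) (by linarith)) ?_ (by linarith)
    have : ‖v‖ ^ 2 * (1 + b) = ‖v‖ ^ 2 + 2 * ⟪v, u⟫ := by rw [hb]; field_simp
    rw [this, norm_add_sq_real v u]
    linarith [sq_nonneg ‖u‖]
  have hquad := one_add_rpow_neg_le_quadratic hp0 hbabs
  rw [← hC₁] at hquad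
  set m := min 1 (‖v + w‖ ^ 2 / ‖v‖ ^ 2) * (‖u‖ ^ 2 / ‖v‖ ^ 2) with hm
  have e2 : -q * ⟪v, u⟫ / ‖v‖ ^ 2 * decayWeight q v = decayWeight q v * (-(p * b)) := by
    rw [hb, hp]; ring
  rw [e2]
  have h3 : decayWeight q v * (1 + b) ^ (-p) ≤
      decayWeight q v * (1 - p * b + C₁ * (4 * m)) :=
    mul_le_mul_of_nonneg_left (hquad.trans (by gcongr)) hφ.le
  linarith

theorem decayWeight_increment_le_far {d : ℕ} {κ q : ℝ} (hκ : 0 < κ) (hκ1 : κ ≤ 1)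
    (hq : 0 ≤ q) {v u w : Vel d} (hv : 1 ≤ ‖v‖) (huw : ⟪u, w⟫ = 0) (hvu : ‖v‖ / 2 ≤ ‖v + u‖)
    (hu : κ * ‖v‖ < ‖u‖) :
    decayWeight q (v + u) - decayWeight q v ≤
      2 ^ q * (4 / κ ^ 2) * decayWeight q v * min 1 (‖v + w‖ ^ 2 / ‖v‖ ^ 2) := by
  have hv0 : 0 < ‖v‖ := by linarith
  have hφ := decayWeight_pos q v
  have hm0 : 0 ≤ min 1 (‖v + w‖ ^ 2 / ‖v‖ ^ 2) := le_min zero_le_one (by positivity)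
  rcases le_or_gt ‖v‖ ‖v + u‖ with h | h
  · have h1 := decayWeight_anti hq h
    have : 0 ≤ 2 ^ q * (4 / κ ^ 2) * decayWeight q v * min 1 (‖v + w‖ ^ 2 / ‖v‖ ^ 2) := by
      positivity
    linarith
  · have hin : ⟪v, u⟫ = ⟪v + w, u⟫ := by rw [inner_add_left, real_inner_comm u w, huw, add_zero]
    have hu0 : 0 < ‖u‖ := (by positivity : 0 < κ * ‖v‖).trans hu
    have h1 : ‖u‖ ^ 2 ≤ 2 * (‖v + w‖ * ‖u‖) := by
      have h2 : ‖v + u‖ ^ 2 < ‖v‖ ^ 2 := by gcongr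
      rw [norm_add_sq_real v u, hin] at h2
      have := (abs_le.1 (abs_real_inner_le_norm (v + w) u)).1
      linarith
    have h2 : κ * ‖v‖ / 2 ≤ ‖v + w‖ := by
      have : ‖u‖ ≤ 2 * ‖v + w‖ := by
        refine le_of_mul_le_mul_right ?_ hu0
        nlinarith
      linarith
    have h3 : κ ^ 2 / 4 ≤ min 1 (‖v + w‖ ^ 2 / ‖v‖ ^ 2) := by
      refine le_min (by nlinarith) ?_
      rw [le_div_iff₀ (by positivity)]
      calc κ ^ 2 / 4 * ‖v‖ ^ 2 = (κ * ‖v‖ / 2) ^ 2 := by ring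
        _ ≤ _ := pow_le_pow_left₀ (by positivity) h2 2
    have h4 : decayWeight q (v + u) ≤ 2 ^ q * decayWeight q v := by
      refine decayWeight_half hq ?_
      rw [max_eq_right hv]
      exact hvu.trans (le_max_right _ _)
    have h5 : 2 ^ q * decayWeight q v ≤ 2 ^ q * (4 / κ ^ 2) * decayWeight q v *
        min 1 (‖v + w‖ ^ 2 / ‖v‖ ^ 2) := by
      calc 2 ^ q * decayWeight q v = 2 ^ q * (4 / κ ^ 2) * decayWeight q v * (κ ^ 2 / 4) := by
            field_simp
        _ ≤ _ := by gcongr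
    linarith

/-- The increment of the weight along a collision, up to its odd first-order term. -/
theorem exists_decayWeight_increment_le {d : ℕ} {κ q : ℝ} (hκ : 0 < κ) (hκ1 : κ ≤ 1 / 4)
    (hq : 0 ≤ q) :
    ∃ C : ℝ, 0 ≤ C ∧ ∀ v u w : Vel d, 1 ≤ ‖v‖ → ⟪u, w⟫ = 0 → ‖v‖ / 2 ≤ ‖v + u‖ →
      decayWeight q (v + u) - decayWeight q v ≤
        tilt κ q v u + C * decayWeight q v * remainderWeight κ v u w := by
  obtain ⟨C₁, hC₁0, hC₁⟩ := exists_decayWeight_increment_le_near (d := d) hq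
  refine ⟨C₁ + 2 ^ q * (4 / κ ^ 2), by positivity, fun v u w hv huw hvu => ?_⟩
  have hφ := decayWeight_pos q v
  have hm0 : 0 ≤ min 1 (‖v + w‖ ^ 2 / ‖v‖ ^ 2) := le_min zero_le_one (by positivity)
  unfold remainderWeight tilt
  by_cases hu : ‖u‖ ≤ κ * ‖v‖
  · rw [indicator_of_mem (show u ∈ {u | 1 ≤ ‖v‖ ∧ ‖u‖ ≤ κ * ‖v‖} from ⟨hv, hu⟩), if_pos hu]
    refine (hC₁ v u w hv huw (by nlinarith)).trans ?_
    gcongr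
    exact le_add_of_nonneg_right (by positivity)
  · rw [indicator_of_notMem (fun h => hu h.2), if_neg hu, mul_one, zero_add]
    refine (decayWeight_increment_le_far hκ (by linarith) hq hv huw hvu (not_le.1 hu)).trans ?_
    gcongr
    exact le_add_of_nonneg_left hC₁0

theorem measurable_remainderWeight {d : ℕ} (κ : ℝ) (v : Vel d) :
    Measurable fun x : Vel d × Vel d => remainderWeight κ v x.1 x.2 := by
  unfold remainderWeight
  refine Measurable.mul (Continuous.measurable (by fun_prop)) (Measurable.ite
    (measurableSet_le (by fun_prop) measurable_const) (by fun_prop) measurable_const)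

/-- The remainder integrates to a term of order `|v|^{γ-2}`, thanks to the energy. -/
theorem exists_lintegral_remainder_le {n : ℕ} (hn : 1 ≤ n) {γ s b κ E₀ : ℝ}
    (hs : s ∈ Ioo (0 : ℝ) 1) (hγs : 0 ≤ γ + 2 * s) (hγs2 : γ + 2 * s ≤ 2) (hb0 : 0 ≤ b)
    (hκ : 0 < κ) (hE : 0 ≤ E₀) :
    ∃ C : ℝ, 0 ≤ C ∧ ∀ β : ℝ → ℝ, Measurable β → (∀ c, β c ≤ b) → ∀ (m₀ M₀ h₀ : ℝ)
      (f : Vel (n + 1) → ℝ), IsProfile m₀ M₀ E₀ h₀ f → ∀ v : Vel (n + 1), 0 < ‖v‖ →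
      ∫⁻ x, ENNReal.ofReal (f (v + x.2) * remainderWeight κ v x.1 x.2)
        ∂(collisionMeasure n γ s β) ≤ ENNReal.ofReal (C * ‖v‖ ^ (γ - 2)) := by
  obtain ⟨hs0, hs1⟩ := hs
  set S := (surfaceMeasure n univ).toReal with hS
  set c₁ := κ ^ (2 - 2 * s) / (2 - 2 * s) + κ ^ (-(2 * s)) / (2 * s) with hc₁
  have h22 : 0 < 2 - 2 * s := by linarith
  have hc₁0 : 0 ≤ c₁ := by positivity
  refine ⟨b * (2 ^ n * S * (4 * E₀) * c₁), by positivity,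
    fun β hβ hβb m₀ M₀ h₀ f h v hv => ?_⟩
  let A : Vel (n + 1) → ℝ≥0∞ := fun w =>
    ENNReal.ofReal (f (v + w) * min 1 (‖v + w‖ ^ 2 / ‖v‖ ^ 2))
  let Φ : ℝ → ℝ≥0∞ := fun τ => ENNReal.ofReal (‖v‖ ^ (-2 : ℝ)) *
    (Iic (κ * ‖v‖)).indicator (fun τ => ENNReal.ofReal (τ ^ 2)) τ +
      (Ioi (κ * ‖v‖)).indicator 1 τ
  have hA : Measurable A := by
    have := h.continuous
    exact Measurable.ennreal_ofReal (Continuous.measurable (by fun_prop))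
  have mh : Measurable ((Iic (κ * ‖v‖)).indicator fun τ : ℝ => ENNReal.ofReal (τ ^ 2)) :=
    Measurable.indicator (by fun_prop) measurableSet_Iic
  have mt : Measurable ((Ioi (κ * ‖v‖)).indicator (1 : ℝ → ℝ≥0∞)) :=
    measurable_one.indicator measurableSet_Ioi
  have hΦ : Measurable Φ := (mh.const_mul _).add mt
  have hF : ∀ x : Vel (n + 1) × Vel (n + 1),
      ENNReal.ofReal (f (v + x.2) * remainderWeight κ v x.1 x.2) = A x.2 * Φ ‖x.1‖ := by
    intro x
    have h1 : 0 ≤ f (v + x.2) * min 1 (‖v + x.2‖ ^ 2 / ‖v‖ ^ 2) :=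
      mul_nonneg (h.nonneg _) (le_min zero_le_one (by positivity))
    unfold remainderWeight
    simp only [A, Φ]
    rw [← mul_assoc, ENNReal.ofReal_mul h1]
    congr 1
    by_cases hx : ‖x.1‖ ≤ κ * ‖v‖
    · rw [if_pos hx, indicator_of_mem (by exact hx), indicator_of_notMem (by simpa using hx),
        add_zero, ← ENNReal.ofReal_mul (by positivity), Real.rpow_neg hv.le, Real.rpow_two,
        div_eq_inv_mul]
    · rw [if_neg hx, indicator_of_notMem (by exact hx), indicator_of_mem (by simpa using hx)]
      simp
  simp_rw [hF]
  have hm : Measurable fun x : Vel (n + 1) × Vel (n + 1) => A x.2 * Φ ‖x.1‖ :=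
    (hA.comp measurable_snd).mul (hΦ.comp (by fun_prop))
  have m1 : Measurable fun τ : ℝ => ENNReal.ofReal (τ ^ (-1 - 2 * s)) *
      (Iic (κ * ‖v‖)).indicator (fun τ => ENNReal.ofReal (τ ^ 2)) τ :=
    Measurable.mul (by fun_prop) mh
  have hΦi : ∫⁻ τ in Ioi (0 : ℝ), ENNReal.ofReal (τ ^ (-1 - 2 * s)) * Φ τ =
      ENNReal.ofReal (c₁ * ‖v‖ ^ (-(2 * s))) := by
    have e1 : ∀ τ : ℝ, ENNReal.ofReal (τ ^ (-1 - 2 * s)) * Φ τ =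
        ENNReal.ofReal (‖v‖ ^ (-2 : ℝ)) * (ENNReal.ofReal (τ ^ (-1 - 2 * s)) *
          (Iic (κ * ‖v‖)).indicator (fun τ => ENNReal.ofReal (τ ^ 2)) τ) +
        ENNReal.ofReal (τ ^ (-1 - 2 * s)) * (Ioi (κ * ‖v‖)).indicator 1 τ := fun τ => by
      simp only [Φ]; ring
    simp_rw [e1]
    rw [lintegral_add_left (m1.const_mul _), lintegral_const_mul _ m1,
      lintegral_rpow_head hs1 (by positivity), lintegral_rpow_tail hs0 (by positivity),
      ← ENNReal.ofReal_mul (by positivity), ← ENNReal.ofReal_add (by positivity) (by positivity)]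
    congr 1
    rw [Real.mul_rpow hκ.le hv.le, Real.mul_rpow hκ.le hv.le, hc₁,
      show 2 - 2 * s = 2 + -(2 * s) by ring, Real.rpow_add hv, Real.rpow_neg hv.le 2]
    have : ‖v‖ ^ (2 : ℝ) ≠ 0 := (Real.rpow_pos_of_pos hv _).ne'
    field_simp
  refine (lintegral_collisionMeasure_le hβ hb0 hβb hm).trans ?_
  rw [lintegral_collisionMeasure_mul hn hA hΦ, hΦi,
    ← ENNReal.ofReal_toReal (measure_ne_top (surfaceMeasure n) univ), ← hS]
  calc _ ≤ ENNReal.ofReal b * (2 ^ n * ENNReal.ofReal S *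
        ENNReal.ofReal (4 * E₀ * ‖v‖ ^ (γ + 2 * s - 2)) * ENNReal.ofReal (c₁ * ‖v‖ ^ (-(2 * s)))) :=
        mul_le_mul_right (mul_le_mul_left (mul_le_mul_right
          (h.lintegral_min_le hγs hγs2 hv) _) _) _
    _ = _ := by
        rw [show (2 : ℝ≥0∞) ^ n = ENNReal.ofReal (2 ^ n) by
            rw [ENNReal.ofReal_pow (by norm_num)]; norm_num,
          ← ENNReal.ofReal_mul (by positivity), ← ENNReal.ofReal_mul (by positivity),
          ← ENNReal.ofReal_mul (by positivity), ← ENNReal.ofReal_mul (by positivity)]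
        congr 1
        rw [show γ - 2 = (γ + 2 * s - 2) + -(2 * s) by ring, Real.rpow_add hv]
        ring

/-! ### Post-collisional velocities close to the origin -/

theorem exists_eq_smul_add_chart {n : ℕ} (e : Sph (n + 1)) (v : Vel (n + 1)) :
    ∃ (t : ℝ) (y : Vel n), v = t • (e : Vel (n + 1)) + chart e y := by
  let L : (ℝ × Vel n) →ₗ[ℝ] Vel (n + 1) :=
    (LinearMap.toSpanSingleton ℝ (Vel (n + 1)) (e : Vel (n + 1))).coprod (chart e).toLinearMap
  have hL : ∀ p, L p = p.1 • (e : Vel (n + 1)) + chart e p.2 := fun p => by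
    simp [L]
  have hinj : Function.Injective L := by
    rw [injective_iff_map_eq_zero]
    rintro ⟨t, y⟩ h
    have h1 : ‖t • (e : Vel (n + 1)) + chart e y‖ = 0 := by rw [← hL (t, y), h, norm_zero]
    rw [norm_smul_add_chart, Real.sqrt_eq_zero (by positivity)] at h1
    have h2 : t = 0 := by nlinarith [sq_nonneg t, sq_nonneg ‖y‖]
    have h3 : ‖y‖ = 0 := by nlinarith [sq_nonneg t, sq_nonneg ‖y‖]
    rw [h2, norm_eq_zero.1 h3]; rfl
  have hsurj : Function.Surjective L :=
    (LinearMap.injective_iff_surjective_of_finrank_eq_finrank (by simp [add_comm])).1 hinj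
  obtain ⟨p, hp⟩ := hsurj v
  exact ⟨p.1, p.2, by rw [← hp, hL]⟩

theorem norm_add_chart_sq {n : ℕ} (e : Sph (n + 1)) (t : ℝ) (y₀ y : Vel n) :
    ‖t • (e : Vel (n + 1)) + chart e y₀ + chart e y‖ ^ 2 = t ^ 2 + ‖y₀ + y‖ ^ 2 := by
  rw [add_assoc, ← map_add, norm_smul_add_chart, Real.sq_sqrt (by positivity)]

/-- Integration against the collision measure of a product, through a bound on hyperplanes for
the factor that depends on `v' - v`. -/
theorem lintegral_collisionMeasure_slice_le {n : ℕ} (hn : 1 ≤ n) {γ s b : ℝ} (hb0 : 0 ≤ b)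
    {β : ℝ → ℝ} (hβ : Measurable β) (hb : ∀ c, β c ≤ b) {A F : Vel (n + 1) → ℝ≥0∞}
    (hA : Measurable A) (hF : Measurable F) {S : ℝ≥0∞}
    (hS : ∀ e : Sph (n + 1), ∫⁻ y : Vel n, ENNReal.ofReal (‖y‖ ^ (-(n + 2 * s))) * F (chart e y)
      ≤ S) :
    ∫⁻ x, A x.2 * F x.1 ∂(collisionMeasure n γ s β) ≤ ENNReal.ofReal b * (2 ^ n * (S *
      ∫⁻ w, A w * ENNReal.ofReal (‖w‖ ^ (γ + 2 * s)))) := by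
  have hm : Measurable fun x : Vel (n + 1) × Vel (n + 1) => A x.2 * F x.1 :=
    (hA.comp measurable_snd).mul (hF.comp measurable_fst)
  refine (lintegral_collisionMeasure_le hβ hb0 hb hm).trans (mul_le_mul_right ?_ _)
  have hAm : Measurable fun w : Vel (n + 1) => A w * ENNReal.ofReal (‖w‖ ^ (γ + 2 * s)) :=
    hA.mul (by fun_prop)
  have hAs : Measurable fun p : Sph (n + 1) × ℝ => ENNReal.ofReal (p.2 ^ n) *
      (A (p.2 • (p.1 : Vel (n + 1))) * ENNReal.ofReal (‖p.2 • (p.1 : Vel (n + 1))‖ ^ (γ + 2 * s))) :=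
    Measurable.mul (by fun_prop) (hAm.comp (by fun_prop :
      Measurable fun p : Sph (n + 1) × ℝ => p.2 • (p.1 : Vel (n + 1))))
  rw [lintegral_collisionMeasure_carleman_swap hn measurable_one hm, lintegral_polar hAm]
  refine mul_le_mul_right ?_ _
  rw [← lintegral_const_mul _ hAs.lintegral_prod_right']
  refine lintegral_mono fun e => ?_
  have hAe : Measurable fun t : ℝ => ENNReal.ofReal (t ^ n) * (A (t • (e : Vel (n + 1))) *
      ENNReal.ofReal (‖t • (e : Vel (n + 1))‖ ^ (γ + 2 * s))) :=
    hAs.comp (measurable_prodMk_left (x := e))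
  rw [← lintegral_const_mul S hAe]
  refine setLIntegral_mono' measurableSet_Ioi fun t ht => ?_
  have ht' : (0 : ℝ) < t := ht
  have hnorm : ‖t • (e : Vel (n + 1))‖ = t := by
    rw [norm_smul, norm_eq_of_mem_sphere, mul_one, Real.norm_of_nonneg ht'.le]
  rw [hnorm]
  have hFc : Measurable fun y : Vel n => ENNReal.ofReal (‖y‖ ^ (-(n + 2 * s))) * F (chart e y) :=
    Measurable.mul (by fun_prop) (hF.comp (chart e).continuous.measurable)
  calc _ = ∫⁻ y : Vel n, ENNReal.ofReal (t ^ n) * (A (t • (e : Vel (n + 1))) *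
        ENNReal.ofReal (t ^ (γ + 2 * s))) *
        (ENNReal.ofReal (‖y‖ ^ (-(n + 2 * s))) * F (chart e y)) := by
        refine lintegral_congr fun y => ?_
        rw [Pi.one_apply, mul_one, ENNReal.ofReal_mul (by positivity),
          ENNReal.ofReal_mul (by positivity)]
        ring
    _ ≤ ENNReal.ofReal (t ^ n) * (A (t • (e : Vel (n + 1))) *
        ENNReal.ofReal (t ^ (γ + 2 * s))) * S := by
        rw [lintegral_const_mul _ hFc]
        exact mul_le_mul_right (hS e) _
    _ = _ := mul_comm _ _

/-- The weight near the origin, `q ≤ d + 1`, integrated against a profile. -/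
theorem exists_lintegral_inner_le {n : ℕ} (hn : 1 ≤ n) {γ s b q E₀ : ℝ}
    (hs : s ∈ Ioo (0 : ℝ) 1) (hγs : 0 ≤ γ + 2 * s) (hγs2 : γ + 2 * s ≤ 2) (hb0 : 0 ≤ b)
    (hq : q ≤ n + 2) (hE : 0 ≤ E₀) :
    ∃ C : ℝ, 0 ≤ C ∧ ∀ β : ℝ → ℝ, Measurable β → (∀ c, β c ≤ b) → ∀ (m₀ M₀ h₀ : ℝ)
      (f : Vel (n + 1) → ℝ), IsProfile m₀ M₀ E₀ h₀ f → ∀ v : Vel (n + 1), 1 ≤ ‖v‖ →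
      ∫⁻ x, ENNReal.ofReal (f (v + x.2) * min 1 (‖v + x.2‖ ^ 2 / ‖v‖ ^ 2)) *
        ENNReal.ofReal (({u | ‖v + u‖ < ‖v‖ / 2} : Set (Vel (n + 1))).indicator
          (fun u => decayWeight q (v + u)) x.1)
        ∂(collisionMeasure n γ s β) ≤ ENNReal.ofReal (C * (decayWeight q v * ‖v‖ ^ γ)) := by
  obtain ⟨hs0, hs1⟩ := hs
  have hint : Integrable fun η : Vel n => (1 + ‖η‖ ^ 2) ^ (-((n : ℝ) + 2) / 2) :=
    integrable_rpow_neg_one_add_norm_sq (by simp)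
  set I := ∫ η : Vel n, (1 + ‖η‖ ^ 2) ^ (-((n : ℝ) + 2) / 2) with hI
  have hI0 : 0 ≤ I := integral_nonneg fun η => by positivity
  have hIl : ∫⁻ η : Vel n, ENNReal.ofReal ((1 + ‖η‖ ^ 2) ^ (-((n : ℝ) + 2) / 2)) =
      ENNReal.ofReal I :=
    (ofReal_integral_eq_lintegral_ofReal hint (Eventually.of_forall fun η => by positivity)).symm
  set c₁ : ℝ := 2 ^ (n + 2 * s) * 2 ^ (((n : ℝ) + 2) / 2) * I with hc₁
  have hc₁0 : 0 ≤ c₁ := by positivity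
  refine ⟨b * (2 ^ n * (c₁ * (4 * E₀))), by positivity, fun β hβ hβb m₀ M₀ h₀ f h v hv => ?_⟩
  have hv0 : 0 < ‖v‖ := by linarith
  have hA : Measurable fun w => ENNReal.ofReal (f (v + w) * min 1 (‖v + w‖ ^ 2 / ‖v‖ ^ 2)) := by
    have := h.continuous
    exact Measurable.ennreal_ofReal (Continuous.measurable (by fun_prop))
  have hF : Measurable fun u => ENNReal.ofReal
      (({u | ‖v + u‖ < ‖v‖ / 2} : Set (Vel (n + 1))).indicator
          (fun u => decayWeight q (v + u)) u) := by
    refine Measurable.ennreal_ofReal (Measurable.indicator ?_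
      (measurableSet_lt (by fun_prop) measurable_const))
    exact (continuous_decayWeight q).measurable.comp (measurable_const_add v)
  have hslice : ∀ e : Sph (n + 1), ∫⁻ y : Vel n, ENNReal.ofReal (‖y‖ ^ (-(n + 2 * s))) *
      ENNReal.ofReal (({u | ‖v + u‖ < ‖v‖ / 2} : Set (Vel (n + 1))).indicator
          (fun u => decayWeight q (v + u)) (chart e y)) ≤
      ENNReal.ofReal (c₁ * ‖v‖ ^ (2 - 2 * s - q)) := by
    intro e
    obtain ⟨t, y₀, hty⟩ := exists_eq_smul_add_chart e v
    have hpt : ∀ y : Vel n, ENNReal.ofReal (‖y‖ ^ (-(n + 2 * s))) *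
        ENNReal.ofReal (({u | ‖v + u‖ < ‖v‖ / 2} : Set (Vel (n + 1))).indicator
          (fun u => decayWeight q (v + u)) (chart e y)) ≤
        ENNReal.ofReal (2 ^ (n + 2 * s) * 2 ^ (((n : ℝ) + 2) / 2) * ‖v‖ ^ (2 - 2 * s - q)) *
          ENNReal.ofReal ((1 + ‖y₀ + y‖ ^ 2) ^ (-((n : ℝ) + 2) / 2)) := by
      intro y
      by_cases hy : ‖v + chart e y‖ < ‖v‖ / 2
      · rw [indicator_of_mem (by exact hy), ← ENNReal.ofReal_mul (by positivity),
          ← ENNReal.ofReal_mul (by positivity)]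
        refine ENNReal.ofReal_le_ofReal ?_
        have hyn : ‖v‖ / 2 ≤ ‖y‖ := by
          have h1 := norm_sub_le (v + chart e y) (chart e y)
          rw [add_sub_cancel_right, (chart e).norm_map] at h1
          linarith
        have h1 : ‖y‖ ^ (-((n : ℝ) + 2 * s)) ≤ 2 ^ (n + 2 * s) * ‖v‖ ^ (-((n : ℝ) + 2 * s)) := by
          refine (Real.rpow_le_rpow_of_nonpos (by positivity) hyn
            (by have : (0 : ℝ) ≤ n := by positivity
                linarith)).trans (le_of_eq ?_)
          rw [Real.div_rpow hv0.le (by norm_num), Real.rpow_neg (by norm_num : (0 : ℝ) ≤ 2),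
            div_inv_eq_mul, mul_comm]
        have hle : ‖y₀ + y‖ ^ 2 ≤ ‖v + chart e y‖ ^ 2 := by
          rw [hty, norm_add_chart_sq]; nlinarith [sq_nonneg t]
        set V := max 1 ‖v + chart e y‖ with hV
        have hV1 : 1 ≤ V := le_max_left _ _
        have hVv : V ≤ ‖v‖ := max_le hv (by linarith)
        have hV2 : (1 + ‖y₀ + y‖ ^ 2) / 2 ≤ V ^ 2 := by
          have : ‖v + chart e y‖ ^ 2 ≤ V ^ 2 :=
            pow_le_pow_left₀ (norm_nonneg _) (le_max_right _ _) 2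
          nlinarith
        have h2 : decayWeight q (v + chart e y) ≤ 2 ^ (((n : ℝ) + 2) / 2) *
            (1 + ‖y₀ + y‖ ^ 2) ^ (-((n : ℝ) + 2) / 2) * ‖v‖ ^ ((n : ℝ) + 2 - q) := by
          calc decayWeight q (v + chart e y) = V ^ (-((n : ℝ) + 2)) * V ^ ((n : ℝ) + 2 - q) := by
                rw [decayWeight, ← Real.rpow_add (by linarith)]; congr 1; ring
            _ = (V ^ 2) ^ (-((n : ℝ) + 2) / 2) * V ^ ((n : ℝ) + 2 - q) := by
                rw [← Real.rpow_two, ← Real.rpow_mul (by linarith)]; congr 2; ring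
            _ ≤ ((1 + ‖y₀ + y‖ ^ 2) / 2) ^ (-((n : ℝ) + 2) / 2) * ‖v‖ ^ ((n : ℝ) + 2 - q) := by
                refine mul_le_mul (Real.rpow_le_rpow_of_nonpos (by positivity) hV2 ?_)
                  (Real.rpow_le_rpow (by linarith) hVv (by linarith)) (by positivity)
                  (by positivity)
                have : (0 : ℝ) ≤ n := by positivity
                linarith
            _ = _ := by
                rw [Real.div_rpow (by positivity) (by norm_num), neg_div,
                  Real.rpow_neg (by norm_num : (0 : ℝ) ≤ 2), div_inv_eq_mul]
                ring
        calc _ ≤ 2 ^ (n + 2 * s) * ‖v‖ ^ (-((n : ℝ) + 2 * s)) * (2 ^ (((n : ℝ) + 2) / 2) *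
            (1 + ‖y₀ + y‖ ^ 2) ^ (-((n : ℝ) + 2) / 2) * ‖v‖ ^ ((n : ℝ) + 2 - q)) :=
              mul_le_mul h1 h2 (decayWeight_pos _ _).le (by positivity)
          _ = _ := by
              rw [show 2 - 2 * s - q = -((n : ℝ) + 2 * s) + ((n : ℝ) + 2 - q) by ring,
                Real.rpow_add hv0]
              ring
      · rw [indicator_of_notMem (by exact hy)]; simp
    have hme : Measurable fun η : Vel n =>
      ENNReal.ofReal ((1 + ‖η‖ ^ 2) ^ (-((n : ℝ) + 2) / 2)) := by fun_prop
    refine (lintegral_mono hpt).trans (le_of_eq ?_)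
    rw [lintegral_const_mul' _ _ ENNReal.ofReal_ne_top,
      lintegral_add_left_eq_self (fun η : Vel n =>
      ENNReal.ofReal ((1 + ‖η‖ ^ 2) ^ (-((n : ℝ) + 2) / 2))) y₀, hIl,
      ← ENNReal.ofReal_mul (by positivity), hc₁]
    congr 1; ring
  refine (lintegral_collisionMeasure_slice_le hn hb0 hβ hβb hA hF hslice).trans ?_
  refine (mul_le_mul_right (mul_le_mul_right (mul_le_mul_right
    (h.lintegral_min_le hγs hγs2 hv0) _) _) _).trans (le_of_eq ?_)
  rw [show (2 : ℝ≥0∞) ^ n = ENNReal.ofReal (2 ^ n) by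
      rw [ENNReal.ofReal_pow (by norm_num)]; norm_num,
    ← ENNReal.ofReal_mul (by positivity), ← ENNReal.ofReal_mul (by positivity),
    ← ENNReal.ofReal_mul (by positivity), decayWeight_of_one_le q hv, ← Real.rpow_add hv0]
  congr 1
  rw [show -q + γ = (2 - 2 * s - q) + (γ + 2 * s - 2) by ring, Real.rpow_add hv0]
  ring

/-- The same region with the roles of `v'` and `v'_*` exchanged: the profile is evaluated close to
the origin and the weight far from it. The dependence on `q` is explicit, and mild if `l² q ≤ 1`. -/
theorem exists_lintegral_swapped_le {n : ℕ} (hn : 1 ≤ n) {γ s b q₁ : ℝ} (hs : s ∈ Ioo (0 : ℝ) 1)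
    (hγs : 0 ≤ γ + 2 * s) (hb0 : 0 ≤ b) (hq₁ : n + 1 + γ + 2 * s < q₁) :
    ∃ C : ℝ, 0 ≤ C ∧ ∀ β : ℝ → ℝ, Measurable β → (∀ c, β c ≤ b) → ∀ q : ℝ, q₁ ≤ q →
      ∀ v : Vel (n + 1), 1 ≤ ‖v‖ → ∀ l : ℝ, 0 ≤ l → l ≤ 1 / 2 →
      ∀ F : Vel (n + 1) → ℝ≥0∞, Measurable F → (∀ u, F u ≠ 0 → ‖v + u‖ ≤ l * ‖v‖) →
      ∫⁻ x, F x.1 * ENNReal.ofReal (decayWeight q (v + x.2)) ∂(collisionMeasure n γ s β) ≤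
        ENNReal.ofReal (C * (1 - l ^ 2) ^ (-q / 2) * (decayWeight q v * ‖v‖ ^ γ)) *
          ∫⁻ u, F u := by
  obtain ⟨hs0, hs1⟩ := hs
  have hn0 : (0 : ℝ) ≤ n := by positivity
  set m := γ + 2 * s + 1 with hm
  have hm0 : 0 ≤ m := by linarith
  have hint : Integrable fun η : Vel n => (1 + ‖η‖ ^ 2) ^ (-(q₁ - m) / 2) :=
    integrable_rpow_neg_one_add_norm_sq (by simp; linarith)
  set I := ∫ η : Vel n, (1 + ‖η‖ ^ 2) ^ (-(q₁ - m) / 2) with hI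
  have hI0 : 0 ≤ I := integral_nonneg fun η => by positivity
  have hIl : ∫⁻ η : Vel n, ENNReal.ofReal ((1 + ‖η‖ ^ 2) ^ (-(q₁ - m) / 2)) =
      ENNReal.ofReal I :=
    (ofReal_integral_eq_lintegral_ofReal hint (Eventually.of_forall fun η => by positivity)).symm
  refine ⟨b * (2 ^ n * (2 ^ (n + 1 + 2 * s) * (2 ^ m * I))), by positivity,
    fun β hβ hβb q hq v hv l hl0 hl F hF hFs => ?_⟩
  have hv0 : 0 < ‖v‖ := by linarith
  have hl2 : 0 < 1 - l ^ 2 := by nlinarith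
  have hq0 : 0 ≤ q := by linarith
  have hmea : Measurable fun x : Vel (n + 1) × Vel (n + 1) =>
      F x.1 * ENNReal.ofReal (decayWeight q (v + x.2)) :=
    (hF.comp measurable_fst).mul (Measurable.ennreal_ofReal
      ((continuous_decayWeight q).measurable.comp (by fun_prop)))
  refine (lintegral_collisionMeasure_le hβ hb0 hβb hmea).trans ?_
  rw [lintegral_collisionMeasure_carleman hn measurable_one hmea, lintegral_polar hF]
  -- the weight on a hyperplane orthogonal to `u`
  have hslice : ∀ (e : Sph (n + 1)) (t : ℝ), ‖v + t • (e : Vel (n + 1))‖ ≤ l * ‖v‖ →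
      ∫⁻ y : Vel n, ENNReal.ofReal (‖y‖ ^ m) * ENNReal.ofReal (decayWeight q (v + chart e y)) ≤
        ENNReal.ofReal (2 ^ m * I * ((1 - l ^ 2) ^ (-q / 2) * ‖v‖ ^ (m + n - q))) := by
    intro e t ht
    obtain ⟨a, y₀, hay⟩ := exists_eq_smul_add_chart e v
    have ht2 : (a + t) ^ 2 + ‖y₀‖ ^ 2 ≤ l ^ 2 * ‖v‖ ^ 2 := by
      have h1 := pow_le_pow_left₀ (norm_nonneg _) ht 2
      have h2 : v + t • (e : Vel (n + 1)) = (a + t) • (e : Vel (n + 1)) + chart e y₀ := by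
        nth_rewrite 1 [hay]; module
      rw [h2, norm_smul_add_chart, Real.sq_sqrt (by positivity), mul_pow] at h1
      exact h1
    have hv2 : ‖v‖ ^ 2 = a ^ 2 + ‖y₀‖ ^ 2 := by
      rw [hay, norm_smul_add_chart, Real.sq_sqrt (by positivity)]
    have hpt : ∀ y : Vel n, ENNReal.ofReal (‖y‖ ^ m) *
        ENNReal.ofReal (decayWeight q (v + chart e y)) ≤
        ENNReal.ofReal (2 ^ m * ((1 - l ^ 2) ^ (-q / 2) * ‖v‖ ^ (q₁ - q))) *
          ENNReal.ofReal ((‖v‖ ^ 2 + ‖y₀ + y‖ ^ 2) ^ (-(q₁ - m) / 2)) := by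
      intro y
      rw [← ENNReal.ofReal_mul (by positivity), ← ENNReal.ofReal_mul (by positivity)]
      refine ENNReal.ofReal_le_ofReal ?_
      set Z := ‖v‖ ^ 2 + ‖y₀ + y‖ ^ 2 with hZ
      have hZ0 : 0 < Z := by positivity
      have hZv : ‖v‖ ^ 2 ≤ Z := by rw [hZ]; linarith [sq_nonneg ‖y₀ + y‖]
      have h1 : ‖y‖ ^ m ≤ 2 ^ m * Z ^ (m / 2) := by
        have hy : ‖y‖ ≤ 2 * √Z := by
          have h3 : ‖y‖ ≤ ‖y₀ + y‖ + ‖y₀‖ := by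
            have := norm_sub_le (y₀ + y) y₀
            rwa [add_sub_cancel_left] at this
          have h4 : ‖y₀ + y‖ ≤ √Z := Real.le_sqrt_of_sq_le (by rw [hZ]; linarith [sq_nonneg ‖v‖])
          have h5 : ‖y₀‖ ≤ √Z := Real.le_sqrt_of_sq_le (by nlinarith [sq_nonneg a])
          linarith
        calc ‖y‖ ^ m ≤ (2 * √Z) ^ m := Real.rpow_le_rpow (norm_nonneg _) hy hm0
          _ = _ := by
            rw [Real.mul_rpow (by norm_num) (Real.sqrt_nonneg _), Real.sqrt_eq_rpow,
              ← Real.rpow_mul hZ0.le]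
            congr 2; ring
      have hlow : (1 - l ^ 2) * Z ≤ ‖v + chart e y‖ ^ 2 := by
        have : v + chart e y = a • (e : Vel (n + 1)) + chart e y₀ + chart e y := by rw [← hay]
        rw [this, norm_add_chart_sq, hZ]
        nlinarith [sq_nonneg (a + t), sq_nonneg ‖y₀ + y‖, sq_nonneg l,
          mul_nonneg (sq_nonneg l) (sq_nonneg ‖y₀ + y‖)]
      have hpos : 0 < ‖v + chart e y‖ := by
        have : 0 < ‖v + chart e y‖ ^ 2 := lt_of_lt_of_le (by positivity) hlow
        exact (sq_pos_iff.1 this).lt_of_le' (norm_nonneg _)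
      have h2 : decayWeight q (v + chart e y) ≤ (1 - l ^ 2) ^ (-q / 2) * Z ^ (-q / 2) := by
        calc _ ≤ ‖v + chart e y‖ ^ (-q) := decayWeight_le_rpow hq0 hpos
          _ = (‖v + chart e y‖ ^ 2) ^ (-q / 2) := by
              rw [← Real.rpow_two, ← Real.rpow_mul (norm_nonneg _)]; congr 1; ring
          _ ≤ ((1 - l ^ 2) * Z) ^ (-q / 2) :=
              Real.rpow_le_rpow_of_nonpos (by positivity) hlow (by linarith)
          _ = _ := Real.mul_rpow hl2.le hZ0.le
      have h3 : Z ^ ((q₁ - q) / 2) ≤ ‖v‖ ^ (q₁ - q) := by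
        refine (Real.rpow_le_rpow_of_nonpos (by positivity) hZv (by linarith)).trans (le_of_eq ?_)
        rw [← Real.rpow_two, ← Real.rpow_mul hv0.le]; congr 1; ring
      calc _ ≤ 2 ^ m * Z ^ (m / 2) * ((1 - l ^ 2) ^ (-q / 2) * Z ^ (-q / 2)) :=
            mul_le_mul h1 h2 (decayWeight_pos _ _).le (by positivity)
        _ = 2 ^ m * ((1 - l ^ 2) ^ (-q / 2) * Z ^ ((q₁ - q) / 2)) * Z ^ (-(q₁ - m) / 2) := by
            have : Z ^ (m / 2) * Z ^ (-q / 2) = Z ^ ((q₁ - q) / 2) * Z ^ (-(q₁ - m) / 2) := by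
              rw [← Real.rpow_add hZ0, ← Real.rpow_add hZ0]; congr 1; ring
            linear_combination (2 ^ m * (1 - l ^ 2) ^ (-q / 2)) * this
        _ ≤ _ := by gcongr
    have hme : Measurable fun η : Vel n =>
      ENNReal.ofReal ((‖v‖ ^ 2 + ‖η‖ ^ 2) ^ (-(q₁ - m) / 2)) := by fun_prop
    refine (lintegral_mono hpt).trans (le_of_eq ?_)
    rw [lintegral_const_mul' _ _ ENNReal.ofReal_ne_top,
      lintegral_add_left_eq_self (fun η : Vel n =>
      ENNReal.ofReal ((‖v‖ ^ 2 + ‖η‖ ^ 2) ^ (-(q₁ - m) / 2))) y₀,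
      lintegral_comp_smul_pos hv0 hme]
    have e1 : ∀ η : Vel n, ENNReal.ofReal ((‖v‖ ^ 2 + ‖‖v‖ • η‖ ^ 2) ^ (-(q₁ - m) / 2)) =
        ENNReal.ofReal (‖v‖ ^ (-(q₁ - m))) * ENNReal.ofReal ((1 + ‖η‖ ^ 2) ^ (-(q₁ - m) / 2)) := by
      intro η
      rw [← ENNReal.ofReal_mul (by positivity), norm_smul, norm_norm,
        show ‖v‖ ^ 2 + (‖v‖ * ‖η‖) ^ 2 = ‖v‖ ^ 2 * (1 + ‖η‖ ^ 2) by ring,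
        Real.mul_rpow (by positivity) (by positivity)]
      congr 2
      rw [← Real.rpow_two, ← Real.rpow_mul hv0.le]; congr 1; ring
    simp_rw [e1]
    rw [lintegral_const_mul _ (by fun_prop), hIl, ← ENNReal.ofReal_mul (by positivity),
      ← ENNReal.ofReal_mul (by positivity), ← ENNReal.ofReal_mul (by positivity)]
    congr 1
    rw [show m + n - q = (q₁ - q) + (n + -(q₁ - m)) by ring, Real.rpow_add hv0,
      Real.rpow_add hv0, Real.rpow_natCast]
    ring
  set K : ℝ := 2 ^ (n + 1 + 2 * s) * (2 ^ m * I) * (1 - l ^ 2) ^ (-q / 2) *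
    (decayWeight q v * ‖v‖ ^ γ) with hK
  have hφ := (decayWeight_pos q v).le
  have hFp : Measurable fun p : Sph (n + 1) × ℝ => ENNReal.ofReal (p.2 ^ n) *
      F (p.2 • (p.1 : Vel (n + 1))) :=
    Measurable.mul (by fun_prop) (hF.comp (by fun_prop :
      Measurable fun p : Sph (n + 1) × ℝ => p.2 • (p.1 : Vel (n + 1))))
  have hKe : ENNReal.ofReal (b * (2 ^ n * (2 ^ (n + 1 + 2 * s) * (2 ^ m * I))) *
      (1 - l ^ 2) ^ (-q / 2) * (decayWeight q v * ‖v‖ ^ γ)) =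
      ENNReal.ofReal b * (2 ^ n * ENNReal.ofReal K) := by
    rw [show (2 : ℝ≥0∞) ^ n = ENNReal.ofReal (2 ^ n) by
        rw [ENNReal.ofReal_pow (by norm_num)]; norm_num,
      ← ENNReal.ofReal_mul (by positivity), ← ENNReal.ofReal_mul (by positivity), hK]
    congr 1; ring
  rw [hKe, mul_assoc, mul_assoc]
  refine mul_le_mul_right (mul_le_mul_right ?_ _) _
  rw [← lintegral_const_mul _ hFp.lintegral_prod_right']
  refine lintegral_mono fun e => ?_
  rw [← lintegral_const_mul' _ _ ENNReal.ofReal_ne_top]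
  refine setLIntegral_mono' measurableSet_Ioi fun t ht => ?_
  have ht' : (0 : ℝ) < t := ht
  by_cases hF0 : F (t • (e : Vel (n + 1))) = 0
  · simp [hF0]
  have hsup := hFs _ hF0
  have htv : ‖v‖ / 2 ≤ t := by
    have h1 := norm_sub_le (v + t • (e : Vel (n + 1))) (t • (e : Vel (n + 1)))
    rw [add_sub_cancel_right, norm_smul, norm_eq_of_mem_sphere, mul_one,
      Real.norm_of_nonneg ht'.le] at h1
    nlinarith
  have htp : t ^ (-1 - 2 * s) ≤ t ^ n * (2 ^ (n + 1 + 2 * s) * ‖v‖ ^ (-(n + 1 + 2 * s))) := by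
    have h1 : t ^ (-1 - 2 * s) = t ^ n * t ^ (-((n : ℝ) + 1 + 2 * s)) := by
      rw [← Real.rpow_natCast, ← Real.rpow_add ht']; congr 1; ring
    rw [h1]
    gcongr
    refine (Real.rpow_le_rpow_of_nonpos (by positivity) htv (by linarith)).trans (le_of_eq ?_)
    rw [Real.div_rpow hv0.le (by norm_num), Real.rpow_neg (by norm_num : (0 : ℝ) ≤ 2),
      div_inv_eq_mul, mul_comm]
  have hms : Measurable fun y : Vel n => ENNReal.ofReal (‖y‖ ^ m) *
      ENNReal.ofReal (decayWeight q (v + chart e y)) :=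
    Measurable.mul (by fun_prop) (Measurable.ennreal_ofReal
      ((continuous_decayWeight q).measurable.comp
        ((chart e).continuous.measurable.const_add v)))
  calc _ = ∫⁻ y : Vel n, ENNReal.ofReal (t ^ (-1 - 2 * s)) * F (t • (e : Vel (n + 1))) *
        (ENNReal.ofReal (‖y‖ ^ m) * ENNReal.ofReal (decayWeight q (v + chart e y))) := by
        refine lintegral_congr fun y => ?_
        rw [Pi.one_apply, mul_one, ENNReal.ofReal_mul (by positivity)]
        ring
    _ = ENNReal.ofReal (t ^ (-1 - 2 * s)) * F (t • (e : Vel (n + 1))) *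
        ∫⁻ y : Vel n, (ENNReal.ofReal (‖y‖ ^ m) *
          ENNReal.ofReal (decayWeight q (v + chart e y))) := lintegral_const_mul _ hms
    _ ≤ ENNReal.ofReal (t ^ n * (2 ^ (n + 1 + 2 * s) * ‖v‖ ^ (-(n + 1 + 2 * s)))) *
        F (t • (e : Vel (n + 1))) *
        ENNReal.ofReal (2 ^ m * I * ((1 - l ^ 2) ^ (-q / 2) * ‖v‖ ^ (m + n - q))) := by
        gcongr
        exact hslice e t hsup
    _ = _ := by
        rw [mul_right_comm, ← ENNReal.ofReal_mul (by positivity)]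
        change _ = ENNReal.ofReal K * (ENNReal.ofReal (t ^ n) * F (t • (e : Vel (n + 1))))
        rw [← mul_assoc (ENNReal.ofReal K), ← ENNReal.ofReal_mul (by positivity)]
        congr 2
        rw [hK, decayWeight_of_one_le q hv, ← Real.rpow_add hv0,
          show -q + γ = -((n : ℝ) + 1 + 2 * s) + (m + n - q) by rw [hm]; ring, Real.rpow_add hv0]
        ring

/-! ### Contact with a barrier of exponent at most `d + 1` -/

theorem two_pow_eq_ofReal (n : ℕ) : (2 : ℝ≥0∞) ^ n = ENNReal.ofReal (2 ^ n) := by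
  rw [ENNReal.ofReal_pow (by norm_num)]; norm_num

/-- Energy conservation: `|v'|² + |v'_*|² ≥ |v|²`. -/
theorem norm_sq_le_add_of_inner_eq_zero {d : ℕ} {v u w : Vel d} (h : ⟪u, w⟫ = 0) :
    ‖v‖ ^ 2 ≤ ‖v + u‖ ^ 2 + ‖v + w‖ ^ 2 := by
  have h1 : ‖v + u‖ ^ 2 + ‖v + w‖ ^ 2 = ‖v‖ ^ 2 + ‖v + u + w‖ ^ 2 := by
    simp only [norm_add_sq_real, inner_add_left, h]; ring
  rw [h1]; linarith [sq_nonneg ‖v + u + w‖]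

/-- The gain part of the collision operator acting on a weight of exponent at most `d + 1`. -/
theorem exists_weight_gain {n : ℕ} (hn : 1 ≤ n) {γ s b q E₀ : ℝ}
    (hs : s ∈ Ioo (0 : ℝ) 1) (hγs : 0 ≤ γ + 2 * s) (hγs2 : γ + 2 * s ≤ 2) (hb0 : 0 ≤ b)
    (hq0 : 0 ≤ q) (hq : q ≤ n + 2) (hE : 0 ≤ E₀) :
    ∃ C : ℝ, 0 ≤ C ∧ ∀ β : ℝ → ℝ, Measurable β → (∀ c, β c ≤ b) → ∀ (m₀ M₀ h₀ : ℝ)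
      (f : Vel (n + 1) → ℝ), IsProfile m₀ M₀ E₀ h₀ f → ∀ v : Vel (n + 1),
      ∃ P : Vel (n + 1) × Vel (n + 1) → ℝ, Measurable P ∧ (∀ x, 0 ≤ P x) ∧
        (∀ u w, ⟪u, w⟫ = 0 → f (v + w) * (decayWeight q (v + u) - decayWeight q v) ≤
          f (v + w) * tilt (1 / 4) q v u + P (u, w)) ∧
        ∫⁻ x, ENNReal.ofReal (P x) ∂(collisionMeasure n γ s β) ≤
          ENNReal.ofReal (C * (decayWeight q v * max 1 ‖v‖ ^ γ)) := by
  obtain ⟨C₁, hC₁0, hC₁⟩ := exists_decayWeight_increment_le (d := n + 1) (κ := 1 / 4) (q := q)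
    (by norm_num) le_rfl hq0
  obtain ⟨C₂, hC₂0, hC₂⟩ := exists_lintegral_remainder_le (γ := γ) (b := b) (κ := 1 / 4)
    (E₀ := E₀) hn hs hγs hγs2 hb0 (by norm_num) hE
  obtain ⟨C₃, hC₃0, hC₃⟩ := exists_lintegral_inner_le (γ := γ) (b := b) (q := q) (E₀ := E₀)
    hn hs hγs hγs2 hb0 hq hE
  refine ⟨C₁ * C₂ + 4 * C₃, by positivity, fun β hβ hβb m₀ M₀ h₀ f h v => ?_⟩
  have hφ := decayWeight_pos q v
  rcases lt_or_ge ‖v‖ 1 with hv | hv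
  · -- the weight is maximal at `v`
    refine ⟨fun _ => 0, measurable_const, fun _ => le_rfl, fun u w _ => ?_, ?_⟩
    · have h1 : tilt (1 / 4) q v u = 0 := by
        unfold tilt; exact indicator_of_notMem (fun hu => absurd hu.1 (not_le.2 hv)) _
      have h2 : decayWeight q v = 1 := by
        unfold decayWeight; rw [max_eq_left hv.le, Real.one_rpow]
      rw [h1, h2, mul_zero, add_zero]
      exact mul_nonpos_of_nonneg_of_nonpos (h.nonneg _)
        (sub_nonpos.2 (decayWeight_le_one hq0 _))
    · simp
  · have hv0 : 0 < ‖v‖ := by linarith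
    let I : Vel (n + 1) → ℝ := ({u | ‖v + u‖ < ‖v‖ / 2} : Set (Vel (n + 1))).indicator
          (fun u => decayWeight q (v + u))
    have hI0 : ∀ u, 0 ≤ I u := fun u => indicator_nonneg (fun u _ => (decayWeight_pos q _).le) u
    have hIm : Measurable I := Measurable.indicator
      ((continuous_decayWeight q).measurable.comp (measurable_const_add v))
      (measurableSet_lt (by fun_prop) measurable_const)
    let P₁ : Vel (n + 1) × Vel (n + 1) → ℝ := fun x => f (v + x.2) * remainderWeight (1 / 4) v x.1 x.2
    let P₂ : Vel (n + 1) × Vel (n + 1) → ℝ := fun x =>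
      f (v + x.2) * min 1 (‖v + x.2‖ ^ 2 / ‖v‖ ^ 2)
    have hc := h.continuous
    have hP₁ : Measurable P₁ :=
      (Continuous.measurable (by fun_prop)).mul (measurable_remainderWeight _ v)
    have hP₂ : Measurable P₂ := Continuous.measurable (by fun_prop)
    have hP₁0 : ∀ x, 0 ≤ P₁ x := fun x => mul_nonneg (h.nonneg _) (remainderWeight_nonneg _ _ _ _)
    have hP₂0 : ∀ x, 0 ≤ P₂ x := fun x =>
      mul_nonneg (h.nonneg _) (le_min zero_le_one (by positivity))
    refine ⟨fun x => C₁ * decayWeight q v * P₁ x + 4 * (P₂ x * I x.1),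
      (hP₁.const_mul _).add ((hP₂.mul (hIm.comp measurable_fst)).const_mul _),
      fun x => add_nonneg (mul_nonneg (by positivity) (hP₁0 x))
        (mul_nonneg (by norm_num) (mul_nonneg (hP₂0 x) (hI0 _))), fun u w huw => ?_, ?_⟩
    · have hf0 := h.nonneg (v + w)
      simp only [P₁, P₂, I]
      rcases lt_or_ge ‖v + u‖ (‖v‖ / 2) with hu | hu
      · have h1 : ‖v‖ / 2 ≤ ‖u‖ := by
          have := norm_sub_le (v + u) u
          rw [add_sub_cancel_right] at this
          linarith
        have h2 : tilt (1 / 4) q v u = 0 := by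
          unfold tilt
          exact indicator_of_notMem (fun hu' => absurd hu'.2 (not_le.2 (by linarith))) _
        -- by energy conservation `|v'_*|` is comparable to `|v|` where `|v'|` is small
        have h3 : 1 ≤ 4 * min 1 (‖v + w‖ ^ 2 / ‖v‖ ^ 2) := by
          rw [mul_min_of_nonneg _ _ (by norm_num)]
          refine le_min (by norm_num) ?_
          rw [mul_div_assoc', le_div_iff₀ (by positivity)]
          have := norm_sq_le_add_of_inner_eq_zero (v := v) huw
          nlinarith [norm_nonneg (v + u)]
        rw [indicator_of_mem (by exact hu), h2, mul_zero, zero_add]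
        have h4 : 0 ≤ C₁ * decayWeight q v * (f (v + w) * remainderWeight (1 / 4) v u w) :=
          mul_nonneg (by positivity) (hP₁0 (u, w))
        have h5 := mul_le_mul_of_nonneg_left h3
          (mul_nonneg hf0 (decayWeight_pos q (v + u)).le)
        have h6 := mul_nonneg hf0 hφ.le
        linarith
      · rw [indicator_of_notMem (by simpa using hu), mul_zero, mul_zero, add_zero]
        have := mul_le_mul_of_nonneg_left (hC₁ v u w hv huw hu) hf0
        linarith
    · have e1 : ∀ x : Vel (n + 1) × Vel (n + 1),
          ENNReal.ofReal (C₁ * decayWeight q v * P₁ x + 4 * (P₂ x * I x.1)) =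
          ENNReal.ofReal (C₁ * decayWeight q v) * ENNReal.ofReal (P₁ x) +
          ENNReal.ofReal 4 * (ENNReal.ofReal (P₂ x) * ENNReal.ofReal (I x.1)) := fun x => by
        rw [ENNReal.ofReal_add (mul_nonneg (by positivity) (hP₁0 x))
          (mul_nonneg (by norm_num) (mul_nonneg (hP₂0 x) (hI0 _))),
          ENNReal.ofReal_mul (p := C₁ * decayWeight q v) (by positivity),
          ENNReal.ofReal_mul (p := 4) (by norm_num), ENNReal.ofReal_mul (hP₂0 x)]
      simp_rw [e1]
      rw [lintegral_add_left (hP₁.ennreal_ofReal.const_mul _),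
        lintegral_const_mul' _ _ ENNReal.ofReal_ne_top,
        lintegral_const_mul' _ _ ENNReal.ofReal_ne_top]
      refine (add_le_add (mul_le_mul_right (hC₂ β hβ hβb m₀ M₀ h₀ f h v hv0) _)
        (mul_le_mul_right (hC₃ β hβ hβb m₀ M₀ h₀ f h v hv) _)).trans ?_
      rw [← ENNReal.ofReal_mul (by positivity), ← ENNReal.ofReal_mul (by positivity),
        ← ENNReal.ofReal_add (by positivity) (by positivity), max_eq_right hv]
      refine ENNReal.ofReal_le_ofReal ?_
      have h1 : ‖v‖ ^ (γ - 2) ≤ ‖v‖ ^ γ := Real.rpow_le_rpow_of_exponent_le hv (by linarith)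
      have h2 : C₁ * decayWeight q v * (C₂ * ‖v‖ ^ (γ - 2)) ≤
          C₁ * decayWeight q v * (C₂ * ‖v‖ ^ γ) := by gcongr
      linarith

theorem surfaceMeasure_univ_pos {n : ℕ} (hn : 1 ≤ n) : 0 < (surfaceMeasure n univ).toReal := by
  have : Nonempty (Fin n) := ⟨⟨0, hn⟩⟩
  refine ENNReal.toReal_pos ?_ (measure_ne_top _ _)
  rw [surfaceMeasure, Measure.toSphere_apply_univ, finrank_euclideanSpace, Fintype.card_fin]
  exact mul_ne_zero (by exact_mod_cast (by omega : n ≠ 0))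
    (Metric.measure_ball_pos _ _ one_pos).ne'

/-- Collisions with `r < |v' - v| < 2r`: lower bound of their total weight. -/
theorem exists_le_lintegral_band {n : ℕ} (hn : 1 ≤ n) {γ s b : ℝ} (hs : 0 < s) (hb : 0 < b) :
    ∃ c : ℝ, 0 < c ∧ ∀ β : ℝ → ℝ, Measurable β → (∀ x, b ≤ β x) →
      ∀ A : Vel (n + 1) → ℝ≥0∞, Measurable A → ∀ a r : ℝ, 0 ≤ a → 0 < r →
      ENNReal.ofReal a ≤ ∫⁻ w, A w * ENNReal.ofReal (‖w‖ ^ (γ + 2 * s)) →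
      ENNReal.ofReal (c * a * r ^ (-(2 * s))) ≤
        ∫⁻ x, A x.2 * (Ioo r (2 * r)).indicator 1 ‖x.1‖ ∂(collisionMeasure n γ s β) := by
  have hS := surfaceMeasure_univ_pos hn
  set S := (surfaceMeasure n univ).toReal with hSd
  refine ⟨b * (2 ^ n * S) * 2 ^ (-1 - 2 * s), by positivity,
    fun β hβ hβb A hA a r ha hr hle => ?_⟩
  have hI : Measurable ((Ioo r (2 * r)).indicator (1 : ℝ → ℝ≥0∞)) :=
    measurable_one.indicator measurableSet_Ioo
  have hF : Measurable fun x : Vel (n + 1) × Vel (n + 1) =>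
      A x.2 * (Ioo r (2 * r)).indicator 1 ‖x.1‖ :=
    (hA.comp measurable_snd).mul (hI.comp (by fun_prop))
  refine le_trans ?_ (le_lintegral_collisionMeasure hβ hb.le hβb hF)
  rw [lintegral_collisionMeasure_mul hn hA hI]
  have hτ : ENNReal.ofReal (2 ^ (-1 - 2 * s) * r ^ (-(2 * s))) ≤
      ∫⁻ τ in Ioi (0 : ℝ), ENNReal.ofReal (τ ^ (-1 - 2 * s)) * (Ioo r (2 * r)).indicator 1 τ := by
    calc _ = ∫⁻ τ in Ioo r (2 * r), ENNReal.ofReal ((2 * r) ^ (-1 - 2 * s)) := by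
          rw [setLIntegral_const, Real.volume_Ioo, ← ENNReal.ofReal_mul (by positivity)]
          congr 1
          rw [Real.mul_rpow (by norm_num) hr.le, show -(2 * s) = (-1 - 2 * s) + 1 by ring,
            Real.rpow_add hr, Real.rpow_one]
          ring
      _ ≤ ∫⁻ τ in Ioo r (2 * r), ENNReal.ofReal (τ ^ (-1 - 2 * s)) *
          (Ioo r (2 * r)).indicator 1 τ := by
          refine setLIntegral_mono' measurableSet_Ioo fun τ hτ => ?_
          rw [indicator_of_mem hτ, Pi.one_apply, mul_one]
          exact ENNReal.ofReal_le_ofReal (Real.rpow_le_rpow_of_nonpos (hr.trans hτ.1) hτ.2.le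
            (by linarith))
      _ ≤ _ := lintegral_mono_set fun τ hτ => hr.trans hτ.1
  calc _ = ENNReal.ofReal b * (2 ^ n * surfaceMeasure n univ * ENNReal.ofReal a *
        ENNReal.ofReal (2 ^ (-1 - 2 * s) * r ^ (-(2 * s)))) := by
        rw [← ENNReal.ofReal_toReal (measure_ne_top (surfaceMeasure n) univ), ← hSd,
          two_pow_eq_ofReal, ← ENNReal.ofReal_mul (by positivity),
          ← ENNReal.ofReal_mul (by positivity), ← ENNReal.ofReal_mul (by positivity),
          ← ENNReal.ofReal_mul (by positivity)]
        congr 1; ring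
    _ ≤ _ := by gcongr

/-- Collisions with `v'_*` in a ball and `v' - v` in a given set, through the volume of the set. -/
theorem exists_lintegral_core_le {n : ℕ} (hn : 1 ≤ n) {γ s b R L₀ : ℝ} (hs : 0 < s)
    (hγs : 0 ≤ γ + 2 * s) (hb0 : 0 ≤ b) (hR : 1 ≤ R) (hL₀ : 0 ≤ L₀) :
    ∃ C : ℝ, 0 ≤ C ∧ ∀ β : ℝ → ℝ, Measurable β → (∀ c, β c ≤ b) →
      ∀ h : Vel (n + 1) → ℝ, Measurable h → (∀ x, h x ≤ L₀) → (∀ x, R < ‖x‖ → h x = 0) →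
      ∀ v : Vel (n + 1), ∀ r : ℝ, 0 < r → ∀ B : Set (Vel (n + 1)), MeasurableSet B →
      (∀ u ∈ B, r < ‖u‖) →
      ∫⁻ x, ENNReal.ofReal (h (v + x.2)) * B.indicator 1 x.1 ∂(collisionMeasure n γ s β) ≤
        ENNReal.ofReal (C * max 1 ‖v‖ ^ (γ + 2 * s + 1) * r ^ (-(n + 1 + 2 * s))) * volume B := by
  set m := γ + 2 * s + 1 with hm
  have hm0 : 0 ≤ m := by linarith
  have hn0 : (0 : ℝ) ≤ n := by positivity
  have hfin : volume (Metric.closedBall (0 : Vel n) R) ≠ ⊤ := measure_closedBall_lt_top.ne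
  set D := (volume (Metric.closedBall (0 : Vel n) R)).toReal with hD
  refine ⟨b * 2 ^ n * (L₀ * (1 + R) ^ m * D), by positivity,
    fun β hβ hβb h hh hhL hhR v r hr B hB hBr => ?_⟩
  have hV1 : 1 ≤ max 1 ‖v‖ := le_max_left _ _
  set V := max 1 ‖v‖ with hV
  have hm1 : Measurable fun w => ENNReal.ofReal (h (v + w)) :=
    (hh.comp (measurable_const_add v)).ennreal_ofReal
  have hB1 : Measurable (B.indicator (1 : Vel (n + 1) → ℝ≥0∞)) := measurable_one.indicator hB
  have hF : Measurable fun x : Vel (n + 1) × Vel (n + 1) =>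
      ENNReal.ofReal (h (v + x.2)) * B.indicator 1 x.1 :=
    (hm1.comp measurable_snd).mul (hB1.comp measurable_fst)
  refine (lintegral_collisionMeasure_le hβ hb0 hβb hF).trans ?_
  have hvol : volume B = ∫⁻ u, B.indicator 1 u := (lintegral_indicator_one hB).symm
  rw [lintegral_collisionMeasure_carleman hn measurable_one hF, hvol, lintegral_polar hB1]
  have hslice : ∀ e : Sph (n + 1), ∫⁻ y : Vel n, ENNReal.ofReal (‖y‖ ^ m) *
      ENNReal.ofReal (h (v + chart e y)) ≤ ENNReal.ofReal (L₀ * (1 + R) ^ m * D * V ^ m) := by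
    intro e
    obtain ⟨a, y₀, hay⟩ := exists_eq_smul_add_chart e v
    have hy₀ : ‖y₀‖ ≤ V := by
      refine le_trans ?_ (le_max_right _ _)
      rw [hay, norm_smul_add_chart]
      exact Real.le_sqrt_of_sq_le (by linarith [sq_nonneg a])
    have hpt : ∀ y : Vel n, ENNReal.ofReal (‖y‖ ^ m) * ENNReal.ofReal (h (v + chart e y)) ≤
        (Metric.closedBall (-y₀) R).indicator
          (fun _ => ENNReal.ofReal (L₀ * (1 + R) ^ m * V ^ m)) y := by
      intro y
      by_cases hy : y ∈ Metric.closedBall (-y₀) R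
      · rw [indicator_of_mem hy, ← ENNReal.ofReal_mul (by positivity)]
        refine ENNReal.ofReal_le_ofReal ?_
        rw [Metric.mem_closedBall, dist_eq_norm, sub_neg_eq_add] at hy
        have h1 : ‖y‖ ≤ (1 + R) * V := by
          have := norm_sub_le (y + y₀) y₀
          rw [add_sub_cancel_right] at this
          nlinarith
        calc ‖y‖ ^ m * h (v + chart e y) ≤ ((1 + R) * V) ^ m * L₀ :=
              mul_le_mul_of_nonneg (Real.rpow_le_rpow (norm_nonneg _) h1 hm0) (hhL _)
                (by positivity) hL₀
          _ = _ := by rw [Real.mul_rpow (by linarith) (by linarith)]; ring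
      · rw [indicator_of_notMem hy]
        rw [Metric.mem_closedBall, dist_eq_norm, sub_neg_eq_add, not_le] at hy
        rw [hhR, ENNReal.ofReal_zero, mul_zero]
        refine hy.trans_le ?_
        have h2 : ‖y₀ + y‖ ^ 2 ≤ ‖v + chart e y‖ ^ 2 := by
          have : v + chart e y = a • (e : Vel (n + 1)) + chart e y₀ + chart e y := by rw [← hay]
          rw [this, norm_add_chart_sq]; nlinarith [sq_nonneg a]
        rw [add_comm]
        exact (pow_le_pow_iff_left₀ (norm_nonneg _) (norm_nonneg _) two_ne_zero).1 h2
    refine (lintegral_mono hpt).trans (le_of_eq ?_)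
    rw [lintegral_indicator measurableSet_closedBall, setLIntegral_const,
      Measure.addHaar_closedBall_center, ← ENNReal.ofReal_toReal hfin, ← hD,
      ← ENNReal.ofReal_mul (by positivity)]
    congr 1; ring
  set K : ℝ := L₀ * (1 + R) ^ m * D * V ^ m * r ^ (-((n : ℝ) + 1 + 2 * s)) with hK
  have hKe : ENNReal.ofReal (b * 2 ^ n * (L₀ * (1 + R) ^ m * D) * V ^ m *
      r ^ (-((n : ℝ) + 1 + 2 * s))) = ENNReal.ofReal b * (2 ^ n * ENNReal.ofReal K) := by
    rw [two_pow_eq_ofReal, ← ENNReal.ofReal_mul (by positivity),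
      ← ENNReal.ofReal_mul (by positivity), hK]
    congr 1; ring
  rw [hKe, mul_assoc, mul_assoc]
  refine mul_le_mul_right (mul_le_mul_right ?_ _) _
  rw [← lintegral_const_mul' _ _ ENNReal.ofReal_ne_top]
  refine lintegral_mono fun e => ?_
  rw [← lintegral_const_mul' _ _ ENNReal.ofReal_ne_top]
  refine setLIntegral_mono' measurableSet_Ioi fun t ht => ?_
  have ht' : (0 : ℝ) < t := ht
  by_cases hBe : t • (e : Vel (n + 1)) ∈ B
  · have htr : r < t := by
      have := hBr _ hBe
      rwa [norm_smul, norm_eq_of_mem_sphere, mul_one, Real.norm_of_nonneg ht'.le] at this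
    have htp : t ^ (-1 - 2 * s) ≤ t ^ n * r ^ (-((n : ℝ) + 1 + 2 * s)) := by
      have h1 : t ^ (-1 - 2 * s) = t ^ n * t ^ (-((n : ℝ) + 1 + 2 * s)) := by
        rw [← Real.rpow_natCast, ← Real.rpow_add ht']; congr 1; ring
      rw [h1]
      exact mul_le_mul_of_nonneg_left
        (Real.rpow_le_rpow_of_nonpos hr htr.le (by linarith)) (by positivity)
    simp only [indicator_of_mem hBe, Pi.one_apply, mul_one]
    calc _ = ∫⁻ y : Vel n, ENNReal.ofReal (t ^ (-1 - 2 * s)) *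
          (ENNReal.ofReal (‖y‖ ^ m) * ENNReal.ofReal (h (v + chart e y))) := by
          refine lintegral_congr fun y => ?_
          rw [ENNReal.ofReal_mul (by positivity)]
          ring
      _ = ENNReal.ofReal (t ^ (-1 - 2 * s)) * ∫⁻ y : Vel n, (ENNReal.ofReal (‖y‖ ^ m) *
          ENNReal.ofReal (h (v + chart e y))) := lintegral_const_mul' _ _ ENNReal.ofReal_ne_top
      _ ≤ ENNReal.ofReal (t ^ n * r ^ (-((n : ℝ) + 1 + 2 * s))) *
          ENNReal.ofReal (L₀ * (1 + R) ^ m * D * V ^ m) := by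
          gcongr
          exact hslice e
      _ = _ := by
          rw [← ENNReal.ofReal_mul (by positivity), ← ENNReal.ofReal_mul (by positivity), hK]
          congr 1; ring
  · simp [indicator_of_notMem hBe]

/-- At a suitable small scale around `v`, most collisions bring `v'` to a place where the profile is
at most half of its value at `v`: the superlevel set has small volume, by the mass and energy bounds. The scale is `r = (A / (⟨v⟩ g))^{1/d}`. -/
theorem exists_le_lintegral_good {n : ℕ} (hn : 1 ≤ n) {γ s b₀ b₁ m₀ M₀ E₀ h₀ : ℝ}
    (hs : s ∈ Ioo (0 : ℝ) 1) (hγs : 0 ≤ γ + 2 * s) (hb₀ : 0 < b₀) (hb₁ : 0 ≤ b₁) (hm₀ : 0 < m₀)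
    (hM₀ : 0 ≤ M₀) (hE₀ : 0 ≤ E₀) (hh₀ : 0 ≤ h₀) :
    ∃ c A R L₀ : ℝ, 0 < c ∧ 0 < A ∧ ∀ β : ℝ → ℝ, Measurable β → (∀ x, b₀ ≤ β x) → (∀ x, β x ≤ b₁) →
      ∀ f : Vel (n + 1) → ℝ, IsProfile m₀ M₀ E₀ h₀ f → ∀ (v : Vel (n + 1)) (r : ℝ), 0 < f v → 0 < r →
      2 * r ≤ max 1 ‖v‖ / 2 → r ^ (n + 1) * (max 1 ‖v‖ * f v) = A →
      ENNReal.ofReal (c * max 1 ‖v‖ ^ (γ + 2 * s) * (max 1 ‖v‖ * f v) ^ (2 * s / (n + 1))) ≤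
        ∫⁻ x, ENNReal.ofReal (({x | ‖x‖ ≤ R ∧ f x ≤ L₀} : Set (Vel (n + 1))).indicator f (v + x.2)) *
          ({u | (r < ‖u‖ ∧ ‖u‖ < 2 * r) ∧ f (v + u) ≤ f v / 2} : Set (Vel (n + 1))).indicator 1 x.1
          ∂(collisionMeasure n γ s β) := by
  obtain ⟨hs0, hs1⟩ := hs
  obtain ⟨R, L₀, c₀, hR1, hL1, hc₀, hcore⟩ := exists_core (d := n + 1) (by omega) hm₀ hE₀ hh₀ hγs
  obtain ⟨c₁, hc₁, hband⟩ := exists_le_lintegral_band (n := n) (γ := γ) (b := b₀) hn hs0 hb₀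
  obtain ⟨C₂, hC₂0, hslice⟩ := exists_lintegral_core_le (n := n) (γ := γ) (s := s) (b := b₁) (R := R)
    (L₀ := L₀) hn hs0 hγs hb₁ hR1 (by linarith)
  set D : ℝ := C₂ * (2 * (M₀ + 4 * E₀)) with hD
  have hD0 : 0 ≤ D := by positivity
  -- `A` is such that the superlevel set carries at most half of the weight of the band
  set A : ℝ := 2 * D / (c₁ * c₀) + 1 with hA
  have hA0 : 0 < A := by positivity
  refine ⟨c₁ * c₀ / 2 * A ^ (-(2 * s / (n + 1))), A, R, L₀, by positivity, hA0,
    fun β hβ hβ0 hβ1 f h v r hg hr hrV hrA => ?_⟩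
  set V := max 1 ‖v‖ with hV
  have hV1 : 1 ≤ V := le_max_left _ _
  have hV0 : 0 < V := by linarith
  set g := f v with hgdef
  set T : Set (Vel (n + 1)) := {x | ‖x‖ ≤ R ∧ f x ≤ L₀} with hT
  have hTm : MeasurableSet T := (measurableSet_le measurable_norm measurable_const).inter
    (measurableSet_le h.continuous.measurable measurable_const)
  have hf1 : Measurable (T.indicator f) := h.continuous.measurable.indicator hTm
  have hf1L : ∀ x, T.indicator f x ≤ L₀ := fun x => by
    by_cases hx : x ∈ T
    · rw [indicator_of_mem hx]; exact hx.2
    · rw [indicator_of_notMem hx]; linarith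
  have hf1R : ∀ x, R < ‖x‖ → T.indicator f x = 0 := fun x hx =>
    indicator_of_notMem (fun h => absurd h.1 (not_le.2 hx)) _
  set Gd : Set (Vel (n + 1)) := {u | (r < ‖u‖ ∧ ‖u‖ < 2 * r) ∧ f (v + u) ≤ g / 2} with hGd
  set Bd : Set (Vel (n + 1)) := {u | (r < ‖u‖ ∧ ‖u‖ < 2 * r) ∧ g / 2 < f (v + u)} with hBd
  have hfv : Measurable fun u => f (v + u) := h.continuous.measurable.comp (measurable_const_add v)
  have hring : MeasurableSet {u : Vel (n + 1) | r < ‖u‖ ∧ ‖u‖ < 2 * r} :=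
    (measurableSet_lt measurable_const measurable_norm).inter
      (measurableSet_lt measurable_norm measurable_const)
  have hGm : MeasurableSet Gd := hring.inter (measurableSet_le hfv measurable_const)
  have hBm : MeasurableSet Bd := hring.inter (measurableSet_lt measurable_const hfv)
  have hm1 : Measurable fun w => ENNReal.ofReal (T.indicator f (v + w)) :=
    (hf1.comp (measurable_const_add v)).ennreal_ofReal
  -- volume of the superlevel set
  have hvolB : volume Bd ≤ ENNReal.ofReal (2 * (M₀ + 4 * E₀) * V ^ (-2 : ℝ) / g) := by
    have h1 : ENNReal.ofReal (g / 2) * volume Bd ≤ ENNReal.ofReal ((M₀ + 4 * E₀) * V ^ (-2 : ℝ)) := by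
      refine le_trans ?_ (h.lintegral_near_le hM₀ hE₀ v)
      have hS : MeasurableSet {x : Vel (n + 1) | ‖x - v‖ < V / 2} :=
        measurableSet_lt (by fun_prop) measurable_const
      have htr := lintegral_add_left_eq_self (μ := volume)
        ({x : Vel (n + 1) | ‖x - v‖ < V / 2}.indicator fun x => ENNReal.ofReal (f x)) v
      rw [← setLIntegral_const, ← lintegral_indicator hBm, ← lintegral_indicator hS, ← htr]
      refine lintegral_mono fun u => ?_
      by_cases hu : u ∈ Bd
      · rw [indicator_of_mem hu, indicator_of_mem
          (show v + u ∈ {x : Vel (n + 1) | ‖x - v‖ < V / 2} by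
            change ‖v + u - v‖ < V / 2
            rw [add_sub_cancel_left]; linarith [hu.1.2])]
        exact ENNReal.ofReal_le_ofReal hu.2.le
      · rw [indicator_of_notMem hu]; exact bot_le
    have h2 : volume Bd = ENNReal.ofReal (2 / g) * (ENNReal.ofReal (g / 2) * volume Bd) := by
      rw [← mul_assoc, ← ENNReal.ofReal_mul (by positivity)]
      have : 2 / g * (g / 2) = 1 := by field_simp
      rw [this, ENNReal.ofReal_one, one_mul]
    rw [h2]
    refine (mul_le_mul_right h1 _).trans (le_of_eq ?_)
    rw [← ENNReal.ofReal_mul (by positivity)]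
    congr 1; ring
  set W : ℝ := V ^ (γ + 2 * s) * r ^ (-(2 * s)) with hW
  have hW0 : 0 < W := by positivity
  -- the whole band
  have htot := hband β hβ hβ0 (fun w => ENNReal.ofReal (T.indicator f (v + w))) hm1
    (c₀ * V ^ (γ + 2 * s)) r (by positivity) hr (hcore M₀ f h v)
  -- the superlevel set in the band
  have hbad : ∫⁻ x, ENNReal.ofReal (T.indicator f (v + x.2)) * Bd.indicator 1 x.1
      ∂(collisionMeasure n γ s β) ≤ ENNReal.ofReal (c₁ * c₀ / 2 * W) := by
    refine (hslice β hβ hβ1 _ hf1 hf1L hf1R v r hr Bd hBm (fun u hu => hu.1.1)).trans ?_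
    refine (mul_le_mul_right hvolB _).trans ?_
    rw [← ENNReal.ofReal_mul (by positivity)]
    refine ENNReal.ofReal_le_ofReal ?_
    have e1 : V ^ (γ + 2 * s + 1) = V ^ (γ + 2 * s) * V := by
      rw [Real.rpow_add hV0, Real.rpow_one]
    have e2 : r ^ (-((n : ℝ) + 1 + 2 * s)) = r ^ (-(2 * s)) / r ^ (n + 1) := by
      rw [show -((n : ℝ) + 1 + 2 * s) = -(2 * s) - ((n + 1 : ℕ) : ℝ) by push_cast; ring,
        Real.rpow_sub hr, Real.rpow_natCast]
    have e3 : V ^ (-2 : ℝ) = 1 / (V * V) := by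
      rw [Real.rpow_neg hV0.le, Real.rpow_two]; field_simp
    have e4 : C₂ * V ^ (γ + 2 * s + 1) * r ^ (-((n : ℝ) + 1 + 2 * s)) *
        (2 * (M₀ + 4 * E₀) * V ^ (-2 : ℝ) / g) = D / A * W := by
      rw [← hrA, e1, e2, e3, hW, hD]; field_simp
    rw [e4]
    refine mul_le_mul_of_nonneg_right ?_ hW0.le
    rw [div_le_iff₀ hA0, hA, mul_add]
    have : c₁ * c₀ / 2 * (2 * D / (c₁ * c₀)) = D := by field_simp
    rw [this]
    have : 0 < c₁ * c₀ := by positivity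
    linarith
  have hsplit : ∫⁻ x, ENNReal.ofReal (T.indicator f (v + x.2)) * (Ioo r (2 * r)).indicator 1 ‖x.1‖
      ∂(collisionMeasure n γ s β) ≤
      ∫⁻ x, ENNReal.ofReal (T.indicator f (v + x.2)) * Gd.indicator 1 x.1
        ∂(collisionMeasure n γ s β) +
      ∫⁻ x, ENNReal.ofReal (T.indicator f (v + x.2)) * Bd.indicator 1 x.1
        ∂(collisionMeasure n γ s β) := by
    have hG1 : Measurable (Gd.indicator (1 : Vel (n + 1) → ℝ≥0∞)) := measurable_one.indicator hGm
    have hmG : Measurable fun x : Vel (n + 1) × Vel (n + 1) =>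
        ENNReal.ofReal (T.indicator f (v + x.2)) * Gd.indicator 1 x.1 :=
      (hm1.comp measurable_snd).mul (hG1.comp measurable_fst)
    rw [← lintegral_add_left hmG]
    refine lintegral_mono fun x => ?_
    simp only
    rw [← mul_add]
    refine mul_le_mul_right ?_ _
    by_cases hx : ‖x.1‖ ∈ Ioo r (2 * r)
    · rw [indicator_of_mem hx]
      rcases le_or_gt (f (v + x.1)) (g / 2) with hx2 | hx2
      · rw [indicator_of_mem (show x.1 ∈ Gd from ⟨hx, hx2⟩)]; exact le_self_add
      · rw [indicator_of_mem (show x.1 ∈ Bd from ⟨hx, hx2⟩)]; exact le_add_self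
    · rw [indicator_of_notMem hx]; exact bot_le
  have hfin : ENNReal.ofReal (c₁ * c₀ / 2 * W) + ENNReal.ofReal (c₁ * c₀ / 2 * W) ≤
      ∫⁻ x, ENNReal.ofReal (T.indicator f (v + x.2)) * Gd.indicator 1 x.1
        ∂(collisionMeasure n γ s β) + ENNReal.ofReal (c₁ * c₀ / 2 * W) := by
    refine le_trans (le_of_eq ?_) ((htot.trans hsplit).trans (add_le_add_right hbad _))
    rw [← ENNReal.ofReal_add (by positivity) (by positivity), hW]
    congr 1; ring
  refine le_trans (le_of_eq ?_) (ENNReal.le_of_add_le_add_right ENNReal.ofReal_ne_top hfin)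
  congr 1
  have hre : r ^ (-(2 * s)) = A ^ (-(2 * s / ((n : ℝ) + 1))) * (V * g) ^ (2 * s / ((n : ℝ) + 1)) := by
    have hn1 : (n : ℝ) + 1 ≠ 0 := by positivity
    rw [← hrA, Real.mul_rpow (by positivity) (by positivity), ← Real.rpow_natCast,
      ← Real.rpow_mul hr.le, mul_assoc, ← Real.rpow_add (by positivity), neg_add_cancel,
      Real.rpow_zero, mul_one]
    congr 1
    push_cast
    field_simp
  rw [hW, hre]
  ring

set_option maxHeartbeats 800000 in
/-- Where a profile touches the barrier `N (φ_q + ε)` from below, with `q ≤ d + 1` and `N` large, its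
collision operator is very negative. -/
theorem exists_contact_bound {n : ℕ} (hn : 1 ≤ n) {γ s b₀ b₁ m₀ M₀ E₀ h₀ q : ℝ}
    (hs : s ∈ Ioo (0 : ℝ) 1) (hγs : 0 ≤ γ + 2 * s) (hγs2 : γ + 2 * s ≤ 2) (hb₀ : 0 < b₀)
    (hb₁ : b₀ ≤ b₁) (hm₀ : 0 < m₀) (hM₀ : 0 ≤ M₀) (hE₀ : 0 ≤ E₀) (hh₀ : 0 ≤ h₀) (hq0 : 0 ≤ q)
    (hq : q ≤ n + 2) :
    ∃ N₀ c : ℝ, 1 ≤ N₀ ∧ 0 < c ∧ ∀ bt : ℝ → ℝ, IsAngularFactor b₀ b₁ bt →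
      ∀ f : Vel (n + 1) → ℝ, IsProfile m₀ M₀ E₀ h₀ f → ∀ (v : Vel (n + 1)) (L N ε : ℝ),
      N₀ ≤ N → 0 ≤ ε → (∀ x, f x ≤ N * (decayWeight q x + ε)) →
      f v = N * (decayWeight q v + ε) → HasCollisionValue γ s bt f f v L →
      L ≤ -(c * (f v * (max 1 ‖v‖ ^ γ *
        (f v * max 1 ‖v‖ ^ ((n : ℝ) + 2)) ^ (2 * s / (n + 1))))) := by
  have hs' := hs
  obtain ⟨hs0, hs1⟩ := hs
  have hn0 : (0 : ℝ) ≤ n := by positivity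
  set e : ℝ := 2 * s / (n + 1) with he
  have he0 : 0 < e := by positivity
  obtain ⟨C, hC0, hC⟩ := exists_collision_le (γ := γ) hn hs' hγs hb₀ hb₁
  obtain ⟨C₂, hC₂0, hgain⟩ := exists_weight_gain (γ := γ) (b := b₁) (E₀ := E₀) hn hs' hγs hγs2
    (by linarith) hq0 hq hE₀
  obtain ⟨c₃, A, R, L₀, hc₃, hA0, hgood⟩ := exists_le_lintegral_good (γ := γ) (s := s) (b₀ := b₀)
    (b₁ := b₁) (m₀ := m₀) (M₀ := M₀) (E₀ := E₀) (h₀ := h₀) hn hs' hγs hb₀ (by linarith) hm₀ hM₀ hE₀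
    hh₀
  -- `δ` and `N₀` are such that the Riesz potential and the increment of the weight each use up at
  -- most a quarter of the good term `c₃ g ⟨v⟩^γ X^e / 4`, where `X = g ⟨v⟩^{d+1}`
  set δ : ℝ := c₃ / 4 / (4 * (C + 1)) with hδ
  obtain ⟨X₀, hX₀1, hriesz⟩ := exists_riesz_le_small (γ := γ) (s := s) (m₀ := m₀) (M₀ := M₀) (E₀ := E₀)
    (h₀ := h₀) (A := 2 ^ q) hn hs0 hγs (by linarith) (by linarith) hM₀ hE₀ hh₀
    (Real.one_le_rpow one_le_two hq0) (δ := δ) (by positivity)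
  obtain ⟨X₁, hX₁⟩ := ((tendsto_rpow_atTop he0).eventually_ge_atTop
    (4 * C₂ / (c₃ / 4))).exists_forall_of_atTop
  -- at distance `2 κ ⟨v⟩` the tilt of the weight is at most a quarter of the weight
  set κ : ℝ := 1 / (8 * (q + 1)) with hκ
  have hκ0 : 0 < κ := by positivity
  refine ⟨max X₀ (max X₁ (A / κ ^ (n + 1))), c₃ / 8, hX₀1.trans (le_max_left _ _), by positivity,
    fun bt hbt f h v L N ε hN hε hfN hfv hL => ?_⟩
  obtain ⟨β, hβ, hβ0, hβ1, hcoll⟩ := hC bt hbt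
  set V := max 1 ‖v‖ with hV
  have hV1 : 1 ≤ V := le_max_left _ _
  have hV0 : 0 < V := by linarith
  set g := f v with hg
  have hφ := decayWeight_pos q v
  have hN0 : 0 < N := by linarith [hX₀1.trans ((le_max_left _ _).trans hN)]
  have hφg : N * decayWeight q v ≤ g := by rw [hfv]; nlinarith
  have hg0 : 0 < g := lt_of_lt_of_le (by positivity) hφg
  set X := g * V ^ ((n : ℝ) + 2) with hX
  have hNX : N ≤ X := by
    have h1 : N * V ^ (-q) * V ^ ((n : ℝ) + 2) ≤ X := mul_le_mul_of_nonneg_right hφg (by positivity)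
    rw [mul_assoc, ← Real.rpow_add hV0] at h1
    have h2 : 1 ≤ V ^ (-q + ((n : ℝ) + 2)) := Real.one_le_rpow hV1 (by linarith)
    nlinarith
  have hX0 : 0 < X := by positivity
  have hXe : 0 < X ^ e := by positivity
  have hX₁' : C₂ ≤ c₃ / 16 * X ^ e := by
    have := hX₁ X ((le_max_left _ _).trans ((le_max_right _ _).trans (hN.trans hNX)))
    rw [div_le_iff₀ (by positivity)] at this
    linarith
  have hXκ : A / κ ^ (n + 1) ≤ X :=
    (le_max_right _ _).trans ((le_max_right _ _).trans (hN.trans hNX))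
  -- the scale at which the profile is compared with its value at `v`
  set r : ℝ := (A / (V * g)) ^ (((n + 1 : ℕ) : ℝ)⁻¹) with hr
  have hr0 : 0 < r := by positivity
  have hrn : r ^ (n + 1) = A / (V * g) :=
    Real.rpow_inv_natCast_pow (by positivity) (by omega)
  have hrV : r ≤ κ * V := by
    refine (pow_le_pow_iff_left₀ hr0.le (by positivity) (by omega : n + 1 ≠ 0)).1 ?_
    rw [hrn, mul_pow, div_le_iff₀ (by positivity)]
    rw [div_le_iff₀ (by positivity)] at hXκ
    have : V ^ ((n : ℝ) + 2) = V ^ (n + 1) * V := by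
      rw [← pow_succ, ← Real.rpow_natCast]; congr 1; push_cast; ring
    rw [hX, this] at hXκ
    linarith
  have hκ8 : κ * 8 ≤ 1 := by
    rw [hκ, div_mul_eq_mul_div, div_le_one (by positivity)]; linarith
  have hqκ : q * κ * 8 ≤ 1 := by
    have : q * κ * 8 = q / (q + 1) := by rw [hκ]; field_simp
    rw [this, div_le_one (by positivity)]; linarith
  set T : Set (Vel (n + 1)) := {x | ‖x‖ ≤ R ∧ f x ≤ L₀} with hT
  have hTm : MeasurableSet T := (measurableSet_le measurable_norm measurable_const).inter
    (measurableSet_le h.continuous.measurable measurable_const)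
  set Gd : Set (Vel (n + 1)) := {u | (r < ‖u‖ ∧ ‖u‖ < 2 * r) ∧ f (v + u) ≤ g / 2} with hGd
  have hGm : MeasurableSet Gd := ((measurableSet_lt measurable_const measurable_norm).inter
    (measurableSet_lt measurable_norm measurable_const)).inter
    (measurableSet_le (h.continuous.measurable.comp (measurable_const_add v)) measurable_const)
  have hTf0 : ∀ x, 0 ≤ T.indicator f x := fun x => indicator_nonneg (fun x _ => h.nonneg x) x
  have hTf : ∀ x, T.indicator f x ≤ f x := fun x => indicator_le_self' (fun x _ => h.nonneg x) x
  have hgd := hgood β hβ hβ0 hβ1 f h v r hg0 hr0 (by nlinarith) (by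
    change r ^ (n + 1) * (V * g) = A
    rw [hrn]; exact div_mul_cancel₀ _ (by positivity))
  obtain ⟨P, hPm, hP0, hPpt, hPint⟩ := hgain β hβ hβ1 m₀ M₀ h₀ f h v
  have hbound : CollisionBound n γ s β f v (fun u w => f (v + w) * (f (v + u) - f v))
      (N * (C₂ * (decayWeight q v * V ^ γ)) -
        g / 4 * (c₃ * V ^ (γ + 2 * s) * (V * g) ^ (2 * s / (n + 1)))) := by
    have hG1 : Measurable (Gd.indicator (1 : Vel (n + 1) → ℝ)) := measurable_one.indicator hGm
    have hf1 : Measurable fun w => T.indicator f (v + w) :=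
      (h.continuous.measurable.indicator hTm).comp (measurable_const_add v)
    have hGm' : Measurable fun x : Vel (n + 1) × Vel (n + 1) =>
        T.indicator f (v + x.2) * Gd.indicator 1 x.1 :=
      (hf1.comp measurable_snd).mul (hG1.comp measurable_fst)
    have hG0 : ∀ u, (0 : ℝ) ≤ Gd.indicator 1 u := fun u =>
      indicator_nonneg (fun _ _ => zero_le_one) u
    refine ⟨fun u => N * tilt (1 / 4) q v u, fun x => N * P x,
      fun x => g / 4 * (T.indicator f (v + x.2) * Gd.indicator 1 x.1),
      N * (q * (1 / 4)), r, N * (C₂ * (decayWeight q v * V ^ γ)),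
      g / 4 * (c₃ * V ^ (γ + 2 * s) * (V * g) ^ (2 * s / (n + 1))),
      (measurable_tilt _ _ _).const_mul _, fun u => by simp only [tilt_neg]; ring, fun u => ?_,
      hPm.const_mul _, hGm'.const_mul _, fun x => mul_nonneg hN0.le (hP0 x),
      fun x => mul_nonneg (by positivity) (mul_nonneg (hTf0 _) (hG0 _)), hr0, by positivity,
      by positivity, fun u w huw => ?_, ?_, ?_, le_rfl⟩
    · rw [abs_mul, abs_of_pos hN0]
      exact mul_le_mul_of_nonneg_left (abs_tilt_le_const (by norm_num) hq0 v u) hN0.le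
    · have hfw := h.nonneg (v + w)
      -- on the good set the increment is at most `-g / 2`, elsewhere it is that of the barrier
      by_cases hu : u ∈ Gd
      · simp only [indicator_of_mem hu, Pi.one_apply, mul_one]
        have h1 : |N * tilt (1 / 4) q v u| ≤ g / 4 := by
          rw [abs_mul, abs_of_pos hN0]
          have h2 : ‖u‖ / V ≤ 2 * κ := by
            rw [div_le_iff₀ hV0]; linarith [hu.1.2]
          calc N * |tilt (1 / 4) q v u| ≤ N * (q * (‖u‖ / V) * decayWeight q v) :=
                mul_le_mul_of_nonneg_left (abs_tilt_le hq0 v u) hN0.le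
            _ ≤ N * (q * (2 * κ) * decayWeight q v) := by gcongr
            _ = (q * κ * 8 / 4) * (N * decayWeight q v) := by ring
            _ ≤ 1 / 4 * g := by gcongr
            _ = g / 4 := by ring
        have h3 := (abs_le.1 h1).1
        have h4 := mul_le_mul_of_nonneg_right (hTf (v + w)) hg0.le
        have h5 := mul_nonneg hN0.le (hP0 (u, w))
        have h6 := mul_le_mul_of_nonneg_left hu.2 hfw
        have h7 := mul_le_mul_of_nonneg_left h3 hfw
        linarith
      · simp only [indicator_of_notMem hu, mul_zero, sub_zero]
        have h1 : f (v + u) - f v ≤ N * (decayWeight q (v + u) - decayWeight q v) := by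
          have := hfN (v + u)
          rw [← hg, hfv]; linarith
        have h2 := mul_le_mul_of_nonneg_left h1 hfw
        have h3 := mul_le_mul_of_nonneg_left (hPpt u w huw) hN0.le
        linarith
    · simp_rw [ENNReal.ofReal_mul hN0.le]
      rw [lintegral_const_mul' _ _ ENNReal.ofReal_ne_top]
      exact mul_le_mul_right hPint _
    · have hg4 : 0 ≤ g / 4 := by positivity
      simp_rw [ENNReal.ofReal_mul hg4]
      rw [lintegral_const_mul' _ _ ENNReal.ofReal_ne_top]
      refine mul_le_mul_right (hgd.trans ?_) _
      rw [setLIntegral_lt_norm_fst]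
      refine lintegral_mono fun x => ?_
      by_cases hu : x.1 ∈ Gd
      · rw [indicator_of_mem hu, indicator_of_mem hu, indicator_of_mem
          (show ‖x.1‖ ∈ Ioi r from hu.1.1)]
        simp only [Pi.one_apply, mul_one]
        exact le_rfl
      · rw [indicator_of_notMem hu, mul_zero]; exact bot_le
  have hnear : ∀ x, ‖x - v‖ < V / 2 → f x ≤ 2 ^ q * g := by
    intro x hx
    have h1 : V / 2 ≤ max 1 ‖x‖ := by
      rcases le_total 1 ‖v‖ with hv | hv
      · rw [hV, max_eq_right hv] at hx ⊢
        have := norm_sub_norm_le v x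
        rw [norm_sub_rev] at this
        exact le_trans (by linarith) (le_max_right _ _)
      · rw [hV, max_eq_left hv]
        exact le_trans (by norm_num) (le_max_left _ _)
    have h2 := decayWeight_half hq0 h1
    have h3 : 1 ≤ (2 : ℝ) ^ q := Real.one_le_rpow one_le_two hq0
    calc f x ≤ N * (decayWeight q x + ε) := hfN x
      _ ≤ N * (2 ^ q * decayWeight q v + 2 ^ q * ε) := by
          gcongr
          nlinarith
      _ = 2 ^ q * g := by rw [hfv]; ring
  have hS := hriesz f h v g hg0 hnear ((le_max_left _ _).trans (hN.trans hNX))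
  have hfin := hcoll f h.continuous h.nonneg h.bounded v L _ _ hL
    (h.lintegral_rpow_lt_top hγs hγs2 v) (by positivity) hS hbound
  refine hfin.trans ?_
  have hVX : V ^ (γ + 2 * s) * (V * g) ^ (2 * s / ((n : ℝ) + 1)) = V ^ γ * X ^ e := by
    have hd1 : (n : ℝ) + 1 ≠ 0 := by positivity
    have h1 : V ^ (γ + 2 * s) * V ^ e = V ^ γ * V ^ (((n : ℝ) + 2) * e) := by
      rw [← Real.rpow_add hV0, ← Real.rpow_add hV0]
      congr 1
      rw [he]; field_simp; ring
    rw [hX, Real.mul_rpow hV0.le hg0.le, Real.mul_rpow hg0.le (by positivity), ← Real.rpow_mul hV0.le,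
      ← mul_assoc, ← he, h1]
    ring
  rw [mul_assoc c₃, hVX]
  set Y := g * (V ^ γ * X ^ e) with hY
  have hY0 : 0 < Y := by positivity
  have h1 : N * (C₂ * (decayWeight q v * V ^ γ)) ≤ c₃ / 16 * Y := by
    calc N * (C₂ * (decayWeight q v * V ^ γ)) = C₂ * V ^ γ * (N * decayWeight q v) := by ring
      _ ≤ c₃ / 16 * X ^ e * V ^ γ * g := by gcongr
      _ = _ := by rw [hY]; ring
  have h2 : g * C * (δ * (V ^ γ * X ^ e)) ≤ c₃ / 16 * Y := by
    have : C / (C + 1) ≤ 1 := by rw [div_le_one (by positivity)]; linarith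
    calc g * C * (δ * (V ^ γ * X ^ e)) = C / (C + 1) * (c₃ / 16 * Y) := by
          rw [hδ, hY]; field_simp; ring
      _ ≤ 1 * (c₃ / 16 * Y) := by gcongr
      _ = _ := one_mul _
  have h3 : g / 4 * (c₃ * (V ^ γ * X ^ e)) = c₃ / 4 * Y := by rw [hY]; ring
  rw [h3]
  linarith

/-! ### Contact with a barrier of large exponent -/

/-- Upper bound for `f(v'_*) (f(v') - f(v))` at a point where `f` touches the weight of exponent
`q` from below: where `|v'| < |v|/2` the weight bounds the factor `f(v'_*)`, elsewhere it
bounds `f(v') - f(v)`. -/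
noncomputable def swappedIncrement {d : ℕ} (f : Vel d → ℝ) (q : ℝ) (v u w : Vel d) : ℝ :=
  if ‖v + u‖ < ‖v‖ / 2 then f (v + u) * decayWeight q (v + w)
  else f (v + w) * (decayWeight q (v + u) - decayWeight q v)

/-- The part of `swappedIncrement` from collisions with `|v'| < |v|/2`. -/
noncomputable def swappedInner {d : ℕ} (f : Vel d → ℝ) (q : ℝ) (v : Vel d) (x : Vel d × Vel d) : ℝ :=
  ({u | ‖v + u‖ < ‖v‖ / 2} : Set (Vel d)).indicator (fun u => f (v + u)) x.1 *
    decayWeight q (v + x.2)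

/-- Gathers the first-order expansion of the weight, its remainder, the collisions with
`|v'| < |v|/2`, and a possible negative part `G`. -/
theorem exists_collisionBound_swapped {n : ℕ} (hn : 1 ≤ n) {γ s b κ q E₀ : ℝ}
    (hs : s ∈ Ioo (0 : ℝ) 1) (hγs : 0 ≤ γ + 2 * s) (hγs2 : γ + 2 * s ≤ 2) (hb0 : 0 ≤ b)
    (hκ : 0 < κ) (hκ1 : κ ≤ 1 / 4) (hq : 0 ≤ q) (hE : 0 ≤ E₀) :
    ∃ C : ℝ, 0 ≤ C ∧ ∀ β : ℝ → ℝ, Measurable β → (∀ c, β c ≤ b) → ∀ (m₀ M₀ h₀ : ℝ)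
      (f : Vel (n + 1) → ℝ), IsProfile m₀ M₀ E₀ h₀ f → ∀ v : Vel (n + 1), 1 ≤ ‖v‖ →
      ∀ p : ℝ, 0 ≤ p → ∫⁻ x, ENNReal.ofReal (swappedInner f q v x)
        ∂(collisionMeasure n γ s β) ≤ ENNReal.ofReal p →
      ∀ (G : Vel (n + 1) × Vel (n + 1) → ℝ) (δ g : ℝ), Measurable G → (∀ x, 0 ≤ G x) → 0 < δ →
      0 ≤ g → (∀ u w, ⟪u, w⟫ = 0 → 0 < G (u, w) →
        κ * ‖v‖ < ‖u‖ ∧ swappedIncrement f q v u w ≤ -G (u, w)) →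
      ENNReal.ofReal g ≤ ∫⁻ x in {x | δ < ‖x.1‖}, ENNReal.ofReal (G x)
        ∂(collisionMeasure n γ s β) →
      CollisionBound n γ s β f v (swappedIncrement f q v)
        (C * (decayWeight q v * ‖v‖ ^ (γ - 2)) + p - g) := by
  obtain ⟨C₁, hC₁0, hC₁⟩ := exists_decayWeight_increment_le (d := n + 1) (q := q) hκ hκ1 hq
  obtain ⟨C₂, hC₂0, hC₂⟩ := exists_lintegral_remainder_le (γ := γ) (b := b) (E₀ := E₀) hn hs hγs
    hγs2 hb0 hκ hE
  refine ⟨C₁ * C₂, by positivity, fun β hβ hβb m₀ M₀ h₀ f h v hv p hp hpI G δ g hGm hG0 hδ hg hG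
    hgI => ?_⟩
  have hv0 : 0 < ‖v‖ := by linarith
  have hφ := decayWeight_pos q v
  have hc := h.continuous
  have hI0 : ∀ x, 0 ≤ swappedInner f q v x := fun x =>
    mul_nonneg (indicator_nonneg (fun u _ => h.nonneg _) _) (decayWeight_pos q _).le
  have hIm : Measurable (swappedInner f q v) := by
    have h1 : Measurable (({u | ‖v + u‖ < ‖v‖ / 2} : Set (Vel (n + 1))).indicator
        (fun u => f (v + u))) := Measurable.indicator
      (hc.measurable.comp (measurable_const_add v)) (measurableSet_lt (by fun_prop) measurable_const)
    exact (h1.comp measurable_fst).mul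
      ((continuous_decayWeight q).measurable.comp (measurable_snd.const_add v))
  let P₁ : Vel (n + 1) × Vel (n + 1) → ℝ := fun x => f (v + x.2) * remainderWeight κ v x.1 x.2
  have hP₁ : Measurable P₁ :=
    (Continuous.measurable (by fun_prop)).mul (measurable_remainderWeight _ v)
  have hP₁0 : ∀ x, 0 ≤ P₁ x := fun x => mul_nonneg (h.nonneg _) (remainderWeight_nonneg _ _ _ _)
  refine ⟨tilt κ q v, fun x => C₁ * decayWeight q v * P₁ x + swappedInner f q v x, G, q * κ, δ,
    C₁ * decayWeight q v * (C₂ * ‖v‖ ^ (γ - 2)) + p, g, measurable_tilt _ _ _, tilt_neg _ _ _,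
    abs_tilt_le_const hκ.le hq v, (hP₁.const_mul _).add hIm, hGm,
    fun x => add_nonneg (mul_nonneg (by positivity) (hP₁0 x)) (hI0 x), hG0, hδ, by positivity, hg,
    fun u w huw => ?_, ?_, hgI, le_of_eq (by ring)⟩
  · have hf0 := h.nonneg (v + w)
    have h4 : 0 ≤ C₁ * decayWeight q v * P₁ (u, w) := mul_nonneg (by positivity) (hP₁0 (u, w))
    have h5 := hI0 (u, w)
    rcases (hG0 (u, w)).eq_or_lt with h0 | h0
    · rw [← h0, sub_zero]
      unfold swappedIncrement
      split_ifs with hu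
      · have h1 : ‖v‖ / 2 ≤ ‖u‖ := by
          have := norm_sub_le (v + u) u
          rw [add_sub_cancel_right] at this
          linarith
        have h2 : tilt κ q v u = 0 := by
          unfold tilt
          exact indicator_of_notMem (fun hu' => absurd hu'.2 (not_le.2 (by nlinarith))) _
        have h3 : swappedInner f q v (u, w) = f (v + u) * decayWeight q (v + w) := by
          unfold swappedInner; rw [indicator_of_mem (by exact hu)]
        simp only [h2, h3, mul_zero]
        linarith
      · have := mul_le_mul_of_nonneg_left (hC₁ v u w hv huw (not_lt.1 hu)) hf0
        simp only [P₁] at h4 ⊢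
        linarith
    · obtain ⟨h1, h2⟩ := hG u w huw h0
      have h3 : tilt κ q v u = 0 := by
        unfold tilt
        exact indicator_of_notMem (fun hu' => absurd hu'.2 (not_le.2 h1)) _
      rw [h3, mul_zero]
      linarith
  · have e1 : ∀ x : Vel (n + 1) × Vel (n + 1),
        ENNReal.ofReal (C₁ * decayWeight q v * P₁ x + swappedInner f q v x) =
        ENNReal.ofReal (C₁ * decayWeight q v) * ENNReal.ofReal (P₁ x) +
        ENNReal.ofReal (swappedInner f q v x) := fun x => by
      rw [ENNReal.ofReal_add (mul_nonneg (by positivity) (hP₁0 x)) (hI0 x),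
        ENNReal.ofReal_mul (p := C₁ * decayWeight q v) (by positivity)]
    simp_rw [e1]
    rw [lintegral_add_right _ hIm.ennreal_ofReal, lintegral_const_mul' _ _ ENNReal.ofReal_ne_top,
      ENNReal.ofReal_add (by positivity) hp,
      ENNReal.ofReal_mul (p := C₁ * decayWeight q v) (by positivity)]
    exact add_le_add (mul_le_mul_right (hC₂ β hβ hβb m₀ M₀ h₀ f h v hv0) _) hpI

theorem lintegral_indicator_mul_decayWeight_le {n : ℕ} {γ s q C M l : ℝ} {β : ℝ → ℝ} {f : Vel (n + 1) → ℝ}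
    (hf : Continuous f) {v : Vel (n + 1)} (S : Set (Vel (n + 1))) (hSm : MeasurableSet S)
    (hS : ∀ x ∈ S, ‖x‖ ≤ l * ‖v‖) (hC : 0 ≤ C)
    (hM : ∫⁻ x in S, ENNReal.ofReal (f x) ≤ ENNReal.ofReal M)
    (hsw : ∀ F : Vel (n + 1) → ℝ≥0∞, Measurable F → (∀ u, F u ≠ 0 → ‖v + u‖ ≤ l * ‖v‖) →
      ∫⁻ x, F x.1 * ENNReal.ofReal (decayWeight q (v + x.2)) ∂(collisionMeasure n γ s β) ≤
        ENNReal.ofReal C * ∫⁻ u, F u) :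
    ∫⁻ x, S.indicator (fun y => ENNReal.ofReal (f y)) (v + x.1) *
      ENNReal.ofReal (decayWeight q (v + x.2)) ∂(collisionMeasure n γ s β) ≤
        ENNReal.ofReal (C * M) := by
  have hm : Measurable (S.indicator fun y => ENNReal.ofReal (f y)) :=
    hf.measurable.ennreal_ofReal.indicator hSm
  refine (hsw (fun u => S.indicator (fun y => ENNReal.ofReal (f y)) (v + u))
    (hm.comp (measurable_const_add v)) fun u hu => hS _ (mem_of_indicator_ne_zero hu)).trans ?_
  rw [ENNReal.ofReal_mul hC, lintegral_add_left_eq_self (μ := volume)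
    (S.indicator fun y => ENNReal.ofReal (f y)) v, lintegral_indicator hSm]
  exact mul_le_mul_right hM _

/-- The increment of a weight of any exponent `q > d + γ + 2s`. -/
theorem exists_swappedIncrement_le {n : ℕ} (hn : 1 ≤ n) {γ s b q M₀ E₀ : ℝ}
    (hs : s ∈ Ioo (0 : ℝ) 1) (hγs : 0 ≤ γ + 2 * s) (hγs2 : γ + 2 * s ≤ 2) (hb0 : 0 ≤ b)
    (hq : n + 1 + γ + 2 * s < q) (hM : 0 ≤ M₀) (hE : 0 ≤ E₀) :
    ∃ C : ℝ, 0 ≤ C ∧ ∀ β : ℝ → ℝ, Measurable β → (∀ c, β c ≤ b) → ∀ (m₀ h₀ : ℝ)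
      (f : Vel (n + 1) → ℝ), IsProfile m₀ M₀ E₀ h₀ f → ∀ v : Vel (n + 1), 1 ≤ ‖v‖ →
      CollisionBound n γ s β f v (swappedIncrement f q v) (C * (decayWeight q v * ‖v‖ ^ γ)) := by
  have hn0 : (0 : ℝ) ≤ n := by positivity
  have hq0 : 0 ≤ q := by linarith
  obtain ⟨C₁, hC₁0, h₁⟩ := exists_collisionBound_swapped (γ := γ) (b := b) (q := q) (E₀ := E₀) hn hs
    hγs hγs2 hb0 (show (0 : ℝ) < 1 / 4 by norm_num) le_rfl hq0 hE
  obtain ⟨C₂, hC₂0, h₂⟩ := exists_lintegral_swapped_le (γ := γ) (b := b) hn hs hγs hb0 hq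
  refine ⟨C₁ + C₂ * (1 - (1 / 2) ^ 2) ^ (-q / 2) * M₀, by positivity,
    fun β hβ hβb m₀ h₀ f h v hv => ?_⟩
  have hφ := decayWeight_pos q v
  have hv0 : 0 < ‖v‖ := by linarith
  have hp : ∫⁻ x, ENNReal.ofReal (swappedInner f q v x) ∂(collisionMeasure n γ s β) ≤
      ENNReal.ofReal (C₂ * (1 - (1 / 2) ^ 2) ^ (-q / 2) * (decayWeight q v * ‖v‖ ^ γ) * M₀) := by
    refine le_trans (lintegral_mono fun x => ?_) (lintegral_indicator_mul_decayWeight_le h.continuous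
      {y | ‖y‖ < ‖v‖ / 2} (measurableSet_lt measurable_norm measurable_const)
      (fun y (hy : ‖y‖ < ‖v‖ / 2) => by linarith) (by positivity)
      ((setLIntegral_le_lintegral _ _).trans h.mass_upper)
      (h₂ β hβ hβb q le_rfl v hv (1 / 2) (by norm_num) le_rfl))
    unfold swappedInner
    by_cases hx : ‖v + x.1‖ < ‖v‖ / 2
    · rw [indicator_of_mem (by exact hx), indicator_of_mem (by exact hx),
        ENNReal.ofReal_mul (h.nonneg _)]
    · rw [indicator_of_notMem (by exact hx), zero_mul, ENNReal.ofReal_zero]; exact bot_le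
  refine (h₁ β hβ hβb m₀ M₀ h₀ f h v hv _ (by positivity) hp (fun _ => 0) 1 0 measurable_const
    (fun _ => le_rfl) one_pos le_rfl (fun u w _ h => absurd h (lt_irrefl _)) (by simp)).mono
    (fun _ _ _ => le_rfl) ?_
  have h1 : ‖v‖ ^ (γ - 2) ≤ ‖v‖ ^ γ := Real.rpow_le_rpow_of_exponent_le hv (by linarith)
  have h2 := mul_le_mul_of_nonneg_left h1 (mul_nonneg hC₁0 hφ.le)
  linarith

/-- Collisions with `v'_*` in a bounded set and `|v' - v| ≥ |v| / √q` move `v'` away from the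
origin enough to divide the weight of exponent `q` by a fixed factor. -/
theorem decayWeight_le_of_large_displacement {d : ℕ} {q R : ℝ} (hq : 2 ≤ q) {v u w : Vel d}
    (hv : 1 ≤ ‖v‖) (huw : ⟪u, w⟫ = 0) (hw : ‖v + w‖ ≤ R) (hR : 4 * R ≤ ‖u‖)
    (hu : √(2 / q) * ‖v‖ ≤ ‖u‖) :
    ‖v‖ ≤ ‖v + u‖ ∧ decayWeight q (v + u) ≤ 2 / 3 * decayWeight q v := by
  have hq0 : 0 < q := by linarith
  have hv0 : 0 < ‖v‖ := by linarith
  have h1 : ⟪v, u⟫ = ⟪v + w, u⟫ := by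
    rw [inner_add_left, real_inner_comm u w, huw, add_zero]
  have h2 : -(R * ‖u‖) ≤ ⟪v, u⟫ := by
    rw [h1]
    have := (abs_le.1 (abs_real_inner_le_norm (v + w) u)).1
    nlinarith [norm_nonneg u]
  have h3 : 2 / q * ‖v‖ ^ 2 ≤ ‖u‖ ^ 2 := by
    have := pow_le_pow_left₀ (by positivity) hu 2
    rwa [mul_pow, Real.sq_sqrt (by positivity)] at this
  have h4 : (1 + 1 / q) * ‖v‖ ^ 2 ≤ ‖v + u‖ ^ 2 := by
    rw [norm_add_sq_real]
    have h5 : 2 / q * ‖v‖ ^ 2 = 2 * (1 / q * ‖v‖ ^ 2) := by ring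
    nlinarith [norm_nonneg u]
  have h6 : ‖v‖ ≤ ‖v + u‖ := by
    refine (pow_le_pow_iff_left₀ (norm_nonneg _) (norm_nonneg _) two_ne_zero).1 (le_trans ?_ h4)
    have : 0 ≤ 1 / q * ‖v‖ ^ 2 := by positivity
    linarith
  refine ⟨h6, ?_⟩
  have e : ∀ x : Vel d, 1 ≤ ‖x‖ → decayWeight q x = (‖x‖ ^ 2) ^ (-(q / 2)) := fun x hx => by
    rw [decayWeight_of_one_le q hx, ← Real.rpow_natCast, ← Real.rpow_mul (norm_nonneg _)]
    congr 1; push_cast; ring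
  rw [e v hv, e _ (hv.trans h6)]
  have h7 : 3 / 2 ≤ (1 + 1 / q) ^ (q / 2) := by
    have := one_add_mul_self_le_rpow_one_add (s := 1 / q) (by
      have : 0 ≤ 1 / q := by positivity
      linarith) (show 1 ≤ q / 2 by linarith)
    have h8 : q / 2 * (1 / q) = 1 / 2 := by field_simp
    rw [h8] at this
    linarith
  calc (‖v + u‖ ^ 2) ^ (-(q / 2)) ≤ ((1 + 1 / q) * ‖v‖ ^ 2) ^ (-(q / 2)) :=
        Real.rpow_le_rpow_of_nonpos (by positivity) h4 (by linarith)
    _ = ((1 + 1 / q) ^ (q / 2))⁻¹ * (‖v‖ ^ 2) ^ (-(q / 2)) := by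
        rw [Real.mul_rpow (by positivity) (by positivity), Real.rpow_neg (by positivity)]
    _ ≤ (3 / 2)⁻¹ * (‖v‖ ^ 2) ^ (-(q / 2)) := by gcongr
    _ = _ := by norm_num

/-- For weights of large exponent `q`, the collisions with `v'_*` in a bounded set give a negative
contribution of order `q^s`, whereas the other ones contribute `O(1)` as `|v| → ∞`, uniformly
in `q`. -/
theorem exists_swappedIncrement_le_neg {n : ℕ} (hn : 1 ≤ n) {γ s b₀ b₁ m₀ M₀ E₀ h₀ : ℝ}
    (hs : s ∈ Ioo (0 : ℝ) 1) (hγs : 0 ≤ γ + 2 * s) (hγs2 : γ + 2 * s ≤ 2) (hb₀ : 0 < b₀)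
    (hb₁ : 0 ≤ b₁) (hm₀ : 0 < m₀) (hM : 0 ≤ M₀) (hE : 0 ≤ E₀) (hh₀ : 0 ≤ h₀) :
    ∃ c K q₁ : ℝ, 0 < c ∧ 0 ≤ K ∧ ∀ q : ℝ, q₁ ≤ q → ∃ R : ℝ, 1 ≤ R ∧
      ∀ β : ℝ → ℝ, Measurable β → (∀ x, b₀ ≤ β x) → (∀ x, β x ≤ b₁) →
      ∀ f : Vel (n + 1) → ℝ, IsProfile m₀ M₀ E₀ h₀ f → ∀ v : Vel (n + 1), R ≤ ‖v‖ →
      CollisionBound n γ s β f v (swappedIncrement f q v)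
        ((K - c * q ^ s) * (decayWeight q v * ‖v‖ ^ γ)) := by
  have hs0 := hs.1
  have hn0 : (0 : ℝ) ≤ n := by positivity
  obtain ⟨R₀, L₀, c₀, hR1, hL1, hc₀, hcore⟩ := exists_core (d := n + 1) (by omega) hm₀ hE hh₀ hγs
  obtain ⟨c₁, hc₁, hband⟩ := exists_le_lintegral_band (n := n) (γ := γ) (b := b₀) hn hs0 hb₀
  obtain ⟨C₂, hC₂0, h₂⟩ := exists_lintegral_swapped_le (γ := γ) (b := b₁) hn hs hγs hb₁
    (show n + 1 + γ + 2 * s < n + 4 by linarith)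
  refine ⟨c₁ * c₀ * 2⁻¹ ^ s / 3, C₂ * 2 * M₀ + 1, max 32 (n + 4), by positivity, by positivity,
    fun q hq => ?_⟩
  have hq32 : 32 ≤ q := (le_max_left _ _).trans hq
  have hqn : (n : ℝ) + 4 ≤ q := (le_max_right _ _).trans hq
  have hq0 : 0 < q := by linarith
  -- with `v'_*` bounded, `φ_q` drops by a fixed factor when `|v' - v| ≥ κ |v|`
  set κ : ℝ := √(2 / q) with hκ
  have hκ0 : 0 < κ := by positivity
  have hκ4 : κ ≤ 1 / 4 := by
    rw [hκ, Real.sqrt_le_left (by norm_num), div_le_iff₀ hq0]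
    linarith
  -- `l² q = 1` bounds the constant for `|v'| < l |v|` uniformly in `q`; beyond, the energy gives
  -- a factor `|v|^{-2}`, which outweighs any dependence on `q`
  set l : ℝ := √(1 / q) with hl
  have hl0 : 0 < l := by positivity
  have hlsq : l ^ 2 = 1 / q := Real.sq_sqrt (by positivity)
  have hl2 : l ≤ 1 / 2 := by
    rw [hl, Real.sqrt_le_left (by norm_num), div_le_iff₀ hq0]
    linarith
  obtain ⟨C₁, hC₁0, h₁⟩ := exists_collisionBound_swapped (γ := γ) (b := b₁) (q := q) (E₀ := E₀) hn hs
    hγs hγs2 hb₁ hκ0 hκ4 hq0.le hE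
  set C₃ : ℝ := C₂ * (1 - (1 / 2) ^ 2) ^ (-q / 2) * (E₀ / l ^ 2) with hC₃
  have hC₃0 : 0 ≤ C₃ := by positivity
  refine ⟨max 1 (max (4 * R₀ / κ) (C₁ + C₃)), le_max_left _ _, fun β hβ hβ0 hβ1 f h v hv => ?_⟩
  have hv1 : 1 ≤ ‖v‖ := (le_max_left _ _).trans hv
  have hvR : 4 * R₀ ≤ κ * ‖v‖ := by
    have := ((le_max_left _ _).trans (le_max_right _ _)).trans hv
    rw [div_le_iff₀ hκ0] at this
    linarith
  have hvC : C₁ + C₃ ≤ ‖v‖ := ((le_max_right _ _).trans (le_max_right _ _)).trans hv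
  have hv0 : 0 < ‖v‖ := by linarith
  have hφ := decayWeight_pos q v
  set Y := decayWeight q v * ‖v‖ ^ γ with hY
  have hY0 : 0 < Y := by positivity
  have hp : ∫⁻ x, ENNReal.ofReal (swappedInner f q v x) ∂(collisionMeasure n γ s β) ≤
      ENNReal.ofReal (C₂ * 2 * M₀ * Y + C₃ / ‖v‖ ^ 2 * Y) := by
    have hl1 : (1 - l ^ 2) ^ (-q / 2) ≤ 2 := by
      rw [hlsq, neg_div, Real.rpow_neg (by
        rw [sub_nonneg, div_le_one hq0]; linarith)]
      refine inv_le_of_inv_le₀ (by norm_num) ?_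
      have := one_add_mul_self_le_rpow_one_add (s := -(1 / q)) (by
        rw [neg_le_neg_iff, div_le_one hq0]; linarith) (show 1 ≤ q / 2 by linarith)
      have h8 : q / 2 * -(1 / q) = -(1 / 2) := by field_simp
      rw [h8, ← sub_eq_add_neg] at this
      refine le_trans (by norm_num) this
    have hl3 : 0 ≤ 1 - l ^ 2 := by
      rw [hlsq, sub_nonneg, div_le_one hq0]; linarith
    have hl4 : 0 ≤ C₂ * (1 - l ^ 2) ^ (-q / 2) * Y :=
      mul_nonneg (mul_nonneg hC₂0 (Real.rpow_nonneg hl3 _)) hY0.le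
    have hI1 := lintegral_indicator_mul_decayWeight_le (γ := γ) (s := s) (q := q) h.continuous (v := v)
      {y | ‖y‖ < l * ‖v‖} (measurableSet_lt measurable_norm measurable_const)
      (fun y (hy : ‖y‖ < l * ‖v‖) => hy.le) hl4
      ((setLIntegral_le_lintegral _ _).trans h.mass_upper)
      (h₂ β hβ hβ1 q hqn v hv1 l hl0.le hl2)
    have hI2 := lintegral_indicator_mul_decayWeight_le (γ := γ) (s := s) (q := q) h.continuous (v := v)
      {y | l * ‖v‖ ≤ ‖y‖ ∧ ‖y‖ < ‖v‖ / 2} ((measurableSet_le measurable_const measurable_norm).inter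
        (measurableSet_lt measurable_norm measurable_const))
      (fun y hy => by linarith [hy.2]) (by positivity)
      ((lintegral_mono_set (fun y hy => hy.1)).trans
        (h.lintegral_far_le (show 0 < l * ‖v‖ by positivity)))
      (h₂ β hβ hβ1 q hqn v hv1 (1 / 2) (by norm_num) le_rfl)
    have hm1 : Measurable fun x : Vel (n + 1) × Vel (n + 1) =>
        ({y | ‖y‖ < l * ‖v‖} : Set (Vel (n + 1))).indicator (fun y => ENNReal.ofReal (f y)) (v + x.1) *
          ENNReal.ofReal (decayWeight q (v + x.2)) := by
      have : Measurable (({y | ‖y‖ < l * ‖v‖} : Set (Vel (n + 1))).indicator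
          fun y => ENNReal.ofReal (f y)) := h.measurable.indicator
        (measurableSet_lt measurable_norm measurable_const)
      exact (this.comp (measurable_fst.const_add v)).mul
        ((continuous_decayWeight q).measurable.comp (measurable_snd.const_add v)).ennreal_ofReal
    refine le_trans (lintegral_mono fun x => ?_)
      ((lintegral_add_left hm1 _).le.trans ((add_le_add hI1 hI2).trans ?_))
    · simp only
      rw [← add_mul]
      unfold swappedInner
      rw [ENNReal.ofReal_mul (indicator_nonneg (fun u _ => h.nonneg _) _)]
      refine mul_le_mul_left ?_ _
      by_cases hx : ‖v + x.1‖ < ‖v‖ / 2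
      · rw [indicator_of_mem (by exact hx)]
        rcases lt_or_ge ‖v + x.1‖ (l * ‖v‖) with hx2 | hx2
        · rw [indicator_of_mem (by exact hx2)]; exact le_self_add
        · rw [indicator_of_mem (s := {y | l * ‖v‖ ≤ ‖y‖ ∧ ‖y‖ < ‖v‖ / 2})
            (show v + x.1 ∈ {y | l * ‖v‖ ≤ ‖y‖ ∧ ‖y‖ < ‖v‖ / 2} from ⟨hx2, hx⟩)]
          exact le_add_self
      · rw [indicator_of_notMem (by exact hx), ENNReal.ofReal_zero]; exact bot_le
    · rw [← ENNReal.ofReal_add (mul_nonneg hl4 hM) (by positivity)]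
      refine ENNReal.ofReal_le_ofReal (add_le_add ?_ (le_of_eq ?_))
      · calc C₂ * (1 - l ^ 2) ^ (-q / 2) * Y * M₀ ≤ C₂ * 2 * Y * M₀ := by gcongr
          _ = _ := by ring
      · rw [hC₃, mul_pow]; field_simp; rw [hY]; ring
  set T : Set (Vel (n + 1)) := {x | ‖x‖ ≤ R₀ ∧ f x ≤ L₀} with hT
  have hTm : MeasurableSet T := (measurableSet_le measurable_norm measurable_const).inter
    (measurableSet_le h.continuous.measurable measurable_const)
  have hTf0 : ∀ x, 0 ≤ T.indicator f x := fun x => indicator_nonneg (fun x _ => h.nonneg x) x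
  have hf1 : Measurable fun w => T.indicator f (v + w) :=
    (h.continuous.measurable.indicator hTm).comp (measurable_const_add v)
  set r := κ * ‖v‖ with hr
  have hr0 : 0 < r := by positivity
  have hI1 : Measurable ((Ioo r (2 * r)).indicator (1 : ℝ → ℝ)) :=
    measurable_one.indicator measurableSet_Ioo
  have hI0 : ∀ t, (0 : ℝ) ≤ (Ioo r (2 * r)).indicator 1 t := fun t =>
    indicator_nonneg (fun _ _ => zero_le_one) t
  have hgI := hband β hβ hβ0 (fun w => ENNReal.ofReal (T.indicator f (v + w))) hf1.ennreal_ofReal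
    (c₀ * max 1 ‖v‖ ^ (γ + 2 * s)) r (by positivity) hr0 (hcore M₀ f h v)
  rw [max_eq_right hv1] at hgI
  refine (h₁ β hβ hβ1 m₀ M₀ h₀ f h v hv1 _ (by positivity) hp
    (fun x => decayWeight q v / 3 * (T.indicator f (v + x.2) * (Ioo r (2 * r)).indicator 1 ‖x.1‖)) r
    (decayWeight q v / 3 * (c₁ * (c₀ * ‖v‖ ^ (γ + 2 * s)) * r ^ (-(2 * s))))
    (((hf1.comp measurable_snd).mul (hI1.comp (by fun_prop))).const_mul _)
    (fun x => mul_nonneg (by positivity) (mul_nonneg (hTf0 _) (hI0 _))) hr0 (by positivity)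
    (fun u w huw hG => ?_) ?_).mono (fun _ _ _ => le_rfl) ?_
  · have hu : ‖u‖ ∈ Ioo r (2 * r) := by
      by_contra hu
      simp [indicator_of_notMem hu] at hG
    have hw : v + w ∈ T := by
      by_contra hw
      simp [indicator_of_notMem hw] at hG
    obtain ⟨h3, h4⟩ := decayWeight_le_of_large_displacement (by linarith) hv1 huw hw.1
      (hvR.trans hu.1.le) hu.1.le
    refine ⟨hu.1, ?_⟩
    unfold swappedIncrement
    rw [if_neg (by linarith)]
    simp only [indicator_of_mem hu, indicator_of_mem hw, Pi.one_apply, mul_one]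
    have := mul_le_mul_of_nonneg_left h4 (h.nonneg (v + w))
    linarith
  · have hφ3 : 0 ≤ decayWeight q v / 3 := by positivity
    simp_rw [ENNReal.ofReal_mul hφ3]
    rw [lintegral_const_mul' _ _ ENNReal.ofReal_ne_top]
    refine mul_le_mul_right (hgI.trans ?_) _
    rw [setLIntegral_lt_norm_fst]
    refine lintegral_mono fun x => ?_
    by_cases hu : ‖x.1‖ ∈ Ioo r (2 * r)
    · rw [indicator_of_mem hu, indicator_of_mem hu, indicator_of_mem
        (show ‖x.1‖ ∈ Ioi r from hu.1)]
      simp only [Pi.one_apply, mul_one]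
      exact le_rfl
    · rw [indicator_of_notMem hu, mul_zero]; exact bot_le
  · have e1 : ‖v‖ ^ (γ + 2 * s) * r ^ (-(2 * s)) = ‖v‖ ^ γ * (2⁻¹ ^ s * q ^ s) := by
      have h5 : κ ^ (-(2 * s)) = 2⁻¹ ^ s * q ^ s := by
        rw [← Real.mul_rpow (by norm_num) hq0.le, hκ, Real.sqrt_eq_rpow, ← Real.rpow_mul (by positivity),
          show 1 / 2 * (-(2 * s)) = -s by ring, Real.rpow_neg (by positivity),
          ← Real.inv_rpow (by positivity), inv_div]
        congr 1; ring
      rw [hr, Real.mul_rpow hκ0.le hv0.le, h5, mul_left_comm, ← Real.rpow_add hv0]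
      rw [show γ + 2 * s + -(2 * s) = γ by ring]; ring
    have e2 : ‖v‖ ^ (γ - 2) = ‖v‖ ^ γ / ‖v‖ ^ 2 := by
      rw [Real.rpow_sub hv0, Real.rpow_two]
    have e3 : decayWeight q v / 3 * (c₁ * (c₀ * ‖v‖ ^ (γ + 2 * s)) * r ^ (-(2 * s))) =
        c₁ * c₀ * 2⁻¹ ^ s / 3 * q ^ s * Y := by
      rw [show decayWeight q v / 3 * (c₁ * (c₀ * ‖v‖ ^ (γ + 2 * s)) * r ^ (-(2 * s))) =
        decayWeight q v / 3 * (c₁ * c₀) * (‖v‖ ^ (γ + 2 * s) * r ^ (-(2 * s))) by ring, e1, hY]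
      ring
    rw [e3, e2]
    have h6 : (C₁ + C₃) / ‖v‖ ^ 2 ≤ 1 := by
      rw [div_le_one (by positivity)]
      nlinarith
    have h7 := mul_le_mul_of_nonneg_right h6 hY0.le
    have h8 : C₁ * (decayWeight q v * (‖v‖ ^ γ / ‖v‖ ^ 2)) + C₃ / ‖v‖ ^ 2 * Y =
        (C₁ + C₃) / ‖v‖ ^ 2 * Y := by rw [hY]; ring
    linarith

/-! ### The barrier argument -/

theorem mem_timeInterval_of_le {T : EReal} {t t₁ : ℝ} (h : t₁ ∈ timeInterval T) (ht0 : 0 ≤ t)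
    (ht : t ≤ t₁) : t ∈ timeInterval T :=
  ⟨ht0, (EReal.coe_le_coe_iff.2 ht).trans h.2⟩

namespace IsMildDecaySolution

variable {d : ℕ} {γ s : ℝ} {bt : ℝ → ℝ} {T : EReal} {f : ℝ → Vel d → Vel d → ℝ}

/-- By periodicity all values of a solution are attained at positions in a fixed ball. -/
theorem exists_position_eq (hf : IsMildDecaySolution γ s bt T f) (x : Vel d) :
    ∃ y ∈ Metric.closedBall (0 : Vel d) (√d), ∀ t ∈ timeInterval T, ∀ v, f t y v = f t x v := by
  refine ⟨x + WithLp.toLp 2 (fun i => ((-⌊x i⌋ : ℤ) : ℝ)), ?_,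
    fun t ht v => hf.periodic t ht x v fun i => -⌊x i⌋⟩
  rw [mem_closedBall_zero_iff, EuclideanSpace.norm_eq]
  refine Real.sqrt_le_sqrt ?_
  calc _ ≤ ∑ _i : Fin d, (1 : ℝ) := Finset.sum_le_sum fun i _ => ?_
    _ = d := by simp
  have h1 : (x + WithLp.toLp 2 (fun i => ((-⌊x i⌋ : ℤ) : ℝ))) i = Int.fract (x i) := by
    simp [Int.fract, sub_eq_add_neg]
  rw [h1, Real.norm_of_nonneg (Int.fract_nonneg _)]
  nlinarith [Int.fract_nonneg (x i), Int.fract_lt_one (x i)]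

theorem continuous_slice (hf : IsMildDecaySolution γ s bt T f) {t : ℝ} (ht : t ∈ timeInterval T)
    (x : Vel d) : Continuous (f t x) :=
  (hf.differentiable_v t ht x).continuous

/-- A solution is bounded on bounded time intervals. -/
theorem exists_bound (hf : IsMildDecaySolution γ s bt T f) {t₁ : ℝ} (ht₁ : t₁ ∈ timeInterval T) :
    ∃ B : ℝ, ∀ t ∈ Icc 0 t₁, ∀ x v, f t x v ≤ B := by
  obtain ⟨R, -, hR⟩ := hf.decay 1 one_pos
  have hK : IsCompact (Icc 0 t₁ ×ˢ (Metric.closedBall (0 : Vel d) (√d) ×ˢ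
      Metric.closedBall (0 : Vel d) R)) :=
    isCompact_Icc.prod ((isCompact_closedBall _ _).prod (isCompact_closedBall _ _))
  have hsub : ∀ t ∈ Icc 0 t₁, t ∈ timeInterval T := fun t ht =>
    mem_timeInterval_of_le ht₁ ht.1 ht.2
  obtain ⟨B, hB⟩ := hK.exists_bound_of_continuousOn
    (hf.continuous.mono fun p hp => ⟨hsub _ hp.1, mem_univ _⟩)
  refine ⟨max 1 B, fun t ht x v => ?_⟩
  obtain ⟨y, hy, hyx⟩ := hf.exists_position_eq x
  rw [← hyx t (hsub t ht) v]
  rcases le_total R ‖v‖ with hv | hv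
  · have := hR t (hsub t ht) y v hv
    rw [Real.rpow_zero, one_mul] at this
    exact this.trans (le_max_left _ _)
  · exact (le_abs_self _).trans ((hB (t, y, v) ⟨ht, hy, mem_closedBall_zero_iff.2 hv⟩).trans
      (le_max_right _ _))

/-- Comparison principle: a solution stays below `g` if it does so initially and for large
velocities, and if at a first contact point the collision operator would be less than `∂_t g`.
There the gradient in `x` vanishes and `∂_t f ≥ ∂_t g`. -/
theorem lt_of_barrier (hf : IsMildDecaySolution γ s bt T f) {t₀ t₁ : ℝ} (ht₀ : 0 ≤ t₀)
    (ht₁ : t₁ ∈ timeInterval T) {g g' : ℝ → Vel d → ℝ}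
    (hg : ContinuousOn (fun p : ℝ × Vel d => g p.1 p.2) (Icc t₀ t₁ ×ˢ univ))
    (hg' : ∀ t ∈ Ioc t₀ t₁, ∀ v, HasDerivAt (fun τ => g τ v) (g' t v) t)
    (hinit : ∀ x v, f t₀ x v < g t₀ v) {R : ℝ}
    (hR : ∀ t ∈ Icc t₀ t₁, ∀ x v, R ≤ ‖v‖ → f t x v < g t v)
    (hcontact : ∀ t ∈ Ioc t₀ t₁, ∀ x v L, (∀ y, f t x y ≤ g t y) → f t x v = g t v →
      HasCollisionValue γ s bt (f t x) (f t x) v L → L < g' t v) :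
    ∀ t ∈ Icc t₀ t₁, ∀ x v, f t x v < g t v := by
  have hsub : ∀ t ∈ Icc t₀ t₁, t ∈ timeInterval T := fun t ht =>
    mem_timeInterval_of_le ht₁ (ht₀.trans ht.1) ht.2
  set K : Set (ℝ × Vel d × Vel d) := Icc t₀ t₁ ×ˢ (Metric.closedBall (0 : Vel d) (√d) ×ˢ
      Metric.closedBall (0 : Vel d) R) with hK
  have hKc : IsCompact K :=
    isCompact_Icc.prod ((isCompact_closedBall _ _).prod (isCompact_closedBall _ _))
  have hfc : ContinuousOn (fun p : ℝ × Vel d × Vel d => f p.1 p.2.1 p.2.2) (Icc t₀ t₁ ×ˢ univ) :=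
    hf.continuous.mono fun p hp => ⟨hsub _ hp.1, mem_univ _⟩
  have hgc : ContinuousOn (fun p : ℝ × Vel d × Vel d => g p.1 p.2.2) (Icc t₀ t₁ ×ˢ univ) :=
    hg.comp (f := fun p : ℝ × Vel d × Vel d => (p.1, p.2.2)) (by fun_prop)
      fun p hp => ⟨hp.1, mem_univ _⟩
  set D : Set (ℝ × Vel d × Vel d) := {p ∈ K | g p.1 p.2.2 ≤ f p.1 p.2.1 p.2.2} with hD
  have hKsub : K ⊆ Icc t₀ t₁ ×ˢ univ := fun p hp => ⟨hp.1, mem_univ _⟩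
  have hDc : IsCompact D := by
    refine hKc.of_isClosed_subset ?_ (sep_subset _ _)
    exact hKc.isClosed.isClosed_le (hgc.mono hKsub) (hfc.mono hKsub)
  -- a violation of the inequality yields a point of `D` at the same time
  have hviol : ∀ t ∈ Icc t₀ t₁, ∀ x v, g t v ≤ f t x v → ∃ y, (t, y, v) ∈ D := by
    intro t ht x v h
    obtain ⟨y, hy, hyx⟩ := hf.exists_position_eq x
    refine ⟨y, ⟨ht, hy, mem_closedBall_zero_iff.2 ?_⟩, by rw [hyx t (hsub t ht)]; exact h⟩
    by_contra hv
    exact absurd (hR t ht x v (not_le.1 hv).le) (not_lt.2 h)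
  by_contra! hcon
  obtain ⟨t, ht, x, v, hle⟩ := hcon
  obtain ⟨y, hy⟩ := hviol t ht x v hle
  obtain ⟨⟨ts, xs, vs⟩, hps, hmin⟩ := hDc.exists_isMinOn ⟨_, hy⟩ continuous_fst.continuousOn
  have hts : ts ∈ Icc t₀ t₁ := hps.1.1
  have hbefore : ∀ t ∈ Ico t₀ ts, ∀ x v, f t x v < g t v := by
    intro t ht x v
    by_contra h
    obtain ⟨y, hy⟩ := hviol t ⟨ht.1, ht.2.le.trans hts.2⟩ x v (not_lt.1 h)
    exact absurd (hmin hy) (not_le.2 ht.2)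
  have htpos : t₀ < ts := by
    refine lt_of_le_of_ne hts.1 fun h => ?_
    have h1 := hps.2
    simp only at h1
    rw [← h] at h1
    exact absurd (hinit xs vs) (not_lt.2 h1)
  have htIoc : ts ∈ Ioc t₀ t₁ := ⟨htpos, hts.2⟩
  have hle : ∀ x v, f ts x v ≤ g ts v := by
    intro x v
    have hcf : ContinuousWithinAt (fun t => f t x v) (Ico t₀ ts) ts :=
      ((hfc.comp (f := fun t : ℝ => (t, x, v)) (s := Icc t₀ t₁) (by fun_prop)
        fun t ht => ⟨ht, mem_univ _⟩) ts hts).mono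
          fun t ht => ⟨ht.1, ht.2.le.trans hts.2⟩
    have hcg : ContinuousWithinAt (fun t => g t v) (Ico t₀ ts) ts :=
      (hg' ts htIoc v).continuousAt.continuousWithinAt
    have : (𝓝[Ico t₀ ts] ts).NeBot := by
      rw [← mem_closure_iff_nhdsWithin_neBot, closure_Ico htpos.ne]
      exact right_mem_Icc.2 htpos.le
    exact le_of_tendsto_of_tendsto hcf.tendsto hcg.tendsto
      (eventually_nhdsWithin_of_forall fun t ht => (hbefore t ht x v).le)
  have heq : f ts xs vs = g ts vs := le_antisymm (hle _ _) hps.2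
  have hx : fderiv ℝ (fun y => f ts y vs) xs = 0 := by
    refine IsLocalMax.fderiv_eq_zero (Eventually.of_forall fun y => ?_)
    simp only [heq]
    exact hle y vs
  have htime : g' ts vs ≤ derivWithin (fun τ => f τ xs vs) (timeInterval T) ts := by
    have h1 : HasDerivWithinAt (fun τ => f τ xs vs)
        (derivWithin (fun τ => f τ xs vs) (timeInterval T) ts) (Icc t₀ ts) ts :=
      ((hf.differentiable_t ts (hsub ts hts) xs vs).hasDerivWithinAt).mono
        fun t ht => hsub t ⟨ht.1, ht.2.trans hts.2⟩
    have h2 := h1.sub (hg' ts htIoc vs).hasDerivWithinAt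
    have hmax : IsLocalMaxOn ((fun τ => f τ xs vs) - fun τ => g τ vs) (Icc t₀ ts) ts := by
      refine eventually_nhdsWithin_of_forall fun t ht => ?_
      simp only [Pi.sub_apply, heq, sub_self]
      rcases ht.2.eq_or_lt with h | h
      · rw [h, heq, sub_self]
      · linarith [hbefore t ⟨ht.1, h⟩ xs vs]
    have h3 := hmax.hasFDerivWithinAt_nonpos h2.hasFDerivWithinAt
      (y := t₀ - ts) (mem_posTangentConeAt_of_segment_subset (by
        rw [add_sub_cancel, segment_symm, segment_eq_Icc htpos.le]))
    simp at h3
    nlinarith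
  have := hcontact ts htIoc xs vs _ (hle xs) heq (hf.equation ts (hsub ts hts) xs vs)
  rw [hx] at this
  simp at this
  linarith

/-- Every velocity distribution of a solution is a profile. -/
theorem isProfile (hf : IsMildDecaySolution γ s bt T f) {m₀ M₀ E₀ H₀ : ℝ}
    (hH : HydroBounds T m₀ M₀ E₀ H₀ f) {t : ℝ} (ht : t ∈ timeInterval T) (x : Vel d) :
    IsProfile m₀ M₀ E₀ (H₀ + E₀ + (∫ v : Vel d, Real.exp (-‖v‖ ^ 2 - 1))) (f t x) := by
  obtain ⟨B, hB⟩ := hf.exists_bound ht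
  exact isProfile_of_bounds (hf.continuous_slice ht x) (hf.nonneg t ht x)
    ⟨B, hB t (right_mem_Icc.2 ht.1) x⟩ (hH.mass_integrable t ht x) (hH.energy_integrable t ht x)
    (hH.entropy_integrable t ht x) (hH.mass_lower t ht x) (hH.mass_upper t ht x)
    (hH.energy_upper t ht x) (hH.entropy_upper t ht x)

end IsMildDecaySolution

theorem IsAngularFactor.max_right {b₀ b₁ : ℝ} {bt : ℝ → ℝ} (h : IsAngularFactor b₀ b₁ bt) :
    IsAngularFactor b₀ (max b₀ b₁) bt :=
  ⟨h.smooth, h.lower, fun c hc => (h.upper c hc).trans (le_max_right _ _)⟩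

/-! ### Regularization and propagation of decay -/

theorem exists_le_rpow_neg {α t₁ : ℝ} (hα : 0 < α) (ht₁ : 0 < t₁) (y : ℝ) :
    ∃ t₀ : ℝ, 0 < t₀ ∧ t₀ ≤ t₁ ∧ y < t₀ ^ (-α) := by
  have h := (tendsto_rpow_neg_nhdsGT_zero (y := -α) (by linarith)).eventually_gt_atTop y
  obtain ⟨t₀, h1, h2, h3⟩ := (h.and (Ioo_mem_nhdsGT ht₁)).exists
  exact ⟨t₀, h2, h3.le, h1⟩

theorem entropy_const_nonneg {d : ℕ} {E₀ H₀ : ℝ} (hE₀ : 0 ≤ E₀) (hH₀ : 0 ≤ H₀) :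
    0 ≤ H₀ + E₀ + (∫ v : Vel d, Real.exp (-‖v‖ ^ 2 - 1)) :=
  add_nonneg (add_nonneg hH₀ hE₀) (integral_nonneg fun _ => (Real.exp_pos _).le)

variable {n : ℕ} {γ s b₀ b₁ m₀ M₀ E₀ H₀ : ℝ}

/-- Propagation of decay of exponent at most `d + 1`. -/
theorem exists_propagation_small_exponent (hn : 1 ≤ n) {q : ℝ}
    (hs : s ∈ Ioo (0 : ℝ) 1) (hγs : 0 ≤ γ + 2 * s) (hγs2 : γ + 2 * s ≤ 2) (hb₀ : 0 < b₀)
    (hb₁ : b₀ ≤ b₁) (hm₀ : 0 < m₀) (hM₀ : 0 ≤ M₀) (hE₀ : 0 ≤ E₀) (hH₀ : 0 ≤ H₀) (hq0 : 0 ≤ q)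
    (hq : q ≤ n + 2) :
    ∃ N₀ : ℝ, 1 ≤ N₀ ∧ ∀ (bt : ℝ → ℝ) (T : EReal) (f : ℝ → Vel (n + 1) → Vel (n + 1) → ℝ),
      IsAngularFactor b₀ b₁ bt → IsMildDecaySolution γ s bt T f → HydroBounds T m₀ M₀ E₀ H₀ f →
      ∀ C : ℝ, (∀ x v, f 0 x v ≤ C * decayWeight q v) →
      ∀ t ∈ timeInterval T, ∀ x v, f t x v ≤ max N₀ C * decayWeight q v := by
  obtain ⟨N₀, c, hN₀, hc, hcontact⟩ := exists_contact_bound hn hs hγs hγs2 hb₀ hb₁ hm₀ hM₀ hE₀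
    (entropy_const_nonneg (d := n + 1) hE₀ hH₀) hq0 hq
  refine ⟨N₀, hN₀, fun bt T f hbt hf hH C hC t ht x v => ?_⟩
  set N := max N₀ C with hN
  have hN0 : 0 < N := by linarith [le_max_left N₀ C]
  refine le_of_forall_pos_le_add fun δ hδ => ?_
  set ε := δ / N with hε
  have hε0 : 0 < ε := by positivity
  obtain ⟨R, -, hR⟩ := hf.decay (N * ε / 2) (by positivity)
  have hsub : ∀ t' ∈ Icc 0 t, t' ∈ timeInterval T := fun t' ht' =>
    mem_timeInterval_of_le ht ht'.1 ht'.2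
  have := hf.lt_of_barrier le_rfl ht (g := fun _ v => N * (decayWeight q v + ε))
    (g' := fun _ _ => 0)
    (((((continuous_decayWeight q).comp continuous_snd).add continuous_const).const_mul
      N).continuousOn)
    (fun t _ v => hasDerivAt_const t _) (fun x v => ?_) (R := R) (fun t' ht' x v hv => ?_)
    (fun t' ht' x v L hle heq hL => ?_) t (right_mem_Icc.2 ht.1) x v
  · have h1 : N * ε = δ := by rw [hε]; field_simp
    simp only [mul_add, h1] at this
    exact this.le
  · have h1 : C * decayWeight q v ≤ N * decayWeight q v :=
      mul_le_mul_of_nonneg_right (le_max_right _ _) (decayWeight_pos q v).le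
    have h2 : 0 < N * ε := by positivity
    linarith [hC x v]
  · have h1 := hR t' (hsub t' ht') x v hv
    rw [Real.rpow_zero, one_mul] at h1
    have h2 : 0 < N * ε := by positivity
    have h3 := mul_pos hN0 (decayWeight_pos q v)
    linarith
  · have h1 := hcontact bt hbt (f t' x) (hf.isProfile hH (hsub t' ⟨ht'.1.le, ht'.2⟩) x) v L N ε
      (le_max_left _ _) hε0.le hle heq hL
    have h2 : 0 < f t' x v := by
      rw [heq]; exact mul_pos hN0 (add_pos (decayWeight_pos q v) hε0)
    have hV : 0 < max 1 ‖v‖ := lt_max_of_lt_left one_pos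
    have h3 : 0 < c * (f t' x v * (max 1 ‖v‖ ^ γ *
        (f t' x v * max 1 ‖v‖ ^ ((n : ℝ) + 2)) ^ (2 * s / (n + 1)))) := by positivity
    linarith

theorem rpow_le_of_weight_le {N y V γ q m e : ℝ} (hV : 1 ≤ V) (hN : 0 < N) (he : 0 ≤ e)
    (hy : N * V ^ (-q) ≤ y) (h : 0 ≤ γ + (m - q) * e) : N ^ e ≤ V ^ γ * (y * V ^ m) ^ e := by
  have hV0 : 0 < V := by linarith
  calc N ^ e ≤ N ^ e * V ^ (γ + (m - q) * e) :=
        le_mul_of_one_le_right (by positivity) (Real.one_le_rpow hV h)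
    _ = V ^ γ * (N * V ^ (-q) * V ^ m) ^ e := by
        rw [mul_assoc N, ← Real.rpow_add hV0, Real.mul_rpow hN.le (by positivity),
          ← Real.rpow_mul hV0.le, Real.rpow_add hV0, neg_add_eq_sub]
        ring
    _ ≤ _ := by gcongr

set_option maxHeartbeats 1000000 in
/-- Instantaneous decay: the barrier `N (1 + t^{-d/(2s)}) (φ_q + ε)` is infinite at `t = 0`. The
condition on `q` makes the weights cancel in the superlinear term of the contact bound. -/
theorem exists_instantaneous_decay (hn : 1 ≤ n) {q : ℝ}
    (hs : s ∈ Ioo (0 : ℝ) 1) (hγs : 0 ≤ γ + 2 * s) (hγs2 : γ + 2 * s ≤ 2) (hb₀ : 0 < b₀)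
    (hb₁ : b₀ ≤ b₁) (hm₀ : 0 < m₀) (hM₀ : 0 ≤ M₀) (hE₀ : 0 ≤ E₀) (hH₀ : 0 ≤ H₀) (hq0 : 0 ≤ q)
    (hq : q ≤ n + 2) (hqγ : 0 ≤ γ + (n + 2 - q) * (2 * s / (n + 1))) :
    ∃ N : ℝ, 1 ≤ N ∧ ∀ (bt : ℝ → ℝ) (T : EReal) (f : ℝ → Vel (n + 1) → Vel (n + 1) → ℝ),
      IsAngularFactor b₀ b₁ bt → IsMildDecaySolution γ s bt T f → HydroBounds T m₀ M₀ E₀ H₀ f →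
      ∀ t ∈ timeInterval T, 0 < t → ∀ x v,
        f t x v ≤ N * (1 + t ^ (-(((n : ℝ) + 1) / (2 * s)))) * decayWeight q v := by
  obtain ⟨N₀, c, hN₀, hc, hcontact⟩ := exists_contact_bound hn hs hγs hγs2 hb₀ hb₁ hm₀ hM₀ hE₀
    (entropy_const_nonneg (d := n + 1) hE₀ hH₀) hq0 hq
  have hs0 := hs.1
  set e : ℝ := 2 * s / (n + 1) with he
  set α : ℝ := ((n : ℝ) + 1) / (2 * s) with hα
  have he0 : 0 < e := by positivity
  have hα0 : 0 < α := by positivity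
  have hαe : α * e = 1 := by rw [hα, he]; field_simp
  obtain ⟨N, hNc, hNN⟩ := (((tendsto_rpow_atTop he0).eventually_gt_atTop (α / c)).and
    (eventually_ge_atTop N₀)).exists
  rw [div_lt_iff₀ hc] at hNc
  have hN0 : 0 < N := by linarith
  refine ⟨N, by linarith, fun bt T f hbt hf hH t₁ ht₁ ht₁0 x v => ?_⟩
  have hN1 : 0 < N * (1 + t₁ ^ (-α)) := by positivity
  refine le_of_forall_pos_le_add fun δ hδ => ?_
  set ε := δ / (N * (1 + t₁ ^ (-α))) with hε
  have hε0 : 0 < ε := by positivity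
  obtain ⟨B, hB⟩ := hf.exists_bound ht₁
  obtain ⟨R, -, hR⟩ := hf.decay (N * ε / 2) (by positivity)
  obtain ⟨t₀, ht₀, ht₀₁, hBt⟩ := exists_le_rpow_neg hα0 ht₁0 (B / (N * ε))
  rw [div_lt_iff₀ (by positivity)] at hBt
  have hsub : ∀ t' ∈ Icc t₀ t₁, t' ∈ timeInterval T := fun t' ht' =>
    mem_timeInterval_of_le ht₁ (ht₀.le.trans ht'.1) ht'.2
  have := hf.lt_of_barrier ht₀.le ht₁ (g := fun t v => N * (1 + t ^ (-α)) * (decayWeight q v + ε))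
    (g' := fun t v => N * (-α * t ^ (-α - 1)) * (decayWeight q v + ε)) ?_
    (fun t ht v => ?_) (fun x v => ?_) (R := R) (fun t' ht' x v hv => ?_)
    (fun t ht x v L hle heq hL => ?_) t₁ (right_mem_Icc.2 ht₀₁) x v
  · have h1 : N * (1 + t₁ ^ (-α)) * ε = δ := by rw [hε]; field_simp
    simp only [mul_add _ (decayWeight q v), h1] at this
    exact this.le
  · refine ContinuousOn.mul (continuousOn_const.mul (continuousOn_const.add
      (continuousOn_fst.rpow_const fun p hp => Or.inl (ht₀.trans_le hp.1.1).ne'))) ?_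
    exact (((continuous_decayWeight q).comp continuous_snd).add continuous_const).continuousOn
  · exact (((Real.hasDerivAt_rpow_const (Or.inl (ht₀.trans ht.1).ne')).const_add 1).const_mul
      N).mul_const _
  · have h1 := hB t₀ ⟨ht₀.le, ht₀₁⟩ x v
    have h2 : 0 < t₀ ^ (-α) := by positivity
    have h3 := decayWeight_pos q v
    have h4 : 0 < N * (1 + t₀ ^ (-α)) * decayWeight q v := by positivity
    have h5 : 0 < N * ε := by positivity
    change _ < N * (1 + t₀ ^ (-α)) * (decayWeight q v + ε)
    nlinarith
  · have h1 := hR t' (hsub t' ht') x v hv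
    rw [Real.rpow_zero, one_mul] at h1
    have ht'0 : 0 < t' := ht₀.trans_le ht'.1
    have h2 : 0 < t' ^ (-α) := by positivity
    have h3 := decayWeight_pos q v
    have h4 : 0 < N * (1 + t' ^ (-α)) * decayWeight q v := by positivity
    have h5 : 0 < N * ε := by positivity
    have h6 : 0 < N * t' ^ (-α) * ε := by positivity
    change _ < N * (1 + t' ^ (-α)) * (decayWeight q v + ε)
    nlinarith
  · have ht0 : 0 < t := ht₀.trans ht.1
    have htα : 0 < t ^ (-α) := by positivity
    set Nt := N * (1 + t ^ (-α)) with hNt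
    have hNNt : N ≤ Nt := by nlinarith
    have hNt0 : 0 < Nt := by linarith
    have h1 := hcontact bt hbt (f t x) (hf.isProfile hH (hsub t ⟨ht.1.le, ht.2⟩) x) v L Nt ε
      (hNN.trans hNNt) hε0.le hle heq hL
    have hφ := decayWeight_pos q v
    set y := f t x v with hy
    have hy1 : Nt * decayWeight q v ≤ y := by rw [heq]; nlinarith
    have hy0 : 0 < y := lt_of_lt_of_le (by positivity) hy1
    set V := max 1 ‖v‖ with hV
    have hV1 : 1 ≤ V := le_max_left _ _
    have hV0 : 0 < V := by linarith
    have hpow : N ^ e / t ≤ V ^ γ * (y * V ^ ((n : ℝ) + 2)) ^ e := by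
      calc N ^ e / t = (N * t ^ (-α)) ^ e := by
            rw [Real.mul_rpow hN0.le htα.le, ← Real.rpow_mul ht0.le, neg_mul, hαe, Real.rpow_neg_one]
            rfl
        _ ≤ Nt ^ e := by
            refine Real.rpow_le_rpow (by positivity) ?_ he0.le
            rw [hNt]; nlinarith
        _ ≤ _ := rpow_le_of_weight_le hV1 hNt0 he0.le hy1 hqγ
    have h2 : α / t * y < c * (N ^ e / t) * y := by
      refine mul_lt_mul_of_pos_right ?_ hy0
      rw [mul_div_assoc']
      gcongr
      linarith
    have h3 : c * (N ^ e / t) * y ≤ c * (y * (V ^ γ * (y * V ^ ((n : ℝ) + 2)) ^ e)) := by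
      rw [mul_assoc, mul_comm y]
      gcongr
    have h4 : -(α / t * y) ≤ N * (-α * t ^ (-α - 1)) * (decayWeight q v + ε) := by
      have h5 : N * t ^ (-α) * (decayWeight q v + ε) ≤ y := by
        rw [heq, hNt]
        have : 0 < N * (decayWeight q v + ε) := by positivity
        nlinarith
      have h6 : N * (-α * t ^ (-α - 1)) * (decayWeight q v + ε) =
          -(α / t * (N * t ^ (-α) * (decayWeight q v + ε))) := by
        rw [Real.rpow_sub ht0, Real.rpow_one]; ring
      rw [h6]
      have : 0 < α / t := by positivity
      nlinarith
    linarith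

/-- Contact with a barrier made of two weights. -/
theorem collisionBound_of_contact {β : ℝ → ℝ} {f : Vel (n + 1) → ℝ} (hf : ∀ x, 0 ≤ f x)
    {q p N N' a a' : ℝ} {v : Vel (n + 1)} (hN : 0 ≤ N) (hN' : 0 ≤ N')
    (hle : ∀ x, f x ≤ N * decayWeight q x + N' * decayWeight p x)
    (heq : f v = N * decayWeight q v + N' * decayWeight p v)
    (h : CollisionBound n γ s β f v (swappedIncrement f q v) a)
    (h' : CollisionBound n γ s β f v (swappedIncrement f p v) a') :
    CollisionBound n γ s β f v (fun u w => f (v + w) * (f (v + u) - f v)) (N * a + N' * a') := by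
  refine ((h.const_mul hN).add (h'.const_mul hN')).mono (fun u w _ => ?_) le_rfl
  have hw := hf (v + w)
  unfold swappedIncrement
  split_ifs with hu
  · have h1 := mul_le_mul_of_nonneg_right (hle (v + w)) (hf (v + u))
    have h2 := mul_nonneg hw (hf v)
    linarith
  · have h1 := mul_le_mul_of_nonneg_left (hle (v + u)) hw
    rw [heq]
    linarith

set_option maxHeartbeats 1000000 in
/-- Propagation of decay of large exponent, for soft potentials with `γ + 2s < 1`. The bound with
exponent `d + 1` makes the auxiliary weight `φ_p`, `d + γ + 2s < p < d + 1`, dominate for large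
velocities; it may grow exponentially in time because its coefficient is sent to zero. -/
theorem exists_propagation_large_exponent (hn : 1 ≤ n)
    (hs : s ∈ Ioo (0 : ℝ) 1) (hγs : 0 ≤ γ + 2 * s) (hγs1 : γ + 2 * s < 1) (hγ : γ ≤ 0) (hb₀ : 0 < b₀)
    (hb₁ : b₀ ≤ b₁) (hm₀ : 0 < m₀) (hM₀ : 0 ≤ M₀) (hE₀ : 0 ≤ E₀) (hH₀ : 0 ≤ H₀) :
    ∃ q₀ : ℝ, 0 ≤ q₀ ∧ ∀ q : ℝ, q₀ ≤ q → ∀ C : ℝ, 0 < C → ∃ N : ℝ, 0 < N ∧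
      ∀ (bt : ℝ → ℝ) (T : EReal) (f : ℝ → Vel (n + 1) → Vel (n + 1) → ℝ),
      IsAngularFactor b₀ b₁ bt → IsMildDecaySolution γ s bt T f → HydroBounds T m₀ M₀ E₀ H₀ f →
      (∀ x v, f 0 x v ≤ C * decayWeight q v) →
      ∀ t ∈ timeInterval T, ∀ x v, f t x v ≤ N * decayWeight q v := by
  have hs0 := hs.1
  have hs1 := hs.2
  have hn1 : (1 : ℝ) ≤ n := by exact_mod_cast hn
  have hγs2 : γ + 2 * s ≤ 2 := by linarith
  have hb₁0 : 0 ≤ b₁ := by linarith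
  have hh₀ := entropy_const_nonneg (d := n + 1) hE₀ hH₀
  set p : ℝ := n + 1 + (γ + 2 * s + 1) / 2 with hp
  obtain ⟨C₁, hC₁0, hcoll⟩ := exists_collision_le (γ := γ) hn hs hγs hb₀ hb₁
  obtain ⟨C₂, hC₂1, hriesz⟩ := IsProfile.exists_riesz_le (m₀ := m₀) (M₀ := M₀) (E₀ := E₀)
    (h₀ := H₀ + E₀ + (∫ v : Vel (n + 1), Real.exp (-‖v‖ ^ 2 - 1))) (n := n) (γ := γ) (by linarith) hγ hM₀
  obtain ⟨c, K, q₁, hc, hK0, hneg⟩ := exists_swappedIncrement_le_neg hn hs hγs hγs2 hb₀ hb₁0 hm₀ hM₀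
    hE₀ hh₀
  obtain ⟨C₃, hC₃0, hpos⟩ := exists_swappedIncrement_le (γ := γ) (b := b₁) (q := p) (M₀ := M₀)
    (E₀ := E₀) hn hs hγs hγs2 hb₁0 (by linarith) hM₀ hE₀
  obtain ⟨N₀, hN₀, hprop⟩ := exists_propagation_small_exponent (q := (n : ℝ) + 2) hn hs hγs hγs2 hb₀
    hb₁ hm₀ hM₀ hE₀ hH₀ (by linarith) le_rfl
  set D : ℝ := C₁ * (C₂ * (M₀ + 2)) with hD
  have hD0 : 0 ≤ D := by positivity
  obtain ⟨q₂, hq₂⟩ := ((tendsto_rpow_atTop hs0).eventually_ge_atTop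
    ((K + D) / c)).exists_forall_of_atTop
  refine ⟨max (n + 2) (max q₁ q₂), le_max_of_le_left (by linarith), fun q hq C hC => ?_⟩
  have hqn : (n : ℝ) + 2 ≤ q := (le_max_left _ _).trans hq
  have hq0 : 0 < q := by linarith
  obtain ⟨R₁, hR₁1, hnegq⟩ := hneg q ((le_max_left _ _).trans ((le_max_right _ _).trans hq))
  have hqs : K + D ≤ c * q ^ s := by
    have := hq₂ q ((le_max_right _ _).trans ((le_max_right _ _).trans hq))
    rw [div_le_iff₀ hc] at this
    linarith
  set N₁ := max N₀ C with hN₁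
  have hN₁0 : 0 < N₁ := lt_max_of_lt_right hC
  set R := max R₁ (N₁ * 2 ^ ((n : ℝ) + 2)) with hR
  have hR1 : 1 ≤ R := hR₁1.trans (le_max_left _ _)
  have hR0 : 0 < R := by linarith
  set N := max C (N₁ * R ^ q) with hN
  have hN0 : 0 < N := lt_max_of_lt_left hC
  refine ⟨N, hN0, fun bt T f hbt hf hH hf0 t₁ ht₁ x v => ?_⟩
  have hfN : ∀ t ∈ timeInterval T, ∀ x v, f t x v ≤ N₁ * decayWeight ((n : ℝ) + 2) v := by
    refine hprop bt T f hbt hf hH C fun x v => (hf0 x v).trans ?_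
    exact mul_le_mul_of_nonneg_left (decayWeight_le_of_exponent_le hqn v) hC.le
  -- growth rate that outweighs the action of the collision operator on `φ_p`
  set k : ℝ := C₃ + D + 1 with hk
  refine le_of_forall_pos_le_add fun δ hδ => ?_
  set ε := δ / Real.exp (k * t₁) with hε
  have hε0 : 0 < ε := by positivity
  obtain ⟨R₂, hR₂⟩ := ((tendsto_rpow_atTop (show 0 < (n : ℝ) + 2 - p by linarith)).eventually_gt_atTop
    (N₁ / ε)).exists_forall_of_atTop
  have hsub : ∀ t' ∈ Icc 0 t₁, t' ∈ timeInterval T := fun t' ht' =>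
    mem_timeInterval_of_le ht₁ ht'.1 ht'.2
  have := hf.lt_of_barrier le_rfl ht₁
    (g := fun t v => N * decayWeight q v + ε * Real.exp (k * t) * decayWeight p v)
    (g' := fun t v => ε * (Real.exp (k * t) * k) * decayWeight p v) ?_
    (fun t ht v => ?_) (fun x v => ?_) (R := max 1 R₂) (fun t ht x v hv => ?_)
    (fun t ht x v L hle heq hL => ?_) t₁ (right_mem_Icc.2 ht₁.1) x v
  · have h1 : ε * Real.exp (k * t₁) = δ := by rw [hε]; field_simp
    simp only [h1] at this
    have h2 := mul_le_mul_of_nonneg_left (decayWeight_le_one (q := p) (by linarith) v) hδ.le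
    linarith
  · have h1 := continuous_decayWeight (d := n + 1) q
    have h2 := continuous_decayWeight (d := n + 1) p
    exact Continuous.continuousOn (by fun_prop)
  · have h1 : HasDerivAt (fun τ : ℝ => Real.exp (k * τ)) (Real.exp (k * t) * k) t := by
      simpa using ((hasDerivAt_id t).const_mul k).exp
    exact ((h1.const_mul ε).mul_const _).const_add _
  · have h1 : C * decayWeight q v ≤ N * decayWeight q v :=
      mul_le_mul_of_nonneg_right (le_max_left _ _) (decayWeight_pos q v).le
    have h2 := decayWeight_pos p v
    have h3 : 0 < ε * Real.exp (k * 0) * decayWeight p v := by positivity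
    change _ < N * decayWeight q v + ε * Real.exp (k * 0) * decayWeight p v
    linarith [hf0 x v]
  · have hv1 : 1 ≤ ‖v‖ := (le_max_left _ _).trans hv
    have hv0 : 0 < ‖v‖ := by linarith
    have h1 := hfN t (hsub t ht) x v
    have h2 := hR₂ ‖v‖ ((le_max_right _ _).trans hv)
    rw [div_lt_iff₀ hε0] at h2
    have hk0 : 0 < k := by positivity
    have h3 : 1 ≤ Real.exp (k * t) := Real.one_le_exp (mul_nonneg hk0.le ht.1)
    have h4 := mul_pos hN0 (decayWeight_pos q v)
    have h5 : N₁ * decayWeight ((n : ℝ) + 2) v < ε * decayWeight p v := by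
      rw [decayWeight_of_one_le _ hv1, decayWeight_of_one_le _ hv1]
      calc N₁ * ‖v‖ ^ (-((n : ℝ) + 2)) < ‖v‖ ^ ((n : ℝ) + 2 - p) * ε * ‖v‖ ^ (-((n : ℝ) + 2)) :=
            mul_lt_mul_of_pos_right h2 (by positivity)
        _ = ε * (‖v‖ ^ ((n : ℝ) + 2 - p) * ‖v‖ ^ (-((n : ℝ) + 2))) := by ring
        _ = _ := by rw [← Real.rpow_add hv0]; congr 2; ring
    have h6 : ε * decayWeight p v ≤ ε * Real.exp (k * t) * decayWeight p v :=
      mul_le_mul_of_nonneg_right (le_mul_of_one_le_right hε0.le h3) (decayWeight_pos p v).le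
    linarith
  · have htT := hsub t ⟨ht.1.le, ht.2⟩
    have hprof := hf.isProfile hH htT x
    set ε' := ε * Real.exp (k * t) with hε'
    have hε'0 : 0 < ε' := by positivity
    have hφq := decayWeight_pos q v
    have hφp := decayWeight_pos p v
    -- for `|v| ≤ R` the barrier is above the bound of exponent `d + 1`, by the choice of `N`
    have hvR : R < ‖v‖ := by
      by_contra hv
      have h1 : R ^ (-q) ≤ decayWeight q v :=
        Real.rpow_le_rpow_of_nonpos (lt_max_of_lt_left one_pos) (max_le hR1 (not_lt.1 hv))
          (by linarith)
      have h2 : N₁ ≤ N * decayWeight q v := by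
        calc N₁ = N₁ * R ^ q * R ^ (-q) := by
              rw [mul_assoc, ← Real.rpow_add hR0, add_neg_cancel, Real.rpow_zero, mul_one]
          _ ≤ N * decayWeight q v :=
              mul_le_mul (le_max_right _ _) h1 (by positivity) hN0.le
      have h3 := hfN t htT x v
      have h4 := mul_le_mul_of_nonneg_left
        (decayWeight_le_one (q := (n : ℝ) + 2) (by linarith) v) hN₁0.le
      have h5 : 0 < ε' * decayWeight p v := by positivity
      linarith
    have hv1 : 1 ≤ ‖v‖ := hR1.trans hvR.le
    have hv0 : 0 < ‖v‖ := by linarith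
    obtain ⟨β, hβ, hβ0, hβ1, hQ⟩ := hcoll bt hbt
    have hCB := collisionBound_of_contact hprof.nonneg hN0.le hε'0.le hle heq
      (hnegq β hβ hβ0 hβ1 (f t x) hprof v ((le_max_left _ _).trans hvR.le))
      (hpos β hβ hβ1 m₀ _ (f t x) hprof v hv1)
    -- the bound of exponent `d + 1` near `v` makes the Riesz potential at most `C |v|^γ`, with a
    -- constant that does not depend on `q`
    have hS : ∫⁻ z, ENNReal.ofReal (f t x (v + z)) * ENNReal.ofReal (‖z‖ ^ γ) ≤
        ENNReal.ofReal (C₂ * (M₀ + 2) * ‖v‖ ^ γ) := by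
      refine (hriesz (f t x) hprof v (N₁ * (2 ^ ((n : ℝ) + 2) * ‖v‖ ^ (-((n : ℝ) + 2)))) ‖v‖ 0 M₀
        (by positivity) hv0 le_rfl hM₀ (fun y hy => ?_)
        ((setLIntegral_le_lintegral _ _).trans hprof.mass_upper)).trans
        (ENNReal.ofReal_le_ofReal ?_)
      · refine (hfN t htT x y).trans (mul_le_mul_of_nonneg_left ?_ hN₁0.le)
        rw [← decayWeight_of_one_le _ hv1]
        refine decayWeight_half (by linarith) ?_
        rw [max_eq_right hv1] at hy ⊢
        have := norm_sub_norm_le v y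
        rw [norm_sub_rev] at this
        have h1 : ‖v‖ / 2 ≤ ‖y‖ := by linarith
        exact h1.trans (le_max_right _ _)
      · rw [max_eq_right hv1, mul_assoc C₂]
        refine mul_le_mul_of_nonneg_left ?_ (by linarith)
        have h1 : N₁ * (2 ^ ((n : ℝ) + 2) * ‖v‖ ^ (-((n : ℝ) + 2))) * ‖v‖ ^ (n + 1 + γ) =
            N₁ * 2 ^ ((n : ℝ) + 2) / ‖v‖ * ‖v‖ ^ γ := by
          have : ‖v‖ ^ (-((n : ℝ) + 2)) * ‖v‖ ^ ((n : ℝ) + 1 + γ) = ‖v‖ ^ γ / ‖v‖ := by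
            rw [← Real.rpow_add hv0, ← Real.rpow_sub_one hv0.ne']; congr 1; ring
          rw [mul_assoc, mul_assoc, this]; ring
        have h2 : N₁ * 2 ^ ((n : ℝ) + 2) / ‖v‖ ≤ 1 := by
          rw [div_le_one hv0]; exact (le_max_right _ _).trans hvR.le
        have h3 : 0 < ‖v‖ ^ γ := by positivity
        rw [h1]
        nlinarith
    have hfin := hQ (f t x) hprof.continuous hprof.nonneg hprof.bounded v L _ _ hL
      (hprof.lintegral_rpow_lt_top hγs hγs2 v) (by positivity) hS hCB
    have hY : 0 < ‖v‖ ^ γ := by positivity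
    have hY1 : ‖v‖ ^ γ ≤ 1 := Real.rpow_le_one_of_one_le_of_nonpos hv1 hγ
    have heq' : f t x v = N * decayWeight q v + ε' * decayWeight p v := heq
    rw [heq'] at hfin
    have h1 : N * decayWeight q v * ‖v‖ ^ γ * (K + D - c * q ^ s) ≤ 0 :=
      mul_nonpos_of_nonneg_of_nonpos (by positivity) (by linarith)
    have h2 : ε' * decayWeight p v * (C₃ + D) * ‖v‖ ^ γ ≤ ε' * decayWeight p v * (C₃ + D) :=
      mul_le_of_le_one_right (by positivity) hY1
    have h3 : 0 < ε' * decayWeight p v := by positivity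
    have h4 : ε * (Real.exp (k * t) * k) * decayWeight p v =
        ε' * decayWeight p v * (C₃ + D) + ε' * decayWeight p v := by rw [hε', hk]; ring
    have h5 : (N * decayWeight q v + ε' * decayWeight p v) * C₁ * (C₂ * (M₀ + 2) * ‖v‖ ^ γ) =
        (N * decayWeight q v + ε' * decayWeight p v) * D * ‖v‖ ^ γ := by rw [hD]; ring
    rw [h4]
    rw [h5] at hfin
    linarith

/-- A weight of exponent `q` with a coefficient that is more singular at `t = 0` dominates a bound
independent of the velocity, unless `|v|` and `t |v|^γ` are large. -/
theorem exists_weight_dominates {q γ α M : ℝ} (hq : 0 < q) (hγ : 0 < γ) (hα : 0 < α) (hM : 0 < M)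
    {R : ℝ} (hR : 1 ≤ R) :
    ∃ N : ℝ, 0 < N ∧ ∀ {d : ℕ} (t : ℝ) (v : Vel d), 0 < t →
      (‖v‖ ≤ R ∨ t * ‖v‖ ^ γ ≤ α + q / γ) →
      M * (1 + t ^ (-α)) ≤ N * (1 + t ^ (-(α + q / γ))) * decayWeight q v := by
  set β := α + q / γ with hβ
  have hqγ : 0 < q / γ := by positivity
  have hβ0 : 0 < β := by positivity
  have hR0 : 0 < R := by linarith
  set N := max (2 * M * R ^ q) (M * (β ^ α + 1) * β ^ (q / γ)) with hN
  have hN0 : 0 < N := lt_max_of_lt_left (by positivity)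
  refine ⟨N, hN0, fun t v ht hv => ?_⟩
  have htα : 0 < t ^ (-α) := by positivity
  have htβ : 0 < t ^ (-β) := by positivity
  rcases le_or_gt ‖v‖ R with hvR | hvR
  · have h1 : R ^ (-q) ≤ decayWeight q v :=
      Real.rpow_le_rpow_of_nonpos (lt_max_of_lt_left one_pos) (max_le hR hvR) (by linarith)
    have h2 : 1 + t ^ (-α) ≤ 2 * (1 + t ^ (-β)) := by
      rcases le_total t 1 with h | h
      · have := Real.rpow_le_rpow_of_exponent_ge ht h (show -β ≤ -α by linarith)
        linarith
      · have := Real.rpow_le_one_of_one_le_of_nonpos h (show -α ≤ 0 by linarith)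
        linarith
    calc M * (1 + t ^ (-α)) ≤ M * (2 * (1 + t ^ (-β))) := by gcongr
      _ = 2 * M * R ^ q * (1 + t ^ (-β)) * R ^ (-q) := by
          rw [Real.rpow_neg hR0.le]; field_simp
      _ ≤ N * (1 + t ^ (-β)) * decayWeight q v := by
          gcongr
          exact le_max_left _ _
  · have hv1 : 1 ≤ ‖v‖ := hR.trans hvR.le
    have hv0 : 0 < ‖v‖ := by linarith
    have htv : t * ‖v‖ ^ γ ≤ β := hv.resolve_left (not_le.2 hvR)
    have h1 : 1 ≤ β ^ α * t ^ (-α) := by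
      have htβ' : t ≤ β := le_trans (le_mul_of_one_le_right ht.le (Real.one_le_rpow hv1 hγ.le)) htv
      rw [Real.rpow_neg ht.le, ← div_eq_mul_inv, one_le_div (by positivity)]
      exact Real.rpow_le_rpow ht.le htβ' hα.le
    have h2 : β ^ (-(q / γ)) * t ^ (q / γ) ≤ decayWeight q v := by
      rw [decayWeight_of_one_le q hv1]
      have h3 : ‖v‖ ^ γ ≤ β / t := by rw [le_div_iff₀ ht]; linarith
      have h4 : ‖v‖ ^ (-q) = (‖v‖ ^ γ) ^ (-(q / γ)) := by
        rw [← Real.rpow_mul hv0.le]; congr 1; field_simp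
      rw [h4]
      refine le_trans (le_of_eq ?_)
        (Real.rpow_le_rpow_of_nonpos (by positivity) h3 (by linarith))
      rw [Real.div_rpow hβ0.le ht.le, Real.rpow_neg ht.le, div_inv_eq_mul]
    calc M * (1 + t ^ (-α)) ≤ M * (β ^ α * t ^ (-α) + t ^ (-α)) := by gcongr
      _ = M * (β ^ α + 1) * β ^ (q / γ) * t ^ (-β) * (β ^ (-(q / γ)) * t ^ (q / γ)) := by
          have h5 : t ^ (-β) * t ^ (q / γ) = t ^ (-α) := by
            rw [← Real.rpow_add ht]; congr 1; rw [hβ]; ring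
          have h6 : β ^ (q / γ) * β ^ (-(q / γ)) = 1 := by
            rw [← Real.rpow_add hβ0, add_neg_cancel, Real.rpow_zero]
          calc _ = M * (β ^ α + 1) * t ^ (-α) := by ring
            _ = M * (β ^ α + 1) * (β ^ (q / γ) * β ^ (-(q / γ))) * (t ^ (-β) * t ^ (q / γ)) := by
                rw [h5, h6]; ring
            _ = _ := by ring
      _ ≤ N * (1 + t ^ (-β)) * decayWeight q v := by
          gcongr
          · exact le_max_right _ _
          · linarith

set_option maxHeartbeats 1000000 in
/-- Instantaneous decay of any exponent for hard potentials. For large velocities the collision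
operator acts on the weight as `-|v|^γ`, which controls the time derivative of the coefficient as
soon as `t |v|^γ` is large. -/
theorem exists_instantaneous_decay_large_exponent (hn : 1 ≤ n)
    (hs : s ∈ Ioo (0 : ℝ) 1) (hγs2 : γ + 2 * s ≤ 2) (hγ : 0 < γ) (hb₀ : 0 < b₀)
    (hb₁ : b₀ ≤ b₁) (hm₀ : 0 < m₀) (hM₀ : 0 ≤ M₀) (hE₀ : 0 ≤ E₀) (hH₀ : 0 ≤ H₀) :
    ∃ q₀ : ℝ, 0 < q₀ ∧ ∀ q : ℝ, q₀ ≤ q → ∃ N β : ℝ, 0 < N ∧ 0 < β ∧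
      ∀ (bt : ℝ → ℝ) (T : EReal) (f : ℝ → Vel (n + 1) → Vel (n + 1) → ℝ),
      IsAngularFactor b₀ b₁ bt → IsMildDecaySolution γ s bt T f → HydroBounds T m₀ M₀ E₀ H₀ f →
      UniformDecay T q₀ f → ∀ t ∈ timeInterval T, 0 < t → ∀ x v,
        f t x v ≤ N * (1 + t ^ (-β)) * decayWeight q v := by
  have hs0 := hs.1
  have hn1 : (1 : ℝ) ≤ n := by exact_mod_cast hn
  have hγs : 0 ≤ γ + 2 * s := by linarith
  have hb₁0 : 0 ≤ b₁ := by linarith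
  have hh₀ := entropy_const_nonneg (d := n + 1) hE₀ hH₀
  obtain ⟨C₁, hC₁0, hcoll⟩ := exists_collision_le (γ := γ) hn hs hγs hb₀ hb₁
  obtain ⟨c, K, q₁, hc, hK0, hneg⟩ := exists_swappedIncrement_le_neg hn hs hγs hγs2 hb₀ hb₁0 hm₀ hM₀
    hE₀ hh₀
  obtain ⟨M, hM1, hinst⟩ := exists_instantaneous_decay (q := (n : ℝ) + 2) hn hs hγs hγs2 hb₀
    hb₁ hm₀ hM₀ hE₀ hH₀ (by linarith) le_rfl (by rw [sub_self, zero_mul, add_zero]; exact hγ.le)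
  set D : ℝ := C₁ * (4 * (M₀ + E₀)) with hD
  have hD0 : 0 ≤ D := by positivity
  obtain ⟨q₂, hq₂⟩ := ((tendsto_rpow_atTop hs0).eventually_ge_atTop
    ((K + D + 1) / c)).exists_forall_of_atTop
  set q₀ := max 1 (max q₁ q₂) with hq₀
  have hq₀1 : 1 ≤ q₀ := le_max_left _ _
  have hqs : ∀ q, q₀ ≤ q → K + D + 1 ≤ c * q ^ s := fun q hq => by
    have := hq₂ q ((le_max_right _ _).trans ((le_max_right _ _).trans hq))
    rw [div_le_iff₀ hc] at this
    linarith
  have hneg' : ∀ q, q₀ ≤ q → _ := fun q hq =>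
    hneg q ((le_max_left _ _).trans ((le_max_right _ _).trans hq))
  refine ⟨q₀, by linarith, fun q hq => ?_⟩
  have hq0 : 0 < q := by linarith
  obtain ⟨R₁, hR₁1, hneg1⟩ := hneg' q hq
  obtain ⟨R₂, hR₂1, hneg2⟩ := hneg' q₀ le_rfl
  set R := max R₁ R₂ with hR
  have hR1 : 1 ≤ R := hR₁1.trans (le_max_left _ _)
  set α : ℝ := ((n : ℝ) + 1) / (2 * s) with hα
  have hα0 : 0 < α := by positivity
  obtain ⟨N, hN0, hdom⟩ := exists_weight_dominates hq0 hγ hα0 (show 0 < M by linarith) hR1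
  -- at `|v| = t^{-1/γ}` the weight is `t^{q/γ}`, which `t^{-q/γ}` compensates
  set β := α + q / γ with hβ
  have hβ0 : 0 < β := by positivity
  refine ⟨N, β, hN0, hβ0, fun bt T f hbt hf hH hdec t₁ ht₁ ht₁0 x v => ?_⟩
  refine le_of_forall_pos_le_add fun ε hε => ?_
  obtain ⟨B, hB⟩ := hf.exists_bound ht₁
  obtain ⟨R₃, -, hR₃⟩ := hdec (ε / 2) (by positivity)
  set R₄ := max 1 R₃ with hR₄
  have hR₄1 : 1 ≤ R₄ := le_max_left _ _
  have hR₄0 : 0 < R₄ := by linarith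
  obtain ⟨t₀, ht₀, ht₀₁, hBt⟩ := exists_le_rpow_neg hβ0 ht₁0 (B * R₄ ^ q / N)
  rw [div_lt_iff₀ hN0] at hBt
  have hsub : ∀ t' ∈ Icc t₀ t₁, t' ∈ timeInterval T := fun t' ht' =>
    mem_timeInterval_of_le ht₁ (ht₀.le.trans ht'.1) ht'.2
  -- the decay of exponent `q₀` excludes a contact at infinity
  have hlarge : ∀ t ∈ timeInterval T, ∀ x v, R₄ ≤ ‖v‖ → f t x v < ε * decayWeight q₀ v := by
    intro t ht x v hv
    have hv1 : 1 ≤ ‖v‖ := hR₄1.trans hv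
    have hv0 : 0 < ‖v‖ := by linarith
    have h1 := hR₃ t ht x v ((le_max_right _ _).trans hv)
    have hp : 0 < ‖v‖ ^ q₀ := by positivity
    rw [decayWeight_of_one_le _ hv1, Real.rpow_neg hv0.le, ← div_eq_mul_inv, lt_div_iff₀ hp]
    linarith
  have := hf.lt_of_barrier ht₀.le ht₁
    (g := fun t v => N * (1 + t ^ (-β)) * decayWeight q v + ε * decayWeight q₀ v)
    (g' := fun t v => N * (-β * t ^ (-β - 1)) * decayWeight q v) ?_
    (fun t ht v => ?_) (fun x v => ?_) (R := R₄) (fun t ht x v hv => ?_)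
    (fun t ht x v L hle heq hL => ?_) t₁ (right_mem_Icc.2 ht₀₁) x v
  · have h2 := mul_le_mul_of_nonneg_left (decayWeight_le_one (q := q₀) (by linarith) v) hε.le
    linarith
  · have h1 := ((continuous_decayWeight (d := n + 1) q).comp
      (continuous_snd (X := ℝ))).continuousOn (s := Icc t₀ t₁ ×ˢ univ)
    have h2 := ((continuous_decayWeight (d := n + 1) q₀).comp
      (continuous_snd (X := ℝ))).continuousOn (s := Icc t₀ t₁ ×ˢ univ)
    exact ((continuousOn_const.mul (continuousOn_const.add (continuousOn_fst.rpow_const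
      fun p hp => Or.inl (ht₀.trans_le hp.1.1).ne'))).mul h1).add (continuousOn_const.mul h2)
  · exact ((((Real.hasDerivAt_rpow_const (Or.inl (ht₀.trans ht.1).ne')).const_add 1).const_mul
      N).mul_const _).add_const _
  · have h0 : 0 < t₀ ^ (-β) := by positivity
    have hφ := decayWeight_pos q v
    have hφ₀ := mul_pos hε (decayWeight_pos q₀ v)
    change _ < N * (1 + t₀ ^ (-β)) * decayWeight q v + ε * decayWeight q₀ v
    rcases le_total R₄ ‖v‖ with hv | hv
    · have h1 := hlarge t₀ (hsub t₀ (left_mem_Icc.2 ht₀₁)) x v hv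
      have h2 : 0 < N * (1 + t₀ ^ (-β)) * decayWeight q v := by positivity
      linarith
    · have h1 : R₄ ^ (-q) ≤ decayWeight q v :=
        Real.rpow_le_rpow_of_nonpos (lt_max_of_lt_left one_pos) (max_le hR₄1 hv) (by linarith)
      have h2 : B < t₀ ^ (-β) * N * R₄ ^ (-q) := by
        have := mul_lt_mul_of_pos_right hBt (show 0 < R₄ ^ (-q) by positivity)
        rwa [mul_assoc B, ← Real.rpow_add hR₄0, add_neg_cancel, Real.rpow_zero, mul_one] at this
      have h3 : t₀ ^ (-β) * N * R₄ ^ (-q) ≤ t₀ ^ (-β) * N * decayWeight q v := by gcongr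
      have h4 : 0 < N * decayWeight q v := by positivity
      have h5 := hB t₀ ⟨ht₀.le, ht₀₁⟩ x v
      linarith
  · have ht0 : 0 < t := ht₀.trans_le ht.1
    have h1 := hlarge t (hsub t ht) x v hv
    have h2 := decayWeight_pos q v
    have h3 : 0 < N * (1 + t ^ (-β)) * decayWeight q v := by positivity
    change _ < N * (1 + t ^ (-β)) * decayWeight q v + ε * decayWeight q₀ v
    linarith
  · have ht0 : 0 < t := ht₀.trans ht.1
    have htT := hsub t ⟨ht.1.le, ht.2⟩
    have hprof := hf.isProfile hH htT x
    have htβ : 0 < t ^ (-β) := by positivity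
    set Nt := N * (1 + t ^ (-β)) with hNt
    have hNt0 : 0 < Nt := by positivity
    have hφ := decayWeight_pos q v
    have hφ₀ := mul_pos hε (decayWeight_pos q₀ v)
    have heq' : f t x v = Nt * decayWeight q v + ε * decayWeight q₀ v := heq
    -- otherwise the barrier exceeds the instantaneous bound of exponent `d + 1`
    have hfar : R < ‖v‖ ∧ β < t * ‖v‖ ^ γ := by
      by_contra hcon
      rw [not_and_or, not_lt, not_lt] at hcon
      have h1 := hdom t v ht0 hcon
      have h2 := hinst bt T f hbt hf hH t htT ht0 x v
      have h3 : M * (1 + t ^ (-α)) * decayWeight ((n : ℝ) + 2) v ≤ M * (1 + t ^ (-α)) :=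
        mul_le_of_le_one_right (by positivity) (decayWeight_le_one (by linarith) v)
      linarith
    have hv1 : 1 ≤ ‖v‖ := hR1.trans hfar.1.le
    have hv0 : 0 < ‖v‖ := by linarith
    obtain ⟨β', hβ', hβ'0, hβ'1, hQ⟩ := hcoll bt hbt
    have hCB := collisionBound_of_contact hprof.nonneg hNt0.le hε.le hle heq
      (hneg1 β' hβ' hβ'0 hβ'1 (f t x) hprof v ((le_max_left _ _).trans hfar.1.le))
      (hneg2 β' hβ' hβ'0 hβ'1 (f t x) hprof v ((le_max_right _ _).trans hfar.1.le))
    have hS := hprof.riesz_le_of_nonneg hγ.le (by linarith) hM₀ hE₀ v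
    rw [max_eq_right hv1] at hS
    have hfin := hQ (f t x) hprof.continuous hprof.nonneg hprof.bounded v L _ _ hL
      (hprof.lintegral_rpow_lt_top hγs hγs2 v) (by positivity) hS hCB
    have hY : 0 < ‖v‖ ^ γ := by positivity
    have hy0 : 0 < f t x v := by rw [heq']; positivity
    have h1 : Nt * decayWeight q v * ‖v‖ ^ γ * (K + D + 1 - c * q ^ s) ≤ 0 :=
      mul_nonpos_of_nonneg_of_nonpos (by positivity) (by linarith [hqs q hq])
    have h2 : ε * decayWeight q₀ v * ‖v‖ ^ γ * (K + D + 1 - c * q₀ ^ s) ≤ 0 :=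
      mul_nonpos_of_nonneg_of_nonpos (by positivity) (by linarith [hqs q₀ le_rfl])
    have h3 : L ≤ -(f t x v * ‖v‖ ^ γ) := by
      have h4 : f t x v * C₁ * (4 * (M₀ + E₀) * ‖v‖ ^ γ) = f t x v * D * ‖v‖ ^ γ := by rw [hD]; ring
      rw [h4] at hfin
      rw [heq'] at hfin ⊢
      linarith
    have h5 : N * t ^ (-β) * decayWeight q v ≤ f t x v := by
      have h6 : 0 < N * decayWeight q v := by positivity
      rw [heq', hNt]
      linarith
    have h7 : N * (-β * t ^ (-β - 1)) * decayWeight q v =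
        -(β / t * (N * t ^ (-β) * decayWeight q v)) := by
      rw [Real.rpow_sub ht0, Real.rpow_one]; ring
    have h8 : β / t < ‖v‖ ^ γ := by rw [div_lt_iff₀ ht0]; linarith [hfar.2]
    have h9 : β / t * (N * t ^ (-β) * decayWeight q v) ≤ β / t * f t x v :=
      mul_le_mul_of_nonneg_left h5 (by positivity)
    have h10 := mul_lt_mul_of_pos_right h8 hy0
    change L < N * (-β * t ^ (-β - 1)) * decayWeight q v
    rw [h7]
    linarith

end Boltzmann

theorem mainTheorem3 (d : ℕ) (hd : 2 ≤ d) (γ s : ℝ) (hs : s ∈ Ioo (0 : ℝ) 1)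
    (hγs : γ + 2 * s ∈ Icc (0 : ℝ) 2) (b₀ b₁ : ℝ) (hb₀ : 0 < b₀)
    (m₀ M₀ E₀ H₀ : ℝ) (hm₀ : 0 < m₀) (hM₀ : 0 < M₀) (hE₀ : 0 < E₀) (hH₀ : 0 < H₀) :
    -- (1)
    (γ ∈ Ioc (-2 : ℝ) 0 →
      ∃ N : ℝ, 0 < N ∧
        ∀ q : ℝ, (γ < 0 ∧ q = (d : ℝ) + 1 + γ * d / (2 * s)) ∨ (γ = 0 ∧ q ∈ Ico (0 : ℝ) (d + 1)) →
        ∀ (bt : ℝ → ℝ) (T : EReal) (f : ℝ → Boltzmann.Vel d → Boltzmann.Vel d → ℝ),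
          Boltzmann.IsAngularFactor b₀ b₁ bt → 0 < T →
          Boltzmann.IsMildDecaySolution γ s bt T f → Boltzmann.HydroBounds T m₀ M₀ E₀ H₀ f →
          ∀ t ∈ Boltzmann.timeInterval T, 0 < t → ∀ x v : Boltzmann.Vel d,
            f t x v ≤ N * (1 + t ^ (-((d : ℝ) / (2 * s)))) * Boltzmann.decayWeight q v) ∧
    -- (2)
    (0 < γ →
      ∃ N β : ℝ, 0 < N ∧ 0 < β ∧
        ∀ (bt : ℝ → ℝ) (T : EReal) (f : ℝ → Boltzmann.Vel d → Boltzmann.Vel d → ℝ),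
          Boltzmann.IsAngularFactor b₀ b₁ bt → 0 < T →
          Boltzmann.IsMildDecaySolution γ s bt T f → Boltzmann.HydroBounds T m₀ M₀ E₀ H₀ f →
          ∀ t ∈ Boltzmann.timeInterval T, 0 < t → ∀ x v : Boltzmann.Vel d,
            f t x v ≤ N * (1 + t ^ (-β)) * Boltzmann.decayWeight ((d : ℝ) + 1) v) ∧
    -- (3)
    (γ ≤ 0 → γ + 2 * s < 1 →
      ∃ q₀ : ℝ, 0 ≤ q₀ ∧ ∀ q : ℝ, q₀ ≤ q → ∀ C : ℝ, 0 < C →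
        ∃ N : ℝ, 0 < N ∧
          ∀ (bt : ℝ → ℝ) (T : EReal) (f : ℝ → Boltzmann.Vel d → Boltzmann.Vel d → ℝ),
            Boltzmann.IsAngularFactor b₀ b₁ bt → 0 < T →
            Boltzmann.IsMildDecaySolution γ s bt T f → Boltzmann.HydroBounds T m₀ M₀ E₀ H₀ f →
            (∀ x v : Boltzmann.Vel d, f 0 x v ≤ C * Boltzmann.decayWeight q v) →
            ∀ t ∈ Boltzmann.timeInterval T, ∀ x v : Boltzmann.Vel d,
              f t x v ≤ N * Boltzmann.decayWeight q v) ∧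
    -- (4)
    (0 < γ →
      ∃ q₀ : ℝ, 0 < q₀ ∧ ∀ q : ℝ, 0 < q →
        ∃ N β : ℝ, 0 < N ∧ 0 < β ∧
          ∀ (bt : ℝ → ℝ) (T : EReal) (f : ℝ → Boltzmann.Vel d → Boltzmann.Vel d → ℝ),
            Boltzmann.IsAngularFactor b₀ b₁ bt → 0 < T →
            Boltzmann.IsMildDecaySolution γ s bt T f → Boltzmann.HydroBounds T m₀ M₀ E₀ H₀ f →
            Boltzmann.UniformDecay T q₀ f →
            ∀ t ∈ Boltzmann.timeInterval T, 0 < t → ∀ x v : Boltzmann.Vel d,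
              f t x v ≤ N * (1 + t ^ (-β)) * Boltzmann.decayWeight q v) := by
  obtain ⟨n, rfl⟩ : ∃ n, d = n + 1 := ⟨d - 1, by omega⟩
  have hn : 1 ≤ n := by omega
  obtain ⟨hγs0, hγs2⟩ := hγs
  have hs0 := hs.1
  have hs1 := hs.2
  have hn1 : (1 : ℝ) ≤ n := by exact_mod_cast hn
  -- the upper bound is replaced by one that is compatible with the lower bound by definition
  have hb₁ : b₀ ≤ max b₀ b₁ := le_max_left _ _
  have hcast : ((n + 1 : ℕ) : ℝ) = (n : ℝ) + 1 := by push_cast; rfl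
  simp only [hcast]
  refine ⟨fun hγ => ?_, fun hγ => ?_, fun hγ hγs1 => ?_, fun hγ => ?_⟩
  · -- for `γ = 0` the exponent `d + 1` itself is attained
    obtain ⟨N, hN, h⟩ := Boltzmann.exists_instantaneous_decay
      (q := (n : ℝ) + 2 + γ * (n + 1) / (2 * s)) hn hs hγs0 hγs2 hb₀ hb₁ hm₀ hM₀.le hE₀.le hH₀.le
      (by
        have : -((n : ℝ) + 1) ≤ γ * (n + 1) / (2 * s) := by
          rw [le_div_iff₀ (by positivity)]; nlinarith
        linarith)
      (by
        have : γ * ((n : ℝ) + 1) / (2 * s) ≤ 0 :=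
          div_nonpos_of_nonpos_of_nonneg (mul_nonpos_of_nonpos_of_nonneg hγ.2 (by positivity))
            (by positivity)
        linarith)
      (le_of_eq (by field_simp; ring))
    refine ⟨N, by linarith, fun q hq bt T f hbt _ hf hH t ht ht0 x v =>
      (h bt T f hbt.max_right hf hH t ht ht0 x v).trans ?_⟩
    refine mul_le_mul_of_nonneg_left (Boltzmann.decayWeight_le_of_exponent_le ?_ v) (by positivity)
    rcases hq with ⟨-, rfl⟩ | ⟨rfl, -, hq⟩
    · linarith
    · rw [zero_mul, zero_div]; linarith
  · obtain ⟨N, hN, h⟩ := Boltzmann.exists_instantaneous_decay (q := (n : ℝ) + 2) hn hs hγs0 hγs2 hb₀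
      hb₁ hm₀ hM₀.le hE₀.le hH₀.le (by linarith) le_rfl
      (by rw [sub_self, zero_mul, add_zero]; exact hγ.le)
    refine ⟨N, ((n : ℝ) + 1) / (2 * s), by linarith, by positivity,
      fun bt T f hbt _ hf hH t ht ht0 x v => ?_⟩
    rw [show (n : ℝ) + 1 + 1 = n + 2 by ring]
    exact h bt T f hbt.max_right hf hH t ht ht0 x v
  · obtain ⟨q₀, hq₀, h⟩ := Boltzmann.exists_propagation_large_exponent hn hs hγs0 hγs1 hγ hb₀ hb₁ hm₀
      hM₀.le hE₀.le hH₀.le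
    refine ⟨q₀, hq₀, fun q hq C hC => ?_⟩
    obtain ⟨N, hN, h⟩ := h q hq C hC
    exact ⟨N, hN, fun bt T f hbt _ hf hH hf0 => h bt T f hbt.max_right hf hH hf0⟩
  · obtain ⟨q₀, hq₀, h⟩ := Boltzmann.exists_instantaneous_decay_large_exponent hn hs hγs2 hγ hb₀ hb₁ hm₀
      hM₀.le hE₀.le hH₀.le
    refine ⟨q₀, hq₀, fun q _ => ?_⟩
    obtain ⟨N, β, hN, hβ, h⟩ := h (max q₀ q) (le_max_left _ _)
    refine ⟨N, β, hN, hβ, fun bt T f hbt _ hf hH hdec t ht ht0 x v =>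
      (h bt T f hbt.max_right hf hH hdec t ht ht0 x v).trans ?_⟩
    exact mul_le_mul_of_nonneg_left
      (Boltzmann.decayWeight_le_of_exponent_le (le_max_right _ _) v) (by positivity)
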